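/- Let $\ell\ge 3$, $n\ge 1$, $\Gamma_\ell=\langle\gamma_1,\dots,\gamma_\ell:\gamma_1\cdots\gamma_\ell=1\rangle$, and let $\mathrm{Rep}(\Gamma_\ell,U(n))=U(n)\backslash\mathrm{Hom}(\Gamma_\ell,U(n))$ be the space of conjugacy classes of representations. For $A\in U(n)$ write its eigenvalues as $e^{2\pi i\alpha_1},\dots,e^{2\pi i\alpha_n}$ with $0\le\alpha_1\le\dots\le\alpha_n<1$, and set $\mathrm{spec}(A)=(\alpha_1,\dots,\alpha_n)$. The spectral projection is $\pi(\rho)=(\mathrm{spec}\,\rho(\gamma_1),\dots,\mathrm{spec}\,\rho(\gamma_\ell))$. Let $I\ge 0$ be an integer, let $\mathfrak m=(m^1,\dots,m^\ell)$, where $m^s$ is an ordered partition of $n$ into $l_s$ positive parts $\mu^s_1,\dots,\mu^s_{l_s}$, and let $z\subset\{1,\dots,\ell\}$. The stratum $\mathcal P_{I,\ell}(n,\mathfrak m,z)$ is the set of arrays $(\alpha^s_j)_{1\le s\le\ell,\,1\le j\le n}$ with $0\le\alpha^s_1\le\dots\le\alpha^s_n<1$ and $\sum_{s,j}\alpha^s_j=I$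 such that, for each $s$, the distinct values among $\alpha^s_1,\dots,\alpha^s_n$, in increasing order, have multiplicities $\mu^s_1,\dots,\mu^s_{l_s}$, and $\alpha^s_1=0$ if and only if $s\in z$. For a Lagrangian subspace $L\subset\mathbb C^n$ let $\sigma_L$ be the complex antilinear involution with fixed point set $L$. For Lagrangian subspaces $\lambda=(L_1,\dots,L_\ell)$ let $\tilde\varphi(\lambda)$ be the representation $\gamma_s\mapsto\sigma_{L_s}\sigma_{L_{s+1}}$ (indices mod $\ell$). Representations of this form are called Lagrangian. Let $\mathcal L\mathrm{Rep}^{irr}(\Gamma_\ell,U(n))\subset\mathrm{Rep}(\Gamma_\ell,U(n))$ be the set of classes of irreducible Lagrangian representations, $\mathcal L\mathrm{Rep}^{irr}_{\mathfrak a}(\Gamma_\ell,U(n))$ its subset with $\pi=\mathfrak a$, and $\mathcal L_{I,\ell}(n,\mathfrak m,z)$ the set of points of $\mathcal P_{I,\ell}(n,\mathfrak m,z)$ of the form $\pi(\rho)$ with $\rho$ Lagrangian. **Proposition.** Let $\rho:\Gamma_\ell\to U(n)$ be an irreducible Lagrangian representation with $\pi(\rho)=\mathfrak a\in\mathcal L_{I,\ell}(n,\mathfrak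 m,z)$. Then: 1. Near $[\rho]$, $\mathcal L\mathrm{Rep}^{irr}_{\mathfrak a}(\Gamma_\ell,U(n))$ is a smooth manifold (for the smooth structure of the moduli space) of dimension $$d=\frac{\ell-2}{2}\,n^2+1-\frac12\sum_{s=1}^{\ell}\sum_{j=1}^{l_s}(\mu^s_j)^2 .$$ 2. The spectral projection $\pi:\mathcal L\mathrm{Rep}^{irr}(\Gamma_\ell,U(n))\cap\pi^{-1}(\mathcal L_{I,\ell}(n,\mathfrak m,z))\to\mathcal P_{I,\ell}(n,\mathfrak m,z)$ is locally surjective at $[\rho]$ (the image of every neighbourhood of $[\rho]$ contains a neighbourhood of $\mathfrak a$ in the stratum), and it is a smooth fibration near $[\rho]$: some neighbourhood of $[\rho]$ in the source is diffeomorphic to the product of a neighbourhood of $\mathfrak a$ in $\mathcal P_{I,\ell}(n,\mathfrak m,z)$ with an open subset of $\mathbb R^d$, so that $\pi$ becomes the projection to the first factor. 3. Twisting and bending deformations span all variations of the conjugacy classes. Let $\rho=\tilde\varphi(\lambda)$ with $\lambda=(L_1,\dots,L_\ell)$. A twist deformation of $\rho$ is $\tilde\varphi(c_1L_1,\dots,c_\ell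 L_\ell)$ with $c_s\in U(1)$. A real bending of length $r\in\{1,\dots,\ell\}$ about $L_s$ replaces $L_{s+1},\dots,L_{s+r}$ (indices mod $\ell$) by $bL_{s+1},\dots,bL_{s+r}$, where $b\in U(n)$ satisfies $bL_s=L_s$. Write the velocity at $\rho$ of a path of representations as $(X_s)$, $X_s=\dot\rho(\gamma_s)\rho(\gamma_s)^{-1}\in\mathfrak u(n)$, and let $V$ be the real span of the velocities of all twist deformations and of all real bendings of $\rho$ (of all lengths, about all $L_s$). Then: - (a) for every tangent vector $v=(v^s_j)$ to $\mathcal P_{I,\ell}(n,\mathfrak m,z)$ at $\mathfrak a$ there is $(X_s)\in V$ such that, for each $s$, $X_s$ equals, modulo the image of $1-\mathrm{Ad}_{\rho(\gamma_s)}$ on $\mathfrak u(n)$, the endomorphism $D_s$ acting as $2\pi i\,v^s_j$ on the $e^{2\pi i\alpha^s_j}$-eigenspace of $\rho(\gamma_s)$; - (b) for the velocity $(X_s)$ of any smooth deformation of $\rho$ through Lagrangian representations $\tilde\varphi(g_1(t)L_1,\dots,g_\ell(t)L_\ell)$, where the $g_s$ are smooth paths in $U(n)$ with $g_s(0)=1$,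 there is $(X'_s)\in V$ with $X_s-X'_s\in\mathrm{Im}(1-\mathrm{Ad}_{\rho(\gamma_s)})$ for all $s$. -/

import Mathlib

namespace LagRep

open scoped ContDiff Topology

noncomputable section

/-- Hermitian space `ℂⁿ`. -/
abbrev Cn (n : ℕ) : Type := EuclideanSpace ℂ (Fin n)

/-- The group `U(n)`. -/
abbrev Un (n : ℕ) : Type := Matrix.unitaryGroup (Fin n) ℂ

/-- Unitary matrices are the same as complex linear isometries of `ℂⁿ`. -/
def unEquiv (n : ℕ) : Un n ≃* (Cn n ≃ₗᵢ[ℂ] Cn n) :=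
  (Unitary.mapEquiv
    { (Matrix.toEuclideanCLM (n := Fin n) (𝕜 := ℂ)).toRingEquiv.toMulEquiv with
      map_star' := map_star (Matrix.toEuclideanCLM (n := Fin n) (𝕜 := ℂ)) }).toMulEquiv.trans
    Unitary.linearIsometryEquiv

theorem unEquiv_apply {n : ℕ} (g : Un n) (x : Cn n) :
    unEquiv n g x = WithLp.toLp 2 ((g : Matrix (Fin n) (Fin n) ℂ).mulVec x.ofLp) := rfl

/-! ### Representations of `Γ_ℓ` -/

/-- `Γ_ℓ = ⟨γ_1, …, γ_ℓ : γ_1 ⋯ γ_ℓ = 1⟩`. -/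
abbrev Gam (ℓ : ℕ) : Type :=
  PresentedGroup ({(List.ofFn (fun s : Fin ℓ => FreeGroup.of s)).prod} : Set (FreeGroup (Fin ℓ)))

/-- The generator `γ_s`. -/
def gen {ℓ : ℕ} (s : Fin ℓ) : Gam ℓ := PresentedGroup.of s

/-- `Hom(Γ_ℓ, U(n))`. -/
abbrev HomU (ℓ n : ℕ) : Type := Gam ℓ →* Un n

/-- The matrix `ρ(γ_s)`. -/
def genMat {ℓ n : ℕ} (ρ : HomU ℓ n) (s : Fin ℓ) : Matrix (Fin n) (Fin n) ℂ := (ρ (gen s) : Un n)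

/-- The entries of the matrices `ρ(γ_1), …, ρ(γ_ℓ)`: these realize `Hom(Γ_ℓ, U(n))` as a subset of
a finite dimensional vector space. -/
def coords {ℓ n : ℕ} (ρ : HomU ℓ n) : Fin ℓ → Fin n → Fin n → ℂ := fun s i j => genMat ρ s i j

/-- `Hom(Γ_ℓ, U(n))` is topologized as a subset of `U(n)^ℓ`. -/
instance homTopology (ℓ n : ℕ) : TopologicalSpace (HomU ℓ n) :=
  TopologicalSpace.induced coords inferInstance

/-- Conjugation of representations. -/
instance conjSetoid (ℓ n : ℕ) : Setoid (HomU ℓ n) where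
  r ρ ρ' := ∃ g : Un n, ∀ γ, ρ' γ = g * ρ γ * g⁻¹
  iseqv :=
    { refl := fun ρ => ⟨1, fun γ => by simp⟩
      symm := fun {ρ ρ'} ⟨g, hg⟩ => ⟨g⁻¹, fun γ => by rw [hg γ]; group⟩
      trans := fun {ρ ρ' ρ''} ⟨g, hg⟩ ⟨h, hh⟩ => ⟨h * g, fun γ => by rw [hh γ, hg γ]; group⟩ }

/-- The moduli space `Rep(Γ_ℓ, U(n)) = U(n) \ Hom(Γ_ℓ, U(n))`, with the quotient topology. -/
abbrev Rep (ℓ n : ℕ) : Type := Quotient (conjSetoid ℓ n)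

/-- The class `[ρ]` in the moduli space. -/
def cls {ℓ n : ℕ} (ρ : HomU ℓ n) : Rep ℓ n := Quotient.mk _ ρ

/-- The linear representation on `ℂⁿ` given by `ρ`. -/
def linRep {ℓ n : ℕ} (ρ : HomU ℓ n) : Representation ℂ (Gam ℓ) (Cn n) where
  toFun γ := ((unEquiv n (ρ γ)).toLinearEquiv : Cn n →ₗ[ℂ] Cn n)
  map_one' := by ext; simp
  map_mul' γ δ := by ext; simp

/-- Irreducibility of `ρ`. -/
def Irr {ℓ n : ℕ} (ρ : HomU ℓ n) : Prop := (linRep ρ).IsIrreducible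

/-! ### Spectra -/

/-- `spec(A) = (α_1 ≤ ⋯ ≤ α_n)` in `[0, 1)`, where `exp(2πiα_j)` are the eigenvalues of `A` with
multiplicity. -/
def spec {n : ℕ} (A : Matrix (Fin n) (Fin n) ℂ) : Fin n → ℝ := fun j =>
  ((A.charpoly.roots.map (fun w => Int.fract (Complex.arg w / (2 * Real.pi)))).sort
    (fun x y => x ≤ y)).getD j 0

/-- The spectral projection `π` on `Hom(Γ_ℓ, U(n))`. -/
def specHom {ℓ n : ℕ} (ρ : HomU ℓ n) : Fin ℓ → Fin n → ℝ := fun s => spec (genMat ρ s)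

theorem specHom_conj {ℓ n : ℕ} (ρ ρ' : HomU ℓ n) (h : ρ ≈ ρ') : specHom ρ = specHom ρ' := by
  obtain ⟨g, hg⟩ := h
  funext s
  have h1 : genMat ρ' s = (g : Matrix (Fin n) (Fin n) ℂ) * genMat ρ s *
      ((g⁻¹ : Un n) : Matrix (Fin n) (Fin n) ℂ) := by
    simp only [genMat, hg]
    rfl
  have h2 : (genMat ρ' s).charpoly = (genMat ρ s).charpoly := by
    rw [h1, Matrix.charpoly_mul_comm, ← mul_assoc]
    have h3 : ((g⁻¹ : Un n) : Matrix (Fin n) (Fin n) ℂ) * (g : Matrix (Fin n) (Fin n) ℂ) = 1 := by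
      have h4 : g⁻¹ * g = 1 := by group
      exact congrArg Subtype.val h4
    rw [h3, one_mul]
  unfold specHom spec
  rw [h2]

/-- The spectral projection `π` on `Rep(Γ_ℓ, U(n))`. -/
def specProj {ℓ n : ℕ} : Rep ℓ n → Fin ℓ → Fin n → ℝ := Quotient.lift specHom specHom_conj

/-- The index `I(𝔞)`. -/
def ind {ℓ n : ℕ} (a : Fin ℓ → Fin n → ℝ) : ℝ := ∑ s, ∑ j, a s j

/-- The vector `α` has the multiplicity structure of the ordered partition `c` of `n`:
its entries are constant on the blocks, and strictly increase from one block to the next. -/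
def HasMult {n : ℕ} (α : Fin n → ℝ) (c : Composition n) : Prop :=
  ∃ αhat : Fin c.length → ℝ, StrictMono αhat ∧ ∀ i, α i = αhat (c.index i)

/-- The stratum `P_{I,ℓ}(n, 𝔪, z)`: the spectral data of index `I` with entries in `[0, 1)`,
multiplicity structure `𝔪`, for which `0` occurs in the `s`-th row exactly when `s ∈ z`. -/
def stratum {ℓ n : ℕ} (I : ℕ) (m : Fin ℓ → Composition n) (z : Set (Fin ℓ)) :
    Set (Fin ℓ → Fin n → ℝ) :=
  {a | (∀ s j, 0 ≤ a s j ∧ a s j < 1) ∧ ind a = I ∧ (∀ s, HasMult (a s) (m s)) ∧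
    ∀ s, (∃ j, a s j = 0) ↔ s ∈ z}

/-! ### Lagrangian subspaces -/

/-- A Lagrangian subspace of `ℂⁿ`: a real subspace that is its own orthogonal complement for the
symplectic form `Im ⟨x, y⟩`. -/
@[ext]
structure Lagr (n : ℕ) where
  carrier : Submodule ℝ (Cn n)
  mem_iff : ∀ x, x ∈ carrier ↔ ∀ y ∈ carrier, (inner ℂ x y).im = 0

/-- The involution `σ_L` of `ℂⁿ` with fixed point set `L`. As the orthogonal complement of `L` for
`Re ⟨x, y⟩` is `iL`, the complex antilinear involution fixing `L` is the reflection in `L`. -/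
def Lagr.sigma {n : ℕ} (L : Lagr n) : Cn n ≃ₗᵢ[ℝ] Cn n := L.carrier.reflection

theorem real_inner_eq {n : ℕ} (x y : Cn n) : inner ℝ x y = (inner ℂ x y).re := by
  simp [PiLp.inner_apply]

theorem Lagr.I_smul_mem_orthogonal {n : ℕ} (L : Lagr n) {x : Cn n} (hx : x ∈ L.carrier) :
    Complex.I • x ∈ L.carrierᗮ := by
  rw [Submodule.mem_orthogonal]
  intro y hy
  rw [real_inner_eq, inner_smul_right]
  have := (L.mem_iff y).1 hy x hx
  simp [this]

theorem Lagr.I_smul_mem {n : ℕ} (L : Lagr n) {x : Cn n} (hx : x ∈ L.carrierᗮ) :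
    Complex.I • x ∈ L.carrier := by
  rw [L.mem_iff]
  intro y hy
  have h := (Submodule.mem_orthogonal' _ _).1 hx y hy
  rw [real_inner_eq] at h
  rw [inner_smul_left]
  simp [h]

theorem Lagr.sigma_I_smul {n : ℕ} (L : Lagr n) (x : Cn n) :
    L.sigma (Complex.I • x) = -(Complex.I • L.sigma x) := by
  obtain ⟨p, hp, q, hq, rfl⟩ := L.carrier.exists_add_mem_mem_orthogonal x
  have h1 := Submodule.reflection_mem_subspace_eq_self hp
  have h2 := Submodule.reflection_mem_subspace_orthogonalComplement_eq_neg hq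
  have h3 := Submodule.reflection_mem_subspace_eq_self (L.I_smul_mem hq)
  have h4 := Submodule.reflection_mem_subspace_orthogonalComplement_eq_neg
    (L.I_smul_mem_orthogonal hp)
  simp only [Lagr.sigma, smul_add, map_add, h1, h2, h3, h4, smul_neg]
  abel

theorem Lagr.sigma_smul {n : ℕ} (L : Lagr n) (c : ℂ) (x : Cn n) :
    L.sigma (c • x) = (starRingEnd ℂ c) • L.sigma x := by
  have h : ∀ y : Cn n, c • y = c.re • y + c.im • (Complex.I • y) := by
    intro y
    ext i
    simp only [PiLp.smul_apply, PiLp.add_apply, smul_eq_mul, Complex.real_smul]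
    conv_lhs => rw [← Complex.re_add_im c]
    ring
  have h' : ∀ y : Cn n, (starRingEnd ℂ c) • y = c.re • y - c.im • (Complex.I • y) := by
    intro y
    ext i
    simp only [PiLp.smul_apply, PiLp.sub_apply, smul_eq_mul, Complex.real_smul]
    have hc : (starRingEnd ℂ) c = c.re - c.im * Complex.I := by
      apply Complex.ext <;> simp
    rw [hc]
    ring
  rw [h, h', map_add, map_smul, map_smul, L.sigma_I_smul, smul_neg, sub_eq_add_neg]

theorem Lagr.sigma_sigma {n : ℕ} (L : Lagr n) (x : Cn n) : L.sigma (L.sigma x) = x :=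
  Submodule.reflection_reflection _ x

/-- `σ_{L₁} σ_{L₂}` as a complex linear isometry. -/
def Lagr.prodIso {n : ℕ} (L₁ L₂ : Lagr n) : Cn n ≃ₗᵢ[ℂ] Cn n where
  toFun x := L₁.sigma (L₂.sigma x)
  invFun x := L₂.sigma (L₁.sigma x)
  left_inv x := by simp only [Lagr.sigma_sigma]
  right_inv x := by simp only [Lagr.sigma_sigma]
  map_add' x y := by simp only [map_add]
  map_smul' c x := by simp [Lagr.sigma_smul]
  norm_map' x := by
    change ‖L₁.sigma (L₂.sigma x)‖ = ‖x‖
    rw [LinearIsometryEquiv.norm_map, LinearIsometryEquiv.norm_map]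

/-- `τ₂(L₁, L₂) = σ_{L₁} σ_{L₂} ∈ U(n)`. -/
def tau {n : ℕ} (L₁ L₂ : Lagr n) : Un n := (unEquiv n).symm (L₁.prodIso L₂)

theorem tau_self {n : ℕ} (L : Lagr n) : tau L L = 1 := by
  rw [tau, MulEquiv.symm_apply_eq, map_one]
  ext x : 1
  exact L.sigma_sigma x

theorem tau_mul {n : ℕ} (L₁ L₂ L₃ : Lagr n) : tau L₁ L₂ * tau L₂ L₃ = tau L₁ L₃ := by
  rw [tau, tau, ← map_mul, tau]
  congr 1
  ext x : 1
  change L₁.sigma (L₂.sigma (L₂.sigma (L₃.sigma x))) = L₁.sigma (L₃.sigma x)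
  rw [L₂.sigma_sigma]

theorem tau_chain {n k : ℕ} (L : Fin (k + 1) → Lagr n) :
    (List.ofFn (fun i : Fin k => tau (L i.castSucc) (L i.succ))).prod
      = tau (L 0) (L (Fin.last k)) := by
  induction k with
  | zero => simp [tau_self]
  | succ k ih =>
    rw [List.ofFn_succ, List.prod_cons]
    have := ih (fun i => L i.succ)
    simp only [Fin.succ_castSucc, Fin.succ_last] at this
    rw [this]
    exact tau_mul _ _ _

theorem tau_cycle {n ℓ : ℕ} (L : Fin ℓ → Lagr n) :
    (List.ofFn (fun s : Fin ℓ => tau (L s) (L (finRotate ℓ s)))).prod = 1 := by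
  cases ℓ with
  | zero => simp
  | succ k =>
    rw [List.ofFn_succ', List.concat_eq_append, List.prod_append]
    have h : ∀ i : Fin k, finRotate (k + 1) i.castSucc = i.succ := fun i => by simp
    simp only [h, finRotate_last, tau_chain, List.prod_singleton, tau_mul, tau_self]

/-- The representation `φ̃(L_1, …, L_ℓ)`, sending `γ_s` to `σ_{L_s} σ_{L_{s+1}}` (indices mod `ℓ`). -/
def lagRep {ℓ n : ℕ} (L : Fin ℓ → Lagr n) : HomU ℓ n :=
  PresentedGroup.toGroup (f := fun s => tau (L s) (L (finRotate ℓ s))) (by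
    intro r hr
    rw [Set.mem_singleton_iff.1 hr, map_list_prod, List.map_ofFn]
    simpa [Function.comp_def] using tau_cycle L)

/-- The set `LHom(Γ_ℓ, U(n))` of Lagrangian representations. -/
def LHom (ℓ n : ℕ) : Set (HomU ℓ n) := Set.range lagRep

/-- The set `LRep^{irr}(Γ_ℓ, U(n))` of classes of irreducible Lagrangian representations. -/
def LRepIrr (ℓ n : ℕ) : Set (Rep ℓ n) := cls '' {ρ | ρ ∈ LHom ℓ n ∧ Irr ρ}

/-- `LRep_𝔞^{irr}(Γ_ℓ, U(n))`. -/
def LRepIrrAt {ℓ n : ℕ} (a : Fin ℓ → Fin n → ℝ) : Set (Rep ℓ n) :=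
  LRepIrr ℓ n ∩ specProj ⁻¹' {a}

/-- `L_{I,ℓ}(n, 𝔪, z)`: the spectral data in the stratum realized by Lagrangian representations. -/
def lagStratum {ℓ n : ℕ} (I : ℕ) (m : Fin ℓ → Composition n) (z : Set (Fin ℓ)) :
    Set (Fin ℓ → Fin n → ℝ) :=
  specHom '' LHom ℓ n ∩ stratum I m z

/-! ### Smooth structure on subsets of the moduli space

A function on a subset of the moduli space is smooth if its pull-back to
`Hom(Γ_ℓ, U(n)) ⊆ (ℂ^{n×n})^ℓ` locally extends to a smooth function of the matrix entries; a map into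
the moduli space is smooth if it locally lifts to a smooth family of representations. -/

/-- `Φ` restricts to a diffeomorphism from the subset `S` of the moduli space onto the subset `T`
of the vector space `E`. -/
def IsDiffeo {ℓ n : ℕ} {E : Type} [NormedAddCommGroup E] [NormedSpace ℝ E]
    (S : Set (Rep ℓ n)) (T : Set E) (Φ : Rep ℓ n → E) : Prop :=
  Set.BijOn Φ S T ∧
  (∀ ρ : HomU ℓ n, cls ρ ∈ S →
    ∃ (U : Set (Fin ℓ → Fin n → Fin n → ℂ)) (g : (Fin ℓ → Fin n → Fin n → ℂ) → E),
      IsOpen U ∧ coords ρ ∈ U ∧ ContDiffOn ℝ ∞ g U ∧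
      ∀ ρ' : HomU ℓ n, cls ρ' ∈ S → coords ρ' ∈ U → g (coords ρ') = Φ (cls ρ')) ∧
  (∀ t ∈ T, ∃ (U : Set E) (h : E → (Fin ℓ → Fin n → Fin n → ℂ)),
      IsOpen U ∧ t ∈ U ∧ ContDiffOn ℝ ∞ h U ∧
      ∀ t' ∈ T ∩ U, ∃ ρ' : HomU ℓ n, coords ρ' = h t' ∧ cls ρ' ∈ S ∧ Φ (cls ρ') = t')

/-- Near `x`, the subset `S` of the moduli space is a smooth manifold of dimension `d`. -/
def IsManifoldNear {ℓ n : ℕ} (d : ℕ) (S : Set (Rep ℓ n)) (x : Rep ℓ n) : Prop :=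
  ∃ (W : Set (Rep ℓ n)) (V : Set (EuclideanSpace ℝ (Fin d)))
    (Φ : Rep ℓ n → EuclideanSpace ℝ (Fin d)),
    IsOpen W ∧ x ∈ W ∧ x ∈ S ∧ IsOpen V ∧ IsDiffeo (S ∩ W) V Φ

/-- The map `f : S → P` is locally surjective at `x ∈ S`: the image of each neighbourhood of `x`
in `S` contains a neighbourhood of `f x` in `P`. -/
def IsLocSurjAt {ℓ n : ℕ} {F : Type} [TopologicalSpace F]
    (S : Set (Rep ℓ n)) (P : Set F) (f : Rep ℓ n → F) (x : Rep ℓ n) : Prop :=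
  ∀ W : Set (Rep ℓ n), IsOpen W → x ∈ W →
    ∃ B : Set F, IsOpen B ∧ f x ∈ B ∧ P ∩ B ⊆ f '' (S ∩ W)

/-- The map `f : S → P` is a smooth fibration near `x ∈ S`: a neighbourhood of `x` in `S` is
diffeomorphic to the product of a neighbourhood of `f x` in `P` and an open set of `ℝ^d`, in such a
way that `f` becomes the first projection. -/
def IsFibrationNear {ℓ n : ℕ} {F : Type} [NormedAddCommGroup F] [NormedSpace ℝ F] (d : ℕ)
    (S : Set (Rep ℓ n)) (P : Set F) (f : Rep ℓ n → F) (x : Rep ℓ n) : Prop :=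
  ∃ (W : Set (Rep ℓ n)) (B : Set F) (V : Set (EuclideanSpace ℝ (Fin d)))
    (Φ : Rep ℓ n → F × EuclideanSpace ℝ (Fin d)),
    IsOpen W ∧ x ∈ W ∧ x ∈ S ∧ IsOpen B ∧ f x ∈ B ∧ IsOpen V ∧
    (∀ y ∈ S ∩ W, (Φ y).1 = f y) ∧ IsDiffeo (S ∩ W) ((P ∩ B) ×ˢ V) Φ

/-! ### Deformations of Lagrangian representations -/

theorem unEquiv_inv_apply {n : ℕ} (g : Un n) (x : Cn n) :
    unEquiv n g (unEquiv n g⁻¹ x) = x := by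
  change (unEquiv n g * unEquiv n g⁻¹) x = x
  rw [← map_mul]
  simp

/-- The action `L ↦ gL` of `U(n)` on Lagrangian subspaces. -/
def Lagr.act {n : ℕ} (g : Un n) (L : Lagr n) : Lagr n where
  carrier := L.carrier.map (((unEquiv n g).toLinearEquiv : Cn n →ₗ[ℂ] Cn n).restrictScalars ℝ)
  mem_iff x := by
    constructor
    · rintro ⟨x, hx, rfl⟩ y ⟨y, hy, rfl⟩
      simpa using (L.mem_iff x).1 hx y hy
    · intro h
      refine ⟨unEquiv n g⁻¹ x, (L.mem_iff _).2 fun y hy => ?_, unEquiv_inv_apply g x⟩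
      have := h (unEquiv n g y) ⟨y, hy, rfl⟩
      rwa [← unEquiv_inv_apply g x, LinearIsometryEquiv.inner_map_map] at this

/-- The scalar matrix `c ∈ U(1) ⊆ U(n)`. -/
def scalarU (n : ℕ) (c : Circle) : Un n :=
  ⟨(c : ℂ) • (1 : Matrix (Fin n) (Fin n) ℂ), by
    rw [Matrix.mem_unitaryGroup_iff, star_smul, star_one, Matrix.smul_mul, Matrix.one_mul,
      smul_smul]
    simp [Complex.mul_conj]⟩

/-- The twist `(c_1 L_1, …, c_ℓ L_ℓ)`. -/
def twist {ℓ n : ℕ} (c : Fin ℓ → Circle) (L : Fin ℓ → Lagr n) : Fin ℓ → Lagr n :=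
  fun s => (L s).act (scalarU n (c s))

open Classical in
/-- The result of replacing `L_{s+1}, …, L_{s+r}` (indices mod `ℓ`) by `b L_{s+1}, …, b L_{s+r}`. -/
def bend {ℓ n : ℕ} (s : Fin ℓ) (r : ℕ) (b : Un n) (L : Fin ℓ → Lagr n) : Fin ℓ → Lagr n :=
  fun s' => if ∃ k : ℕ, 1 ≤ k ∧ k ≤ r ∧ (finRotate ℓ ^ k) s = s' then (L s').act b else L s'

/-- `X = (X_1, …, X_ℓ)` is the velocity at `t = 0` of the path of representations `ρ_t`, in the
right trivialization: `X_s = (d/dt) ρ_t(γ_s) · ρ_0(γ_s)⁻¹`. -/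
def IsVelocity {ℓ n : ℕ} (ρ : ℝ → HomU ℓ n) (X : Fin ℓ → Matrix (Fin n) (Fin n) ℂ) : Prop :=
  ∀ s i j, HasDerivAt (fun t => genMat (ρ t) s i j) ((X s * genMat (ρ 0) s) i j) 0

/-- A smooth path in `U(n)` starting at the identity. -/
def IsSmoothPath {n : ℕ} (g : ℝ → Un n) : Prop :=
  g 0 = 1 ∧ ∀ i j, ContDiff ℝ ∞ (fun t => (g t : Matrix (Fin n) (Fin n) ℂ) i j)

/-- Velocities of twist deformations of `φ̃(L)`. -/
def twistVel {ℓ n : ℕ} (L : Fin ℓ → Lagr n) : Set (Fin ℓ → Matrix (Fin n) (Fin n) ℂ) :=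
  {X | ∃ c : ℝ → Fin ℓ → Circle, (∀ s, c 0 s = 1) ∧ (∀ s, ContDiff ℝ ∞ (fun t => (c t s : ℂ))) ∧
    IsVelocity (fun t => lagRep (twist (c t) L)) X}

/-- Velocities of real bendings of `φ̃(L)` of length `r` about `L_s`, i.e. by elements of the
stabilizer of `L_s`. -/
def bendVel {ℓ n : ℕ} (L : Fin ℓ → Lagr n) (s : Fin ℓ) (r : ℕ) :
    Set (Fin ℓ → Matrix (Fin n) (Fin n) ℂ) :=
  {X | ∃ b : ℝ → Un n, IsSmoothPath b ∧ (∀ t, (L s).act (b t) = L s) ∧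
    IsVelocity (fun t => lagRep (bend s r (b t) L)) X}

/-- Velocities of arbitrary Lagrangian deformations of `φ̃(L)`. -/
def lagVel {ℓ n : ℕ} (L : Fin ℓ → Lagr n) : Set (Fin ℓ → Matrix (Fin n) (Fin n) ℂ) :=
  {X | ∃ g : ℝ → Fin ℓ → Un n, (∀ s, IsSmoothPath (fun t => g t s)) ∧
    IsVelocity (fun t => lagRep (fun s => (L s).act (g t s))) X}

/-- The real span of the velocities of all twist deformations and all real bendings of `φ̃(L)`. -/
def twistBendSpan {ℓ n : ℕ} (L : Fin ℓ → Lagr n) :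
    Submodule ℝ (Fin ℓ → Matrix (Fin n) (Fin n) ℂ) :=
  Submodule.span ℝ (twistVel L ∪ {X | ∃ (s : Fin ℓ) (r : ℕ), 1 ≤ r ∧ r ≤ ℓ ∧ X ∈ bendVel L s r})

/-- `X` is tangent (in the right trivialization) to the conjugacy class of `A`:
`X = (1 - Ad_A) Y` for some `Y ∈ 𝔲(n)`. -/
def IsConjTangent {n : ℕ} (A : Un n) (X : Matrix (Fin n) (Fin n) ℂ) : Prop :=
  ∃ Y : Matrix (Fin n) (Fin n) ℂ, star Y = -Y ∧
    X = Y - (A : Matrix (Fin n) (Fin n) ℂ) * Y * ((A⁻¹ : Un n) : Matrix (Fin n) (Fin n) ℂ)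

/-- `D` is the velocity (in the right trivialization) at `A` of the variation of `A` which fixes its
eigenvectors and moves the eigenvalue `exp(2πiα_j)` with velocity `v_j` in `α_j`. -/
def IsEigenVel {n : ℕ} (A : Un n) (α v : Fin n → ℝ) (D : Matrix (Fin n) (Fin n) ℂ) : Prop :=
  ∀ (j : Fin n) (w : Fin n → ℂ),
    (A : Matrix (Fin n) (Fin n) ℂ).mulVec w
      = Complex.exp (2 * Real.pi * Complex.I * (α j : ℂ)) • w →
    D.mulVec w = (2 * Real.pi * Complex.I * (v j : ℂ)) • w

/-- `v` is a tangent vector at `a` to the (relatively open in an affine space) set `P`. -/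
def IsTangent {F : Type} [AddCommGroup F] [Module ℝ F] (P : Set F) (a v : F) : Prop :=
  ∀ᶠ t : ℝ in 𝓝 0, a + t • v ∈ P

end

end LagRep

open LagRep

/-! ### Lagrangian subspaces as symmetric unitary matrices, and spectra. -/

namespace LagRep

open scoped ContDiff Topology Matrix
open Matrix

noncomputable section

/-! ### Lagrangian subspaces and unitary frames -/

/-! A Lagrangian subspace `L = U ℝⁿ` is encoded by the symmetric unitary matrix `S = U Uᵀ`, since
`σ_L x = S x̄`. A Lagrangian representation then has `A_s = S_s S_{s+1}ᴴ`, and the eigenvectors of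
`A_s` can be chosen to form a frame `U_s` of `L_s`, with `L_{s+1} = U_s Δ(-α_s) ℝⁿ`
(`exists_frame_pair`).

The map `X ↦ S Xᵀ Sᴴ` (`refl`) is an involution on skew-Hermitian matrices, self-adjoint for the
trace form: its `+1` eigenspace is the tangent space of the Lagrangian Grassmannian at `L`, its `-1`
eigenspace the Lie algebra of the stabilizer of `L`. A matrix fixed by all these involutions
commutes with all `A_s`, hence is scalar when the representation is irreducible
(`scalar_of_refl_eq`). Every surjectivity statement follows by duality: a functional killing the
image is a trace pairing whose symmetrization is fixed by all the involutions, so it is scalar, and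
twists or a trace condition dispose of the scalar. This yields part 3 (`lagVar_single_mem`,
`exists_lagVar_eq_mod`), and also that the linearized closing condition below is onto the families
of total trace zero (`exists_symDiff_eq`).

For parts 1 and 2, move the frames to `cay(p_s) U_s` and the spectra to `α_s + t_s`. This describes
Lagrangian subspaces exactly when a closing condition holds around the cycle. Total conjugation and
the changes of frame preserving `L_s` and `A_s` are redundant; a linear complement `C` of these
gauge directions is chosen. The closing condition is a submersion already along `C` with `t = 0`, so
its zeros are parametrized by the spectra and `d` further coordinates; counting dimensions gives
`d`. The traces of words are conjugation invariant and, by infinitesimal rigidity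
(`eq_gauge_of_trace_wordVar`: an infinitesimal variation of an irreducible tuple that preserves the
traces of words is a commutator), they separate tangent vectors of the model, so they supply smooth
coordinates on the moduli space.

The model contains every class near `[ρ]` with spectrum in the stratum. Indeed the frames and
spectra over a representation lie in a compact space, those over `ρ` form a single gauge orbit, and
a slice theorem (`eventually_exists_slice`) applies along this orbit. The criterion
`isFibrationNear_of_model` turns these facts into the fibration; local surjectivity and the manifold
structure of the fibre are consequences. -/

theorem unEquiv_ofLp {n : ℕ} (g : Un n) (x : Cn n) :
    (unEquiv n g x).ofLp = (g : Matrix (Fin n) (Fin n) ℂ) *ᵥ x.ofLp := rfl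

theorem Un.star_mul_self {n : ℕ} (g : Un n) :
    (g : Matrix (Fin n) (Fin n) ℂ)ᴴ * (g : Matrix (Fin n) (Fin n) ℂ) = 1 :=
  Matrix.mem_unitaryGroup_iff'.1 g.2

theorem Un.mul_star_self {n : ℕ} (g : Un n) :
    (g : Matrix (Fin n) (Fin n) ℂ) * (g : Matrix (Fin n) (Fin n) ℂ)ᴴ = 1 :=
  Matrix.mem_unitaryGroup_iff.1 g.2

theorem Un.coe_mul {n : ℕ} (g h : Un n) :
    ((g * h : Un n) : Matrix (Fin n) (Fin n) ℂ)
      = (g : Matrix (Fin n) (Fin n) ℂ) * (h : Matrix (Fin n) (Fin n) ℂ) := rfl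

theorem Un.coe_inv {n : ℕ} (g : Un n) :
    ((g⁻¹ : Un n) : Matrix (Fin n) (Fin n) ℂ) = (g : Matrix (Fin n) (Fin n) ℂ)ᴴ := rfl

/-- Passing to symplectic orthogonal complements reverses an inclusion and fixes both subspaces. -/
theorem Lagr.eq_of_le {n : ℕ} {L L' : Lagr n} (h : L.carrier ≤ L'.carrier) : L = L' := by
  refine Lagr.ext (le_antisymm h fun x hx => (L.mem_iff x).2 fun y hy => ?_)
  exact (L'.mem_iff x).1 hx y (h hy)

theorem Lagr.act_one {n : ℕ} (L : Lagr n) : L.act 1 = L := by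
  refine Lagr.eq_of_le ?_
  rintro _ ⟨y, hy, rfl⟩
  simpa using hy

theorem Lagr.act_act {n : ℕ} (g h : Un n) (L : Lagr n) : (L.act h).act g = L.act (g * h) := by
  refine Lagr.eq_of_le ?_
  rintro _ ⟨_, ⟨y, hy, rfl⟩, rfl⟩
  refine ⟨y, hy, ?_⟩
  simp

theorem inner_eq_sum {n : ℕ} (x y : Cn n) :
    inner ℂ x y = ∑ k, (starRingEnd ℂ) (x k) * y k := by
  simp [PiLp.inner_apply, mul_comm]

/-- The standard Lagrangian subspace `ℝⁿ ⊆ ℂⁿ`. -/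
def stdLagr (n : ℕ) : Lagr n where
  carrier :=
    { carrier := {x | ∀ j, (starRingEnd ℂ) (x j) = x j}
      add_mem' := fun {a b} ha hb j => by simp [ha j, hb j]
      zero_mem' := fun j => by simp
      smul_mem' := fun c a ha j => by simp [ha j] }
  mem_iff x := by
    constructor
    · intro hx y hy
      rw [← Complex.conj_eq_iff_im, inner_eq_sum, map_sum]
      refine Finset.sum_congr rfl fun k _ => ?_
      rw [map_mul, hx k, hx k, hy k]
    · intro h j
      have := h (EuclideanSpace.single j 1) (fun k => by
        by_cases hk : k = j
        · subst hk; simp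
        · simp [hk])
      rw [inner_eq_sum] at this
      rw [Complex.conj_eq_iff_im]
      simpa [Finset.sum_ite_eq] using this

/-- Multiplication by `i` exchanges `L` with its real orthogonal complement. -/
theorem Lagr.finrank_eq {n : ℕ} (L : Lagr n) : Module.finrank ℝ L.carrier = n := by
  have e : L.carrier ≃ₗ[ℝ] L.carrierᗮ :=
    { toFun := fun x => ⟨Complex.I • (x : Cn n), L.I_smul_mem_orthogonal x.2⟩
      invFun := fun x => ⟨-(Complex.I • (x : Cn n)), L.carrier.neg_mem (L.I_smul_mem x.2)⟩
      left_inv := fun x => by ext j; simp [← mul_assoc]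
      right_inv := fun x => by ext j; simp [← mul_assoc]
      map_add' := fun x y => by ext j; simp
      map_smul' := fun c x => by ext j; simp; ring }
  have h1 := Submodule.finrank_add_finrank_orthogonal L.carrier
  have h2 := e.finrank_eq
  have h3 : Module.finrank ℝ (Cn n) = 2 * n := by
    rw [finrank_real_of_complex]; simp
  omega

/-- A real orthonormal basis of `L` is also Hermitian orthonormal, because the imaginary part of the
inner product vanishes on `L`; its vectors are the columns of `U`. -/
theorem Lagr.exists_frame {n : ℕ} (L : Lagr n) : ∃ U : Un n, L = (stdLagr n).act U := by
  let b := (stdOrthonormalBasis ℝ L.carrier).reindex (finCongr L.finrank_eq)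
  let U : Matrix (Fin n) (Fin n) ℂ := Matrix.of fun i j => (b j : Cn n) i
  have hU : U ∈ Matrix.unitaryGroup (Fin n) ℂ := by
    rw [Matrix.mem_unitaryGroup_iff']
    ext i j
    have h1 : (star U * U) i j = inner ℂ (b i : Cn n) (b j : Cn n) := by
      rw [inner_eq_sum, Matrix.mul_apply]
      rfl
    have h2 := (L.mem_iff _).1 (b i).2 _ (b j).2
    have h3 : inner ℝ (b i) (b j) = if i = j then 1 else 0 :=
      orthonormal_iff_ite.1 b.orthonormal i j
    rw [Submodule.coe_inner, real_inner_eq] at h3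
    rw [h1, Matrix.one_apply]
    apply Complex.ext
    · rw [h3]; split_ifs <;> simp
    · rw [h2]; split_ifs <;> simp
  refine ⟨⟨U, hU⟩, (Lagr.eq_of_le ?_).symm⟩
  rintro _ ⟨x, hx, rfl⟩
  have hx' : ∀ j, x j = ((x j).re : ℂ) := fun j =>
    (Complex.conj_eq_iff_re.1 (hx j)).symm
  have : unEquiv n ⟨U, hU⟩ x = ∑ j, (x j).re • (b j : Cn n) := by
    ext i
    rw [unEquiv_ofLp]
    simp only [Matrix.mulVec, dotProduct, WithLp.ofLp_sum, Finset.sum_apply, WithLp.ofLp_smul,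
      Pi.smul_apply, Complex.real_smul]
    refine Finset.sum_congr rfl fun j _ => ?_
    rw [← hx' j, mul_comm]
    rfl
  change unEquiv n ⟨U, hU⟩ x ∈ L.carrier
  rw [this]
  exact Submodule.sum_mem _ fun j _ => L.carrier.smul_mem _ (b j).2

/-- Write `x = U w`. The involution conjugates the coordinates `w = Uᴴ x`, and `U` times the
conjugate of `Uᴴ x` is `U Uᵀ x̄`. -/
theorem sigma_act_std {n : ℕ} (U : Un n) (x : Cn n) :
    (((stdLagr n).act U).sigma x).ofLp
      = ((U : Matrix (Fin n) (Fin n) ℂ) * (U : Matrix (Fin n) (Fin n) ℂ)ᵀ) *ᵥ (star x.ofLp) := by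
  set w : Cn n := unEquiv n U⁻¹ x with hw
  have hx : unEquiv n U w = x := unEquiv_inv_apply U x
  let p : Cn n := WithLp.toLp 2 fun j => ((w j).re : ℂ)
  let q : Cn n := WithLp.toLp 2 fun j => ((w j).im : ℂ)
  have hp : unEquiv n U p ∈ ((stdLagr n).act U).carrier := ⟨p, fun j => by simp [p], rfl⟩
  have hq : unEquiv n U q ∈ ((stdLagr n).act U).carrier := ⟨q, fun j => by simp [q], rfl⟩
  have hwpq : w = p + Complex.I • q := by
    ext j
    simp only [PiLp.add_apply, PiLp.smul_apply, smul_eq_mul, p, q]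
    rw [mul_comm, Complex.re_add_im]
  have hs : ((stdLagr n).act U).sigma x = unEquiv n U (p - Complex.I • q) := by
    rw [← hx, hwpq, map_add, map_smul, map_add, Lagr.sigma_I_smul, map_sub, map_smul]
    have h1 : ((stdLagr n).act U).sigma (unEquiv n U p) = unEquiv n U p :=
      Submodule.reflection_mem_subspace_eq_self hp
    have h2 : ((stdLagr n).act U).sigma (unEquiv n U q) = unEquiv n U q :=
      Submodule.reflection_mem_subspace_eq_self hq
    rw [h1, h2, sub_eq_add_neg]
  have hc : (p - Complex.I • q).ofLp = star w.ofLp := by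
    funext j
    have : w.ofLp j = (w j).re + (w j).im * Complex.I := (Complex.re_add_im _).symm
    simp only [Pi.star_apply, p, q, WithLp.ofLp_sub, WithLp.ofLp_smul, Pi.sub_apply, Pi.smul_apply,
      smul_eq_mul]
    apply Complex.ext <;> simp
  rw [hs, unEquiv_ofLp, hc, ← Matrix.mulVec_mulVec, hw, unEquiv_ofLp]
  congr 1
  have : ((U⁻¹ : Un n) : Matrix (Fin n) (Fin n) ℂ) = (U : Matrix (Fin n) (Fin n) ℂ)ᴴ := rfl
  rw [this, Matrix.star_mulVec, Matrix.conjTranspose_conjTranspose, ← Matrix.vecMul_transpose,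
    Matrix.transpose_transpose]

theorem eq_of_mulVec_toLp {n : ℕ} {A B : Matrix (Fin n) (Fin n) ℂ}
    (h : ∀ x : Cn n, A *ᵥ x.ofLp = B *ᵥ x.ofLp) : A = B :=
  Matrix.mulVec_injective (funext fun x => h (WithLp.toLp 2 x))

theorem tau_mulVec {n : ℕ} (L₁ L₂ : Lagr n) (x : Cn n) :
    (tau L₁ L₂ : Matrix (Fin n) (Fin n) ℂ) *ᵥ x.ofLp = (L₁.sigma (L₂.sigma x)).ofLp := by
  rw [← unEquiv_ofLp, tau, MulEquiv.apply_symm_apply]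
  rfl

/-- Conjugating twice gives `S_U` times the entrywise conjugate of `S_V`, which is `S_Vᴴ` by
symmetry of `S_V`. -/
theorem tau_act_std {n : ℕ} (U V : Un n) :
    (tau ((stdLagr n).act U) ((stdLagr n).act V) : Matrix (Fin n) (Fin n) ℂ)
      = ((U : Matrix (Fin n) (Fin n) ℂ) * (U : Matrix (Fin n) (Fin n) ℂ)ᵀ) *
        ((V : Matrix (Fin n) (Fin n) ℂ) * (V : Matrix (Fin n) (Fin n) ℂ)ᵀ)ᴴ := by
  refine eq_of_mulVec_toLp fun x => ?_
  rw [tau_mulVec, sigma_act_std, sigma_act_std, Matrix.star_mulVec, star_star,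
    ← Matrix.mulVec_transpose, Matrix.mulVec_mulVec]
  congr 2
  rw [Matrix.conjTranspose_mul, Matrix.transpose_mul]
  rfl

theorem Lagr.mem_iff_sigma {n : ℕ} (L : Lagr n) (x : Cn n) : x ∈ L.carrier ↔ L.sigma x = x :=
  (Submodule.reflection_eq_self_iff x).symm

theorem tau_left_injective {n : ℕ} {L L₁ L₂ : Lagr n} (h : tau L L₁ = tau L L₂) : L₁ = L₂ := by
  refine Lagr.eq_of_le fun x hx => ?_
  rw [Lagr.mem_iff_sigma] at hx ⊢
  have h1 := tau_mulVec L L₁ x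
  rw [h, tau_mulVec, hx] at h1
  have h2 : L.sigma (L₂.sigma x) = L.sigma x := WithLp.ofLp_injective 2 h1
  exact L.sigma.injective h2

theorem genMat_lagRep {ℓ n : ℕ} (L : Fin ℓ → Lagr n) (s : Fin ℓ) :
    genMat (lagRep L) s = (tau (L s) (L (finRotate ℓ s)) : Matrix (Fin n) (Fin n) ℂ) := by
  unfold genMat lagRep gen
  rw [PresentedGroup.toGroup.of]

theorem genMat_injective {ℓ n : ℕ} {ρ ρ' : HomU ℓ n} (h : ∀ s, genMat ρ s = genMat ρ' s) :
    ρ = ρ' :=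
  PresentedGroup.ext fun s => Subtype.ext (h s)

theorem genMat_mem {ℓ n : ℕ} (ρ : HomU ℓ n) (s : Fin ℓ) :
    genMat ρ s ∈ Matrix.unitaryGroup (Fin n) ℂ := (ρ (gen s)).2

/-! ### Orthogonal diagonalization of symmetric unitary matrices -/

theorem exists_joint_eigenbasis {E : Type*} [NormedAddCommGroup E] [InnerProductSpace ℝ E]
    [FiniteDimensional ℝ E] {n : ℕ} (hn : Module.finrank ℝ E = n) {f g : E →ₗ[ℝ] E}
    (hA : f.IsSymmetric) (hB : g.IsSymmetric) (hAB : Commute f g) :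
    ∃ (b : OrthonormalBasis (Fin n) ℝ E) (x y : Fin n → ℝ), (∀ j, f (b j) = x j • b j) ∧
      ∀ j, g (b j) = y j • b j := by
  have hint := LinearMap.IsSymmetric.directSum_isInternal_of_commute hA hB hAB
  have horth := LinearMap.IsSymmetric.orthogonalFamily_eigenspace_inf_eigenspace hA hB
  have htop := hint.submodule_iSup_eq_top
  -- Discarding the zero joint eigenspaces leaves a finite index set, so that orthonormal bases of
  -- the remaining ones can be collected into one.
  let ι := {p : ℝ × ℝ // Module.End.eigenspace f p.2 ⊓ Module.End.eigenspace g p.1 ≠ ⊥}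
  have hfin : Finite ι :=
    (WellFoundedGT.finite_ne_bot_of_iSupIndep hint.submodule_iSupIndep).to_subtype
  have : Fintype ι := Fintype.ofFinite ι
  let W : ι → Submodule ℝ (E) := fun p =>
    Module.End.eigenspace f p.1.2 ⊓ Module.End.eigenspace g p.1.1
  have hW : OrthogonalFamily ℝ (fun i => W i) fun i => (W i).subtypeₗᵢ :=
    horth.comp Subtype.val_injective
  have hWtop : iSup W = ⊤ := by
    rw [eq_top_iff, ← htop]
    refine iSup_le fun p => ?_
    by_cases hp : Module.End.eigenspace f p.2 ⊓ Module.End.eigenspace g p.1 = ⊥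
    · rw [hp]; exact bot_le
    · exact le_iSup W ⟨p, hp⟩
  have hWint : DirectSum.IsInternal W := by
    rw [hW.isInternal_iff, hWtop, Submodule.top_orthogonal_eq_bot]
  let b := hWint.subordinateOrthonormalBasis hn hW
  let idx := fun j => hWint.subordinateOrthonormalBasisIndex hn j hW
  have hb : ∀ j, b j ∈ W (idx j) := fun j => hWint.subordinateOrthonormalBasis_subordinate hn j hW
  exact ⟨b, fun j => (idx j).1.2, fun j => (idx j).1.1,
    fun j => Module.End.mem_eigenspace_iff.1 (hb j).1,
    fun j => Module.End.mem_eigenspace_iff.1 (hb j).2⟩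

/-- Write `B = X + iY`. Symmetry of `B` makes `X` and `Y` real symmetric, and the imaginary part of
`Bᴴ B = 1` says that they commute; a joint real eigenbasis diagonalizes `B`. The condition `Oᵀ = Oᴴ`
says that `O` is real. -/
theorem exists_real_orthogonal_diagonalization {n : ℕ} {B : Matrix (Fin n) (Fin n) ℂ}
    (hB : Bᴴ * B = 1) (hs : Bᵀ = B) :
    ∃ (O : Matrix (Fin n) (Fin n) ℂ) (w : Fin n → ℂ), Oᴴ * O = 1 ∧ Oᵀ = Oᴴ ∧
      B = O * Matrix.diagonal w * Oᴴ := by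
  let X : Matrix (Fin n) (Fin n) ℝ := B.map Complex.re
  let Y : Matrix (Fin n) (Fin n) ℝ := B.map Complex.im
  have hXs : Xᵀ = X := by
    ext i j; exact congrArg Complex.re (congrFun (congrFun hs i) j)
  have hYs : Yᵀ = Y := by
    ext i j; exact congrArg Complex.im (congrFun (congrFun hs i) j)
  have hXY : X * Y = Y * X := by
    ext i j
    have h1 : (Bᴴ * B) i j = ∑ k, star (B i k) * B k j := by
      rw [Matrix.mul_apply]
      refine Finset.sum_congr rfl fun k _ => ?_
      rw [Matrix.conjTranspose_apply]
      congr 2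
      exact congrFun (congrFun hs i) k
    have h2 := congrArg Complex.im h1
    rw [hB, Complex.im_sum] at h2
    have h3 : ((1 : Matrix (Fin n) (Fin n) ℂ) i j).im = 0 := by
      rw [Matrix.one_apply]; split_ifs <;> simp
    rw [h3] at h2
    simp only [Complex.star_def, Complex.mul_im, Complex.conj_re, Complex.conj_im] at h2
    rw [Finset.sum_add_distrib] at h2
    simp only [neg_mul, Finset.sum_neg_distrib] at h2
    rw [Matrix.mul_apply, Matrix.mul_apply]
    simp only [X, Y, Matrix.map_apply]
    linarith
  let fX := Matrix.toEuclideanLin X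
  let fY := Matrix.toEuclideanLin Y
  have hfX : fX.IsSymmetric := Matrix.isSymmetric_toEuclideanLin_iff.2 (by
    rw [Matrix.IsHermitian, Matrix.conjTranspose_eq_transpose_of_trivial, hXs])
  have hfY : fY.IsSymmetric := Matrix.isSymmetric_toEuclideanLin_iff.2 (by
    rw [Matrix.IsHermitian, Matrix.conjTranspose_eq_transpose_of_trivial, hYs])
  have hcomm : Commute fX fY := by
    refine LinearMap.ext fun v => ?_
    change fX (fY v) = fY (fX v)
    simp only [fX, fY, Matrix.toLpLin_apply, Matrix.mulVec_mulVec, hXY]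
  obtain ⟨b, x, y, hx, hy⟩ := exists_joint_eigenbasis (finrank_euclideanSpace_fin (𝕜 := ℝ) (n := n)) hfX hfY hcomm
  let O : Matrix (Fin n) (Fin n) ℂ := Matrix.of fun i j => ((b j i : ℝ) : ℂ)
  have hOO : Oᴴ * O = 1 := by
    ext i j
    have h1 : inner ℝ (b i) (b j) = if i = j then 1 else 0 :=
      orthonormal_iff_ite.1 b.orthonormal i j
    rw [Matrix.mul_apply, Matrix.one_apply]
    have h2 : ∑ k, Oᴴ i k * O k j = ((inner ℝ (b i) (b j) : ℝ) : ℂ) := by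
      rw [PiLp.inner_apply, Complex.ofReal_sum]
      refine Finset.sum_congr rfl fun k _ => ?_
      simp [O, mul_comm]
    rw [h2, h1]
    split_ifs <;> simp
  have hOt : Oᵀ = Oᴴ := by
    ext i j; simp [O]
  refine ⟨O, fun j => (x j : ℂ) + (y j : ℂ) * Complex.I, hOO, hOt, ?_⟩
  have hBO : B * O = O * Matrix.diagonal
      (fun j => (x j : ℂ) + (y j : ℂ) * Complex.I) := by
    ext i j
    have hx' := congrFun (congrArg WithLp.ofLp (hx j)) i
    have hy' := congrFun (congrArg WithLp.ofLp (hy j)) i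
    simp only [fX, fY, Matrix.toLpLin_apply, Matrix.mulVec, dotProduct, WithLp.ofLp_smul,
      Pi.smul_apply, smul_eq_mul] at hx' hy'
    rw [Matrix.mul_diagonal, Matrix.mul_apply]
    have h1 : ∀ k, B i k * O k j = ((X i k * b j k : ℝ) : ℂ) + ((Y i k * b j k : ℝ) : ℂ) *
        Complex.I := by
      intro k
      simp only [X, Y, O, Matrix.map_apply, Matrix.of_apply, Complex.ofReal_mul]
      conv_lhs => rw [← Complex.re_add_im (B i k)]
      ring
    simp only [h1]
    rw [Finset.sum_add_distrib, ← Finset.sum_mul, ← Complex.ofReal_sum, ← Complex.ofReal_sum, hx',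
      hy']
    simp only [O, Matrix.of_apply, Complex.ofReal_mul]
    ring
  rw [← hBO, mul_assoc, mul_eq_one_comm.1 hOO, mul_one]

/-! ### Spectra of unitary matrices -/

/-- The diagonal matrix with entries `exp(πiθ_j)`. -/
def Delta {n : ℕ} (θ : Fin n → ℝ) : Matrix (Fin n) (Fin n) ℂ :=
  Matrix.diagonal fun j => Complex.exp (Real.pi * Complex.I * (θ j : ℂ))

theorem Delta_add {n : ℕ} (θ θ' : Fin n → ℝ) : Delta (θ + θ') = Delta θ * Delta θ' := by
  simp only [Delta, Matrix.diagonal_mul_diagonal, Pi.add_apply, Complex.ofReal_add, mul_add,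
    Complex.exp_add]

theorem Delta_zero {n : ℕ} : Delta (0 : Fin n → ℝ) = 1 := by
  simp [Delta]

theorem Delta_transpose {n : ℕ} (θ : Fin n → ℝ) : (Delta θ)ᵀ = Delta θ := by
  simp [Delta]

theorem Delta_conjTranspose {n : ℕ} (θ : Fin n → ℝ) : (Delta θ)ᴴ = Delta (-θ) := by
  simp only [Delta, Matrix.diagonal_conjTranspose]
  congr 1
  funext j
  simp [← Complex.exp_conj]

theorem Delta_mul_neg {n : ℕ} (θ : Fin n → ℝ) : Delta θ * Delta (-θ) = 1 := by
  rw [← Delta_add, add_neg_cancel, Delta_zero]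

theorem Delta_two {n : ℕ} (θ : Fin n → ℝ) :
    Delta (2 • θ) = Matrix.diagonal fun j => Complex.exp (2 * Real.pi * Complex.I * (θ j : ℂ)) := by
  rw [Delta]
  congr 1
  funext j
  congr 1
  simp
  ring

theorem fract_arg_exp {x : ℝ} (h0 : 0 ≤ x) (h1 : x < 1) :
    Int.fract (Complex.arg (Complex.exp (2 * Real.pi * Complex.I * (x : ℂ))) / (2 * Real.pi))
      = x := by
  set w := Complex.exp (2 * Real.pi * Complex.I * (x : ℂ)) with hw
  have hn : ‖w‖ = 1 := by
    rw [hw, show (2 * Real.pi * Complex.I * (x : ℂ)) = ((2 * Real.pi * x : ℝ) : ℂ) * Complex.I by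
      push_cast; ring, Complex.norm_exp_ofReal_mul_I]
  have h2 := Complex.norm_mul_exp_arg_mul_I w
  rw [hn, Complex.ofReal_one, one_mul] at h2
  conv_rhs at h2 => rw [hw]
  obtain ⟨k, hk⟩ := Complex.exp_eq_exp_iff_exists_int.1 h2
  have hpi := Real.pi_pos.ne'
  have h3 : (w.arg : ℂ) = ((2 * Real.pi * (x + k) : ℝ) : ℂ) := by
    have hI := Complex.I_ne_zero
    apply mul_right_cancel₀ hI
    rw [hk]; push_cast; ring
  have h4 := Complex.ofReal_injective h3
  rw [h4, mul_div_cancel_left₀ _ (by positivity), Int.fract_add_intCast, Int.fract_eq_self.2 ⟨h0, h1⟩]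

theorem roots_charpoly_conj_diagonal {n : ℕ} {U : Matrix (Fin n) (Fin n) ℂ} (hU : Uᴴ * U = 1)
    (w : Fin n → ℂ) :
    (U * Matrix.diagonal w * Uᴴ).charpoly.roots = Finset.univ.val.map w := by
  rw [Matrix.charpoly_mul_comm, ← mul_assoc, hU, one_mul, Matrix.charpoly_diagonal]
  exact Polynomial.roots_multiset_prod_X_sub_C (Finset.univ.val.map w) ▸ (by
    simp [Finset.prod, Function.comp_def])

theorem spec_conj_Delta {n : ℕ} {U : Matrix (Fin n) (Fin n) ℂ} (hU : Uᴴ * U = 1)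
    {α : Fin n → ℝ} (h0 : ∀ j, 0 ≤ α j) (h1 : ∀ j, α j < 1) (hm : Monotone α) :
    spec (U * Delta (2 • α) * Uᴴ) = α := by
  have h2 : ((U * Delta (2 • α) * Uᴴ).charpoly.roots.map
      (fun w => Int.fract (Complex.arg w / (2 * Real.pi)))).sort (fun x y => x ≤ y)
      = List.ofFn α := by
    rw [Delta_two, roots_charpoly_conj_diagonal hU, Multiset.map_map]
    have h3 : (Finset.univ.val.map ((fun w => Int.fract (Complex.arg w / (2 * Real.pi))) ∘
        fun j => Complex.exp (2 * Real.pi * Complex.I * (α j : ℂ)))) = Finset.univ.val.map α := by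
      refine Multiset.map_congr rfl fun j _ => ?_
      exact fract_arg_exp (h0 j) (h1 j)
    rw [h3]
    have h4 : (Finset.univ.val.map α) = (List.ofFn α : Multiset ℝ) := by
      rw [← Fin.univ_val_map]
    rw [h4, Multiset.coe_sort]
    exact List.mergeSort_of_pairwise (by simpa using hm.sortedLE_ofFn.pairwise)
  funext j
  unfold spec
  rw [h2]
  simp

/-- `Delta θ` as an element of `U(n)`. -/
def DeltaU {n : ℕ} (θ : Fin n → ℝ) : Un n :=
  ⟨Delta θ, by
    rw [Matrix.mem_unitaryGroup_iff, Matrix.star_eq_conjTranspose, Delta_conjTranspose,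
      Delta_mul_neg]⟩

theorem coe_DeltaU {n : ℕ} (θ : Fin n → ℝ) :
    ((DeltaU θ : Un n) : Matrix (Fin n) (Fin n) ℂ) = Delta θ := rfl

/-- The matrix `U Uᵀ` determines the involution, hence its fixed set; conversely `τ(L, L) = 1` reads
`S_U S_Vᴴ = 1`. -/
theorem act_std_eq_iff {n : ℕ} {U V : Un n} :
    (stdLagr n).act U = (stdLagr n).act V ↔
      (U : Matrix (Fin n) (Fin n) ℂ) * (U : Matrix (Fin n) (Fin n) ℂ)ᵀ
        = (V : Matrix (Fin n) (Fin n) ℂ) * (V : Matrix (Fin n) (Fin n) ℂ)ᵀ := by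
  have hV : ((V : Matrix (Fin n) (Fin n) ℂ) * (V : Matrix (Fin n) (Fin n) ℂ)ᵀ)ᴴ *
      ((V : Matrix (Fin n) (Fin n) ℂ) * (V : Matrix (Fin n) (Fin n) ℂ)ᵀ) = 1 := by
    have := congrArg Matrix.transpose (Un.mul_star_self V)
    rw [Matrix.transpose_mul, Matrix.transpose_one] at this
    rw [Matrix.conjTranspose_mul]
    calc _ = (V : Matrix (Fin n) (Fin n) ℂ)ᵀᴴ * ((V : Matrix (Fin n) (Fin n) ℂ)ᴴ *
          (V : Matrix (Fin n) (Fin n) ℂ)) * (V : Matrix (Fin n) (Fin n) ℂ)ᵀ := by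
            simp only [mul_assoc]
      _ = 1 := by rw [Un.star_mul_self, mul_one]; exact this
  constructor
  · intro h
    have h1 := tau_act_std U V
    rw [← h, tau_self] at h1
    have h2 := congrArg (· * ((V : Matrix (Fin n) (Fin n) ℂ) *
      (V : Matrix (Fin n) (Fin n) ℂ)ᵀ)) h1
    simp only [mul_assoc _ _ ((V : Matrix (Fin n) (Fin n) ℂ) *
      (V : Matrix (Fin n) (Fin n) ℂ)ᵀ), hV, mul_one] at h2
    rw [← h2]
    simp
  · intro h
    refine tau_left_injective (L := (stdLagr n).act U) (Subtype.ext ?_)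
    rw [tau_act_std, tau_act_std, h]

/-- Angles double because `S` is quadratic in the frame; this is why `Delta` is built from
`exp(πiθ)` and not `exp(2πiθ)`. -/
theorem tau_frame_pair {n : ℕ} (U : Un n) (α : Fin n → ℝ) :
    (tau ((stdLagr n).act U) ((stdLagr n).act (U * DeltaU (-α))) : Matrix (Fin n) (Fin n) ℂ)
      = (U : Matrix (Fin n) (Fin n) ℂ) * Delta (2 • α) * (U : Matrix (Fin n) (Fin n) ℂ)ᴴ := by
  rw [tau_act_std]
  change _ * ((((U : Matrix (Fin n) (Fin n) ℂ) * Delta (-α)) * ((U : Matrix (Fin n) (Fin n) ℂ) *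
    Delta (-α))ᵀ)ᴴ) = _
  have h : (U : Matrix (Fin n) (Fin n) ℂ)ᵀ * (U : Matrix (Fin n) (Fin n) ℂ)ᵀᴴ = 1 := by
    have := congrArg Matrix.transpose (Un.star_mul_self U)
    rwa [Matrix.transpose_mul, Matrix.transpose_one] at this
  rw [Matrix.transpose_mul, Delta_transpose, Matrix.conjTranspose_mul, Matrix.conjTranspose_mul,
    Matrix.conjTranspose_mul, Delta_conjTranspose, neg_neg, two_smul, Delta_add]
  calc _ = (U : Matrix (Fin n) (Fin n) ℂ) * ((U : Matrix (Fin n) (Fin n) ℂ)ᵀ *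
      (U : Matrix (Fin n) (Fin n) ℂ)ᵀᴴ) * (Delta α * Delta α) *
      (U : Matrix (Fin n) (Fin n) ℂ)ᴴ := by simp only [mul_assoc]
    _ = _ := by rw [h, mul_one]

theorem exists_sorted_orthogonal_diagonalization {n : ℕ} {B : Matrix (Fin n) (Fin n) ℂ}
    (hBu : Bᴴ * B = 1) (hs : Bᵀ = B) :
    ∃ (O : Matrix (Fin n) (Fin n) ℂ) (α : Fin n → ℝ), Oᴴ * O = 1 ∧ Oᵀ = Oᴴ ∧
      (∀ j, 0 ≤ α j) ∧ (∀ j, α j < 1) ∧ Monotone α ∧ B = O * Delta (2 • α) * Oᴴ := by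
  obtain ⟨O, w, hO, hOt, hB⟩ := exists_real_orthogonal_diagonalization hBu hs
  have hOU : O ∈ Matrix.unitaryGroup (Fin n) ℂ := Matrix.mem_unitaryGroup_iff'.2 hO
  have hw : ∀ j, ‖w j‖ = 1 := by
    intro j
    have h1 : Matrix.diagonal w = Oᴴ * B * O := by
      rw [hB]
      calc _ = (Oᴴ * O) * Matrix.diagonal w * (Oᴴ * O) := by rw [hO, one_mul, mul_one]
        _ = _ := by simp only [mul_assoc]
    have h2 : Matrix.diagonal w ∈ Matrix.unitaryGroup (Fin n) ℂ := by
      rw [h1]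
      exact mul_mem (mul_mem (Unitary.star_mem hOU) (Matrix.mem_unitaryGroup_iff'.2 hBu)) hOU
    have h3 := congrFun (congrFun (Matrix.mem_unitaryGroup_iff.1 h2) j) j
    rw [Matrix.star_eq_conjTranspose, Matrix.diagonal_conjTranspose,
      Matrix.diagonal_mul_diagonal, Matrix.diagonal_apply_eq, Matrix.one_apply_eq, Pi.star_apply,
      Complex.star_def, Complex.mul_conj, Complex.normSq_eq_norm_sq] at h3
    have h4 : ‖w j‖ ^ 2 = 1 := by exact_mod_cast h3
    exact (pow_eq_one_iff_of_nonneg (norm_nonneg _) two_ne_zero).1 h4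
  let β : Fin n → ℝ := fun j => Int.fract ((w j).arg / (2 * Real.pi))
  have hβ : ∀ j, Complex.exp (2 * Real.pi * Complex.I * (β j : ℂ)) = w j := by
    intro j
    have h1 := Complex.norm_mul_exp_arg_mul_I (w j)
    rw [hw, Complex.ofReal_one, one_mul] at h1
    rw [← h1]
    refine Complex.exp_eq_exp_iff_exists_int.2 ⟨-⌊(w j).arg / (2 * Real.pi)⌋, ?_⟩
    have h2 := Int.fract_add_floor ((w j).arg / (2 * Real.pi))
    have h3 : (β j : ℂ) = (w j).arg / (2 * Real.pi) - (⌊(w j).arg / (2 * Real.pi)⌋ : ℂ) := by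
      have : β j = (w j).arg / (2 * Real.pi) - ⌊(w j).arg / (2 * Real.pi)⌋ := by
        simp only [β]; linarith
      rw [this]; push_cast; ring
    have hpi : (Real.pi : ℂ) ≠ 0 := by exact_mod_cast Real.pi_ne_zero
    rw [h3]
    push_cast
    field_simp
    ring
  -- Sorting the eigenvalues permutes the columns of `O`, which stays real and orthogonal.
  let σ := Tuple.sort β
  have hσ : Monotone (β ∘ σ) := Tuple.monotone_sort β
  let O' : Matrix (Fin n) (Fin n) ℂ := O.submatrix id σ
  have hO' : O'ᴴ * O' = 1 := by
    have : O'ᴴ * O' = (Oᴴ * O).submatrix σ σ := by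
      ext i j; simp [O', Matrix.mul_apply]
    rw [this, hO]
    ext i j
    simp [Matrix.one_apply]
  have hO't : O'ᵀ = O'ᴴ := by
    ext i j
    exact congrFun (congrFun hOt (σ i)) j
  have hB' : O' * Delta (2 • (β ∘ σ)) * O'ᴴ = O * Matrix.diagonal w * Oᴴ := by
    ext i j
    rw [Delta_two, Matrix.mul_apply, Matrix.mul_apply]
    simp only [Matrix.mul_diagonal, Matrix.conjTranspose_apply, O', Matrix.submatrix_apply, id,
      Function.comp_apply, hβ]
    exact Equiv.sum_comp σ fun k => O i k * w k * star (O j k)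
  exact ⟨O', β ∘ σ, hO', hO't, fun j => Int.fract_nonneg _, fun j => Int.fract_lt_one _, hσ,
    hB.trans hB'.symm⟩

/-- In the coordinates of a frame `V₁` of `L₁` the product `σ_{L₁} σ_{L₂}` becomes a symmetric
unitary matrix. A real orthogonal `O` diagonalizes it, and `V₁ O` is again a frame of `L₁`, now made
of eigenvectors. -/
theorem exists_frame_pair {n : ℕ} (L₁ L₂ : Lagr n) :
    ∃ U : Un n, ∃ α : Fin n → ℝ, (∀ j, 0 ≤ α j) ∧ (∀ j, α j < 1) ∧ Monotone α ∧
      L₁ = (stdLagr n).act U ∧ L₂ = (stdLagr n).act (U * DeltaU (-α)) := by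
  obtain ⟨V₁, rfl⟩ := L₁.exists_frame
  obtain ⟨V₂, rfl⟩ := L₂.exists_frame
  obtain ⟨A, hA⟩ : ∃ A, A = tau ((stdLagr n).act V₁) ((stdLagr n).act V₂) := ⟨_, rfl⟩
  have hAm := tau_act_std V₁ V₂
  rw [← hA] at hAm
  obtain ⟨B, hB0⟩ : ∃ B, B = V₁⁻¹ * A * V₁ := ⟨_, rfl⟩
  have hBs : (B : Matrix (Fin n) (Fin n) ℂ)ᵀ = (B : Matrix (Fin n) (Fin n) ℂ) := by
    have h1 : (B : Matrix (Fin n) (Fin n) ℂ)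
        = (V₁ : Matrix (Fin n) (Fin n) ℂ)ᵀ * (V₂ : Matrix (Fin n) (Fin n) ℂ)ᴴᵀ *
          ((V₂ : Matrix (Fin n) (Fin n) ℂ)ᴴ * (V₁ : Matrix (Fin n) (Fin n) ℂ)) := by
      rw [hB0, Un.coe_mul, Un.coe_mul, Un.coe_inv, hAm, Matrix.conjTranspose_mul]
      calc _ = ((V₁ : Matrix (Fin n) (Fin n) ℂ)ᴴ * (V₁ : Matrix (Fin n) (Fin n) ℂ)) *
            (V₁ : Matrix (Fin n) (Fin n) ℂ)ᵀ * (V₂ : Matrix (Fin n) (Fin n) ℂ)ᵀᴴ *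
            ((V₂ : Matrix (Fin n) (Fin n) ℂ)ᴴ * (V₁ : Matrix (Fin n) (Fin n) ℂ)) := by
              simp only [mul_assoc]
        _ = _ := by rw [Un.star_mul_self, one_mul]; rfl
    rw [h1]
    simp only [Matrix.transpose_mul, Matrix.transpose_transpose, mul_assoc]
  obtain ⟨O, α, hO, hOt, h0, h1, hσ, hB⟩ :=
    exists_sorted_orthogonal_diagonalization (Un.star_mul_self B) hBs
  obtain ⟨W, hW⟩ : ∃ W : Un n, (W : Matrix (Fin n) (Fin n) ℂ) = O :=
    ⟨⟨O, Matrix.mem_unitaryGroup_iff'.2 hO⟩, rfl⟩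
  have hU : (stdLagr n).act V₁ = (stdLagr n).act (V₁ * W) := by
    rw [act_std_eq_iff, Un.coe_mul, hW, Matrix.transpose_mul, hOt]
    calc _ = (V₁ : Matrix (Fin n) (Fin n) ℂ) * (O * Oᴴ) *
          (V₁ : Matrix (Fin n) (Fin n) ℂ)ᵀ := by rw [mul_eq_one_comm.1 hO, mul_one]
      _ = _ := by simp only [mul_assoc]
  refine ⟨V₁ * W, α, h0, h1, hσ, hU, ?_⟩
  refine tau_left_injective (L := (stdLagr n).act V₁) (Subtype.ext ?_)
  rw [← hA]
  conv_rhs => rw [hU, tau_frame_pair, Un.coe_mul, hW, Matrix.conjTranspose_mul]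
  have h2 : A = V₁ * B * V₁⁻¹ := by rw [hB0]; group
  rw [h2, Un.coe_mul, Un.coe_mul, Un.coe_inv, hB]
  simp only [mul_assoc]

end

end LagRep

/-! ### Burnside's theorem and variations with constant traces of words. -/

namespace LagRep

open scoped ContDiff Topology Matrix
open Matrix

noncomputable section

/-! ### The algebra generated by the values of an irreducible representation -/

/-- The product of the matrices `A_s` along the word `w`. -/
def wordProd {ℓ n : ℕ} (A : Fin ℓ → Matrix (Fin n) (Fin n) ℂ) (w : List (Fin ℓ)) :
    Matrix (Fin n) (Fin n) ℂ := (w.map A).prod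

theorem wordProd_nil {ℓ n : ℕ} (A : Fin ℓ → Matrix (Fin n) (Fin n) ℂ) : wordProd A [] = 1 := rfl

theorem wordProd_cons {ℓ n : ℕ} (A : Fin ℓ → Matrix (Fin n) (Fin n) ℂ) (s : Fin ℓ)
    (w : List (Fin ℓ)) : wordProd A (s :: w) = A s * wordProd A w := by
  simp [wordProd]

theorem wordProd_append {ℓ n : ℕ} (A : Fin ℓ → Matrix (Fin n) (Fin n) ℂ) (u v : List (Fin ℓ)) :
    wordProd A (u ++ v) = wordProd A u * wordProd A v := by
  simp [wordProd]

theorem adjoin_le_span_wordProd {ℓ n : ℕ} (A : Fin ℓ → Matrix (Fin n) (Fin n) ℂ)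
    {X : Matrix (Fin n) (Fin n) ℂ} (hX : X ∈ Algebra.adjoin ℂ (Set.range A)) :
    X ∈ Submodule.span ℂ (Set.range (wordProd A)) := by
  induction hX using Algebra.adjoin_induction with
  | mem x hx =>
    obtain ⟨s, rfl⟩ := hx
    exact Submodule.subset_span ⟨[s], by simp [wordProd]⟩
  | algebraMap r =>
    rw [Algebra.algebraMap_eq_smul_one]
    exact Submodule.smul_mem _ _ (Submodule.subset_span ⟨[], rfl⟩)
  | add x y _ _ hx hy => exact Submodule.add_mem _ hx hy
  | mul x y hx' hy' hx hy =>
    clear hx' hy'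
    induction hx, hy using Submodule.span_induction₂ with
    | mem_mem x y hx hy =>
      obtain ⟨u, rfl⟩ := hx
      obtain ⟨v, rfl⟩ := hy
      exact Submodule.subset_span ⟨u ++ v, wordProd_append A u v⟩
    | zero_left y hy => simp
    | zero_right x hx => simp
    | add_left x y z _ _ _ h1 h2 => rw [add_mul]; exact Submodule.add_mem _ h1 h2
    | add_right x y z _ _ _ h1 h2 => rw [mul_add]; exact Submodule.add_mem _ h1 h2
    | smul_left r x y _ _ h => rw [smul_mul_assoc]; exact Submodule.smul_mem _ _ h
    | smul_right r x y _ _ h => rw [mul_smul_comm]; exact Submodule.smul_mem _ _ h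

/-- Left multiplication by `a` is injective on the finite dimensional space `S`, hence onto, so `1`
is attained. Consequently words need no inverse letters. -/
theorem Subalgebra.mem_of_mul_eq_one {n : ℕ} (S : Subalgebra ℂ (Matrix (Fin n) (Fin n) ℂ))
    {a b : Matrix (Fin n) (Fin n) ℂ} (ha : a ∈ S) (hab : b * a = 1) : b ∈ S := by
  let f : S →ₗ[ℂ] S := LinearMap.mulLeft ℂ (⟨a, ha⟩ : S)
  have hf : Function.Injective f := by
    intro x y hxy
    have h1 : a * x = a * y := congrArg Subtype.val hxy
    have h2 : b * (a * x) = b * (a * y) := by rw [h1]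
    rw [← mul_assoc, ← mul_assoc, hab, one_mul, one_mul] at h2
    exact Subtype.ext h2
  obtain ⟨c, hc⟩ := LinearMap.surjective_of_injective hf 1
  have h1 : a * (c : Matrix (Fin n) (Fin n) ℂ) = 1 := congrArg Subtype.val hc
  have : b = c := left_inv_eq_right_inv hab h1
  rw [this]
  exact c.2

theorem coe_mem_adjoin {ℓ n : ℕ} (ρ : HomU ℓ n) (γ : Gam ℓ) :
    ((ρ γ : Un n) : Matrix (Fin n) (Fin n) ℂ) ∈ Algebra.adjoin ℂ (Set.range (genMat ρ)) := by
  have h : γ ∈ Subgroup.closure (Set.range (PresentedGroup.of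
      (rels := ({(List.ofFn (fun s : Fin ℓ => FreeGroup.of s)).prod} : Set (FreeGroup (Fin ℓ)))))) := by
    rw [PresentedGroup.closure_range_of]; trivial
  induction h using Subgroup.closure_induction with
  | mem x hx =>
    obtain ⟨s, rfl⟩ := hx
    exact Algebra.subset_adjoin ⟨s, rfl⟩
  | one => rw [map_one]; exact Subalgebra.one_mem _
  | mul x y _ _ hx hy => rw [map_mul]; exact Subalgebra.mul_mem _ hx hy
  | inv x _ hx =>
    rw [map_inv]
    exact Subalgebra.mem_of_mul_eq_one _ hx (Un.star_mul_self _)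

theorem linRep_apply {ℓ n : ℕ} (ρ : HomU ℓ n) (γ : Gam ℓ) (x : Cn n) :
    linRep ρ γ x = Matrix.toEuclideanLin ((ρ γ : Un n) : Matrix (Fin n) (Fin n) ℂ) x := rfl

/-- This is Burnside's theorem. By Schur's lemma the commutant is `ℂ`, so every matrix is linear
over the commutant, and Jacobson density realizes it by an element of the group algebra. -/
theorem span_wordProd_eq_top {ℓ n : ℕ} {ρ : HomU ℓ n} (h : Irr ρ) :
    Submodule.span ℂ (Set.range (wordProd (genMat ρ))) = ⊤ := by
  rw [eq_top_iff]
  intro X _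
  have : (linRep ρ).IsIrreducible := h
  let M := (linRep ρ).asModule
  have hs : IsSimpleModule (MonoidAlgebra ℂ (Gam ℓ)) M :=
    (Representation.irreducible_iff_isSimpleModule_asModule _).1 h
  have hfin : FiniteDimensional ℂ M := inferInstanceAs (Module.Finite ℂ (linRep ρ).asModule)
  have hschur := IsSimpleModule.algebraMap_end_bijective_of_isAlgClosed
    (A := MonoidAlgebra ℂ (Gam ℓ)) (V := M) ℂ
  let e : M ≃ₗ[ℂ] Cn n := (linRep ρ).asModuleEquiv
  let f0 : M →ₗ[ℂ] M := e.symm.toLinearMap ∘ₗ (Matrix.toEuclideanLin X) ∘ₗ e.toLinearMap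
  let f : Module.End (Module.End (MonoidAlgebra ℂ (Gam ℓ)) M) M :=
    { toFun := f0
      map_add' := fun x y => f0.map_add x y
      map_smul' := fun a x => by
        obtain ⟨c, rfl⟩ := hschur.2 a
        exact f0.map_smul c x }
  let b := Module.finBasis ℂ M
  classical
  -- Density gives agreement on a finite set only; a basis is enough by linearity.
  obtain ⟨r, hr⟩ := jacobson_density f (Finset.univ.image b)
  have hr' : ∀ m : M, f0 m = r • m := by
    intro m
    have h1 : f0 = (DistribSMul.toLinearMap ℂ M r : M →ₗ[ℂ] M) :=
      b.ext fun i => hr _ (Finset.mem_image_of_mem _ (Finset.mem_univ i))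
    exact congrArg (fun g : M →ₗ[ℂ] M => g m) h1
  have hX : Matrix.toEuclideanLin X = (linRep ρ).asAlgebraHom r := by
    refine LinearMap.ext fun x => ?_
    have h1 := congrArg e (hr' (e.symm x))
    have h2 := (linRep ρ).asModuleEquiv_map_smul r (e.symm x)
    change e (r • e.symm x) = (linRep ρ).asAlgebraHom r (e (e.symm x)) at h2
    rw [h2] at h1
    simpa [f0] using h1
  have hmem : ∀ r : MonoidAlgebra ℂ (Gam ℓ), ∃ Y ∈ Algebra.adjoin ℂ (Set.range (genMat ρ)),
      (linRep ρ).asAlgebraHom r = Matrix.toEuclideanLin Y := by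
    intro r
    induction r using MonoidAlgebra.induction_on with
    | of g =>
      refine ⟨_, coe_mem_adjoin ρ g, ?_⟩
      rw [Representation.asAlgebraHom_of]
      rfl
    | add f g hf hg =>
      obtain ⟨Y, hY, hY'⟩ := hf
      obtain ⟨Z, hZ, hZ'⟩ := hg
      exact ⟨Y + Z, Subalgebra.add_mem _ hY hZ, by rw [map_add, hY', hZ', map_add]⟩
    | smul c f hf =>
      obtain ⟨Y, hY, hY'⟩ := hf
      exact ⟨c • Y, Subalgebra.smul_mem _ hY c, by rw [map_smul, hY', map_smul]⟩
  obtain ⟨Y, hY, hY'⟩ := hmem r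
  have : X = Y := Matrix.toEuclideanLin.injective (hX.trans hY')
  rw [this]
  exact adjoin_le_span_wordProd _ hY

/-- An invariant subspace is invariant under all matrices, and a rank one matrix carries a given
nonzero vector to any vector. In this form irreducibility is visibly an open condition. -/
theorem irr_of_span_wordProd_eq_top {ℓ n : ℕ} (hn : 1 ≤ n) {ρ : HomU ℓ n}
    (h : Submodule.span ℂ (Set.range (wordProd (genMat ρ))) = ⊤) : Irr ρ := by
  have hne : Nontrivial (Cn n) := by
    have : Nonempty (Fin n) := ⟨⟨0, hn⟩⟩
    infer_instance
  have hinv : ∀ (N : Subrepresentation (linRep ρ)) (X : Matrix (Fin n) (Fin n) ℂ) (x : Cn n),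
      x ∈ N.toSubmodule → Matrix.toEuclideanLin X x ∈ N.toSubmodule := by
    intro N X x hx
    have hX : X ∈ Submodule.span ℂ (Set.range (wordProd (genMat ρ))) := by rw [h]; trivial
    induction hX using Submodule.span_induction with
    | mem X hX =>
      obtain ⟨w, rfl⟩ := hX
      induction w with
      | nil => simpa [wordProd_nil] using hx
      | cons s w ih =>
        rw [wordProd_cons]
        have : Matrix.toEuclideanLin (genMat ρ s * wordProd (genMat ρ) w) x
            = linRep ρ (gen s) (Matrix.toEuclideanLin (wordProd (genMat ρ) w) x) := by
          rw [linRep_apply]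
          simp [Matrix.toLpLin_apply, Matrix.mulVec_mulVec, genMat]
        rw [this]
        exact N.apply_mem_toSubmodule _ ih
    | zero => simp
    | add X Y _ _ h1 h2 =>
      rw [map_add]; exact N.toSubmodule.add_mem h1 h2
    | smul c X _ h1 =>
      rw [map_smul]; exact N.toSubmodule.smul_mem c h1
  have hbt : (⊥ : Subrepresentation (linRep ρ)) ≠ ⊤ := by
    intro hbt
    have h1 : (⊥ : Submodule ℂ (Cn n)) = ⊤ := congrArg Subrepresentation.toSubmodule hbt
    exact bot_ne_top h1
  have : Nontrivial (Subrepresentation (linRep ρ)) := ⟨⟨⊥, ⊤, hbt⟩⟩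
  refine { eq_bot_or_eq_top := fun N => ?_ }
  by_cases hN : N.toSubmodule = ⊥
  · left
    exact Subrepresentation.toSubmodule_injective hN
  · right
    obtain ⟨x, hx, hx0⟩ := Submodule.exists_mem_ne_zero_of_ne_bot hN
    refine Subrepresentation.toSubmodule_injective ?_
    change N.toSubmodule = ⊤
    rw [eq_top_iff]
    intro y _
    have hxo : x.ofLp ≠ 0 := fun h0 => hx0 (WithLp.ofLp_injective 2 h0)
    obtain ⟨j, hj⟩ := Function.ne_iff.1 hxo
    have := hinv N (Matrix.vecMulVec y.ofLp (Pi.single j (x.ofLp j)⁻¹)) x hx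
    rw [Matrix.toLpLin_apply, Matrix.vecMulVec_mulVec, single_dotProduct,
      inv_mul_cancel₀ hj] at this
    simpa using this

theorem scalar_of_commute {ℓ n : ℕ} {A : Fin ℓ → Matrix (Fin n) (Fin n) ℂ}
    (hA : Submodule.span ℂ (Set.range (wordProd A)) = ⊤) {Z : Matrix (Fin n) (Fin n) ℂ}
    (hZ : ∀ s, Z * A s = A s * Z) : ∃ c : ℂ, Z = c • 1 := by
  have h1 : ∀ X, Z * X = X * Z := by
    intro X
    have hX : X ∈ Submodule.span ℂ (Set.range (wordProd A)) := by rw [hA]; trivial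
    induction hX using Submodule.span_induction with
    | mem X hX =>
      obtain ⟨w, rfl⟩ := hX
      induction w with
      | nil => simp [wordProd_nil]
      | cons s w ih => rw [wordProd_cons, ← mul_assoc, hZ, mul_assoc, ih, mul_assoc]
    | zero => simp
    | add X Y _ _ h1 h2 => rw [mul_add, add_mul, h1, h2]
    | smul c X _ h1 => rw [mul_smul_comm, smul_mul_assoc, h1]
  obtain ⟨c, hc⟩ := Matrix.mem_range_scalar_of_commute_single (M := Z)
    (fun i j _ => (h1 _).symm)
  exact ⟨c, by rw [← hc, Matrix.scalar_apply, Matrix.smul_one_eq_diagonal]⟩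

/-! ### Infinitesimal variations with constant traces -/

/-- The variation of `wordProd A w` corresponding to the variation `B_s` of `A_s`. -/
def wordVar {ℓ n : ℕ} (A B : Fin ℓ → Matrix (Fin n) (Fin n) ℂ) :
    List (Fin ℓ) → Matrix (Fin n) (Fin n) ℂ
  | [] => 0
  | s :: w => B s * wordProd A w + A s * wordVar A B w

theorem wordVar_append {ℓ n : ℕ} (A B : Fin ℓ → Matrix (Fin n) (Fin n) ℂ) (u v : List (Fin ℓ)) :
    wordVar A B (u ++ v) = wordVar A B u * wordProd A v + wordProd A u * wordVar A B v := by
  induction u with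
  | nil => simp [wordVar, wordProd_nil]
  | cons s u ih =>
    rw [List.cons_append, wordVar, ih, wordVar, wordProd_append, wordProd_cons]
    simp only [mul_add, add_mul, mul_assoc, add_assoc]

/-- The issue is that words are linearly dependent. If `∑ f_u A_u = 0`, the Leibniz rule identifies
`(∑ f_u δA_u) A_v` with `∑ f_u δA_{uv}`, which has trace zero for every `v`. As the `A_v` span,
nondegeneracy of the trace form gives `∑ f_u δA_u = 0`. -/
theorem exists_derivation {ℓ n : ℕ} {A B : Fin ℓ → Matrix (Fin n) (Fin n) ℂ}
    (hA : Submodule.span ℂ (Set.range (wordProd A)) = ⊤)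
    (hB : ∀ w, (wordVar A B w).trace = 0) :
    ∃ δ : Matrix (Fin n) (Fin n) ℂ →ₗ[ℂ] Matrix (Fin n) (Fin n) ℂ,
      ∀ w, δ (wordProd A w) = wordVar A B w := by
  let P := Finsupp.linearCombination ℂ (wordProd A)
  let D := Finsupp.linearCombination ℂ (wordVar A B)
  have hP : Function.Surjective P := by
    rw [← LinearMap.range_eq_top, Finsupp.range_linearCombination, hA]
  have hker : ∀ f, P f = 0 → D f = 0 := by
    intro f hf
    have h1 : ∀ v, (D f * wordProd A v).trace = 0 := by
      intro v
      have h2 : D f * wordProd A v = f.sum (fun u c => c • wordVar A B (u ++ v))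
          - P f * wordVar A B v := by
        simp only [D, P, Finsupp.linearCombination_apply, Finsupp.sum, Finset.sum_mul]
        rw [← Finset.sum_sub_distrib]
        refine Finset.sum_congr rfl fun u _ => ?_
        rw [wordVar_append, smul_add, smul_mul_assoc, smul_mul_assoc, add_sub_cancel_right]
      rw [h2, hf, zero_mul, sub_zero, Finsupp.sum, Matrix.trace_sum]
      refine Finset.sum_eq_zero fun u _ => ?_
      rw [Matrix.trace_smul, hB, smul_zero]
    refine Matrix.ext_iff_trace_mul_right.2 fun X => ?_
    have hX : X ∈ Submodule.span ℂ (Set.range (wordProd A)) := by rw [hA]; trivial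
    rw [zero_mul, Matrix.trace_zero]
    induction hX using Submodule.span_induction with
    | mem X hX => obtain ⟨w, rfl⟩ := hX; exact h1 w
    | zero => simp
    | add X Y _ _ h1 h2 => rw [mul_add, Matrix.trace_add, h1, h2, add_zero]
    | smul c X _ h1 => rw [mul_smul_comm, Matrix.trace_smul, h1, smul_zero]
  obtain ⟨g, hg⟩ := P.exists_rightInverse_of_surjective (LinearMap.range_eq_top.2 hP)
  refine ⟨D ∘ₗ g, fun w => ?_⟩
  have h1 : P (g (wordProd A w) - Finsupp.single w 1) = 0 := by
    rw [map_sub]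
    have : P (g (wordProd A w)) = wordProd A w := congrArg (fun f => f (wordProd A w)) hg
    rw [this]
    simp [P]
  have h2 := hker _ h1
  rw [map_sub, sub_eq_zero] at h2
  rw [LinearMap.comp_apply, h2]
  simp [D]

/-- Derivations of a full matrix algebra are inner. With `Y = ∑ δ(E_{i0}) E_{0i}`, summing `δ(X
E_{i0}) E_{0i}` over `i` gives `δX + X Y` by the Leibniz rule and `Y X` by expanding `X E_{i0}` in
elementary matrices. -/
theorem exists_inner {n : ℕ} (hn : 1 ≤ n)
    (δ : Matrix (Fin n) (Fin n) ℂ →ₗ[ℂ] Matrix (Fin n) (Fin n) ℂ)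
    (hδ : ∀ X Y, δ (X * Y) = δ X * Y + X * δ Y) : ∃ Y, ∀ X, δ X = Y * X - X * Y := by
  let o : Fin n := ⟨0, hn⟩
  refine ⟨∑ i, δ (Matrix.single i o 1) * Matrix.single o i 1, fun X => ?_⟩
  rw [Finset.sum_mul, Finset.mul_sum, eq_sub_iff_add_eq]
  have h1 : ∀ i, δ X * Matrix.single i i 1 + X * (δ (Matrix.single i o 1) * Matrix.single o i 1)
      = ∑ k, X k i • (δ (Matrix.single k o 1) * Matrix.single o i 1) := by
    intro i
    have h2 : X * Matrix.single i o 1 = ∑ k, X k i • Matrix.single k o (1 : ℂ) := by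
      ext a b
      rw [Matrix.sum_apply]
      by_cases hb : b = o
      · subst hb
        simp [Matrix.single_apply]
      · simp [Matrix.mul_apply, Ne.symm hb]
    have h3 := congrArg (fun Z => δ Z * Matrix.single o i (1 : ℂ)) h2
    simp only [hδ, map_sum, map_smul] at h3
    rw [add_mul, mul_assoc, Matrix.single_mul_single_same, Finset.sum_mul, one_mul, mul_assoc] at h3
    simp only [smul_mul_assoc] at h3
    exact h3
  have h4 : (∑ i, Matrix.single i i (1 : ℂ)) = (1 : Matrix (Fin n) (Fin n) ℂ) := by
    ext a b
    simp [Matrix.sum_apply, Matrix.single_apply, Matrix.one_apply, ite_and]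
  calc δ X + _ = ∑ i, (δ X * Matrix.single i i 1 +
        X * (δ (Matrix.single i o 1) * Matrix.single o i 1)) := by
        rw [Finset.sum_add_distrib, ← Finset.mul_sum, ← Finset.mul_sum, h4, mul_one]
    _ = ∑ i, ∑ k, X k i • (δ (Matrix.single k o 1) * Matrix.single o i 1) :=
        Finset.sum_congr rfl fun i _ => h1 i
    _ = ∑ k, ∑ i, X k i • (δ (Matrix.single k o 1) * Matrix.single o i 1) := Finset.sum_comm
    _ = _ := by
        refine Finset.sum_congr rfl fun k _ => ?_
        rw [mul_assoc]
        have h5 : Matrix.single o k (1 : ℂ) * X = ∑ i, X k i • Matrix.single o i (1 : ℂ) := by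
          ext a b
          rw [Matrix.sum_apply]
          by_cases ha : a = o
          · subst ha
            simp [Matrix.single_apply]
          · simp [Matrix.mul_apply, Ne.symm ha]
        rw [h5, Finset.mul_sum]
        simp only [mul_smul_comm]

/-- The infinitesimal form of the principle that an irreducible representation is determined up to
conjugation by its character. -/
theorem exists_commutator_of_trace_wordVar {ℓ n : ℕ} (hn : 1 ≤ n)
    {A B : Fin ℓ → Matrix (Fin n) (Fin n) ℂ}
    (hA : Submodule.span ℂ (Set.range (wordProd A)) = ⊤)
    (hB : ∀ w, (wordVar A B w).trace = 0) : ∃ Y, ∀ s, B s = Y * A s - A s * Y := by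
  obtain ⟨δ, hδ⟩ := exists_derivation hA hB
  have hder : ∀ X Y, δ (X * Y) = δ X * Y + X * δ Y := by
    intro X Y
    have hX : X ∈ Submodule.span ℂ (Set.range (wordProd A)) := by rw [hA]; trivial
    have hY : Y ∈ Submodule.span ℂ (Set.range (wordProd A)) := by rw [hA]; trivial
    induction hX, hY using Submodule.span_induction₂ with
    | mem_mem x y hx hy =>
      obtain ⟨u, rfl⟩ := hx
      obtain ⟨v, rfl⟩ := hy
      rw [← wordProd_append, hδ, hδ, hδ, wordVar_append]
    | zero_left y hy => simp
    | zero_right x hx => simp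
    | add_left x y z _ _ _ h1 h2 => simp only [add_mul, map_add, h1, h2]; abel
    | add_right x y z _ _ _ h1 h2 => simp only [mul_add, map_add, h1, h2]; abel
    | smul_left r x y _ _ h => simp only [smul_mul_assoc, map_smul, h, smul_add]
    | smul_right r x y _ _ h => simp only [mul_smul_comm, map_smul, h, smul_add]
  obtain ⟨Y, hY⟩ := exists_inner hn δ hder
  refine ⟨Y, fun s => ?_⟩
  have h1 := hδ [s]
  simp only [wordProd_cons, wordProd_nil, mul_one, wordVar, mul_zero, add_zero] at h1
  rw [← h1, hY]

end

end LagRep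

/-! ### Matrix calculus, trace duality, and the reflections of Lagrangian subspaces. -/

namespace LagRep

open scoped ContDiff Topology Matrix Matrix.Norms.Operator
open Matrix

noncomputable section

-- With these instances removed, the operator norm is the only source of a topology on matrices.
attribute [-instance] instTopologicalSpaceMatrix Matrix.instUniformSpace

/-! ### Calculus for matrix valued functions -/

instance instCompleteSpaceMatrix (n : ℕ) : CompleteSpace (Matrix (Fin n) (Fin n) ℂ) :=
  FiniteDimensional.complete ℂ _

/-- The entry `(i, j)` as a continuous linear functional. -/
def entryCLM {n : ℕ} (i j : Fin n) : Matrix (Fin n) (Fin n) ℂ →L[ℝ] ℂ :=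
  LinearMap.toContinuousLinearMap
    { toFun := fun M => M i j
      map_add' := fun _ _ => rfl
      map_smul' := fun _ _ => rfl }

/-- The elementary matrix with entry `c` at `(i, j)`, as a continuous linear function of `c`. -/
def singleCLM {n : ℕ} (i j : Fin n) : ℂ →L[ℝ] Matrix (Fin n) (Fin n) ℂ :=
  LinearMap.toContinuousLinearMap
    { toFun := fun c => Matrix.single i j c
      map_add' := fun _ _ => Matrix.single_add _ _ _ _
      map_smul' := fun r c => (Matrix.smul_single r i j c).symm }

theorem sum_singleCLM {n : ℕ} (M : Matrix (Fin n) (Fin n) ℂ) :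
    ∑ i, ∑ j, singleCLM i j (M i j) = M :=
  (Matrix.matrix_eq_sum_single M).symm

/-- The transpose as a continuous linear map. -/
def transposeCLM (n : ℕ) : Matrix (Fin n) (Fin n) ℂ →L[ℝ] Matrix (Fin n) (Fin n) ℂ :=
  LinearMap.toContinuousLinearMap
    { toFun := fun M => Mᵀ
      map_add' := Matrix.transpose_add
      map_smul' := fun _ _ => rfl }

/-- The conjugate transpose as a continuous real linear map. -/
def conjTransposeCLM (n : ℕ) : Matrix (Fin n) (Fin n) ℂ →L[ℝ] Matrix (Fin n) (Fin n) ℂ :=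
  LinearMap.toContinuousLinearMap
    { toFun := fun M => Mᴴ
      map_add' := Matrix.conjTranspose_add
      map_smul' := fun r M => by simp }

/-- The trace as a continuous real linear map. -/
def traceCLM (n : ℕ) : Matrix (Fin n) (Fin n) ℂ →L[ℝ] ℂ :=
  LinearMap.toContinuousLinearMap
    { toFun := fun M => M.trace
      map_add' := Matrix.trace_add
      map_smul' := fun r M => Matrix.trace_smul r M }

theorem hasDerivAt_matrix_iff {n : ℕ} {f : ℝ → Matrix (Fin n) (Fin n) ℂ}
    {f' : Matrix (Fin n) (Fin n) ℂ} {t : ℝ} :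
    HasDerivAt f f' t ↔ ∀ i j, HasDerivAt (fun t => f t i j) (f' i j) t := by
  constructor
  · intro h i j
    exact (entryCLM i j).hasFDerivAt.comp_hasDerivAt t h
  · intro h
    have h1 : HasDerivAt (fun t => ∑ i, ∑ j, singleCLM i j (f t i j))
        (∑ i, ∑ j, singleCLM i j (f' i j)) t := by
      refine HasDerivAt.fun_sum fun i _ => HasDerivAt.fun_sum fun j _ => ?_
      exact (singleCLM i j).hasFDerivAt.comp_hasDerivAt t (h i j)
    simpa only [sum_singleCLM] using h1

theorem HasDerivAt.conjTranspose {n : ℕ} {f : ℝ → Matrix (Fin n) (Fin n) ℂ}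
    {f' : Matrix (Fin n) (Fin n) ℂ} {t : ℝ} (h : HasDerivAt f f' t) :
    HasDerivAt (fun t => (f t)ᴴ) f'ᴴ t :=
  (conjTransposeCLM n).hasFDerivAt.comp_hasDerivAt t h

theorem HasDerivAt.transpose {n : ℕ} {f : ℝ → Matrix (Fin n) (Fin n) ℂ}
    {f' : Matrix (Fin n) (Fin n) ℂ} {t : ℝ} (h : HasDerivAt f f' t) :
    HasDerivAt (fun t => (f t)ᵀ) f'ᵀ t :=
  (transposeCLM n).hasFDerivAt.comp_hasDerivAt t h

/-! ### The real trace form -/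

/-- The real and imaginary parts of the entries of `Z` are read off from `f` on the real basis
`E_{ij}`, `i E_{ij}`. -/
theorem exists_trace_functional {n : ℕ} (f : Matrix (Fin n) (Fin n) ℂ →ₗ[ℝ] ℝ) :
    ∃ Z : Matrix (Fin n) (Fin n) ℂ, ∀ X, f X = (Z * X).trace.re := by
  refine ⟨Matrix.of fun j i => (f (Matrix.single i j 1) : ℂ) -
    (f (Matrix.single i j Complex.I) : ℂ) * Complex.I, fun X => ?_⟩
  have h1 : ∀ i j, f (Matrix.single i j (X i j)) = (X i j).re * f (Matrix.single i j 1)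
      + (X i j).im * f (Matrix.single i j Complex.I) := by
    intro i j
    have : Matrix.single i j (X i j) = (X i j).re • Matrix.single i j (1 : ℂ)
        + (X i j).im • Matrix.single i j Complex.I := by
      rw [Matrix.smul_single, Matrix.smul_single, ← Matrix.single_add]
      congr 1
      simp
    rw [this, map_add, map_smul, map_smul, smul_eq_mul, smul_eq_mul]
  conv_lhs => rw [Matrix.matrix_eq_sum_single X]
  simp only [map_sum, h1, Matrix.trace, Matrix.diag, Matrix.mul_apply, Complex.re_sum]
  rw [Finset.sum_comm]
  refine Finset.sum_congr rfl fun i _ => Finset.sum_congr rfl fun j _ => ?_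
  simp
  ring

theorem trace_conjTranspose_mul_self_re {n : ℕ} (X : Matrix (Fin n) (Fin n) ℂ) :
    (Xᴴ * X).trace.re = ∑ i, ∑ j, ‖X j i‖ ^ 2 := by
  simp only [Matrix.trace, Matrix.diag, Matrix.mul_apply, Complex.re_sum,
    Matrix.conjTranspose_apply]
  refine Finset.sum_congr rfl fun i _ => Finset.sum_congr rfl fun j _ => ?_
  rw [Complex.star_def, mul_comm, Complex.mul_conj, Complex.ofReal_re, Complex.normSq_eq_norm_sq]

/-- On skew-Hermitian matrices `-tr X²` is the sum of the squared absolute values of the entries.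
The duality arguments below conclude through this definiteness. -/
theorem eq_zero_of_trace_mul_self {n : ℕ} {X : Matrix (Fin n) (Fin n) ℂ} (hX : Xᴴ = -X)
    (h : (X * X).trace.re = 0) : X = 0 := by
  have h1 := trace_conjTranspose_mul_self_re X
  rw [hX, neg_mul, Matrix.trace_neg, Complex.neg_re, h, neg_zero] at h1
  ext i j
  have h2 := (Finset.sum_eq_zero_iff_of_nonneg (fun i _ => by positivity)).1 h1.symm j
    (Finset.mem_univ _)
  have h3 := (Finset.sum_eq_zero_iff_of_nonneg (fun i _ => by positivity)).1 h2 i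
    (Finset.mem_univ _)
  simpa using h3

/-- The skew-Hermitian part of a matrix. -/
def skewPart {n : ℕ} (Z : Matrix (Fin n) (Fin n) ℂ) : Matrix (Fin n) (Fin n) ℂ :=
  (1 / 2 : ℝ) • (Z - Zᴴ)

theorem skewPart_conjTranspose {n : ℕ} (Z : Matrix (Fin n) (Fin n) ℂ) :
    (skewPart Z)ᴴ = -skewPart Z := by
  simp only [skewPart, Matrix.conjTranspose_smul, Matrix.conjTranspose_sub,
    Matrix.conjTranspose_conjTranspose, star_trivial, ← smul_neg, neg_sub]

/-- Hermitian matrices are orthogonal to skew-Hermitian ones for the real trace form, so a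
functional on `𝔲(n)` may be represented by an element of `𝔲(n)`. -/
theorem trace_skewPart_mul_re {n : ℕ} (Z : Matrix (Fin n) (Fin n) ℂ)
    {X : Matrix (Fin n) (Fin n) ℂ} (hX : Xᴴ = -X) :
    (skewPart Z * X).trace.re = (Z * X).trace.re := by
  have h1 : (Zᴴ * X).trace.re = -(Z * X).trace.re := by
    have h2 : (Zᴴ * X).trace = star ((Xᴴ * Z).trace) := by
      rw [← Matrix.trace_conjTranspose, Matrix.conjTranspose_mul,
        Matrix.conjTranspose_conjTranspose]
    rw [h2, hX, neg_mul, Matrix.trace_neg, star_neg, Matrix.trace_mul_comm]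
    simp
  rw [skewPart, Matrix.smul_mul, Matrix.trace_smul, Matrix.sub_mul, Matrix.trace_sub,
    Complex.smul_re, Complex.sub_re, h1, smul_eq_mul]
  ring

/-- A subspace of a real vector space contains a vector that is killed by every functional
vanishing on the subspace. -/
theorem mem_of_forall_functional {E : Type*} [AddCommGroup E] [Module ℝ E] (R : Submodule ℝ E)
    (x : E) (h : ∀ f : E →ₗ[ℝ] ℝ, (∀ y ∈ R, f y = 0) → f x = 0) : x ∈ R := by
  by_contra hx
  obtain ⟨f, hf, hR⟩ := Submodule.exists_le_ker_of_notMem hx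
  exact hf (h f fun y hy => hR hy)

/-! ### Symmetric unitary matrices and reflections -/

/-- The pair of conditions saying that `S` is a symmetric unitary matrix. -/
structure IsSymUnitary {n : ℕ} (S : Matrix (Fin n) (Fin n) ℂ) : Prop where
  star_mul : Sᴴ * S = 1
  symm : Sᵀ = S

theorem IsSymUnitary.mul_star {n : ℕ} {S : Matrix (Fin n) (Fin n) ℂ} (h : IsSymUnitary S) :
    S * Sᴴ = 1 := mul_eq_one_comm.1 h.star_mul

theorem IsSymUnitary.transpose_star {n : ℕ} {S : Matrix (Fin n) (Fin n) ℂ} (h : IsSymUnitary S) :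
    Sᴴᵀ = Sᴴ := by
  conv_rhs => rw [← h.symm]
  rfl

theorem isSymUnitary_frame {n : ℕ} {U : Matrix (Fin n) (Fin n) ℂ} (hU : Uᴴ * U = 1) :
    IsSymUnitary (U * Uᵀ) := by
  refine ⟨?_, by rw [Matrix.transpose_mul, Matrix.transpose_transpose]⟩
  have h := congrArg Matrix.transpose (mul_eq_one_comm.1 hU)
  rw [Matrix.transpose_mul, Matrix.transpose_one] at h
  rw [Matrix.conjTranspose_mul]
  calc _ = Uᵀᴴ * (Uᴴ * U) * Uᵀ := by simp only [mul_assoc]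
    _ = 1 := by rw [hU, mul_one]; exact h

/-- For a skew-Hermitian matrix `X` this is `-σ_L X σ_L`, where `S = U Uᵀ` for a frame `U` of the
Lagrangian subspace `L`. -/
def refl {n : ℕ} (S X : Matrix (Fin n) (Fin n) ℂ) : Matrix (Fin n) (Fin n) ℂ := S * Xᵀ * Sᴴ

theorem refl_refl {n : ℕ} {S : Matrix (Fin n) (Fin n) ℂ} (h : IsSymUnitary S)
    (X : Matrix (Fin n) (Fin n) ℂ) : refl S (refl S X) = X := by
  simp only [refl, Matrix.transpose_mul, Matrix.transpose_transpose, h.symm, h.transpose_star]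
  calc _ = (S * Sᴴ) * X * (S * Sᴴ) := by simp only [mul_assoc]
    _ = X := by rw [h.mul_star, one_mul, mul_one]

theorem refl_add {n : ℕ} (S X Y : Matrix (Fin n) (Fin n) ℂ) :
    refl S (X + Y) = refl S X + refl S Y := by
  simp [refl, mul_add, add_mul]

theorem refl_sub {n : ℕ} (S X Y : Matrix (Fin n) (Fin n) ℂ) :
    refl S (X - Y) = refl S X - refl S Y := by
  simp [refl, mul_sub, sub_mul]

theorem refl_smul {n : ℕ} (S X : Matrix (Fin n) (Fin n) ℂ) (c : ℝ) :
    refl S (c • X) = c • refl S X := by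
  simp [refl]

theorem refl_conjTranspose {n : ℕ} {S : Matrix (Fin n) (Fin n) ℂ}
    {X : Matrix (Fin n) (Fin n) ℂ} (hX : Xᴴ = -X) : (refl S X)ᴴ = -refl S X := by
  have : Xᵀᴴ = -Xᵀ := by rw [← Matrix.transpose_neg, ← hX]; rfl
  simp only [refl, Matrix.conjTranspose_mul, Matrix.conjTranspose_conjTranspose, this]
  simp [mul_assoc]

/-- `refl S` is an antiautomorphism preserving traces. Being an involution as well, it is
self-adjoint for the trace form. -/
theorem trace_refl_mul_refl {n : ℕ} {S : Matrix (Fin n) (Fin n) ℂ} (h : IsSymUnitary S)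
    (X Y : Matrix (Fin n) (Fin n) ℂ) : (refl S X * refl S Y).trace = (X * Y).trace := by
  have : refl S X * refl S Y = S * (Xᵀ * Yᵀ) * Sᴴ := by
    simp only [refl]
    calc _ = S * Xᵀ * (Sᴴ * S) * Yᵀ * Sᴴ := by simp only [mul_assoc]
      _ = _ := by rw [h.star_mul, mul_one]; simp only [mul_assoc]
  rw [this, Matrix.trace_mul_comm, ← mul_assoc, h.star_mul, one_mul, ← Matrix.transpose_mul,
    Matrix.trace_transpose, Matrix.trace_mul_comm]

theorem trace_refl_mul {n : ℕ} {S : Matrix (Fin n) (Fin n) ℂ} (h : IsSymUnitary S)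
    (X Y : Matrix (Fin n) (Fin n) ℂ) : (refl S X * Y).trace = (X * refl S Y).trace := by
  rw [← trace_refl_mul_refl h X, refl_refl h]

theorem trace_refl {n : ℕ} {S : Matrix (Fin n) (Fin n) ℂ} (h : IsSymUnitary S)
    (X : Matrix (Fin n) (Fin n) ℂ) : (refl S X).trace = X.trace := by
  rw [refl, Matrix.trace_mul_comm, ← mul_assoc, h.star_mul, one_mul, Matrix.trace_transpose]

/-- The values `A_s = σ_{L_s} σ_{L_{s+1}}` of a Lagrangian representation. -/
def lagMat {ℓ n : ℕ} (S : Fin ℓ → Matrix (Fin n) (Fin n) ℂ) (s : Fin ℓ) :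
    Matrix (Fin n) (Fin n) ℂ := S s * (S (finRotate ℓ s))ᴴ

theorem lagMat_star_mul {ℓ n : ℕ} {S : Fin ℓ → Matrix (Fin n) (Fin n) ℂ}
    (hS : ∀ s, IsSymUnitary (S s)) (s : Fin ℓ) : (lagMat S s)ᴴ * lagMat S s = 1 := by
  rw [lagMat, Matrix.conjTranspose_mul, Matrix.conjTranspose_conjTranspose]
  calc _ = S (finRotate ℓ s) * ((S s)ᴴ * S s) * (S (finRotate ℓ s))ᴴ := by simp only [mul_assoc]
    _ = 1 := by rw [(hS s).star_mul, mul_one, (hS _).mul_star]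

/-- Since `A_s = σ_{L_s} σ_{L_{s+1}}`, the reflections at consecutive subspaces differ by
conjugation by `A_s`. -/
theorem refl_next {ℓ n : ℕ} {S : Fin ℓ → Matrix (Fin n) (Fin n) ℂ}
    (hS : ∀ s, IsSymUnitary (S s)) (s : Fin ℓ) (X : Matrix (Fin n) (Fin n) ℂ) :
    lagMat S s * refl (S (finRotate ℓ s)) X * (lagMat S s)ᴴ = refl (S s) X := by
  rw [lagMat, Matrix.conjTranspose_mul, Matrix.conjTranspose_conjTranspose, refl, refl]
  calc _ = S s * ((S (finRotate ℓ s))ᴴ * S (finRotate ℓ s)) * Xᵀ *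
        ((S (finRotate ℓ s))ᴴ * S (finRotate ℓ s)) * (S s)ᴴ := by simp only [mul_assoc]
    _ = _ := by rw [(hS _).star_mul, mul_one, mul_one]

/-- This is the identity `σ_{L_s} A_s⁻¹ σ_{L_s} = A_s` for a product of two involutions. -/
theorem refl_lagMat {ℓ n : ℕ} {S : Fin ℓ → Matrix (Fin n) (Fin n) ℂ}
    (hS : ∀ s, IsSymUnitary (S s)) (s : Fin ℓ) :
    refl (S s) (lagMat S s) = lagMat S s := by
  rw [lagMat, refl, Matrix.transpose_mul, (hS s).symm, (hS _).transpose_star]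
  calc _ = S s * (S (finRotate ℓ s))ᴴ * (S s * (S s)ᴴ) := by simp only [mul_assoc]
    _ = _ := by rw [(hS s).mul_star, mul_one]

theorem refl_mul {n : ℕ} {S : Matrix (Fin n) (Fin n) ℂ} (h : IsSymUnitary S)
    (X Y : Matrix (Fin n) (Fin n) ℂ) : refl S (X * Y) = refl S Y * refl S X := by
  simp only [refl, Matrix.transpose_mul]
  calc _ = S * Yᵀ * 1 * Xᵀ * Sᴴ := by simp only [mul_assoc, one_mul]
    _ = _ := by rw [← h.star_mul]; simp only [mul_assoc]

/-- On the centralizer of `A_s` the reflections `σ_{L_s}` and `σ_{L_{s+1}}` agree. -/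
theorem refl_next_of_commute {ℓ n : ℕ} {S : Fin ℓ → Matrix (Fin n) (Fin n) ℂ}
    (hS : ∀ s, IsSymUnitary (S s)) (s : Fin ℓ) {X : Matrix (Fin n) (Fin n) ℂ}
    (hX : X * lagMat S s = lagMat S s * X) : refl (S (finRotate ℓ s)) X = refl (S s) X := by
  have h1 : lagMat S s * refl (S s) X = refl (S s) X * lagMat S s := by
    have := congrArg (refl (S s)) hX
    rwa [refl_mul (hS s), refl_mul (hS s), refl_lagMat hS] at this
  have h2 := refl_next hS s X
  have h3 := lagMat_star_mul hS s
  calc refl (S (finRotate ℓ s)) X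
      = ((lagMat S s)ᴴ * lagMat S s) * refl (S (finRotate ℓ s)) X *
          ((lagMat S s)ᴴ * lagMat S s) := by rw [h3, one_mul, mul_one]
    _ = (lagMat S s)ᴴ * (lagMat S s * refl (S (finRotate ℓ s)) X * (lagMat S s)ᴴ) *
          lagMat S s := by simp only [mul_assoc]
    _ = (lagMat S s)ᴴ * (lagMat S s * refl (S s) X) := by rw [h2, mul_assoc, h1]
    _ = _ := by rw [← mul_assoc, h3, one_mul]

/-- A matrix fixed by all reflections commutes with all `A_s`. -/
theorem commute_of_refl_eq {ℓ n : ℕ} {S : Fin ℓ → Matrix (Fin n) (Fin n) ℂ}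
    (hS : ∀ s, IsSymUnitary (S s)) {Z : Matrix (Fin n) (Fin n) ℂ}
    (hZ : ∀ s, refl (S s) Z = Z) (s : Fin ℓ) : Z * lagMat S s = lagMat S s * Z := by
  have h2 := refl_next hS s Z
  rw [hZ, hZ] at h2
  conv_lhs => rw [← h2]
  rw [mul_assoc, lagMat_star_mul hS, mul_one]

/-- The form in which irreducibility enters the duality arguments. -/
theorem scalar_of_refl_eq {ℓ n : ℕ} {S : Fin ℓ → Matrix (Fin n) (Fin n) ℂ}
    (hS : ∀ s, IsSymUnitary (S s))
    (hA : Submodule.span ℂ (Set.range (wordProd (lagMat S))) = ⊤)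
    {Z : Matrix (Fin n) (Fin n) ℂ} (hZ : ∀ s, refl (S s) Z = Z) : ∃ c : ℂ, Z = c • 1 :=
  scalar_of_commute hA (commute_of_refl_eq hS hZ)

end

end LagRep

namespace LagRep

open scoped ContDiff Topology Matrix Matrix.Norms.Operator ComplexOrder
open Matrix

noncomputable section

attribute [-instance] instTopologicalSpaceMatrix Matrix.instUniformSpace

/-! ### The Cayley transform -/

/-- The Cayley transform `(1 + X/2)(1 - X/2)⁻¹`. -/
def cay {n : ℕ} (X : Matrix (Fin n) (Fin n) ℂ) : Matrix (Fin n) (Fin n) ℂ :=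
  1 + X * (1 - (1 / 2 : ℝ) • X)⁻¹

/-- The inverse of the Cayley transform. -/
def cayInv {n : ℕ} (O : Matrix (Fin n) (Fin n) ℂ) : Matrix (Fin n) (Fin n) ℂ :=
  (O - 1) * ((1 / 2 : ℝ) • (O + 1))⁻¹

/-- `(1 - cX)ᴴ (1 - cX) = 1 + (cX)ᴴ (cX)` is positive definite. The Cayley transform is therefore
defined on all of `𝔲(n)`; being rational in `X`, it is analytic there and inherits algebraic
relations satisfied by `X`. -/
theorem isUnit_one_sub_skew {n : ℕ} {X : Matrix (Fin n) (Fin n) ℂ} (hX : Xᴴ = -X) (c : ℝ) :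
    IsUnit (1 - c • X) := by
  have h1 : (1 - c • X)ᴴ * (1 - c • X) = 1 + (c • X)ᴴ * (c • X) := by
    rw [Matrix.conjTranspose_sub, Matrix.conjTranspose_one, Matrix.conjTranspose_smul, hX,
      star_trivial]
    generalize hY : c • X = Y
    simp only [smul_neg, sub_neg_eq_add, neg_mul, hY]
    noncomm_ring
  have h2 : (1 + (c • X)ᴴ * (c • X)).PosDef :=
    Matrix.PosDef.one.add_posSemidef (Matrix.posSemidef_conjTranspose_mul_self _)
  have h3 := h2.isUnit
  rw [← h1, Matrix.isUnit_iff_isUnit_det, Matrix.det_mul, IsUnit.mul_iff] at h3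
  exact (Matrix.isUnit_iff_isUnit_det _).2 h3.2

theorem cay_eq {n : ℕ} {X : Matrix (Fin n) (Fin n) ℂ} (h : IsUnit (1 - (1 / 2 : ℝ) • X)) :
    cay X = (1 + (1 / 2 : ℝ) • X) * (1 - (1 / 2 : ℝ) • X)⁻¹ := by
  have h1 : (1 + (1 / 2 : ℝ) • X) = (1 - (1 / 2 : ℝ) • X) + X := by
    have : X = (1 / 2 : ℝ) • X + (1 / 2 : ℝ) • X := by rw [← add_smul]; norm_num
    conv_rhs => rw [sub_add, sub_eq_add_neg]
    conv_rhs => enter [2, 1, 2]; rw [this]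
    congr 1
    abel
  rw [h1, add_mul, Matrix.mul_nonsing_inv _ ((Matrix.isUnit_iff_isUnit_det _).1 h), cay]

theorem cay_zero {n : ℕ} : cay (0 : Matrix (Fin n) (Fin n) ℂ) = 1 := by
  simp [cay]

theorem cay_star_mul {n : ℕ} {X : Matrix (Fin n) (Fin n) ℂ} (hX : Xᴴ = -X) :
    (cay X)ᴴ * cay X = 1 := by
  have hu := isUnit_one_sub_skew hX (1 / 2)
  rw [cay_eq hu]
  -- In terms of `a` the transform is `aᴴ a⁻¹`, and `a` commutes with `aᴴ`.
  obtain ⟨a, ha⟩ : ∃ a, a = 1 - (1 / 2 : ℝ) • X := ⟨_, rfl⟩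
  have has : 1 + (1 / 2 : ℝ) • X = aᴴ := by
    rw [ha, Matrix.conjTranspose_sub, Matrix.conjTranspose_one, Matrix.conjTranspose_smul, hX,
      star_trivial]
    simp
  rw [← ha] at hu ⊢
  rw [has]
  have hd := (Matrix.isUnit_iff_isUnit_det _).1 hu
  have hd' : IsUnit (aᴴ).det := by rw [Matrix.det_conjTranspose]; exact hd.star
  have hc : a * aᴴ = aᴴ * a := by
    rw [← has, ha]
    generalize (1 / 2 : ℝ) • X = Y
    noncomm_ring
  rw [Matrix.conjTranspose_mul, Matrix.conjTranspose_conjTranspose,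
    Matrix.conjTranspose_nonsing_inv]
  calc _ = (aᴴ)⁻¹ * (a * aᴴ) * a⁻¹ := by simp only [mul_assoc]
    _ = ((aᴴ)⁻¹ * aᴴ) * (a * a⁻¹) := by rw [hc]; simp only [mul_assoc]
    _ = 1 := by rw [Matrix.nonsing_inv_mul _ hd', Matrix.mul_nonsing_inv _ hd, one_mul]

theorem cay_cayInv {n : ℕ} {O : Matrix (Fin n) (Fin n) ℂ} (h : IsUnit (O + 1)) :
    cay (cayInv O) = O := by
  obtain ⟨b, hb⟩ : ∃ b, b = (1 / 2 : ℝ) • (O + 1) := ⟨_, rfl⟩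
  have hbu : IsUnit b := by
    rw [hb]
    exact h.smul (Units.mk0 (1 / 2 : ℝ) (by norm_num))
  have hd := (Matrix.isUnit_iff_isUnit_det _).1 hbu
  have hO : O - 1 = (2 : ℝ) • (b - 1) := by
    rw [hb, smul_sub, smul_smul, show (2 : ℝ) * (1 / 2) = 1 by norm_num, one_smul, two_smul]
    abel
  have h1 : 1 - (1 / 2 : ℝ) • cayInv O = b⁻¹ := by
    rw [cayInv, ← hb, hO, Matrix.smul_mul, smul_smul, show (1 / 2 : ℝ) * 2 = 1 by norm_num,
      one_smul, sub_mul, Matrix.mul_nonsing_inv _ hd]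
    simp
  rw [cay, h1, Matrix.nonsing_inv_nonsing_inv _ hd, cayInv, ← hb, mul_assoc,
    Matrix.nonsing_inv_mul _ hd, mul_one, add_sub_cancel]

theorem cayInv_skew {n : ℕ} {O : Matrix (Fin n) (Fin n) ℂ} (hO : Oᴴ * O = 1)
    (h : IsUnit (O + 1)) : (cayInv O)ᴴ = -cayInv O := by
  obtain ⟨b, hb⟩ : ∃ b, b = (1 / 2 : ℝ) • (O + 1) := ⟨_, rfl⟩
  have hbu : IsUnit b := by
    rw [hb]
    exact h.smul (Units.mk0 (1 / 2 : ℝ) (by norm_num))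
  have hd := (Matrix.isUnit_iff_isUnit_det _).1 hbu
  have hd' : IsUnit (bᴴ).det := by rw [Matrix.det_conjTranspose]; exact hd.star
  rw [cayInv, ← hb, Matrix.conjTranspose_mul, Matrix.conjTranspose_nonsing_inv]
  have h1 : (O - 1)ᴴ * b = -(bᴴ * (O - 1)) := by
    rw [hb, Matrix.conjTranspose_smul, Matrix.conjTranspose_add, Matrix.conjTranspose_sub,
      Matrix.conjTranspose_one, star_trivial, Matrix.mul_smul, Matrix.smul_mul, ← smul_neg]
    congr 1
    rw [sub_mul, mul_add, add_mul, mul_sub, hO]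
    simp
    abel
  calc (bᴴ)⁻¹ * (O - 1)ᴴ = (bᴴ)⁻¹ * ((O - 1)ᴴ * b) * b⁻¹ := by
        rw [mul_assoc, mul_assoc, Matrix.mul_nonsing_inv _ hd, mul_one]
    _ = -(((bᴴ)⁻¹ * bᴴ) * (O - 1) * b⁻¹) := by rw [h1]; simp only [mul_neg, neg_mul, mul_assoc]
    _ = _ := by rw [Matrix.nonsing_inv_mul _ hd', one_mul]

theorem contDiffAt_nonsing_inv {n : ℕ} {X : Matrix (Fin n) (Fin n) ℂ} (h : IsUnit X)
    {k : WithTop ℕ∞} :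
    ContDiffAt ℝ k (fun X : Matrix (Fin n) (Fin n) ℂ => X⁻¹) X := by
  obtain ⟨u, rfl⟩ := h
  have : (fun X : Matrix (Fin n) (Fin n) ℂ => X⁻¹) = Ring.inverse :=
    funext fun X => Matrix.nonsing_inv_eq_ringInverse X
  rw [this]
  exact contDiffAt_ringInverse ℝ u

theorem contDiffAt_cay {n : ℕ} {X : Matrix (Fin n) (Fin n) ℂ}
    (h : IsUnit (1 - (1 / 2 : ℝ) • X)) {k : WithTop ℕ∞} : ContDiffAt ℝ k cay X := by
  have h1 : ContDiffAt ℝ k (fun X : Matrix (Fin n) (Fin n) ℂ => (1 - (1 / 2 : ℝ) • X)⁻¹) X :=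
    ContDiffAt.comp X (contDiffAt_nonsing_inv h)
      (by fun_prop)
  exact contDiffAt_const.add (contDiffAt_id.mul h1)

theorem contDiffAt_cayInv {n : ℕ} {O : Matrix (Fin n) (Fin n) ℂ}
    (h : IsUnit ((1 / 2 : ℝ) • (O + 1))) {k : WithTop ℕ∞} : ContDiffAt ℝ k cayInv O := by
  have h1 : ContDiffAt ℝ k
      (fun O : Matrix (Fin n) (Fin n) ℂ => ((1 / 2 : ℝ) • (O + 1))⁻¹) O :=
    ContDiffAt.comp O (contDiffAt_nonsing_inv h)
      (by fun_prop)
  exact (contDiffAt_id.sub contDiffAt_const).mul h1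

theorem hasStrictFDerivAt_cay {n : ℕ} :
    HasStrictFDerivAt cay (ContinuousLinearMap.id ℝ (Matrix (Fin n) (Fin n) ℂ)) 0 := by
  have h1 : ContDiffAt ℝ 1
      (fun X : Matrix (Fin n) (Fin n) ℂ => (1 - (1 / 2 : ℝ) • X)⁻¹) 0 :=
    ContDiffAt.comp 0 (contDiffAt_nonsing_inv (by simp))
      (by fun_prop)
  have h2 := h1.hasStrictFDerivAt (by simp)
  have h3 := ((hasStrictFDerivAt_id (𝕜 := ℝ) (0 : Matrix (Fin n) (Fin n) ℂ)).mul' h2).const_add 1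
  refine h3.congr_fderiv ?_
  ext1 X
  simp only [id, zero_smul, zero_add, smul_zero, sub_zero, inv_one]
  exact mul_one X

theorem hasStrictFDerivAt_cayInv {n : ℕ} :
    HasStrictFDerivAt cayInv (ContinuousLinearMap.id ℝ (Matrix (Fin n) (Fin n) ℂ)) 1 := by
  have h0 : (1 / 2 : ℝ) • ((1 : Matrix (Fin n) (Fin n) ℂ) + 1) = 1 := by
    rw [← two_smul ℝ (1 : Matrix (Fin n) (Fin n) ℂ), smul_smul]
    norm_num
  have h1 : ContDiffAt ℝ 1
      (fun O : Matrix (Fin n) (Fin n) ℂ => ((1 / 2 : ℝ) • (O + 1))⁻¹) 1 :=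
    ContDiffAt.comp 1 (contDiffAt_nonsing_inv (by rw [h0]; exact isUnit_one))
      (by fun_prop)
  have h2 := h1.hasStrictFDerivAt (by simp)
  have h3 := ((hasStrictFDerivAt_id (𝕜 := ℝ) (1 : Matrix (Fin n) (Fin n) ℂ)).sub_const 1).mul' h2
  refine h3.congr_fderiv ?_
  ext1 X
  simp only [id, sub_self, zero_smul, zero_add, h0, inv_one]
  exact mul_one X

end

end LagRep

/-! ### Infinitesimal theory: velocities, surjectivity by duality, rigidity, dimensions. -/

namespace LagRep

open scoped ContDiff Topology Matrix Matrix.Norms.Operator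
open Matrix

noncomputable section

attribute [-instance] instTopologicalSpaceMatrix Matrix.instUniformSpace

/-! ### Velocities of Lagrangian deformations -/

/-- The variation of `(A_s)` induced by the variations `M_s` of the Lagrangian subspaces `L_s`. -/
def lagVar {ℓ n : ℕ} (S : Fin ℓ → Matrix (Fin n) (Fin n) ℂ) :
    (Fin ℓ → Matrix (Fin n) (Fin n) ℂ) →ₗ[ℝ] (Fin ℓ → Matrix (Fin n) (Fin n) ℂ) where
  toFun M s := M s - lagMat S s * M (finRotate ℓ s) * (lagMat S s)ᴴ
  map_add' M N := by
    funext s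
    simp only [Pi.add_apply, mul_add, add_mul]
    abel
  map_smul' c M := by
    funext s
    simp [smul_sub]

theorem lagVar_apply {ℓ n : ℕ} (S : Fin ℓ → Matrix (Fin n) (Fin n) ℂ)
    (M : Fin ℓ → Matrix (Fin n) (Fin n) ℂ) (s : Fin ℓ) :
    lagVar S M s = M s - lagMat S s * M (finRotate ℓ s) * (lagMat S s)ᴴ := rfl

/-- The symmetric unitary matrices of a family of frames. -/
def frameSym {ℓ n : ℕ} (U : Fin ℓ → Un n) (s : Fin ℓ) : Matrix (Fin n) (Fin n) ℂ :=
  (U s : Matrix (Fin n) (Fin n) ℂ) * (U s : Matrix (Fin n) (Fin n) ℂ)ᵀ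

theorem isSymUnitary_frameSym {ℓ n : ℕ} (U : Fin ℓ → Un n) (s : Fin ℓ) :
    IsSymUnitary (frameSym U s) := isSymUnitary_frame (Un.star_mul_self _)

theorem genMat_lagRep_frame {ℓ n : ℕ} (U : Fin ℓ → Un n) (s : Fin ℓ) :
    genMat (lagRep fun s => (stdLagr n).act (U s)) s = lagMat (frameSym U) s := by
  rw [genMat_lagRep, tau_act_std]
  rfl

/-- The infinitesimal variation of the symmetric matrix of `L` under `Y ∈ 𝔲(n)`. -/
def symVar {n : ℕ} (S Y : Matrix (Fin n) (Fin n) ℂ) : Matrix (Fin n) (Fin n) ℂ := Y + refl S Y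

theorem symVar_smul {n : ℕ} (S Y : Matrix (Fin n) (Fin n) ℂ) (c : ℝ) :
    symVar S (c • Y) = c • symVar S Y := by
  rw [symVar, refl_smul, ← smul_add, symVar]

theorem refl_symVar {n : ℕ} {S : Matrix (Fin n) (Fin n) ℂ} (h : IsSymUnitary S)
    (Y : Matrix (Fin n) (Fin n) ℂ) : refl S (symVar S Y) = symVar S Y := by
  rw [symVar, refl_add, refl_refl h, add_comm]

theorem symVar_conjTranspose {n : ℕ} {S Y : Matrix (Fin n) (Fin n) ℂ} (hY : Yᴴ = -Y) :
    (symVar S Y)ᴴ = -symVar S Y := by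
  rw [symVar, Matrix.conjTranspose_add, hY, refl_conjTranspose hY, neg_add]

/-- Moving `L` by `g` replaces `S` by `g S gᵀ`, with derivative `M S` for `M = symVar S Y`. As `M`
is skew-Hermitian, `S_{s+1}ᴴ` varies by `-S_{s+1}ᴴ M_{s+1}`, so `A_s` varies by `M_s A_s - A_s
M_{s+1}`. -/
theorem hasDerivAt_path {ℓ n : ℕ} (U : Fin ℓ → Un n) {g : ℝ → Fin ℓ → Un n}
    {Y : Fin ℓ → Matrix (Fin n) (Fin n) ℂ} (h0 : ∀ s, g 0 s = 1)
    (hg : ∀ s, HasDerivAt (fun t => (g t s : Matrix (Fin n) (Fin n) ℂ)) (Y s) 0) (s : Fin ℓ) :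
    HasDerivAt (fun t => genMat (lagRep fun s => ((stdLagr n).act (U s)).act (g t s)) s)
      (lagVar (frameSym U) (fun s => symVar (frameSym U s) (Y s)) s * lagMat (frameSym U) s) 0 := by
  set S := frameSym U with hS
  have hsu := isSymUnitary_frameSym U
  have h1 : ∀ t, genMat (lagRep fun s => ((stdLagr n).act (U s)).act (g t s)) s
      = ((g t s : Matrix (Fin n) (Fin n) ℂ) * S s * (g t s : Matrix (Fin n) (Fin n) ℂ)ᵀ) *
        ((g t (finRotate ℓ s) : Matrix (Fin n) (Fin n) ℂ) * S (finRotate ℓ s) *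
          (g t (finRotate ℓ s) : Matrix (Fin n) (Fin n) ℂ)ᵀ)ᴴ := by
    intro t
    have h2 : (fun s => ((stdLagr n).act (U s)).act (g t s))
        = fun s => (stdLagr n).act (g t s * U s) := funext fun s => Lagr.act_act _ _ _
    have h3 : ∀ s, frameSym (fun s => g t s * U s) s = (g t s : Matrix (Fin n) (Fin n) ℂ) * S s *
        (g t s : Matrix (Fin n) (Fin n) ℂ)ᵀ := by
      intro s
      rw [frameSym, Un.coe_mul, Matrix.transpose_mul, hS, frameSym]
      simp only [mul_assoc]
    rw [h2, genMat_lagRep_frame, lagMat, h3, h3]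
  have h4 : ∀ s, HasDerivAt (fun t => (g t s : Matrix (Fin n) (Fin n) ℂ) * S s *
      (g t s : Matrix (Fin n) (Fin n) ℂ)ᵀ) (symVar (S s) (Y s) * S s) 0 := by
    intro s
    have h5 := ((hg s).mul_const (S s)).mul (HasDerivAt.transpose (hg s))
    refine h5.congr_deriv ?_
    rw [h0]
    have h6 : ((1 : Un n) : Matrix (Fin n) (Fin n) ℂ) = 1 := rfl
    rw [h6, Matrix.transpose_one, mul_one, one_mul, symVar, refl, add_mul]
    congr 1
    rw [mul_assoc, (hsu s).star_mul, mul_one]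
  have h5 := (h4 s).mul (HasDerivAt.conjTranspose (h4 (finRotate ℓ s)))
  rw [funext h1]
  refine h5.congr_deriv ?_
  simp only [h0]
  have h6 : ((1 : Un n) : Matrix (Fin n) (Fin n) ℂ) = 1 := rfl
  simp only [h6, Matrix.transpose_one, mul_one, one_mul]
  -- the skew part
  have h7 : ∀ s, (Y s)ᴴ = -Y s := by
    intro s
    have h8 := (HasDerivAt.conjTranspose (hg s)).mul (hg s)
    have h9 : (fun t => (g t s : Matrix (Fin n) (Fin n) ℂ)ᴴ * (g t s : Matrix (Fin n) (Fin n) ℂ))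
        = fun _ => 1 := funext fun t => Un.star_mul_self _
    have h10 := h8.unique (by
      change HasDerivAt (fun t => (g t s : Matrix (Fin n) (Fin n) ℂ)ᴴ *
        (g t s : Matrix (Fin n) (Fin n) ℂ)) 0 0
      rw [h9]; exact hasDerivAt_const _ _)
    rw [h0, h6, Matrix.conjTranspose_one, mul_one, one_mul] at h10
    exact eq_neg_of_add_eq_zero_left h10
  rw [lagVar_apply, Matrix.conjTranspose_mul, symVar_conjTranspose (h7 _), sub_mul]
  have h11 := lagMat_star_mul hsu s
  rw [mul_assoc (lagMat (frameSym U) s * _), h11, mul_one, sub_eq_add_neg]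
  simp only [lagMat, mul_assoc, mul_neg, hS]

theorem isVelocity_path {ℓ n : ℕ} (U : Fin ℓ → Un n) {g : ℝ → Fin ℓ → Un n}
    {Y : Fin ℓ → Matrix (Fin n) (Fin n) ℂ} (h0 : ∀ s, g 0 s = 1)
    (hg : ∀ s, HasDerivAt (fun t => (g t s : Matrix (Fin n) (Fin n) ℂ)) (Y s) 0) :
    IsVelocity (fun t => lagRep fun s => ((stdLagr n).act (U s)).act (g t s))
      (lagVar (frameSym U) fun s => symVar (frameSym U s) (Y s)) := by
  intro s i j
  have h1 := hasDerivAt_matrix_iff.1 (hasDerivAt_path U h0 hg s) i j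
  have h2 : genMat (lagRep fun s => ((stdLagr n).act (U s)).act (g 0 s)) s
      = lagMat (frameSym U) s := by
    rw [← genMat_lagRep_frame]
    simp only [h0, Lagr.act_one]
  rw [h2]
  exact h1

theorem IsVelocity.unique {ℓ n : ℕ} {ρ : ℝ → HomU ℓ n} {X X' : Fin ℓ → Matrix (Fin n) (Fin n) ℂ}
    (h : IsVelocity ρ X) (h' : IsVelocity ρ X') : X = X' := by
  funext s
  have h1 : X s * genMat (ρ 0) s = X' s * genMat (ρ 0) s := by
    ext i j
    exact (h s i j).unique (h' s i j)
  have h2 := Matrix.mem_unitaryGroup_iff.1 (genMat_mem (ρ 0) s)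
  calc X s = X s * genMat (ρ 0) s * star (genMat (ρ 0) s) := by rw [mul_assoc, h2, mul_one]
    _ = X' s := by rw [h1, mul_assoc, h2, mul_one]

theorem IsSmoothPath.exists_hasDerivAt {n : ℕ} {g : ℝ → Un n} (h : IsSmoothPath g) :
    ∃ Y : Matrix (Fin n) (Fin n) ℂ, Yᴴ = -Y ∧
      HasDerivAt (fun t => (g t : Matrix (Fin n) (Fin n) ℂ)) Y 0 := by
  have h1 : HasDerivAt (fun t => (g t : Matrix (Fin n) (Fin n) ℂ))
      (Matrix.of fun i j => deriv (fun t => (g t : Matrix (Fin n) (Fin n) ℂ) i j) 0) 0 :=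
    hasDerivAt_matrix_iff.2 fun i j =>
      ((h.2 i j).differentiable (by simp)).differentiableAt.hasDerivAt
  refine ⟨_, ?_, h1⟩
  have h8 := (HasDerivAt.conjTranspose h1).mul h1
  have h9 : (fun t => (g t : Matrix (Fin n) (Fin n) ℂ)ᴴ * (g t : Matrix (Fin n) (Fin n) ℂ))
      = fun _ => 1 := funext fun t => Un.star_mul_self _
  have h10 := h8.unique (by
    change HasDerivAt (fun t => (g t : Matrix (Fin n) (Fin n) ℂ)ᴴ *
      (g t : Matrix (Fin n) (Fin n) ℂ)) 0 0
    rw [h9]; exact hasDerivAt_const _ _)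
  have h6 : ((1 : Un n) : Matrix (Fin n) (Fin n) ℂ) = 1 := rfl
  rw [h.1, h6, Matrix.conjTranspose_one, mul_one, one_mul] at h10
  exact eq_neg_of_add_eq_zero_left h10

/-! ### Twists and bendings span all Lagrangian velocities -/

theorem finRotate_pow_apply {m : ℕ} (k : ℕ) (s : Fin (m + 1)) :
    (finRotate (m + 1) ^ k) s = s + (Fin.ofNat (m + 1) k) := by
  induction k with
  | zero => simp
  | succ k ih =>
    rw [pow_succ', Equiv.Perm.mul_apply, ih, finRotate_apply, add_assoc]
    congr 1
    ext
    simp [Fin.val_add]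

theorem exists_finRotate_pow {ℓ : ℕ} {s t : Fin ℓ} (h : t ≠ s) :
    ∃ r, 1 ≤ r ∧ r ≤ ℓ ∧ (finRotate ℓ ^ r) s = t := by
  cases ℓ with
  | zero => exact s.elim0
  | succ m =>
    refine ⟨(t - s).val, ?_, (t - s).isLt.le, ?_⟩
    · have : t - s ≠ 0 := sub_ne_zero.2 h
      exact Nat.one_le_iff_ne_zero.2 fun h0 => this (Fin.ext h0)
    · rw [finRotate_pow_apply]
      simp

/-- The path `cay(tX)` in `U(n)`. -/
def cayPath {n : ℕ} (X : Matrix (Fin n) (Fin n) ℂ) (hX : Xᴴ = -X) (t : ℝ) : Un n :=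
  ⟨cay (t • X), Matrix.mem_unitaryGroup_iff'.2 (cay_star_mul (by
    rw [Matrix.conjTranspose_smul, hX, star_trivial, smul_neg]))⟩

theorem coe_cayPath {n : ℕ} (X : Matrix (Fin n) (Fin n) ℂ) (hX : Xᴴ = -X) (t : ℝ) :
    (cayPath X hX t : Matrix (Fin n) (Fin n) ℂ) = cay (t • X) := rfl

theorem hasDerivAt_cay_smul {n : ℕ} (X : Matrix (Fin n) (Fin n) ℂ) :
    HasDerivAt (fun t : ℝ => cay (t • X)) X 0 := by
  have h1 : HasDerivAt (fun t : ℝ => t • X) X 0 := by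
    simpa using (hasDerivAt_id (0 : ℝ)).smul_const X
  have h2 : HasFDerivAt cay (ContinuousLinearMap.id ℝ (Matrix (Fin n) (Fin n) ℂ))
      ((0 : ℝ) • X) := by
    rw [zero_smul]; exact hasStrictFDerivAt_cay.hasFDerivAt
  exact h2.comp_hasDerivAt 0 h1

theorem cayPath_isSmoothPath {n : ℕ} (X : Matrix (Fin n) (Fin n) ℂ) (hX : Xᴴ = -X) :
    IsSmoothPath (cayPath X hX) := by
  refine ⟨Subtype.ext (by simp [cayPath, cay_zero]), fun i j => ?_⟩
  have h1 : ContDiff ℝ ∞ (fun t : ℝ => cay (t • X)) := by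
    refine contDiff_iff_contDiffAt.2 fun t => ?_
    refine ContDiffAt.comp (g := cay) t (contDiffAt_cay ?_) (by fun_prop)
    rw [smul_smul]
    exact isUnit_one_sub_skew hX _
  exact (entryCLM i j).contDiff.comp h1

theorem transpose_eq_of_symVar {n : ℕ} {S X : Matrix (Fin n) (Fin n) ℂ} (hS : IsSymUnitary S)
    (h : symVar S X = 0) : Xᵀ = -(Sᴴ * X * S) := by
  have h3 : refl S X = -X := eq_neg_of_add_eq_zero_right h
  rw [← neg_mul, ← mul_neg, ← h3, refl]
  calc Xᵀ = (Sᴴ * S) * Xᵀ * (Sᴴ * S) := by rw [hS.star_mul, one_mul, mul_one]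
    _ = _ := by simp only [mul_assoc]

/-- The Cayley transform of an infinitesimal stabilizer of `L` stabilizes `L`. With `a = 1 - X/2`
and `b = 1 + X/2`, the relation `S Xᵀ = -X S` exchanges them: `S aᵀ = b S` and `S bᵀ = a S`, while
`cay X = b a⁻¹`. -/
theorem cay_mul_mul_transpose {n : ℕ} {S X : Matrix (Fin n) (Fin n) ℂ} (hS : IsSymUnitary S)
    (hX : Xᴴ = -X) (h : symVar S X = 0) : cay X * S * (cay X)ᵀ = S := by
  have hu := isUnit_one_sub_skew hX (1 / 2)
  have hu' := isUnit_one_sub_skew hX (-1 / 2)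
  obtain ⟨a, ha⟩ : ∃ a, a = 1 - (1 / 2 : ℝ) • X := ⟨_, rfl⟩
  obtain ⟨b, hb⟩ : ∃ b, b = 1 + (1 / 2 : ℝ) • X := ⟨_, rfl⟩
  have hb' : b = 1 - (-1 / 2 : ℝ) • X := by rw [hb, neg_div, neg_smul, sub_neg_eq_add]
  rw [cay_eq hu, ← ha, ← hb]
  rw [← ha] at hu
  rw [← hb'] at hu'
  have hd := (Matrix.isUnit_iff_isUnit_det _).1 hu
  have hd' := (Matrix.isUnit_iff_isUnit_det _).1 hu'
  have hX' := transpose_eq_of_symVar hS h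
  have haS : S * aᵀ = b * S := by
    rw [ha, hb, Matrix.transpose_sub, Matrix.transpose_one, Matrix.transpose_smul, hX',
      smul_neg, sub_neg_eq_add, mul_add, add_mul, Matrix.mul_smul, Matrix.smul_mul, ← mul_assoc,
      ← mul_assoc, hS.mul_star]
    simp
  have hbS : S * bᵀ = a * S := by
    rw [ha, hb, Matrix.transpose_add, Matrix.transpose_one, Matrix.transpose_smul, hX', mul_add,
      sub_mul, smul_neg, mul_neg, Matrix.mul_smul, Matrix.smul_mul, ← mul_assoc,
      ← mul_assoc, hS.mul_star]
    simp [sub_eq_add_neg]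
  have haS' : S * (aᵀ)⁻¹ = b⁻¹ * S := by
    have hdt : IsUnit (aᵀ).det := by rwa [Matrix.det_transpose]
    calc S * (aᵀ)⁻¹ = b⁻¹ * b * S * (aᵀ)⁻¹ := by rw [Matrix.nonsing_inv_mul _ hd', one_mul]
      _ = b⁻¹ * (S * aᵀ) * (aᵀ)⁻¹ := by rw [haS]; simp only [mul_assoc]
      _ = b⁻¹ * S * (aᵀ * (aᵀ)⁻¹) := by simp only [mul_assoc]
      _ = b⁻¹ * S := by rw [Matrix.mul_nonsing_inv _ hdt, mul_one]
  have hab : a⁻¹ * b⁻¹ * a = b⁻¹ := by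
    have hc : b * a = a * b := by
      rw [ha, hb]
      generalize (1 / 2 : ℝ) • X = Y
      noncomm_ring
    calc a⁻¹ * b⁻¹ * a = a⁻¹ * b⁻¹ * (a * b) * b⁻¹ := by
          rw [mul_assoc _ (a * b), mul_assoc a, Matrix.mul_nonsing_inv _ hd', mul_one]
      _ = a⁻¹ * (b⁻¹ * b) * a * b⁻¹ := by rw [← hc]; simp only [mul_assoc]
      _ = b⁻¹ := by
        rw [Matrix.nonsing_inv_mul _ hd', mul_one, Matrix.nonsing_inv_mul _ hd, one_mul]
  rw [Matrix.transpose_mul, Matrix.transpose_nonsing_inv]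
  calc b * a⁻¹ * S * ((aᵀ)⁻¹ * bᵀ) = b * a⁻¹ * (S * (aᵀ)⁻¹) * bᵀ := by simp only [mul_assoc]
    _ = b * a⁻¹ * b⁻¹ * (S * bᵀ) := by rw [haS']; simp only [mul_assoc]
    _ = b * (a⁻¹ * b⁻¹ * a) * S := by rw [hbS]; simp only [mul_assoc]
    _ = S := by rw [hab, Matrix.mul_nonsing_inv _ hd', one_mul]

theorem cayPath_act {n : ℕ} (X : Matrix (Fin n) (Fin n) ℂ) (hX : Xᴴ = -X) (U : Un n)
    (h : symVar ((U : Matrix (Fin n) (Fin n) ℂ) * (U : Matrix (Fin n) (Fin n) ℂ)ᵀ) X = 0) (t : ℝ) :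
    ((stdLagr n).act U).act (cayPath X hX t) = (stdLagr n).act U := by
  have hS := isSymUnitary_frame (Un.star_mul_self U)
  have h1 := cay_mul_mul_transpose hS (X := t • X)
    (by rw [Matrix.conjTranspose_smul, hX, star_trivial, smul_neg])
    (by rw [symVar_smul, h, smul_zero])
  rw [Lagr.act_act, act_std_eq_iff, Un.coe_mul, Matrix.transpose_mul, coe_cayPath]
  conv_rhs => rw [← h1]
  simp only [mul_assoc]

/-- The path `cay(tX)` stays in the stabilizer of `L_s`, so it is a legitimate real bending, with
velocity `X` at `t = 0`. -/
theorem bend_var_mem {ℓ n : ℕ} (U : Fin ℓ → Un n) (s : Fin ℓ) {r : ℕ} (hr : 1 ≤ r) (hr' : r ≤ ℓ)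
    {X : Matrix (Fin n) (Fin n) ℂ} (hX : Xᴴ = -X) (h : symVar (frameSym U s) X = 0)
    (P : Fin ℓ → Prop) [DecidablePred P]
    (hP : ∀ s', P s' ↔ ∃ k : ℕ, 1 ≤ k ∧ k ≤ r ∧ (finRotate ℓ ^ k) s = s') :
    lagVar (frameSym U) (fun s' => if P s' then symVar (frameSym U s') X else 0)
      ∈ twistBendSpan fun s => (stdLagr n).act (U s) := by
  refine Submodule.subset_span (Or.inr ⟨s, r, hr, hr', cayPath X hX, cayPath_isSmoothPath X hX,
    cayPath_act X hX (U s) h, ?_⟩)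
  have h1 := isVelocity_path U (g := fun t s' => if P s' then cayPath X hX t else 1)
    (Y := fun s' => if P s' then X else 0) (fun s' => by
      split_ifs
      · exact (cayPath_isSmoothPath X hX).1
      · rfl) (fun s' => by
      split_ifs
      · exact hasDerivAt_cay_smul X
      · exact hasDerivAt_const _ _)
  convert h1 using 1
  · funext t
    congr 1
    funext s'
    simp only [bend, ← hP]
    split_ifs
    · rfl
    · rw [Lagr.act_one]
  · congr 1
    funext s'
    split_ifs
    · rfl
    · simp [symVar, refl]

/-- Rotating `L_t` by `exp(iτ)` multiplies `S_t` by `exp(2iτ)`; the resulting factor `2` is divided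
out at the end. -/
theorem twist_var_mem {ℓ n : ℕ} (U : Fin ℓ → Un n) (t : Fin ℓ) :
    lagVar (frameSym U) (Pi.single t (Complex.I • 1))
      ∈ twistBendSpan fun s => (stdLagr n).act (U s) := by
  have h0 : lagVar (frameSym U) (fun s => symVar (frameSym U s)
      ((if s = t then Complex.I else 0) • (1 : Matrix (Fin n) (Fin n) ℂ)))
      ∈ twistBendSpan fun s => (stdLagr n).act (U s) := by
    refine Submodule.subset_span (Or.inl
      ⟨fun τ s => if s = t then Circle.exp τ else 1, fun s => ?_, fun s => ?_, ?_⟩)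
    · dsimp only; split_ifs <;> simp
    · by_cases hs : s = t
      · simp only [hs, if_true, Circle.coe_exp]
        exact ((Complex.ofRealCLM.contDiff (n := ∞)).mul
          (contDiff_const (c := Complex.I))).cexp
      · simp only [hs, if_false]
        exact contDiff_const
    · have h1 := isVelocity_path U
        (g := fun τ s => scalarU n (if s = t then Circle.exp τ else 1))
        (Y := fun s => (if s = t then Complex.I else 0) • (1 : Matrix (Fin n) (Fin n) ℂ))
        (fun s => Subtype.ext (by dsimp only [scalarU]; split_ifs <;> simp))
        (fun s => by
          dsimp only [scalarU]
          by_cases hs : s = t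
          · simp only [hs, if_true, Circle.coe_exp]
            have h2 : HasDerivAt (fun τ : ℝ => Complex.exp (τ * Complex.I)) Complex.I 0 := by
              have := ((Complex.ofRealCLM.hasDerivAt (x := (0:ℝ))).mul_const Complex.I).cexp
              simpa using this
            exact HasDerivAt.smul_const (F := Matrix (Fin n) (Fin n) ℂ) h2 1
          · simp only [hs, if_false, zero_smul]
            exact hasDerivAt_const (0 : ℝ) _)
      exact h1
  have h1 : (fun s => symVar (frameSym U s)
      ((if s = t then Complex.I else 0) • (1 : Matrix (Fin n) (Fin n) ℂ)))
      = (2 : ℝ) • (Pi.single t (Complex.I • 1) : Fin ℓ → Matrix (Fin n) (Fin n) ℂ) := by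
    funext s
    by_cases hs : s = t
    · subst hs
      have := (isSymUnitary_frameSym U s).mul_star
      simp [symVar, refl, two_smul, this]
    · simp [symVar, refl, hs]
  rw [h1, map_smul] at h0
  have h2 := Submodule.smul_mem _ (1 / 2 : ℝ) h0
  rwa [smul_smul, show (1 / 2 : ℝ) * 2 = 1 by norm_num, one_smul] at h2

/-- Bendings about `L_s` of lengths `r` and `r - 1` differ, to first order, in the motion of the
single subspace `L_{s+r}`. When `t = s` nothing moves, since `X` stabilizes `L_s`. -/
theorem bend_single_mem {ℓ n : ℕ} (U : Fin ℓ → Un n) (s t : Fin ℓ)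
    {X : Matrix (Fin n) (Fin n) ℂ} (hX : Xᴴ = -X) (h : symVar (frameSym U s) X = 0) :
    lagVar (frameSym U) (Pi.single t (symVar (frameSym U t) X))
      ∈ twistBendSpan fun s => (stdLagr n).act (U s) := by
  classical
  by_cases hst : t = s
  · rw [hst, h, Pi.single_zero, map_zero]
    exact Submodule.zero_mem _
  have hex := exists_finRotate_pow hst
  -- Taking the least length that reaches `L_t` ensures that the shorter bending does not already
  -- move `L_t`.
  obtain ⟨hr1, hr2, hr3⟩ := Nat.find_spec hex
  have hmin := fun m hm => Nat.find_min hex (m := m) hm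
  obtain ⟨r, hr⟩ : ∃ r, r = Nat.find hex := ⟨_, rfl⟩
  rw [← hr] at hr1 hr2 hr3 hmin
  obtain ⟨k, rfl⟩ : ∃ k, r = k + 1 := ⟨r - 1, by omega⟩
  let P : ℕ → Fin ℓ → Prop := fun r s' => ∃ k : ℕ, 1 ≤ k ∧ k ≤ r ∧ (finRotate ℓ ^ k) s = s'
  have hmem : ∀ r, r ≤ ℓ → lagVar (frameSym U)
      (fun s' => if P r s' then symVar (frameSym U s') X else 0)
      ∈ twistBendSpan fun s => (stdLagr n).act (U s) := by
    intro r hr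
    -- Length zero is not among the bendings; its variation is simply zero.
    rcases Nat.eq_zero_or_pos r with rfl | h0
    · have : ∀ s', ¬ P 0 s' := fun s' ⟨k, h1, h2, _⟩ => by omega
      simp only [this, if_false]
      have h2 : (fun _ : Fin ℓ => (0 : Matrix (Fin n) (Fin n) ℂ)) = 0 := rfl
      rw [h2, map_zero]
      exact Submodule.zero_mem _
    · exact bend_var_mem U s h0 hr hX h (P r) fun _ => Iff.rfl
  have h1 := Submodule.sub_mem _ (hmem (k + 1) hr2) (hmem k (by omega))
  rw [← map_sub] at h1
  convert h1 using 2
  funext s'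
  have hPt : ¬ P k t := fun ⟨j, h1, h2, h3⟩ => hmin j (by omega) ⟨h1, by omega, h3⟩
  have hPt' : P (k + 1) t := ⟨k + 1, hr1, le_rfl, hr3⟩
  by_cases hs' : s' = t
  · subst hs'
    simp [hPt, hPt']
  · have hiff : P (k + 1) s' ↔ P k s' := by
      constructor
      · rintro ⟨j, h1, h2, h3⟩
        refine ⟨j, h1, ?_, h3⟩
        rcases Nat.lt_or_ge j (k + 1) with h4 | h4
        · omega
        · have : j = k + 1 := le_antisymm h2 h4
          subst this
          exact absurd (h3.symm.trans hr3) hs'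
      · rintro ⟨j, h1, h2, h3⟩
        exact ⟨j, h1, by omega, h3⟩
    simp only [Pi.sub_apply, hiff, sub_self]
    rw [Pi.single_eq_of_ne hs']

/-- Let `f = Re tr(Z ·)` vanish on the variations of `L_t` obtained from twists and bendings, and
let `N = Z + refl S_t Z`. Bendings about `L_s` make `N` orthogonal to the stabilizer algebra of each
`L_s`, hence fixed by every reflection, hence scalar; twists make the scalar zero. On vectors `M`
fixed by `refl S_t` the value `f M` is half the pairing with `N`. -/
theorem lagVar_single_mem {ℓ n : ℕ} (hn : 1 ≤ n) (U : Fin ℓ → Un n)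
    (hA : Submodule.span ℂ (Set.range (wordProd (lagMat (frameSym U)))) = ⊤) (t : Fin ℓ)
    {M : Matrix (Fin n) (Fin n) ℂ} (hM : Mᴴ = -M) (hM' : refl (frameSym U t) M = M) :
    lagVar (frameSym U) (Pi.single t M) ∈ twistBendSpan fun s => (stdLagr n).act (U s) := by
  have hsu := isSymUnitary_frameSym U
  obtain ⟨S, hS⟩ : ∃ S, S = frameSym U := ⟨_, rfl⟩
  let R : Submodule ℝ (Matrix (Fin n) (Fin n) ℂ) :=
    (twistBendSpan fun s => (stdLagr n).act (U s)).comap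
      (lagVar (frameSym U) ∘ₗ LinearMap.single ℝ (fun _ => Matrix (Fin n) (Fin n) ℂ) t)
  change M ∈ R
  refine mem_of_forall_functional R M fun f hf => ?_
  obtain ⟨Z₀, hZ₀⟩ := exists_trace_functional f
  obtain ⟨Z, hZ⟩ : ∃ Z, Z = skewPart Z₀ := ⟨_, rfl⟩
  have hZs : Zᴴ = -Z := hZ ▸ skewPart_conjTranspose Z₀
  have hfZ : ∀ X, Xᴴ = -X → f X = (Z * X).trace.re := fun X hX => by
    rw [hZ₀, hZ, trace_skewPart_mul_re _ hX]
  obtain ⟨N, hN⟩ : ∃ N, N = symVar (frameSym U t) Z := ⟨_, rfl⟩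
  have hNs : Nᴴ = -N := hN ▸ symVar_conjTranspose hZs
  have hbend : ∀ s X, Xᴴ = -X → symVar (frameSym U s) X = 0 → (N * X).trace.re = 0 := by
    intro s X hX hX'
    have h1 := hf _ (bend_single_mem U s t hX hX' : symVar (frameSym U t) X ∈ R)
    rw [hfZ _ (symVar_conjTranspose hX), symVar, mul_add, Matrix.trace_add,
      ← trace_refl_mul (hsu t), ← Matrix.trace_add, ← add_mul] at h1
    rw [hN]
    exact h1
  have hNrefl : ∀ s, refl (frameSym U s) N = N := by
    intro s
    have h1 : (N - refl (frameSym U s) N)ᴴ = -(N - refl (frameSym U s) N) := by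
      rw [Matrix.conjTranspose_sub, hNs, refl_conjTranspose hNs]; abel
    have h2 : symVar (frameSym U s) (N - refl (frameSym U s) N) = 0 := by
      rw [symVar, refl_sub, refl_refl (hsu s)]; abel
    -- The difference `N - refl N` is itself in the stabilizer algebra. Pairing `N` and `refl N`
    -- with it both give zero, so its square has trace zero.
    have h3 := hbend s _ h1 h2
    have h4 : refl (frameSym U s) (N - refl (frameSym U s) N) = -(N - refl (frameSym U s) N) :=
      eq_neg_of_add_eq_zero_right h2
    have h5 : (refl (frameSym U s) N * (N - refl (frameSym U s) N)).trace.re = 0 := by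
      rw [trace_refl_mul (hsu s), h4, mul_neg, Matrix.trace_neg, Complex.neg_re, h3, neg_zero]
    have h6 := eq_zero_of_trace_mul_self h1 (by
      rw [sub_mul, Matrix.trace_sub, Complex.sub_re, h3, h5, sub_zero])
    exact (sub_eq_zero.1 h6).symm
  obtain ⟨c, hc⟩ := scalar_of_refl_eq hsu hA hNrefl
  have htwist : (N * (Complex.I • 1)).trace.re = 0 := by
    have hI : (Complex.I • (1 : Matrix (Fin n) (Fin n) ℂ))ᴴ = -(Complex.I • 1) := by
      simp
    have h1 := hf _ (twist_var_mem U t : Complex.I • (1 : Matrix (Fin n) (Fin n) ℂ) ∈ R)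
    rw [hfZ _ hI] at h1
    have h2 : refl (frameSym U t) (Complex.I • 1) = Complex.I • 1 := by
      simp [refl, (hsu t).mul_star]
    rw [hN, symVar, add_mul, Matrix.trace_add, trace_refl_mul (hsu t), h2, Complex.add_re, h1,
      add_zero]
  have hN0 : N = 0 := by
    refine eq_zero_of_trace_mul_self hNs ?_
    have h1 : c.im = 0 := by
      rw [hc] at htwist
      simpa [show n ≠ 0 by omega] using htwist
    have h2 : c.re = 0 := by
      have h3 := congrFun (congrFun hNs ⟨0, hn⟩) ⟨0, hn⟩
      rw [hc] at h3
      have h4 := congrArg Complex.re h3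
      simp at h4
      linarith
    have h3 : c = 0 := Complex.ext h2 h1
    rw [hc, h3]
    simp
  have h1 : (N * M).trace.re = 2 * f M := by
    rw [hN, symVar, add_mul, Matrix.trace_add, trace_refl_mul (hsu t), hM', Complex.add_re,
      hfZ M hM]
    ring
  rw [hN0, zero_mul, Matrix.trace_zero, Complex.zero_re] at h1
  linarith

theorem lagVar_mem_twistBendSpan {ℓ n : ℕ} (hn : 1 ≤ n) (U : Fin ℓ → Un n)
    (hA : Submodule.span ℂ (Set.range (wordProd (lagMat (frameSym U)))) = ⊤)
    {M : Fin ℓ → Matrix (Fin n) (Fin n) ℂ} (hM : ∀ s, (M s)ᴴ = -M s)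
    (hM' : ∀ s, refl (frameSym U s) (M s) = M s) :
    lagVar (frameSym U) M ∈ twistBendSpan fun s => (stdLagr n).act (U s) := by
  have h1 : M = ∑ s, Pi.single s (M s) := (Finset.univ_sum_single M).symm
  rw [h1, map_sum]
  exact Submodule.sum_mem _ fun s _ => lagVar_single_mem hn U hA s (hM s) (hM' s)

/-- A Lagrangian deformation has as velocity the image under `lagVar` of a family of tangent vectors
to the Grassmannian, one for each `s`. It therefore lies in the span exactly, not only modulo
conjugations. -/
theorem lagVel_subset_twistBendSpan {ℓ n : ℕ} (hn : 1 ≤ n) (U : Fin ℓ → Un n)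
    (hA : Submodule.span ℂ (Set.range (wordProd (lagMat (frameSym U)))) = ⊤)
    {X : Fin ℓ → Matrix (Fin n) (Fin n) ℂ} (hX : X ∈ lagVel fun s => (stdLagr n).act (U s)) :
    X ∈ twistBendSpan fun s => (stdLagr n).act (U s) := by
  obtain ⟨g, hg, hv⟩ := hX
  choose Y hY hY' using fun s => (hg s).exists_hasDerivAt
  have h1 := isVelocity_path U (fun s => (hg s).1) hY'
  rw [IsVelocity.unique hv h1]
  exact lagVar_mem_twistBendSpan hn U hA (fun s => symVar_conjTranspose (hY s))
    fun s => refl_symVar (isSymUnitary_frameSym U s) _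

/-! ### Variations of the eigenvalues -/

/-- The map `(M, Y) ↦ (δA_s A_s⁻¹ - (1 - Ad A_s) Y_s)`. -/
def lagVarMod {ℓ n : ℕ} (S : Fin ℓ → Matrix (Fin n) (Fin n) ℂ) :
    ((Fin ℓ → Matrix (Fin n) (Fin n) ℂ) × (Fin ℓ → Matrix (Fin n) (Fin n) ℂ)) →ₗ[ℝ]
      (Fin ℓ → Matrix (Fin n) (Fin n) ℂ) where
  toFun p s := lagVar S p.1 s - (p.2 s - lagMat S s * p.2 s * (lagMat S s)ᴴ)
  map_add' p q := by
    funext s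
    simp only [Prod.fst_add, Prod.snd_add, map_add, Pi.add_apply, mul_add, add_mul]
    abel
  map_smul' c p := by
    funext s
    simp [smul_sub]

theorem lagVarMod_apply {ℓ n : ℕ} (S : Fin ℓ → Matrix (Fin n) (Fin n) ℂ)
    (M Y : Fin ℓ → Matrix (Fin n) (Fin n) ℂ) (s : Fin ℓ) :
    lagVarMod S (M, Y) s = lagVar S M s - (Y s - lagMat S s * Y s * (lagMat S s)ᴴ) := rfl

/-- Pairs of families of skew-Hermitian matrices `(M, Y)`, where `M_s` is tangent to the
Lagrangian Grassmannian at `L_s`. -/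
def lagVarDomain {ℓ n : ℕ} (S : Fin ℓ → Matrix (Fin n) (Fin n) ℂ) :
    Submodule ℝ ((Fin ℓ → Matrix (Fin n) (Fin n) ℂ) × (Fin ℓ → Matrix (Fin n) (Fin n) ℂ)) where
  carrier := {p | (∀ s, (p.1 s)ᴴ = -p.1 s) ∧ (∀ s, refl (S s) (p.1 s) = p.1 s) ∧
    ∀ s, (p.2 s)ᴴ = -p.2 s}
  add_mem' {p q} hp hq :=
    ⟨fun s => by simp [hp.1 s, hq.1 s, add_comm],
      fun s => by simp [refl_add, hp.2.1 s, hq.2.1 s],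
      fun s => by simp [hp.2.2 s, hq.2.2 s, add_comm]⟩
  zero_mem' := ⟨fun s => by simp, fun s => by simp [refl], fun s => by simp⟩
  smul_mem' c p hp :=
    ⟨fun s => by simp [hp.1 s], fun s => by simp [refl_smul, hp.2.1 s],
      fun s => by simp [hp.2.2 s]⟩

theorem functional_eq_sum {ℓ n : ℕ} (f : (Fin ℓ → Matrix (Fin n) (Fin n) ℂ) →ₗ[ℝ] ℝ) :
    ∃ Z : Fin ℓ → Matrix (Fin n) (Fin n) ℂ, (∀ s, (Z s)ᴴ = -Z s) ∧
      ∀ X : Fin ℓ → Matrix (Fin n) (Fin n) ℂ, (∀ s, (X s)ᴴ = -X s) →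
        f X = ∑ s, (Z s * X s).trace.re := by
  choose Z hZ using fun s => exists_trace_functional
    (f ∘ₗ LinearMap.single ℝ (fun _ => Matrix (Fin n) (Fin n) ℂ) s)
  refine ⟨fun s => skewPart (Z s), fun s => skewPart_conjTranspose _, fun X hX => ?_⟩
  have h1 : X = ∑ s, Pi.single s (X s) := (Finset.univ_sum_single X).symm
  conv_lhs => rw [h1]
  rw [map_sum]
  refine Finset.sum_congr rfl fun s _ => ?_
  rw [trace_skewPart_mul_re _ (hX s), ← hZ]
  rfl

/-- Duality again. A family `(Z_s)` orthogonal to all conjugation directions has `Z_s` commuting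
with `A_s`; orthogonal also to the Lagrangian variations, it has `Z_s + refl S_s Z_s` independent of
`s`. This common value is fixed by all reflections, hence a scalar `c`, and the pairing with `D` is
`½ Re(c ∑ tr D_s) = 0`. -/
theorem exists_lagVar_eq_mod {ℓ n : ℕ} {S : Fin ℓ → Matrix (Fin n) (Fin n) ℂ}
    (hS : ∀ s, IsSymUnitary (S s))
    (hA : Submodule.span ℂ (Set.range (wordProd (lagMat S))) = ⊤)
    {D : Fin ℓ → Matrix (Fin n) (Fin n) ℂ} (hD : ∀ s, (D s)ᴴ = -D s)
    (hD' : ∀ s, refl (S s) (D s) = D s) (htr : ∑ s, (D s).trace = 0) :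
    ∃ M Y : Fin ℓ → Matrix (Fin n) (Fin n) ℂ, (∀ s, (M s)ᴴ = -M s) ∧
      (∀ s, refl (S s) (M s) = M s) ∧ (∀ s, (Y s)ᴴ = -Y s) ∧
      ∀ s, lagVar S M s - D s = Y s - lagMat S s * Y s * (lagMat S s)ᴴ := by
  suffices h : D ∈ (lagVarDomain S).map (lagVarMod S) by
    obtain ⟨⟨M, Y⟩, ⟨h1, h2, h3⟩, h4⟩ := h
    refine ⟨M, Y, h1, h2, h3, fun s => ?_⟩
    rw [← h4, lagVarMod_apply, sub_sub_cancel]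
  refine mem_of_forall_functional _ D fun f hf => ?_
  obtain ⟨Z, hZ, hfZ⟩ := functional_eq_sum f
  have hAs := fun s => lagMat_star_mul hS s
  have hAs' := fun s => mul_eq_one_comm.1 (hAs s)
  have hconj : ∀ s (X : Matrix (Fin n) (Fin n) ℂ), Xᴴ = -X →
      (lagMat S s * X * (lagMat S s)ᴴ)ᴴ = -(lagMat S s * X * (lagMat S s)ᴴ) := by
    intro s X hX
    rw [Matrix.conjTranspose_mul, Matrix.conjTranspose_mul, Matrix.conjTranspose_conjTranspose, hX]
    simp [mul_assoc]
  have hcomm : ∀ s, Z s * lagMat S s = lagMat S s * Z s := by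
    intro s
    -- Tested against the conjugation direction of this `W`, the functional has value `-Re tr W²`.
    obtain ⟨W, hW⟩ : ∃ W, W = Z s - (lagMat S s)ᴴ * Z s * lagMat S s := ⟨_, rfl⟩
    have hWs : Wᴴ = -W := by
      rw [hW, Matrix.conjTranspose_sub, Matrix.conjTranspose_mul, Matrix.conjTranspose_mul,
        Matrix.conjTranspose_conjTranspose, hZ]
      simp [mul_assoc]
      abel
    have h1 := hf _ ⟨(0, Pi.single s W), ⟨fun s => by simp, fun s => by simp [refl], fun s' => by
      by_cases h : s' = s
      · subst h; simp [hWs]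
      · simp [h]⟩, rfl⟩
    have h2 : ∀ s', lagVarMod S (0, Pi.single s W) s'
        = if s' = s then -(W - lagMat S s * W * (lagMat S s)ᴴ) else 0 := by
      intro s'
      rw [lagVarMod_apply, map_zero]
      by_cases h : s' = s
      · subst h; simp
      · simp [h]
    rw [hfZ _ (fun s' => by
      rw [h2]
      split_ifs
      · rw [Matrix.conjTranspose_neg, Matrix.conjTranspose_sub, hconj s W hWs, hWs]
        abel
      · simp)] at h1
    simp only [h2, mul_ite, mul_zero, apply_ite Matrix.trace, Matrix.trace_zero] at h1
    simp only [apply_ite Complex.re, Complex.zero_re, Finset.sum_ite_eq', Finset.mem_univ,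
      if_true] at h1
    have h3 : (Z s * -(W - lagMat S s * W * (lagMat S s)ᴴ)).trace = -(W * W).trace := by
      rw [mul_neg, Matrix.trace_neg, mul_sub, Matrix.trace_sub]
      congr 1
      have h4 : (Z s * (lagMat S s * W * (lagMat S s)ᴴ)).trace
          = ((lagMat S s)ᴴ * Z s * lagMat S s * W).trace := by
        rw [← mul_assoc, Matrix.trace_mul_comm]
        simp only [mul_assoc]
      rw [h4, ← Matrix.trace_sub, ← sub_mul, ← hW]
    rw [h3, Complex.neg_re, neg_eq_zero] at h1
    have h4 := eq_zero_of_trace_mul_self hWs h1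
    rw [hW, sub_eq_zero] at h4
    conv_rhs => rw [h4]
    rw [← mul_assoc, ← mul_assoc, hAs', one_mul]
  -- On the centralizer of `A_s` the reflections at `L_s` and `L_{s+1}` coincide, which allows
  -- comparison of neighbouring indices.
  have hN : ∀ s, symVar (S (finRotate ℓ s)) (Z s) = symVar (S s) (Z s) := fun s => by
    rw [symVar, symVar, refl_next_of_commute hS s (hcomm s)]
  have hstep : ∀ s, symVar (S (finRotate ℓ s)) (Z (finRotate ℓ s)) = symVar (S s) (Z s) := by
    intro s
    obtain ⟨t, ht⟩ : ∃ t, t = finRotate ℓ s := ⟨_, rfl⟩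
    -- This `W` is tangent to the Grassmannian at `L_t`. Moving `L_t` by it affects only `A_t` and
    -- `A_s`, and the pairing reduces to `Re tr((Z_t - Z_s) W) = ½ Re tr W²`.
    obtain ⟨W, hW⟩ : ∃ W, W = symVar (S t) (Z t - Z s) := ⟨_, rfl⟩
    have hWs : Wᴴ = -W := hW ▸ symVar_conjTranspose (by
      rw [Matrix.conjTranspose_sub, hZ, hZ]; abel)
    have hWr : refl (S t) W = W := hW ▸ refl_symVar (hS t) _
    have h1 := hf _ ⟨(Pi.single t W, 0), ⟨fun s' => by
      by_cases h : s' = t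
      · subst h; simp [hWs]
      · simp [h], fun s' => by
      by_cases h : s' = t
      · subst h; simp [hWr]
      · simp [h, refl], fun s' => by simp⟩, rfl⟩
    have h2 : ∀ s', lagVarMod S (Pi.single t W, 0) s' = (if s' = t then W else 0)
        - (if s' = s then lagMat S s * W * (lagMat S s)ᴴ else 0) := by
      intro s'
      rw [lagVarMod_apply, lagVar_apply]
      have h3 : (Pi.single t W : Fin ℓ → Matrix (Fin n) (Fin n) ℂ) (finRotate ℓ s')
          = if s' = s then W else 0 := by
        rw [Pi.single_apply, ht]
        simp only [EmbeddingLike.apply_eq_iff_eq]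
      rw [h3, Pi.single_apply]
      by_cases h : s' = s
      · subst h; simp
      · simp [h]
    rw [hfZ _ (fun s' => by
      rw [h2]
      split_ifs <;> simp only [Matrix.conjTranspose_sub, Matrix.conjTranspose_zero,
        hconj s W hWs, hWs] <;> abel)] at h1
    simp only [h2, mul_sub, mul_ite, mul_zero, Matrix.trace_sub, apply_ite Matrix.trace,
      Matrix.trace_zero, Complex.sub_re] at h1
    simp only [apply_ite Complex.re, Complex.zero_re, Finset.sum_sub_distrib, Finset.sum_ite_eq',
      Finset.mem_univ, if_true] at h1
    have h4 : (Z s * (lagMat S s * W * (lagMat S s)ᴴ)).trace = (Z s * W).trace := by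
      calc _ = (lagMat S s * (Z s * W) * (lagMat S s)ᴴ).trace := by
            rw [← mul_assoc, ← mul_assoc, hcomm]; simp only [mul_assoc]
        _ = _ := by rw [Matrix.trace_mul_comm, ← mul_assoc, hAs, one_mul]
    rw [h4, ← Complex.sub_re, ← Matrix.trace_sub, ← sub_mul] at h1
    have h5 : (W * W).trace.re = 0 := by
      conv_lhs => enter [1, 1, 1]; rw [hW]
      rw [symVar, add_mul, Matrix.trace_add, trace_refl_mul (hS t), hWr, Complex.add_re, h1,
        add_zero]
    have h6 := eq_zero_of_trace_mul_self hWs h5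
    rw [hW, symVar, refl_sub, sub_add_sub_comm, sub_eq_zero] at h6
    rw [← ht]
    calc symVar (S t) (Z t) = Z s + refl (S t) (Z s) := h6
      _ = symVar (S s) (Z s) := by rw [ht]; exact hN s
  have hpow : ∀ (k : ℕ) s, symVar (S ((finRotate ℓ ^ k) s)) (Z ((finRotate ℓ ^ k) s))
      = symVar (S s) (Z s) := by
    intro k s
    induction k with
    | zero => simp
    | succ k ih => rw [pow_succ', Equiv.Perm.mul_apply, hstep, ih]
  have hconst : ∀ s t, symVar (S t) (Z t) = symVar (S s) (Z s) := by
    intro s t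
    by_cases h : t = s
    · rw [h]
    · obtain ⟨r, -, -, hr⟩ := exists_finRotate_pow h
      rw [← hr, hpow]
  rcases isEmpty_or_nonempty (Fin ℓ) with he | ⟨⟨s₀⟩⟩
  · have : D = 0 := Subsingleton.elim _ _
    rw [this, map_zero]
  · obtain ⟨c, hc⟩ := scalar_of_refl_eq hS hA (Z := symVar (S s₀) (Z s₀)) fun s => by
      rw [hconst s s₀, refl_symVar (hS s)]
    have h1 : ∀ s, (Z s * D s).trace.re = 1 / 2 * (c * (D s).trace).re := by
      intro s
      have h2 : (symVar (S s) (Z s) * D s).trace = (Z s * D s).trace + (Z s * D s).trace := by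
        rw [symVar, add_mul, Matrix.trace_add, trace_refl_mul (hS s), hD']
      rw [hconst s₀ s, hc, Matrix.smul_mul, one_mul, Matrix.trace_smul, smul_eq_mul] at h2
      rw [h2, Complex.add_re]
      ring
    rw [hfZ D hD]
    simp only [h1]
    rw [← Finset.mul_sum, ← Complex.re_sum, ← Finset.mul_sum, htr]
    simp

/-! ### Frames adapted to a family of Lagrangian subspaces -/

/-- Block structure is visible in the diagonal matrix of eigenvalues. -/
theorem exp_eq_exp_iff {x y : ℝ} (hx : 0 ≤ x) (hx1 : x < 1) (hy : 0 ≤ y) (hy1 : y < 1) :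
    Complex.exp (2 * Real.pi * Complex.I * (x : ℂ)) = Complex.exp (2 * Real.pi * Complex.I * (y : ℂ))
      ↔ x = y := by
  constructor
  · intro h
    rw [← fract_arg_exp hx hx1, h, fract_arg_exp hy hy1]
  · rintro rfl; rfl

/-- A family of unitary frames of the Lagrangian subspaces `L_s`, in which `A_s` is diagonal. -/
structure IsAdapted {ℓ n : ℕ} (U : Fin ℓ → Un n) (α : Fin ℓ → Fin n → ℝ) : Prop where
  nonneg : ∀ s j, 0 ≤ α s j
  lt_one : ∀ s j, α s j < 1
  mono : ∀ s, Monotone (α s)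
  next : ∀ s, (stdLagr n).act (U (finRotate ℓ s)) = (stdLagr n).act (U s * DeltaU (-α s))

theorem exists_adapted {ℓ n : ℕ} (L : Fin ℓ → Lagr n) :
    ∃ (U : Fin ℓ → Un n) (α : Fin ℓ → Fin n → ℝ), IsAdapted U α ∧
      L = fun s => (stdLagr n).act (U s) := by
  choose U α h0 h1 hm hU hU' using fun s => exists_frame_pair (L s) (L (finRotate ℓ s))
  exact ⟨U, α, ⟨h0, h1, hm, fun s => by rw [← hU, hU']⟩, funext hU⟩

theorem IsAdapted.lagMat_eq {ℓ n : ℕ} {U : Fin ℓ → Un n} {α : Fin ℓ → Fin n → ℝ}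
    (h : IsAdapted U α) (s : Fin ℓ) :
    lagMat (frameSym U) s = (U s : Matrix (Fin n) (Fin n) ℂ) * Delta (2 • α s) *
      (U s : Matrix (Fin n) (Fin n) ℂ)ᴴ := by
  rw [← genMat_lagRep_frame, genMat_lagRep, h.next, tau_frame_pair]

theorem IsAdapted.spec_eq {ℓ n : ℕ} {U : Fin ℓ → Un n} {α : Fin ℓ → Fin n → ℝ}
    (h : IsAdapted U α) : specHom (lagRep fun s => (stdLagr n).act (U s)) = α := by
  funext s
  rw [specHom, genMat_lagRep_frame, h.lagMat_eq,
    spec_conj_Delta (Un.star_mul_self _) (h.nonneg s) (h.lt_one s) (h.mono s)]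

/-- The wanted `D_s` is diagonal in the adapted frame, hence symmetric there, hence fixed by the
reflection at `L_s`; constancy of the index makes the total trace zero. Constancy of `v` on the
blocks of equal `α` makes `D_s` scalar on each eigenspace. -/
theorem exists_eigenVel {ℓ n : ℕ} (hn : 1 ≤ n) {U : Fin ℓ → Un n} {α : Fin ℓ → Fin n → ℝ}
    (h : IsAdapted U α)
    (hA : Submodule.span ℂ (Set.range (wordProd (lagMat (frameSym U)))) = ⊤)
    {v : Fin ℓ → Fin n → ℝ} (hv : ∀ s i j, α s i = α s j → v s i = v s j)
    (hv' : ∑ s, ∑ j, v s j = 0) :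
    ∃ X ∈ twistBendSpan (fun s => (stdLagr n).act (U s)), ∃ D : Fin ℓ → Matrix (Fin n) (Fin n) ℂ,
      ∀ s, IsEigenVel (lagRep (fun s => (stdLagr n).act (U s)) (gen s)) (α s) (v s) (D s) ∧
        IsConjTangent (lagRep (fun s => (stdLagr n).act (U s)) (gen s)) (X s - D s) := by
  have hgen : ∀ s, ((lagRep (fun s => (stdLagr n).act (U s)) (gen s) : Un n) :
      Matrix (Fin n) (Fin n) ℂ) = lagMat (frameSym U) s := genMat_lagRep_frame U
  let E : Fin ℓ → Matrix (Fin n) (Fin n) ℂ := fun s =>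
    Matrix.diagonal fun j => 2 * Real.pi * Complex.I * (v s j : ℂ)
  let D : Fin ℓ → Matrix (Fin n) (Fin n) ℂ := fun s =>
    (U s : Matrix (Fin n) (Fin n) ℂ) * E s * (U s : Matrix (Fin n) (Fin n) ℂ)ᴴ
  have hE : ∀ s, (E s)ᴴ = -E s := by
    intro s
    simp only [E]
    rw [Matrix.diagonal_conjTranspose, Matrix.diagonal_neg]
    congr 1
    funext j
    simp
  have hD : ∀ s, (D s)ᴴ = -D s := by
    intro s
    simp only [D, Matrix.conjTranspose_mul, Matrix.conjTranspose_conjTranspose, hE]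
    simp [mul_assoc]
  have hD' : ∀ s, refl (frameSym U s) (D s) = D s := by
    intro s
    have h1 : (U s : Matrix (Fin n) (Fin n) ℂ)ᵀ * (U s : Matrix (Fin n) (Fin n) ℂ)ᴴᵀ = 1 := by
      rw [← Matrix.transpose_mul, Un.star_mul_self, Matrix.transpose_one]
    have h2 : (U s : Matrix (Fin n) (Fin n) ℂ)ᵀ * (U s : Matrix (Fin n) (Fin n) ℂ)ᵀᴴ = 1 := h1
    simp only [D, refl, frameSym, Matrix.transpose_mul, Matrix.conjTranspose_mul]
    have h3 : (E s)ᵀ = E s := Matrix.diagonal_transpose _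
    rw [h3]
    calc _ = (U s : Matrix (Fin n) (Fin n) ℂ) * ((U s : Matrix (Fin n) (Fin n) ℂ)ᵀ *
          (U s : Matrix (Fin n) (Fin n) ℂ)ᴴᵀ) * E s * ((U s : Matrix (Fin n) (Fin n) ℂ)ᵀ *
          (U s : Matrix (Fin n) (Fin n) ℂ)ᵀᴴ) * (U s : Matrix (Fin n) (Fin n) ℂ)ᴴ := by
            simp only [mul_assoc]
      _ = _ := by rw [h1, h2, mul_one, mul_one]
  have htr : ∑ s, (D s).trace = 0 := by
    have h1 : ∀ s, (D s).trace = 2 * Real.pi * Complex.I * ((∑ j, v s j : ℝ) : ℂ) := by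
      intro s
      rw [Matrix.trace_mul_comm, ← mul_assoc, Un.star_mul_self, one_mul, Matrix.trace_diagonal,
        Complex.ofReal_sum, Finset.mul_sum]
    simp only [h1]
    rw [← Finset.mul_sum, ← Complex.ofReal_sum, hv']
    simp
  obtain ⟨M, Y, hM, hM', hY, hMY⟩ :=
    exists_lagVar_eq_mod (isSymUnitary_frameSym U) hA hD hD' htr
  refine ⟨_, lagVar_mem_twistBendSpan hn U hA hM hM', D, fun s => ⟨fun j w hw => ?_, Y s, hY s, ?_⟩⟩
  · rw [hgen, h.lagMat_eq, Delta_two] at hw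
    obtain ⟨y, hy⟩ : ∃ y, y = (U s : Matrix (Fin n) (Fin n) ℂ)ᴴ *ᵥ w := ⟨_, rfl⟩
    have h1 := congrArg (fun u => (U s : Matrix (Fin n) (Fin n) ℂ)ᴴ *ᵥ u) hw
    simp only [Matrix.mulVec_mulVec, Matrix.mulVec_smul, ← mul_assoc, Un.star_mul_self,
      one_mul] at h1
    rw [← Matrix.mulVec_mulVec, ← hy] at h1
    have h2 : E s *ᵥ y = (2 * Real.pi * Complex.I * (v s j : ℂ)) • y := by
      funext i
      have h3 := congrFun h1 i
      rw [Matrix.mulVec_diagonal, Pi.smul_apply, smul_eq_mul] at h3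
      simp only [E]
      rw [Matrix.mulVec_diagonal, Pi.smul_apply, smul_eq_mul]
      by_cases hyi : y i = 0
      · simp [hyi]
      · have h4 := (exp_eq_exp_iff (h.nonneg s i) (h.lt_one s i) (h.nonneg s j) (h.lt_one s j)).1
          (mul_right_cancel₀ hyi h3)
        rw [hv s i j h4]
    have h3 : w = (U s : Matrix (Fin n) (Fin n) ℂ) *ᵥ y := by
      rw [hy, Matrix.mulVec_mulVec, Un.mul_star_self, Matrix.one_mulVec]
    simp only [D]
    rw [← Matrix.mulVec_mulVec, ← hy, ← Matrix.mulVec_mulVec, h2, Matrix.mulVec_smul, ← h3]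
  · rw [hMY, Un.coe_inv, hgen]

/-! ### The linearized closing condition -/

/-- The variation of the position of `L_{s+1}` relative to `L_s`. -/
def symDiff {ℓ n : ℕ} (S : Fin ℓ → Matrix (Fin n) (Fin n) ℂ) :
    (Fin ℓ → Matrix (Fin n) (Fin n) ℂ) →ₗ[ℝ] (Fin ℓ → Matrix (Fin n) (Fin n) ℂ) where
  toFun p s := symVar (S (finRotate ℓ s)) (p (finRotate ℓ s) - p s)
  map_add' p q := by
    funext s
    simp only [Pi.add_apply, symVar, add_sub_add_comm, refl_add]
    abel
  map_smul' c p := by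
    funext s
    simp only [Pi.smul_apply, RingHom.id_apply, ← smul_sub, symVar_smul]

theorem symDiff_apply {ℓ n : ℕ} (S p : Fin ℓ → Matrix (Fin n) (Fin n) ℂ) (s : Fin ℓ) :
    symDiff S p s = symVar (S (finRotate ℓ s)) (p (finRotate ℓ s) - p s) := rfl

theorem symVar_sub {n : ℕ} (S X Y : Matrix (Fin n) (Fin n) ℂ) :
    symVar S (X - Y) = symVar S X - symVar S Y := by
  simp only [symVar, refl_sub]; abel

theorem symVar_add {n : ℕ} (S X Y : Matrix (Fin n) (Fin n) ℂ) :
    symVar S (X + Y) = symVar S X + symVar S Y := by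
  simp only [symVar, refl_add]; abel

theorem trace_mul_symVar {n : ℕ} {S : Matrix (Fin n) (Fin n) ℂ} (h : IsSymUnitary S)
    (X Y : Matrix (Fin n) (Fin n) ℂ) : (X * symVar S Y).trace = (symVar S X * Y).trace := by
  rw [symVar, symVar, mul_add, add_mul, Matrix.trace_add, Matrix.trace_add, trace_refl_mul h]

theorem eq_of_forall_finRotate {ℓ : ℕ} {β : Type*} {f : Fin ℓ → β}
    (h : ∀ s, f (finRotate ℓ s) = f s) (s t : Fin ℓ) : f t = f s := by
  have hpow : ∀ (k : ℕ) s, f ((finRotate ℓ ^ k) s) = f s := by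
    intro k s
    induction k with
    | zero => simp
    | succ k ih => rw [pow_succ', Equiv.Perm.mul_apply, h, ih]
  by_cases hst : t = s
  · rw [hst]
  · obtain ⟨r, -, -, hr⟩ := exists_finRotate_pow hst
    rw [← hr, hpow]

/-- The total trace is the only obstruction. With `B_s` the symmetrization of the dual vector `Z_s`
at `L_{s+1}`, the functional pairs `B_s` with `p_{s+1} - p_s`; its vanishing for all `p` makes `B`
constant, hence fixed by every reflection and scalar. -/
theorem exists_symDiff_eq {ℓ n : ℕ} {S : Fin ℓ → Matrix (Fin n) (Fin n) ℂ}
    (hS : ∀ s, IsSymUnitary (S s))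
    (hA : Submodule.span ℂ (Set.range (wordProd (lagMat S))) = ⊤)
    {D : Fin ℓ → Matrix (Fin n) (Fin n) ℂ} (hD : ∀ s, (D s)ᴴ = -D s)
    (hD' : ∀ s, refl (S (finRotate ℓ s)) (D s) = D s) (htr : ∑ s, (D s).trace = 0) :
    ∃ p : Fin ℓ → Matrix (Fin n) (Fin n) ℂ, (∀ s, (p s)ᴴ = -p s) ∧ symDiff S p = D := by
  let W : Submodule ℝ (Fin ℓ → Matrix (Fin n) (Fin n) ℂ) :=
    { carrier := {p | ∀ s, (p s)ᴴ = -p s}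
      add_mem' := fun {p q} hp hq s => by simp [hp s, hq s, add_comm]
      zero_mem' := fun s => by simp
      smul_mem' := fun c p hp s => by simp [hp s] }
  suffices h : D ∈ W.map (symDiff S) by
    obtain ⟨p, hp, h⟩ := h
    exact ⟨p, hp, h⟩
  refine mem_of_forall_functional _ D fun f hf => ?_
  obtain ⟨Z, hZ, hfZ⟩ := functional_eq_sum f
  obtain ⟨B, hB⟩ : ∃ B : Fin ℓ → Matrix (Fin n) (Fin n) ℂ,
    ∀ s, B s = symVar (S (finRotate ℓ s)) (Z s) := ⟨_, fun _ => rfl⟩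
  have hBs : ∀ s, (B s)ᴴ = -B s := fun s => by rw [hB]; exact symVar_conjTranspose (hZ s)
  have hBr : ∀ s, refl (S (finRotate ℓ s)) (B s) = B s := fun s => by
    rw [hB]; exact refl_symVar (hS _) _
  have hfB : ∀ p ∈ W, f (symDiff S p) = ∑ s, (B s * (p (finRotate ℓ s) - p s)).trace.re := by
    intro p hp
    have hp' : ∀ s, (p s)ᴴ = -p s := hp
    rw [hfZ (symDiff S p) fun s => symVar_conjTranspose
      (by rw [Matrix.conjTranspose_sub, hp', hp']; abel)]
    refine Finset.sum_congr rfl fun s _ => ?_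
    rw [symDiff_apply, trace_mul_symVar (hS _), hB]
  have hstep : ∀ r, B (finRotate ℓ r) = B r := by
    intro r
    obtain ⟨t, ht⟩ : ∃ t, t = finRotate ℓ r := ⟨_, rfl⟩
    -- Varying `p` at the single index `t = r + 1` tests `B_r - B_t`, which is then tested on
    -- itself.
    obtain ⟨Y, hY⟩ : ∃ Y, Y = B r - B t := ⟨_, rfl⟩
    have hYs : Yᴴ = -Y := by rw [hY, Matrix.conjTranspose_sub, hBs, hBs]; abel
    have hp : Pi.single t Y ∈ W := fun s => by
      by_cases h : s = t
      · subst h; simp [hYs]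
      · simp [h]
    have h1 := hf _ ⟨_, hp, rfl⟩
    have h2 : ∀ s, (Pi.single t Y : Fin ℓ → Matrix (Fin n) (Fin n) ℂ) (finRotate ℓ s)
        = if s = r then Y else 0 := by
      intro s
      rw [Pi.single_apply, ht]
      simp only [EmbeddingLike.apply_eq_iff_eq]
    rw [hfB _ hp] at h1
    simp only [h2, Pi.single_apply, mul_sub, mul_ite, mul_zero, Matrix.trace_sub,
      apply_ite Matrix.trace, Matrix.trace_zero, Complex.sub_re] at h1
    simp only [apply_ite Complex.re, Complex.zero_re, Finset.sum_sub_distrib, Finset.sum_ite_eq',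
      Finset.mem_univ, if_true] at h1
    have h3 : (Y * Y).trace.re = 0 := by
      conv_lhs => enter [1, 1, 1]; rw [hY]
      rw [sub_mul, Matrix.trace_sub, Complex.sub_re, h1]
    have h4 := eq_zero_of_trace_mul_self hYs h3
    rw [hY, sub_eq_zero, ht] at h4
    exact h4.symm
  have hconst := eq_of_forall_finRotate hstep
  rcases isEmpty_or_nonempty (Fin ℓ) with he | ⟨⟨s₀⟩⟩
  · have : D = 0 := Subsingleton.elim _ _
    rw [this, map_zero]
  · obtain ⟨c, hc⟩ := scalar_of_refl_eq hS hA (Z := B s₀) fun s => by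
      have := hBr ((finRotate ℓ).symm s)
      rwa [Equiv.apply_symm_apply, hconst s₀] at this
    have h1 : ∀ s, (Z s * D s).trace.re = 1 / 2 * (c * (D s).trace).re := by
      intro s
      have h2 : (B s * D s).trace = (Z s * D s).trace + (Z s * D s).trace := by
        rw [hB, symVar, add_mul, Matrix.trace_add, trace_refl_mul (hS _), hD']
      rw [hconst s₀ s, hc, Matrix.smul_mul, one_mul, Matrix.trace_smul, smul_eq_mul] at h2
      rw [h2, Complex.add_re]
      ring
    rw [hfZ D hD]
    simp only [h1]
    rw [← Finset.mul_sum, ← Complex.re_sum, ← Finset.mul_sum, htr]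
    simp

theorem commute_conjTranspose {n : ℕ} {A X : Matrix (Fin n) (Fin n) ℂ} (hA : Aᴴ * A = 1)
    (h : X * A = A * X) : Xᴴ * A = A * Xᴴ := by
  have hA' := mul_eq_one_comm.1 hA
  have h1 := congrArg Matrix.conjTranspose h
  rw [Matrix.conjTranspose_mul, Matrix.conjTranspose_mul] at h1
  calc Xᴴ * A = A * (Aᴴ * Xᴴ) * A := by rw [← mul_assoc, hA', one_mul]
    _ = A * Xᴴ * (Aᴴ * A) := by rw [h1]; simp only [mul_assoc]
    _ = _ := by rw [hA, mul_one]

/-- Infinitesimal rigidity: variations of the frames and of the spectra which satisfy the linearized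
closing condition and do not change the traces of words come from gauge transformations. -/
theorem eq_gauge_of_trace_wordVar {ℓ n : ℕ} (hℓ : 1 ≤ ℓ) (hn : 1 ≤ n)
    {S : Fin ℓ → Matrix (Fin n) (Fin n) ℂ} (hS : ∀ s, IsSymUnitary (S s))
    (hA : Submodule.span ℂ (Set.range (wordProd (lagMat S))) = ⊤)
    {p T : Fin ℓ → Matrix (Fin n) (Fin n) ℂ} (hp : ∀ s, (p s)ᴴ = -p s)
    (hT : ∀ s, (T s)ᴴ = -T s) (hTA : ∀ s, T s * lagMat S s = lagMat S s * T s)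
    {c : ℂ} (hc : ∀ s, symVar (S (finRotate ℓ s)) (p (finRotate ℓ s) - p s + T s) = c • 1)
    (hw : ∀ w, (wordVar (lagMat S)
      (fun s => p s * lagMat S s - lagMat S s * p s + (2 : ℂ) • T s * lagMat S s) w).trace = 0) :
    T = 0 ∧ ∃ Y : Matrix (Fin n) (Fin n) ℂ, Yᴴ = -Y ∧ ∀ s,
      refl (S s) (p s - Y) = -(p s - Y) ∧ (p s - Y) * lagMat S s = lagMat S s * (p s - Y) := by
  obtain ⟨Y₀, hY₀⟩ := exists_commutator_of_trace_wordVar hn hA hw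
  have hAs := fun s => lagMat_star_mul hS s
  have hAs' := fun s => mul_eq_one_comm.1 (hAs s)
  -- Here `2 T_s A_s` is the commutator of `Y₀ - p_s` with `A_s`. Multiplication by `T_s`, which
  -- commutes with `A_s`, and by `A_sᴴ` gives `2 tr T_s² = 0`.
  have hT0 : T = 0 := by
    funext s
    refine eq_zero_of_trace_mul_self (hT s) ?_
    have h1 : (2 : ℂ) • (T s * T s) * lagMat S s
        = T s * ((Y₀ - p s) * lagMat S s) - T s * (lagMat S s * (Y₀ - p s)) := by
      have := hY₀ s
      have h2 : (2 : ℂ) • T s * lagMat S s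
          = (Y₀ - p s) * lagMat S s - lagMat S s * (Y₀ - p s) := by
        rw [sub_mul, mul_sub]
        calc _ = (p s * lagMat S s - lagMat S s * p s + (2 : ℂ) • T s * lagMat S s)
              - (p s * lagMat S s - lagMat S s * p s) := by abel
          _ = _ := by rw [this]; abel
      rw [← mul_sub, ← h2]
      simp only [Matrix.smul_mul, Matrix.mul_smul, mul_assoc]
    have h3 : (2 : ℂ) • (T s * T s) = T s * (Y₀ - p s)
        - lagMat S s * (T s * (Y₀ - p s)) * (lagMat S s)ᴴ := by
      calc (2 : ℂ) • (T s * T s) = (2 : ℂ) • (T s * T s) * lagMat S s * (lagMat S s)ᴴ := by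
            rw [mul_assoc, hAs', mul_one]
        _ = T s * (Y₀ - p s) * (lagMat S s * (lagMat S s)ᴴ)
            - (T s * lagMat S s) * (Y₀ - p s) * (lagMat S s)ᴴ := by
            rw [h1, sub_mul]; simp only [mul_assoc]
        _ = _ := by rw [hAs', mul_one, hTA]; simp only [mul_assoc]
    have h4 := congrArg Matrix.trace h3
    rw [Matrix.trace_sub, Matrix.trace_mul_comm (lagMat S s * _), ← mul_assoc, hAs, one_mul,
      sub_self, Matrix.trace_smul, smul_eq_mul] at h4
    have h5 : (T s * T s).trace = 0 := by simpa using h4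
    rw [h5, Complex.zero_re]
  refine ⟨hT0, ?_⟩
  subst hT0
  have hcomm₀ : ∀ s, (p s - Y₀) * lagMat S s = lagMat S s * (p s - Y₀) := by
    intro s
    have := hY₀ s
    simp only [Pi.zero_apply, smul_zero, zero_mul, add_zero] at this
    rw [sub_mul, mul_sub, sub_eq_sub_iff_sub_eq_sub, this]
  -- The Hermitian part of `Y₀` is scalar, so `Y₀` may be replaced by its skew-Hermitian part
  -- without changing commutators.
  obtain ⟨e, he⟩ := scalar_of_commute hA (Z := Y₀ + Y₀ᴴ) fun s => by
    have h1 := commute_conjTranspose (hAs s) (hcomm₀ s)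
    have h2 : Y₀ + Y₀ᴴ = -((p s - Y₀) + (p s - Y₀)ᴴ) := by
      rw [Matrix.conjTranspose_sub, hp]; abel
    rw [h2, neg_mul, mul_neg, add_mul, mul_add, h1, hcomm₀]
  have hY₁ : ((1 / 2 : ℝ) • (Y₀ - Y₀ᴴ))ᴴ = -((1 / 2 : ℝ) • (Y₀ - Y₀ᴴ)) :=
    skewPart_conjTranspose Y₀
  obtain ⟨Y₁, hY₁d⟩ : ∃ Y₁, Y₁ = (1 / 2 : ℝ) • (Y₀ - Y₀ᴴ) := ⟨_, rfl⟩
  rw [← hY₁d] at hY₁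
  have hcomm₁ : ∀ s, (p s - Y₁) * lagMat S s = lagMat S s * (p s - Y₁) := by
    intro s
    have h1 : p s - Y₁ = (p s - Y₀) + ((1 / 2 : ℝ) : ℂ) • (e • 1) := by
      rw [← he, hY₁d]
      ext i j
      simp only [Matrix.sub_apply, Matrix.smul_apply, Matrix.add_apply, Complex.real_smul,
        smul_eq_mul]
      push_cast
      ring
    rw [h1, add_mul, mul_add, hcomm₀]
    simp
  have hsum : ∀ s, symVar (S (finRotate ℓ s)) (p (finRotate ℓ s) - Y₁)
      = symVar (S s) (p s - Y₁) + c • 1 := by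
    intro s
    have h1 := hc s
    simp only [Pi.zero_apply, add_zero] at h1
    have h2 : symVar (S (finRotate ℓ s)) (p s - Y₁) = symVar (S s) (p s - Y₁) := by
      rw [symVar, symVar, refl_next_of_commute hS s (hcomm₁ s)]
    rw [← h1, ← h2, ← symVar_add]
    congr 1
    abel
  -- The traces around the cycle telescope, leaving `ℓ n c = 0`.
  have hc0 : c = 0 := by
    have h1 : ∑ s, (symVar (S (finRotate ℓ s)) (p (finRotate ℓ s) - Y₁)).trace
        = ∑ s, (symVar (S s) (p s - Y₁)).trace :=
      Equiv.sum_comp (finRotate ℓ) fun s => (symVar (S s) (p s - Y₁)).trace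
    simp only [hsum, Matrix.trace_add, Finset.sum_add_distrib] at h1
    have h2 := left_eq_add.1 h1.symm
    rw [Finset.sum_const, Matrix.trace_smul, Matrix.trace_one] at h2
    simp only [Finset.card_univ, Fintype.card_fin, smul_eq_mul, nsmul_eq_mul, mul_eq_zero,
      Nat.cast_eq_zero] at h2
    exact (h2.resolve_left (by omega)).resolve_right (by omega)
  have hconst := eq_of_forall_finRotate (f := fun s => symVar (S s) (p s - Y₁)) fun s => by
    rw [hsum, hc0, zero_smul, add_zero]
  let s₀ : Fin ℓ := ⟨0, hℓ⟩
  obtain ⟨f, hf⟩ := scalar_of_refl_eq hS hA (Z := symVar (S s₀) (p s₀ - Y₁)) fun s => by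
    have h1 := hconst s₀ s
    rw [← h1]
    exact refl_symVar (hS s) _
  have hfs : star f = -f := by
    have h1 : (symVar (S s₀) (p s₀ - Y₁))ᴴ = -symVar (S s₀) (p s₀ - Y₁) :=
      symVar_conjTranspose (by rw [Matrix.conjTranspose_sub, hp, hY₁]; abel)
    rw [hf, Matrix.conjTranspose_smul, Matrix.conjTranspose_one] at h1
    have h2 := congrFun (congrFun h1 ⟨0, hn⟩) ⟨0, hn⟩
    simpa using h2
  -- The symmetrization of `p_s - Y₁` is the scalar `f`, independent of `s`, and a scalar is doubled
  -- by symmetrization, so half of it is absorbed into `Y`.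
  refine ⟨Y₁ + ((1 / 2 : ℝ) * f) • 1, ?_, fun s => ⟨?_, ?_⟩⟩
  · rw [Matrix.conjTranspose_add, Matrix.conjTranspose_smul, Matrix.conjTranspose_one, hY₁,
      star_mul', hfs]
    simp [add_comm]
  · have h1 := hconst s₀ s
    rw [hf] at h1
    have h2 : refl (S s) (p s - (Y₁ + ((1 / 2 : ℝ) * f) • 1))
        = refl (S s) (p s - Y₁) - ((1 / 2 : ℝ) * f) • 1 := by
      rw [← sub_sub, refl_sub]
      congr 1
      simp [refl, (hS s).mul_star]
    have h3 : refl (S s) (p s - Y₁) = f • 1 - (p s - Y₁) := by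
      rw [← h1, symVar]; abel
    rw [h2, h3]
    ext i j
    simp only [Matrix.sub_apply, Matrix.smul_apply, Matrix.add_apply, Matrix.neg_apply,
      smul_eq_mul]
    push_cast
    ring
  · rw [← sub_sub, sub_mul, mul_sub, hcomm₁]
    simp

/-! ### Dimension counts -/

/-- Skew-Hermitian matrices. -/
def skewSub (n : ℕ) : Submodule ℝ (Matrix (Fin n) (Fin n) ℂ) where
  carrier := {X | Xᴴ = -X}
  add_mem' {X Y} hX hY := by
    rw [Set.mem_ofPred_eq] at *
    rw [Matrix.conjTranspose_add, hX, hY, neg_add]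
  zero_mem' := by simp
  smul_mem' c X hX := by
    rw [Set.mem_ofPred_eq] at *
    rw [Matrix.conjTranspose_smul, hX, star_trivial, smul_neg]

theorem mem_skewSub {n : ℕ} {X : Matrix (Fin n) (Fin n) ℂ} : X ∈ skewSub n ↔ Xᴴ = -X := Iff.rfl

/-- Real skew-symmetric matrices with entries only where `a i = a j`. -/
def stdGauge {n : ℕ} (a : Fin n → ℝ) : Submodule ℝ (Matrix (Fin n) (Fin n) ℂ) where
  carrier := {X | Xᴴ = -X ∧ Xᵀ = -X ∧ ∀ i j, a i ≠ a j → X i j = 0}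
  add_mem' {X Y} hX hY := ⟨(skewSub n).add_mem hX.1 hY.1,
    by rw [Matrix.transpose_add, hX.2.1, hY.2.1, neg_add],
    fun i j h => by rw [Matrix.add_apply, hX.2.2 i j h, hY.2.2 i j h, add_zero]⟩
  zero_mem' := ⟨by simp, by simp, by simp⟩
  smul_mem' c X hX := ⟨(skewSub n).smul_mem c hX.1,
    by rw [Matrix.transpose_smul, hX.2.1, smul_neg],
    fun i j h => by rw [Matrix.smul_apply, hX.2.2 i j h, smul_zero]⟩

/-- Imaginary symmetric matrices. -/
def stdSym (n : ℕ) : Submodule ℝ (Matrix (Fin n) (Fin n) ℂ) where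
  carrier := {X | Xᴴ = -X ∧ Xᵀ = X}
  add_mem' {X Y} hX hY := ⟨(skewSub n).add_mem hX.1 hY.1,
    by rw [Matrix.transpose_add, hX.2, hY.2]⟩
  zero_mem' := ⟨by simp, by simp⟩
  smul_mem' c X hX := ⟨(skewSub n).smul_mem c hX.1,
    by rw [Matrix.transpose_smul, hX.2]⟩

theorem skew_re {n : ℕ} {X : Matrix (Fin n) (Fin n) ℂ} (hX : Xᴴ = -X) (i j : Fin n) :
    (X j i).re = -(X i j).re ∧ (X j i).im = (X i j).im := by
  have h := congrFun (congrFun hX i) j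
  rw [Matrix.conjTranspose_apply, Matrix.neg_apply] at h
  have h1 := congrArg Complex.re h
  have h2 := congrArg Complex.im h
  simp only [Complex.star_def, Complex.conj_re, Complex.neg_re, Complex.conj_im,
    Complex.neg_im, neg_inj] at h1 h2
  exact ⟨h1, h2⟩

/-- The real part of a skew-Hermitian matrix is antisymmetric and the imaginary part symmetric, so
their sum is an arbitrary real matrix from which both can be recovered. -/
theorem finrank_skewSub (n : ℕ) : Module.finrank ℝ (skewSub n) = n ^ 2 := by
  let f : skewSub n →ₗ[ℝ] (Fin n × Fin n → ℝ) :=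
    { toFun := fun X p => (X.1 p.1 p.2).re + (X.1 p.1 p.2).im
      map_add' := fun X Y => by
        funext p
        simp only [Submodule.coe_add, Matrix.add_apply, Complex.add_re, Complex.add_im,
          Pi.add_apply]
        ring
      map_smul' := fun c X => by
        funext p
        simp [mul_add] }
  have hf : ∀ X p, f X p = (X.1 p.1 p.2).re + (X.1 p.1 p.2).im := fun _ _ => rfl
  have hinj : Function.Injective f := by
    rw [injective_iff_map_eq_zero]
    intro X hX
    have h1 : ∀ i j, (X.1 i j).re + (X.1 i j).im = 0 := fun i j => by
      rw [← hf X (i, j), hX]; rfl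
    ext i j
    have h2 := h1 i j
    have h3 := h1 j i
    have h4 := skew_re X.2 i j
    rw [h4.1, h4.2] at h3
    refine Complex.ext ?_ ?_
    · change (X.1 i j).re = 0
      linarith
    · change (X.1 i j).im = 0
      linarith
  have hsurj : Function.Surjective f := by
    intro N
    refine ⟨⟨Matrix.of fun i j => ⟨(N (i, j) - N (j, i)) / 2, (N (i, j) + N (j, i)) / 2⟩, ?_⟩, ?_⟩
    · ext i j
      simp only [Matrix.conjTranspose_apply, Matrix.of_apply, Matrix.neg_apply]
      refine Complex.ext ?_ ?_ <;> simp <;> ring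
    · funext p
      rw [hf]
      simp only [Matrix.of_apply]
      ring
  rw [(LinearEquiv.ofBijective f ⟨hinj, hsurj⟩).finrank_eq, Module.finrank_fintype_fun_eq_card,
    Fintype.card_prod, Fintype.card_fin, sq]

open Classical in
theorem finrank_stdGauge_eq_card {n : ℕ} (a : Fin n → ℝ) : Module.finrank ℝ (stdGauge a)
    = Fintype.card {p : Fin n × Fin n // p.1 < p.2 ∧ a p.1 = a p.2} := by
  let f : stdGauge a →ₗ[ℝ] ({p : Fin n × Fin n // p.1 < p.2 ∧ a p.1 = a p.2} → ℝ) :=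
    { toFun := fun X p => (X.1 p.1.1 p.1.2).re
      map_add' := fun X Y => rfl
      map_smul' := fun c X => by
        funext p
        simp }
  have hf : ∀ X p, f X p = (X.1 p.1.1 p.1.2).re := fun _ _ => rfl
  have hinj : Function.Injective f := by
    rw [injective_iff_map_eq_zero]
    intro X hX
    have him : ∀ i j, (X.1 i j).im = 0 := fun i j => by
      have h1 := (skew_re X.2.1 i j).2
      have h2 := congrArg Complex.im (congrFun (congrFun X.2.2.1 i) j)
      rw [Matrix.transpose_apply, Matrix.neg_apply, Complex.neg_im] at h2
      linarith
    have hlt : ∀ i j, i < j → (X.1 i j).re = 0 := fun i j hij => by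
      by_cases h : a i = a j
      · exact congrFun hX ⟨(i, j), hij, h⟩
      · rw [X.2.2.2 i j h, Complex.zero_re]
    ext i j
    refine Complex.ext ?_ (him i j)
    change (X.1 i j).re = 0
    rcases lt_trichotomy i j with h | h | h
    · exact hlt i j h
    · have := (skew_re X.2.1 i j).1
      rw [h] at this ⊢
      linarith
    · have := (skew_re X.2.1 i j).1
      rw [hlt j i h] at this
      linarith
  have hsurj : Function.Surjective f := by
    intro N
    let M : Fin n → Fin n → ℝ := fun i j => if h : i < j ∧ a i = a j then N ⟨(i, j), h⟩
      else if h : j < i ∧ a j = a i then -N ⟨(j, i), h⟩ else 0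
    have hM : ∀ i j, M j i = -M i j := by
      intro i j
      simp only [M]
      by_cases h1 : i < j ∧ a i = a j
      · have h2 : ¬ (j < i ∧ a j = a i) := fun h => lt_asymm h.1 h1.1
        rw [dif_neg h2, dif_pos h1, dif_pos h1]
      · by_cases h2 : j < i ∧ a j = a i
        · rw [dif_pos h2, dif_neg h1, dif_pos h2, neg_neg]
        · rw [dif_neg h2, dif_neg h1, dif_neg h1, dif_neg h2, neg_zero]
    refine ⟨⟨Matrix.of fun i j => (M i j : ℂ), ?_, ?_, ?_⟩, ?_⟩
    · ext i j
      simp [hM i j]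
    · ext i j
      simp [hM i j]
    · intro i j h
      have h1 : ¬ (i < j ∧ a i = a j) := fun h' => h h'.2
      have h2 : ¬ (j < i ∧ a j = a i) := fun h' => h h'.2.symm
      simp [M, h1, h2]
    · funext p
      rw [hf]
      simp only [Matrix.of_apply, Complex.ofReal_re, M]
      rw [dif_pos p.2]
  rw [(LinearEquiv.ofBijective f ⟨hinj, hsurj⟩).finrank_eq, Module.finrank_fintype_fun_eq_card]

-- The ordered pairs of indices with equal values split into those above, below and on the diagonal,
-- the first two being equally many.
open Classical in
theorem two_mul_finrank_stdGauge {n : ℕ} (a : Fin n → ℝ) :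
    2 * Module.finrank ℝ (stdGauge a) + n
      = (Finset.univ.filter fun p : Fin n × Fin n => a p.1 = a p.2).card := by
  rw [finrank_stdGauge_eq_card, Fintype.card_subtype]
  have h1 : (Finset.univ.filter fun p : Fin n × Fin n => p.1 < p.2 ∧ a p.1 = a p.2).card
      = (Finset.univ.filter fun p : Fin n × Fin n => p.2 < p.1 ∧ a p.1 = a p.2).card := by
    refine Finset.card_bij' (fun p _ => p.swap) (fun p _ => p.swap) ?_ ?_ ?_ ?_
    · intro p hp
      simp only [Finset.mem_filter, Finset.mem_univ, true_and, Prod.fst_swap, Prod.snd_swap] at hp ⊢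
      exact ⟨hp.1, hp.2.symm⟩
    · intro p hp
      simp only [Finset.mem_filter, Finset.mem_univ, true_and, Prod.fst_swap, Prod.snd_swap] at hp ⊢
      exact ⟨hp.1, hp.2.symm⟩
    · intro p _; simp
    · intro p _; simp
  have h2 : (Finset.univ.filter fun p : Fin n × Fin n => p.1 = p.2 ∧ a p.1 = a p.2).card = n := by
    have : (Finset.univ.filter fun p : Fin n × Fin n => p.1 = p.2 ∧ a p.1 = a p.2)
        = Finset.univ.image fun i : Fin n => (i, i) := by
      ext ⟨i, j⟩
      simp only [Finset.mem_filter, Finset.mem_univ, true_and, Finset.mem_image, Prod.mk.injEq]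
      constructor
      · rintro ⟨rfl, -⟩; exact ⟨i, rfl, rfl⟩
      · rintro ⟨k, rfl, rfl⟩; exact ⟨rfl, rfl⟩
    rw [this, Finset.card_image_of_injective _ fun i j h => (Prod.mk.injEq _ _ _ _ ▸ h).1]
    simp
  have h3 : (Finset.univ.filter fun p : Fin n × Fin n => a p.1 = a p.2)
      = (Finset.univ.filter fun p : Fin n × Fin n => p.1 < p.2 ∧ a p.1 = a p.2) ∪
        ((Finset.univ.filter fun p : Fin n × Fin n => p.2 < p.1 ∧ a p.1 = a p.2) ∪
        (Finset.univ.filter fun p : Fin n × Fin n => p.1 = p.2 ∧ a p.1 = a p.2)) := by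
    ext p
    simp only [Finset.mem_filter, Finset.mem_univ, true_and, Finset.mem_union]
    have := lt_trichotomy p.1 p.2
    tauto
  have h4 : Disjoint (Finset.univ.filter fun p : Fin n × Fin n => p.2 < p.1 ∧ a p.1 = a p.2)
      (Finset.univ.filter fun p : Fin n × Fin n => p.1 = p.2 ∧ a p.1 = a p.2) := by
    rw [Finset.disjoint_filter]
    rintro p - ⟨h1, -⟩ ⟨h2, -⟩
    exact absurd h2 h1.ne'
  have h5 : Disjoint (Finset.univ.filter fun p : Fin n × Fin n => p.1 < p.2 ∧ a p.1 = a p.2)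
      ((Finset.univ.filter fun p : Fin n × Fin n => p.2 < p.1 ∧ a p.1 = a p.2) ∪
        (Finset.univ.filter fun p : Fin n × Fin n => p.1 = p.2 ∧ a p.1 = a p.2)) := by
    rw [Finset.disjoint_union_right, Finset.disjoint_filter, Finset.disjoint_filter]
    constructor
    · rintro p - ⟨h1, -⟩ ⟨h2, -⟩
      exact lt_asymm h1 h2
    · rintro p - ⟨h1, -⟩ ⟨h2, -⟩
      exact absurd h2 h1.ne
  rw [h3, Finset.card_union_of_disjoint h5, Finset.card_union_of_disjoint h4, h2, ← h1]
  ring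

open Classical in
theorem card_filter_hasMult {n : ℕ} {a : Fin n → ℝ} {c : Composition n} (h : HasMult a c) :
    (Finset.univ.filter fun p : Fin n × Fin n => a p.1 = a p.2).card
      = ∑ j, c.blocksFun j ^ 2 := by
  obtain ⟨b, hb, hab⟩ := h
  have h1 : ∀ k : Fin c.length, (Finset.univ.filter fun i : Fin n => c.index i = k).card
      = c.blocksFun k := by
    intro k
    rw [← Fintype.card_subtype]
    have : Fintype.card (Fin (c.blocksFun k)) = Fintype.card {i // c.index i = k} :=
      Fintype.card_congr
        { toFun := fun j => ⟨c.embedding k j, c.index_embedding k j⟩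
          invFun := fun i => Fin.cast (by rw [i.2]) (c.invEmbedding i.1)
          left_inv := fun j => by
            ext; simp
          right_inv := fun ⟨i, hi⟩ => by
            subst hi
            ext
            simp }
    rw [← this, Fintype.card_fin]
  have h2 : (Finset.univ.filter fun p : Fin n × Fin n => a p.1 = a p.2)
      = Finset.univ.biUnion fun k : Fin c.length =>
        (Finset.univ.filter fun i : Fin n => c.index i = k) ×ˢ
          (Finset.univ.filter fun i : Fin n => c.index i = k) := by
    ext p
    simp only [Finset.mem_filter, Finset.mem_univ, true_and, Finset.mem_biUnion,
      Finset.mem_product, hab, hb.injective.eq_iff]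
    constructor
    · intro h; exact ⟨_, rfl, h.symm⟩
    · rintro ⟨k, h1, h2⟩; rw [h1, h2]
  rw [h2, Finset.card_biUnion]
  · refine Finset.sum_congr rfl fun k _ => ?_
    rw [Finset.card_product, h1, sq]
  · intro k _ k' _ hk
    rw [Function.onFun, Finset.disjoint_left]
    rintro p hp hp'
    simp only [Finset.mem_product, Finset.mem_filter, Finset.mem_univ, true_and] at hp hp'
    exact hk (hp.1.symm.trans hp'.1)

/-- Skew-Hermitian matrices are the direct sum of the real antisymmetric and the imaginary symmetric
ones; for `a = 0` the support condition in `stdGauge` is void. -/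
theorem two_mul_finrank_stdSym (n : ℕ) : 2 * Module.finrank ℝ (stdSym n) = n ^ 2 + n := by
  have h1 : stdGauge (0 : Fin n → ℝ) ⊔ stdSym n = skewSub n := by
    refine le_antisymm (sup_le (fun X hX => hX.1) fun X hX => hX.1) fun X hX => ?_
    have hXt : Xᵀᴴ = -Xᵀ := by rw [← Matrix.transpose_neg, ← mem_skewSub.1 hX]; rfl
    refine Submodule.mem_sup.2 ⟨(1 / 2 : ℝ) • (X - Xᵀ), ?_, (1 / 2 : ℝ) • (X + Xᵀ), ?_, ?_⟩
    · refine Submodule.smul_mem _ _ ⟨?_, ?_, fun i j h => absurd rfl h⟩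
      · rw [Matrix.conjTranspose_sub, hXt, mem_skewSub.1 hX]; abel
      · rw [Matrix.transpose_sub, Matrix.transpose_transpose]; abel
    · refine Submodule.smul_mem _ _ ⟨?_, ?_⟩
      · rw [Matrix.conjTranspose_add, hXt, mem_skewSub.1 hX]; abel
      · rw [Matrix.transpose_add, Matrix.transpose_transpose, add_comm]
    · rw [← smul_add, sub_add_add_cancel, ← two_smul ℝ X, smul_smul]
      norm_num
  have h2 : stdGauge (0 : Fin n → ℝ) ⊓ stdSym n = ⊥ := by
    rw [eq_bot_iff]
    rintro X ⟨hX, hX'⟩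
    have h3 := hX'.2.symm.trans hX.2.1
    rw [Submodule.mem_bot]
    ext i j
    exact self_eq_neg.1 (congrFun (congrFun h3 i) j)
  have h3 := Submodule.finrank_sup_add_finrank_inf_eq (stdGauge (0 : Fin n → ℝ)) (stdSym n)
  rw [h1, h2, finrank_skewSub, finrank_bot] at h3
  have h4 := two_mul_finrank_stdGauge (0 : Fin n → ℝ)
  simp only [Pi.zero_apply, Finset.filter_true, Finset.card_univ, Fintype.card_prod,
    Fintype.card_fin] at h4
  nlinarith

/-- Conjugation by a unitary matrix. -/
def conjEquiv {n : ℕ} (U : Un n) :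
    Matrix (Fin n) (Fin n) ℂ ≃ₗ[ℝ] Matrix (Fin n) (Fin n) ℂ where
  toFun X := (U : Matrix (Fin n) (Fin n) ℂ) * X * (U : Matrix (Fin n) (Fin n) ℂ)ᴴ
  map_add' X Y := by rw [mul_add, add_mul]
  map_smul' c X := by simp
  invFun X := (U : Matrix (Fin n) (Fin n) ℂ)ᴴ * X * (U : Matrix (Fin n) (Fin n) ℂ)
  left_inv X := by
    calc _ = ((U : Matrix (Fin n) (Fin n) ℂ)ᴴ * (U : Matrix (Fin n) (Fin n) ℂ)) * X *
          ((U : Matrix (Fin n) (Fin n) ℂ)ᴴ * (U : Matrix (Fin n) (Fin n) ℂ)) := by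
            simp only [mul_assoc]
      _ = X := by rw [Un.star_mul_self, one_mul, mul_one]
  right_inv X := by
    calc _ = ((U : Matrix (Fin n) (Fin n) ℂ) * (U : Matrix (Fin n) (Fin n) ℂ)ᴴ) * X *
          ((U : Matrix (Fin n) (Fin n) ℂ) * (U : Matrix (Fin n) (Fin n) ℂ)ᴴ) := by
            simp only [mul_assoc]
      _ = X := by rw [Un.mul_star_self, one_mul, mul_one]

theorem conjEquiv_apply {n : ℕ} (U : Un n) (X : Matrix (Fin n) (Fin n) ℂ) :
    conjEquiv U X = (U : Matrix (Fin n) (Fin n) ℂ) * X * (U : Matrix (Fin n) (Fin n) ℂ)ᴴ := rfl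

theorem conjEquiv_mul {n : ℕ} (U : Un n) (X Y : Matrix (Fin n) (Fin n) ℂ) :
    conjEquiv U (X * Y) = conjEquiv U X * conjEquiv U Y := by
  simp only [conjEquiv_apply]
  calc _ = (U : Matrix (Fin n) (Fin n) ℂ) * X * 1 * Y * (U : Matrix (Fin n) (Fin n) ℂ)ᴴ := by
        simp only [mul_assoc, one_mul]
    _ = _ := by rw [← Un.star_mul_self U]; simp only [mul_assoc]

theorem conjEquiv_one {n : ℕ} (U : Un n) : conjEquiv U (1 : Matrix (Fin n) (Fin n) ℂ) = 1 := by
  rw [conjEquiv_apply, mul_one, Un.mul_star_self]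

theorem conjEquiv_conjTranspose {n : ℕ} (U : Un n) (X : Matrix (Fin n) (Fin n) ℂ) :
    (conjEquiv U X)ᴴ = conjEquiv U Xᴴ := by
  simp only [conjEquiv_apply, Matrix.conjTranspose_mul, Matrix.conjTranspose_conjTranspose,
    mul_assoc]

theorem conjEquiv_trace {n : ℕ} (U : Un n) (X : Matrix (Fin n) (Fin n) ℂ) :
    (conjEquiv U X).trace = X.trace := by
  rw [conjEquiv_apply, Matrix.trace_mul_comm, ← mul_assoc, Un.star_mul_self, one_mul]

/-- In the coordinates of a frame, the reflection is the plain transpose; the eigenspaces of `refl`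
are thereby reduced to symmetric and antisymmetric matrices. -/
theorem refl_conjEquiv {n : ℕ} (U : Un n) (X : Matrix (Fin n) (Fin n) ℂ) :
    refl ((U : Matrix (Fin n) (Fin n) ℂ) * (U : Matrix (Fin n) (Fin n) ℂ)ᵀ) (conjEquiv U X)
      = conjEquiv U Xᵀ := by
  have h1 : (U : Matrix (Fin n) (Fin n) ℂ)ᵀ * (U : Matrix (Fin n) (Fin n) ℂ)ᴴᵀ = 1 := by
    rw [← Matrix.transpose_mul, Un.star_mul_self, Matrix.transpose_one]
  have h2 : (U : Matrix (Fin n) (Fin n) ℂ)ᵀ * (U : Matrix (Fin n) (Fin n) ℂ)ᵀᴴ = 1 := h1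
  simp only [conjEquiv_apply, refl, Matrix.transpose_mul, Matrix.conjTranspose_mul]
  calc _ = (U : Matrix (Fin n) (Fin n) ℂ) * ((U : Matrix (Fin n) (Fin n) ℂ)ᵀ *
        (U : Matrix (Fin n) (Fin n) ℂ)ᴴᵀ) * Xᵀ * ((U : Matrix (Fin n) (Fin n) ℂ)ᵀ *
        (U : Matrix (Fin n) (Fin n) ℂ)ᵀᴴ) * (U : Matrix (Fin n) (Fin n) ℂ)ᴴ := by
          simp only [mul_assoc]
    _ = _ := by rw [h1, h2, mul_one, mul_one]

theorem conjEquiv_skew_iff {n : ℕ} (U : Un n) (X : Matrix (Fin n) (Fin n) ℂ) :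
    (conjEquiv U X)ᴴ = -conjEquiv U X ↔ Xᴴ = -X := by
  rw [conjEquiv_conjTranspose, ← map_neg, EmbeddingLike.apply_eq_iff_eq]

theorem refl_conjEquiv_eq_iff {n : ℕ} (U : Un n) (X : Matrix (Fin n) (Fin n) ℂ) :
    refl ((U : Matrix (Fin n) (Fin n) ℂ) * (U : Matrix (Fin n) (Fin n) ℂ)ᵀ) (conjEquiv U X)
      = conjEquiv U X ↔ Xᵀ = X := by
  rw [refl_conjEquiv, EmbeddingLike.apply_eq_iff_eq]

theorem refl_conjEquiv_eq_neg_iff {n : ℕ} (U : Un n) (X : Matrix (Fin n) (Fin n) ℂ) :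
    refl ((U : Matrix (Fin n) (Fin n) ℂ) * (U : Matrix (Fin n) (Fin n) ℂ)ᵀ) (conjEquiv U X)
      = -conjEquiv U X ↔ Xᵀ = -X := by
  rw [refl_conjEquiv, ← map_neg, EmbeddingLike.apply_eq_iff_eq]

theorem commute_Delta_iff {n : ℕ} {α : Fin n → ℝ} (h0 : ∀ j, 0 ≤ α j) (h1 : ∀ j, α j < 1)
    (X : Matrix (Fin n) (Fin n) ℂ) :
    X * Delta (2 • α) = Delta (2 • α) * X ↔ ∀ i j, α i ≠ α j → X i j = 0 := by
  rw [Delta_two]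
  constructor
  · intro h i j hij
    have h2 := congrFun (congrFun h i) j
    rw [Matrix.mul_diagonal, Matrix.diagonal_mul, mul_comm] at h2
    by_contra hX
    exact hij ((exp_eq_exp_iff (h0 i) (h1 i) (h0 j) (h1 j)).1 (mul_right_cancel₀ hX h2).symm)
  · intro h
    ext i j
    rw [Matrix.mul_diagonal, Matrix.diagonal_mul, mul_comm]
    by_cases hij : α i = α j
    · rw [hij]
    · rw [h i j hij, mul_zero, mul_zero]

/-- A family of submodules as a submodule of the product. -/
def piEquivSub {ℓ : ℕ} {M : Type*} [AddCommGroup M] [Module ℝ M] (W : Fin ℓ → Submodule ℝ M) :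
    Submodule.pi Set.univ W ≃ₗ[ℝ] ∀ s, W s where
  toFun X s := ⟨X.1 s, X.2 s (Set.mem_univ s)⟩
  map_add' _ _ := rfl
  map_smul' _ _ := rfl
  invFun X := ⟨fun s => X s, fun s _ => (X s).2⟩
  left_inv _ := rfl
  right_inv _ := rfl

theorem finrank_submodule_pi {ℓ : ℕ} {M : Type*} [AddCommGroup M] [Module ℝ M]
    [FiniteDimensional ℝ M] (W : Fin ℓ → Submodule ℝ M) :
    Module.finrank ℝ (Submodule.pi Set.univ W) = ∑ s, Module.finrank ℝ (W s) := by
  rw [(piEquivSub W).finrank_eq, Module.finrank_pi_fintype]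

end

end LagRep

/-! ### Consequences of the inverse function theorem and an abstract criterion for fibrations. -/

namespace LagRep

open scoped ContDiff Topology

noncomputable section

/-! ### Two consequences of the inverse function theorem -/

section InverseFunction

variable {X F E : Type*} [NormedAddCommGroup X] [NormedSpace ℝ X] [FiniteDimensional ℝ X]
  [NormedAddCommGroup F] [NormedSpace ℝ F]
  [NormedAddCommGroup E] [NormedSpace ℝ E]

/-- Class `ω` is used because regularity of class `ω` at a point holds on a whole neighbourhood,
whereas for class `∞` at a point each finite order may need its own neighbourhood. -/
theorem exists_analytic_localInverse {f : X → F} (hf : ContDiffAt ℝ ω f 0)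
    (hb : Function.Bijective (fderiv ℝ f 0)) : ∃ g : F → X, ContDiffAt ℝ ω g (f 0) ∧ g (f 0) = 0 ∧
      (∀ᶠ x in 𝓝 0, g (f x) = x) ∧ ∀ᶠ y in 𝓝 (f 0), f (g y) = y := by
  have : CompleteSpace X := FiniteDimensional.complete ℝ X
  let e : X ≃L[ℝ] F :=
    (LinearEquiv.ofBijective (fderiv ℝ f 0).toLinearMap hb).toContinuousLinearEquiv
  have he : (e : X →L[ℝ] F) = fderiv ℝ f 0 := by ext; rfl
  have hf' : HasFDerivAt f (e : X →L[ℝ] F) 0 := by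
    rw [he]
    exact (hf.differentiableAt (by simp)).hasFDerivAt
  have hn : (ω : WithTop ℕ∞) ≠ 0 := by simp
  exact ⟨hf.localInverse hf' hn, hf.to_localInverse hf' hn, hf.localInverse_apply_image hf' hn,
    (hf.hasStrictFDerivAt' hf' hn).eventually_left_inverse,
    (hf.hasStrictFDerivAt' hf' hn).eventually_right_inverse⟩

/-- If the functions `φ i ∘ r` and `h` separate tangent vectors at `0`, then finitely many of the
functions `φ i ∘ r` are coordinates on the zero set of `h`. -/
theorem exists_leftInverse_on_zeros [FiniteDimensional ℝ F] {ι : Type*} {h : X → F} {r : X → E} {φ : ι → E → ℝ}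
    (hh : ContDiffAt ℝ ω h 0) (hr : ContDiffAt ℝ ω r 0) (hφ : ∀ i, ContDiff ℝ ω (φ i))
    (h0 : h 0 = 0)
    (hker : ∀ v, fderiv ℝ h 0 v = 0 → (∀ i, fderiv ℝ (φ i ∘ r) 0 v = 0) → v = 0) :
    ∃ (k : ℕ) (w : Fin k → ι) (Φ : (Fin k → ℝ) → X),
      ContDiffAt ℝ ω Φ (fun j => φ (w j) (r 0)) ∧
      ∀ᶠ x in 𝓝 0, h x = 0 → Φ (fun j => φ (w j) (r x)) = x := by
  have hφr : ∀ i, ContDiffAt ℝ ω (φ i ∘ r) 0 := fun i => (hφ i).contDiffAt.comp 0 hr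
  let L : ι → Module.Dual ℝ X := fun i => (fderiv ℝ (φ i ∘ r) 0).toLinearMap
  -- Finitely many of the differentials span all of them, so these alone separate vectors in the
  -- kernel of `dh`.
  obtain ⟨f, hf, hspan, -⟩ := Submodule.exists_fun_fin_finrank_span_eq ℝ (Set.range L)
  choose w hw using hf
  let q : X → Fin _ → ℝ := fun x j => φ (w j) (r x)
  have hq : ContDiffAt ℝ ω q 0 := contDiffAt_pi.2 fun j => hφr (w j)
  let J : X →L[ℝ] F × (Fin _ → ℝ) := (fderiv ℝ h 0).prod (fderiv ℝ q 0)
  have hqd : ∀ v j, fderiv ℝ q 0 v j = fderiv ℝ (φ (w j) ∘ r) 0 v := fun v j => by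
    have h1 := fderiv_pi (𝕜 := ℝ) (φ := fun j x => φ (w j) (r x)) (x := (0 : X))
      fun j => (hφr (w j)).differentiableAt (by simp)
    have h2 : fderiv ℝ q 0 = ContinuousLinearMap.pi fun j => fderiv ℝ (φ (w j) ∘ r) 0 := h1
    rw [h2]
    rfl
  have hJ : Function.Injective J := by
    rw [injective_iff_map_eq_zero]
    intro v hv
    have h1 : fderiv ℝ h 0 v = 0 := congrArg Prod.fst hv
    have h2 : fderiv ℝ q 0 v = 0 := congrArg Prod.snd hv
    refine hker v h1 fun i => ?_
    have h3 : L i ∈ Submodule.span ℝ (Set.range f) := by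
      rw [hspan]; exact Submodule.subset_span ⟨i, rfl⟩
    have h4 : Submodule.span ℝ (Set.range f) ≤ LinearMap.ker (Module.Dual.eval ℝ X v) := by
      rw [Submodule.span_le]
      rintro _ ⟨j, rfl⟩
      rw [SetLike.mem_coe, LinearMap.mem_ker, Module.Dual.eval_apply, ← hw]
      change fderiv ℝ (φ (w j) ∘ r) 0 v = 0
      rw [← hqd, h2]
      rfl
    exact h4 h3
  -- Composing `(h, q)` with a linear left inverse of its derivative gives a map with derivative the
  -- identity; on `h = 0` its local inverse recovers `x` from `q x`.
  obtain ⟨Λ, hΛ⟩ := J.toLinearMap.exists_leftInverse_of_injective (LinearMap.ker_eq_bot.2 hJ)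
  let Λ' : F × (Fin _ → ℝ) →L[ℝ] X := LinearMap.toContinuousLinearMap Λ
  have hΛ' : ∀ p, Λ' p = Λ p := fun _ => rfl
  let G : X → X := fun x => Λ' (h x, q x)
  have hG : ContDiffAt ℝ ω G 0 := Λ'.contDiff.contDiffAt.comp 0 (hh.prodMk hq)
  have hG' : HasFDerivAt G (Λ'.comp J) 0 :=
    Λ'.hasFDerivAt.comp 0 (((hh.differentiableAt (by simp)).hasFDerivAt).prodMk
      ((hq.differentiableAt (by simp)).hasFDerivAt))
  have hG'' : ∀ v, fderiv ℝ G 0 v = v := fun v => by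
    rw [hG'.fderiv]
    exact LinearMap.congr_fun hΛ v
  obtain ⟨g, hg, -, hgl, -⟩ := exists_analytic_localInverse hG
    ⟨fun u v huv => by rwa [hG'', hG''] at huv, fun v => ⟨v, hG'' v⟩⟩
  refine ⟨_, w, fun u => g (Λ' (0, u)), ?_, ?_⟩
  · refine ContDiffAt.comp (g := g) _ ?_ (Λ'.contDiff.comp (contDiff_const.prodMk contDiff_id)).contDiffAt
    have : Λ' (0, fun j => φ (w j) (r 0)) = G 0 := by simp only [G, h0]; rfl
    simpa only [Function.comp_apply, id_eq, this] using hg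
  · filter_upwards [hgl] with x hx hhx
    simp only [G, hhx] at hx
    exact hx

/-- Parametrization of the zero set of `h`, when `h` is a submersion in the first variable. -/
theorem exists_parametrization_of_zeros [FiniteDimensional ℝ F] {C T : Type*} [NormedAddCommGroup C] [NormedSpace ℝ C]
    [FiniteDimensional ℝ C] [NormedAddCommGroup T] [NormedSpace ℝ T] [FiniteDimensional ℝ T]
    {h : C × T → F} (hh : ContDiffAt ℝ ω h 0) (h0 : h 0 = 0)
    (hs : ∀ D, ∃ x : C, fderiv ℝ h 0 (x, 0) = D) {d : ℕ}
    (hd : Module.finrank ℝ C = d + Module.finrank ℝ F) :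
    ∃ (lam : C →L[ℝ] EuclideanSpace ℝ (Fin d)) (R : EuclideanSpace ℝ (Fin d) × T → C × T),
      ContDiffAt ℝ ω R 0 ∧ R 0 = 0 ∧
      (∀ᶠ u in 𝓝 0, h (R u) = 0 ∧ lam (R u).1 = u.1 ∧ (R u).2 = u.2) ∧
      ∀ᶠ p in 𝓝 0, h p = 0 → R (lam p.1, p.2) = p := by
  let L : C →ₗ[ℝ] F := (fderiv ℝ h 0).toLinearMap ∘ₗ LinearMap.inl ℝ C T
  have hL : ∀ x, L x = fderiv ℝ h 0 (x, 0) := fun _ => rfl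
  have hLs : Function.Surjective L := hs
  have hker : Module.finrank ℝ (LinearMap.ker L) = d := by
    have := L.finrank_range_add_finrank_ker
    rw [LinearMap.range_eq_top.2 hLs, finrank_top] at this
    omega
  let e : LinearMap.ker L ≃ₗ[ℝ] EuclideanSpace ℝ (Fin d) :=
    LinearEquiv.ofFinrankEq _ _ (by rw [hker, finrank_euclideanSpace_fin])
  obtain ⟨pr, hpr⟩ := (LinearMap.ker L).subtype.exists_leftInverse_of_injective
    (Submodule.ker_subtype _)
  let lam : C →L[ℝ] EuclideanSpace ℝ (Fin d) := LinearMap.toContinuousLinearMap (e.toLinearMap ∘ₗ pr)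
  have hlam : ∀ x : LinearMap.ker L, lam x = e x := fun x => by
    change e (pr x) = e x
    congr 1
    exact LinearMap.congr_fun hpr x
  let M : C × T →L[ℝ] EuclideanSpace ℝ (Fin d) × T :=
    (lam.comp (ContinuousLinearMap.fst ℝ C T)).prod (ContinuousLinearMap.snd ℝ C T)
  have hM : ∀ p, M p = (lam p.1, p.2) := fun _ => rfl
  -- Coordinates on the kernel of the partial derivative, the parameter in `T`, and `h` together
  -- form a chart in which the zero set is a coordinate plane.
  let G : C × T → (EuclideanSpace ℝ (Fin d) × T) × F := fun p => (M p, h p)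
  have hG : ContDiffAt ℝ ω G 0 := M.contDiff.contDiffAt.prodMk hh
  have hG' : fderiv ℝ G 0 = M.prod (fderiv ℝ h 0) :=
    (M.hasFDerivAt.prodMk (hh.differentiableAt (by simp)).hasFDerivAt).fderiv
  have hb : Function.Bijective (fderiv ℝ G 0) := by
    rw [hG']
    constructor
    · rw [injective_iff_map_eq_zero]
      rintro ⟨x, t⟩ hv
      have h1 : M (x, t) = 0 := congrArg Prod.fst hv
      have h2 : fderiv ℝ h 0 (x, t) = 0 := congrArg Prod.snd hv
      have h3 : lam x = 0 := congrArg Prod.fst h1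
      have h4 : t = 0 := congrArg Prod.snd h1
      subst h4
      have h5 : e ⟨x, h2⟩ = 0 := by rw [← hlam]; exact h3
      have h6 : (⟨x, h2⟩ : LinearMap.ker L) = 0 := by simpa using h5
      have h7 : x = 0 := congrArg Subtype.val h6
      rw [h7]
      rfl
    · rintro ⟨⟨v, t⟩, D⟩
      obtain ⟨x₀, hx₀⟩ := hLs (D - fderiv ℝ h 0 (0, t))
      obtain ⟨k, hk⟩ := e.surjective (v - lam x₀)
      refine ⟨(x₀ + k, t), ?_⟩
      have h1 : fderiv ℝ h 0 (x₀ + k, t) = D := by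
        have : ((x₀ + k, t) : C × T) = (x₀, 0) + ((k : C), 0) + (0, t) := by simp
        rw [this, map_add, map_add, ← hL, ← hL, hx₀, k.2]
        abel
      have h2 : lam (x₀ + k) = v := by rw [map_add, hlam, hk]; abel
      change ((lam (x₀ + k), t), fderiv ℝ h 0 (x₀ + k, t)) = _
      rw [h1, h2]
  obtain ⟨g, hg, hg0, hgl, hgr⟩ := exists_analytic_localInverse hG hb
  have hG0 : G 0 = 0 := by simp only [G, h0, map_zero]; rfl
  rw [hG0] at hg hg0 hgr
  have hi : ContDiffAt ℝ ω (fun u : EuclideanSpace ℝ (Fin d) × T => (u, (0 : F))) 0 :=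
    (contDiff_id.prodMk contDiff_const).contDiffAt
  refine ⟨lam, fun u => g (u, 0), ContDiffAt.comp (g := g) 0 hg hi, hg0, ?_, ?_⟩
  · have hc : Filter.Tendsto (fun u : EuclideanSpace ℝ (Fin d) × T => (u, (0 : F))) (𝓝 0) (𝓝 0) :=
      hi.continuousAt
    filter_upwards [hc.eventually hgr] with u hu
    have h1 : M (g (u, 0)) = u := congrArg Prod.fst hu
    rw [hM] at h1
    exact ⟨congrArg Prod.snd hu, congrArg Prod.fst h1, congrArg Prod.snd h1⟩
  · filter_upwards [hgl] with p hp hhp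
    simp only [G, hhp] at hp
    exact hp

end InverseFunction

/-! ### Fibrations -/

theorem coords_injective {ℓ n : ℕ} : Function.Injective (coords : HomU ℓ n → _) := fun ρ ρ' h =>
  genMat_injective fun s => by
    ext i j
    exact congrFun (congrFun (congrFun h s) i) j

theorem isManifoldNear_of_isFibrationNear {ℓ n d : ℕ} {F : Type} [NormedAddCommGroup F]
    [NormedSpace ℝ F] {S : Set (Rep ℓ n)} {P : Set F} {f : Rep ℓ n → F} {x : Rep ℓ n}
    (h : IsFibrationNear d S P f x) (hx : f x ∈ P) : IsManifoldNear d (S ∩ f ⁻¹' {f x}) x := by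
  obtain ⟨W, B, V, Φ, hW, hxW, hxS, -, hxB, hV, hΦ, hbij, hg, hh⟩ := h
  have hmem : ∀ v ∈ V, ((f x, v) : F × EuclideanSpace ℝ (Fin d)) ∈ (P ∩ B) ×ˢ V :=
    fun v hv => ⟨⟨hx, hxB⟩, hv⟩
  have hsub : S ∩ f ⁻¹' {f x} ∩ W ⊆ S ∩ W := fun y hy => ⟨hy.1.1, hy.2⟩
  refine ⟨W, V, fun y => (Φ y).2, hW, hxW, ⟨hxS, rfl⟩, hV, ⟨?_, ?_, ?_⟩, ?_, ?_⟩
  · exact fun y hy => (hbij.mapsTo (hsub hy)).2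
  · intro y hy y' hy' hyy
    refine hbij.injOn (hsub hy) (hsub hy') (Prod.ext ?_ hyy)
    rw [hΦ y (hsub hy), hΦ y' (hsub hy')]
    exact hy.1.2.trans hy'.1.2.symm
  · intro v hv
    obtain ⟨y, hy, hyv⟩ := hbij.surjOn (hmem v hv)
    refine ⟨y, ⟨⟨hy.1, ?_⟩, hy.2⟩, congrArg Prod.snd hyv⟩
    rw [Set.mem_preimage, Set.mem_singleton_iff, ← hΦ y hy, hyv]
  · intro ρ hρ
    obtain ⟨U, g, hU, hρU, hg, hgΦ⟩ := hg ρ (hsub hρ)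
    exact ⟨U, fun c => (g c).2, hU, hρU, hg.snd, fun ρ' h1 h2 =>
      congrArg Prod.snd (hgΦ ρ' (hsub h1) h2)⟩
  · intro v hv
    obtain ⟨U, k, hU, hvU, hk, hkΦ⟩ := hh _ (hmem v hv)
    have hi : ContDiff ℝ ∞ fun v : EuclideanSpace ℝ (Fin d) => (f x, v) :=
      contDiff_const.prodMk contDiff_id
    refine ⟨(fun v => (f x, v)) ⁻¹' U, fun v => k (f x, v), hU.preimage hi.continuous, hvU,
      hk.comp hi.contDiffOn fun _ h => h, fun v' hv' => ?_⟩
    obtain ⟨ρ', h1, h2, h3⟩ := hkΦ (f x, v') ⟨hmem v' hv'.1, hv'.2⟩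
    refine ⟨ρ', h1, ⟨⟨h2.1, ?_⟩, h2.2⟩, congrArg Prod.snd h3⟩
    rw [Set.mem_preimage, Set.mem_singleton_iff, ← hΦ _ h2, h3]

theorem exists_isOpen_coords_preimage {ℓ n : ℕ} {W : Set (Rep ℓ n)} (hW : IsOpen W) :
    ∃ O : Set (Fin ℓ → Fin n → Fin n → ℂ), IsOpen O ∧ ∀ ρ : HomU ℓ n, cls ρ ∈ W ↔ coords ρ ∈ O := by
  have h1 : IsOpen (cls ⁻¹' W : Set (HomU ℓ n)) := hW.preimage continuous_quotient_mk'
  obtain ⟨O, hO, hOW⟩ := isOpen_induced_iff.1 h1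
  exact ⟨O, hO, fun ρ => (Set.ext_iff.1 hOW ρ).symm⟩

theorem isLocSurjAt_of_isFibrationNear {ℓ n d : ℕ} {F : Type} [NormedAddCommGroup F]
    [NormedSpace ℝ F] {S : Set (Rep ℓ n)} {P : Set F} {f : Rep ℓ n → F} {x : Rep ℓ n}
    (h : IsFibrationNear d S P f x) : IsLocSurjAt S P f x := by
  obtain ⟨W, B, V, Φ, hW, hxW, hxS, hB, hxB, hV, hΦ, hbij, hg, hh⟩ := h
  intro W₁ hW₁ hxW₁
  obtain ⟨O, hO, hOW⟩ := exists_isOpen_coords_preimage hW₁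
  have hx : x ∈ S ∩ W := ⟨hxS, hxW⟩
  have hΦx := hbij.mapsTo hx
  obtain ⟨U, k, hU, hxU, hk, hkΦ⟩ := hh _ hΦx
  obtain ⟨ρ, h1, h2, h3⟩ := hkΦ _ ⟨hΦx, hxU⟩
  -- The local lift may pass through any representative of `x`; this suffices because the preimage
  -- of an open set of classes is closed under conjugation.
  have h4 : cls ρ = x := hbij.injOn h2 hx h3
  have hopen := hk.continuousOn.isOpen_inter_preimage hU hO
  have hi : Continuous fun b : F => (b, (Φ x).2) := by fun_prop
  have hfx : ((f x, (Φ x).2) : F × EuclideanSpace ℝ (Fin d)) = Φ x := by rw [← hΦ x hx]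
  refine ⟨B ∩ (fun b => (b, (Φ x).2)) ⁻¹' (U ∩ k ⁻¹' O), hB.inter (hopen.preimage hi), ⟨hxB, ?_⟩, ?_⟩
  · rw [Set.mem_preimage, hfx]
    refine ⟨hxU, ?_⟩
    rw [Set.mem_preimage, ← h1, ← hOW, h4]
    exact hxW₁
  · rintro b ⟨hbP, hbB, hbU, hbO⟩
    obtain ⟨ρ', h5, h6, h7⟩ := hkΦ (b, (Φ x).2) ⟨⟨⟨hbP, hbB⟩, hΦx.2⟩, hbU⟩
    refine ⟨cls ρ', ⟨h6.1, (hOW ρ').2 (h5 ▸ hbO)⟩, ?_⟩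
    rw [← hΦ _ h6, h7]

/-- The model is the zero set of `h` in `C × T`, with `r p` the representation at `p` and the
component in `T` the displacement of `f`. The submersion hypothesis parametrizes this set by `d`
coordinates and `T`. The invariant functions `φ` recover `p` from the class of its representation,
which gives both injectivity and smoothness of the chart. The last two hypotheses say that zeros of
`h` over `P` give points of `S`, and that every class in `S` near the base point arises from a small
zero. -/
theorem isFibrationNear_of_model {ℓ n d : ℕ} {F G C : Type} [NormedAddCommGroup F] [NormedSpace ℝ F]
    [FiniteDimensional ℝ F] [NormedAddCommGroup G] [NormedSpace ℝ G] [FiniteDimensional ℝ G]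
    [NormedAddCommGroup C] [NormedSpace ℝ C] [FiniteDimensional ℝ C] {ι : Type*}
    {S : Set (Rep ℓ n)} {P : Set F} {f : Rep ℓ n → F} {ρ : HomU ℓ n} (hρ : cls ρ ∈ S)
    (hSP : ∀ y ∈ S, f y ∈ P) {T : Submodule ℝ F} (hT : ∀ b ∈ P, b - f (cls ρ) ∈ T)
    {h : C × T → G} {r : C × T → Fin ℓ → Fin n → Fin n → ℂ} (hh : ContDiffAt ℝ ω h 0)
    (hr : ContDiffAt ℝ ω r 0) (h0 : h 0 = 0) (hr0 : r 0 = coords ρ)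
    (hs : ∀ D, ∃ x : C, fderiv ℝ h 0 (x, 0) = D)
    (hd : Module.finrank ℝ C = d + Module.finrank ℝ G)
    {φ : ι → (Fin ℓ → Fin n → Fin n → ℂ) → ℝ} (hφ : ∀ i, ContDiff ℝ ω (φ i))
    (hφi : ∀ i (ρ₁ ρ₂ : HomU ℓ n), ρ₁ ≈ ρ₂ → φ i (coords ρ₁) = φ i (coords ρ₂))
    (hker : ∀ v, fderiv ℝ h 0 v = 0 → (∀ i, fderiv ℝ (φ i ∘ r) 0 v = 0) → v = 0)
    (hmodel : ∀ᶠ p in 𝓝 0, h p = 0 → f (cls ρ) + (p.2 : F) ∈ P →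
      ∃ ρ', coords ρ' = r p ∧ cls ρ' ∈ S ∧ f (cls ρ') = f (cls ρ) + p.2)
    (hnear : ∀ N ∈ 𝓝 (0 : C × T), ∃ W, IsOpen W ∧ cls ρ ∈ W ∧ ∀ y ∈ S ∩ W, ∃ p ∈ N, h p = 0 ∧
      f y = f (cls ρ) + (p.2 : F) ∧ ∃ ρ', cls ρ' = y ∧ coords ρ' = r p) :
    IsFibrationNear d S P f (cls ρ) := by
  obtain ⟨k, w, Φ₀, hΦ₀, hΦ₀l⟩ := exists_leftInverse_on_zeros hh hr hφ h0 hker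
  obtain ⟨lam, R, hR, hR0, hRr, hRl⟩ := exists_parametrization_of_zeros hh h0 hs hd
  set a := f (cls ρ) with ha
  let q : (Fin ℓ → Fin n → Fin n → ℂ) → Fin k → ℝ := fun c j => φ (w j) c
  have hq : ContDiff ℝ ω q := contDiff_pi.2 fun j => hφ (w j)
  -- Invariance under conjugation makes the chosen coordinate functions well defined and continuous
  -- on the moduli space.
  let qRep : Rep ℓ n → Fin k → ℝ := Quotient.lift (fun ρ => q (coords ρ))
    fun ρ₁ ρ₂ h => funext fun j => hφi (w j) ρ₁ ρ₂ h
  have hqRep : ∀ ρ', qRep (cls ρ') = q (coords ρ') := fun _ => rfl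
  have hqc : Continuous qRep :=
    Continuous.quotient_lift (hq.continuous.comp continuous_induced_dom) _
  obtain ⟨𝒰, h𝒰, h𝒰o, h𝒰0⟩ := eventually_nhds_iff.1 (hΦ₀.eventually (by simp))
  have hqr : ContinuousAt (fun p => q (r p)) 0 := hq.continuous.continuousAt.comp hr.continuousAt
  have hN : ∀ᶠ p in 𝓝 (0 : C × T), (h p = 0 → a + (p.2 : F) ∈ P →
      ∃ ρ', coords ρ' = r p ∧ cls ρ' ∈ S ∧ f (cls ρ') = a + p.2) ∧
      (h p = 0 → Φ₀ (q (r p)) = p) ∧ (h p = 0 → R (lam p.1, p.2) = p) ∧ q (r p) ∈ 𝒰 ∧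
      ContDiffAt ℝ ω r p :=
    hmodel.and (hΦ₀l.and (hRl.and ((hqr.eventually (h𝒰o.mem_nhds h𝒰0)).and
      (hr.eventually (by simp)))))
  obtain ⟨W, hW, hρW, hWN⟩ := hnear _ hN
  obtain ⟨O, hO, hOW⟩ := exists_isOpen_coords_preimage hW
  have hRc : Filter.Tendsto R (𝓝 0) (𝓝 0) := by
    have := hR.continuousAt
    rwa [ContinuousAt, hR0] at this
  have hrO : ∀ᶠ p in 𝓝 (0 : C × T), r p ∈ O :=
    hr.continuousAt.eventually (hO.mem_nhds (by rw [hr0]; exact (hOW ρ).1 hρW))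
  have hM : ∀ᶠ u in 𝓝 (0 : EuclideanSpace ℝ (Fin d) × T), _ :=
    (hRc.eventually hN).and ((hRc.eventually hrO).and (hRr.and (hR.eventually (by simp))))
  obtain ⟨V, hV, B, hB, hVB⟩ := mem_nhds_prod_iff.1 hM
  obtain ⟨V, hVV, hVo, hV0⟩ := mem_nhds_iff.1 hV
  obtain ⟨B, hBB, hBo, hB0⟩ := mem_nhds_iff.1 hB
  replace hVB := fun u (hu : u ∈ V ×ˢ B) => hVB ⟨hVV hu.1, hBB hu.2⟩
  obtain ⟨pr, hpr⟩ := T.subtype.exists_leftInverse_of_injective (Submodule.ker_subtype _)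
  -- Points of `P` differ from `a` by elements of `T`. A projection onto `T` makes the displacement
  -- a smooth function on all of `F`.
  let π : F →L[ℝ] T := LinearMap.toContinuousLinearMap pr
  have hπ : ∀ t : T, π t = t := fun t => LinearMap.congr_fun hpr t
  have hπP : ∀ b ∈ P, a + (π (b - a) : F) = b := fun b hb => by
    have := hπ ⟨b - a, hT b hb⟩
    simp only at this
    rw [this, add_sub_cancel]
  -- The chart in terms of the invariants: recover the model point by `Φ₀`, then record its value of
  -- `f` and its `d` kernel coordinates.
  let Ψ : (Fin k → ℝ) → F × EuclideanSpace ℝ (Fin d) :=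
    fun u => (a + ((Φ₀ u).2 : F), lam (Φ₀ u).1)
  have hΨ : ContDiffOn ℝ ∞ Ψ 𝒰 := by
    intro u hu
    have h1 : ContDiffAt ℝ ∞ Φ₀ u := (h𝒰 u hu).of_le le_top
    exact ((contDiffAt_const.add (T.subtypeL.contDiff.contDiffAt.comp u h1.snd)).prodMk
      (lam.contDiff.contDiffAt.comp u h1.fst)).contDiffWithinAt
  let B' : Set F := (fun b => π (b - a)) ⁻¹' B
  have hB'o : IsOpen B' := hBo.preimage (by fun_prop)
  have hB'a : a ∈ B' := by
    change π (a - a) ∈ B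
    rw [sub_self, map_zero]
    exact hB0
  have hWo : IsOpen (W ∩ qRep ⁻¹' (𝒰 ∩ Ψ ⁻¹' (B' ×ˢ V))) :=
    hW.inter ((hΨ.continuousOn.isOpen_inter_preimage h𝒰o (hB'o.prod hVo)).preimage hqc)
  have key : ∀ y ∈ S ∩ (W ∩ qRep ⁻¹' (𝒰 ∩ Ψ ⁻¹' (B' ×ˢ V))), ∃ p, R (lam p.1, p.2) = p ∧
      f y = a + (p.2 : F) ∧ Ψ (qRep y) = (a + (p.2 : F), lam p.1) ∧
      ∃ ρ', cls ρ' = y ∧ coords ρ' = r p := by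
    rintro y ⟨hyS, hyW, hy𝒰, hyΨ⟩
    obtain ⟨p, ⟨-, hp1, hp2, -, -⟩, hhp, hfp, ρ', rfl, hρ'⟩ := hWN y ⟨hyS, hyW⟩
    refine ⟨p, hp2 hhp, hfp, ?_, ρ', rfl, hρ'⟩
    simp only [Ψ]
    rw [hqRep, hρ', hp1 hhp]
  have lift : ∀ b ∈ P ∩ B', ∀ v ∈ V, ∃ ρ', coords ρ' = r (R (v, π (b - a))) ∧
      cls ρ' ∈ S ∩ (W ∩ qRep ⁻¹' (𝒰 ∩ Ψ ⁻¹' (B' ×ˢ V))) ∧ Ψ (qRep (cls ρ')) = (b, v) := by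
    rintro b ⟨hbP, hbB⟩ v hv
    obtain ⟨⟨hp1, hp2, -, hp3, -⟩, hp4, ⟨hp5, hp6, hp7⟩, -⟩ := hVB (v, π (b - a)) ⟨hv, hbB⟩
    simp only at hp6 hp7
    obtain ⟨ρ', h1, h2, h3⟩ := hp1 hp5 (by rw [hp7, hπP b hbP]; exact hbP)
    have h4 : Ψ (qRep (cls ρ')) = (b, v) := by
      simp only [Ψ]
      rw [hqRep, h1, hp2 hp5, hp6, hp7, hπP b hbP]
    refine ⟨ρ', h1, ⟨h2, (hOW ρ').2 (h1 ▸ hp4), ?_, ?_⟩, h4⟩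
    · rw [hqRep, h1]; exact hp3
    · rw [Set.mem_preimage, h4]; exact ⟨hbB, hv⟩
  have hzero : q (coords ρ) ∈ 𝒰 ∧ Ψ (q (coords ρ)) = (a, 0) := by
    have h1 := hN.self_of_nhds
    refine ⟨hr0 ▸ h1.2.2.2.1, ?_⟩
    simp only [Ψ]
    rw [← hr0, h1.2.1 h0]
    simp
  refine ⟨_, B', V, fun y => Ψ (qRep y), hWo, ⟨hρW, hzero.1, ?_⟩, hρ, hB'o, ?_, hVo, ?_, ⟨?_, ?_, ?_⟩,
    ?_, ?_⟩
  · rw [Set.mem_preimage, hqRep, hzero.2]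
    exact ⟨hB'a, hV0⟩
  · exact hB'a
  · intro y hy
    obtain ⟨p, -, hf, hΨp, -⟩ := key y hy
    simp only
    rw [hΨp, hf]
  · intro y hy
    obtain ⟨p, -, hf, hΨp, -⟩ := key y hy
    have h1 := hy.2.2.2
    rw [Set.mem_preimage, hΨp] at h1
    simp only
    rw [hΨp]
    exact ⟨⟨hf ▸ hSP y hy.1, h1.1⟩, h1.2⟩
  · intro y hy y' hy' hyy
    obtain ⟨p, hp, -, hΨp, ρ₁, rfl, hρ₁⟩ := key y hy
    obtain ⟨p', hp', -, hΨp', ρ₂, rfl, hρ₂⟩ := key y' hy'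
    simp only at hyy
    rw [hΨp, hΨp', Prod.mk.injEq, add_right_inj, Subtype.coe_inj] at hyy
    -- The parametrization `R` reconstructs a model point from its kernel coordinates and its
    -- displacement.
    have h1 : p = p' := by rw [← hp, ← hp', hyy.1, hyy.2]
    rw [coords_injective (hρ₁.trans ((congrArg r h1).trans hρ₂.symm))]
  · rintro ⟨b, v⟩ ⟨hb, hv⟩
    obtain ⟨ρ', -, h2, h3⟩ := lift b hb v hv
    exact ⟨cls ρ', h2, h3⟩
  · intro ρ₁ hρ₁
    exact ⟨q ⁻¹' 𝒰, fun c => Ψ (q c), h𝒰o.preimage hq.continuous, hρ₁.2.2.1,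
      hΨ.comp (hq.of_le le_top).contDiffOn fun _ h => h, fun _ _ _ => rfl⟩
  · rintro ⟨b, v⟩ hbv
    refine ⟨B' ×ˢ V, fun t => r (R (t.2, π (t.1 - a))), hB'o.prod hVo, ⟨hbv.1.2, hbv.2⟩, ?_, ?_⟩
    · rintro ⟨b', v'⟩ ⟨hb', hv'⟩
      obtain ⟨⟨-, -, -, -, h1⟩, -, -, h2⟩ := hVB (v', π (b' - a)) ⟨hv', hb'⟩
      have h3 : ContDiff ℝ ω fun t : F × EuclideanSpace ℝ (Fin d) => (t.2, π (t.1 - a)) :=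
        contDiff_snd.prodMk (π.contDiff.comp (contDiff_fst.sub contDiff_const))
      have h4 : ContDiffAt ℝ ω (fun t : F × EuclideanSpace ℝ (Fin d) => R (t.2, π (t.1 - a)))
          (b', v') := ContDiffAt.comp (g := R) (b', v') h2 h3.contDiffAt
      have h5 : ContDiffAt ℝ ω (fun t : F × EuclideanSpace ℝ (Fin d) => r (R (t.2, π (t.1 - a))))
          (b', v') := ContDiffAt.comp (g := r) (b', v') h1 h4
      exact (h5.of_le le_top).contDiffWithinAt
    · rintro ⟨b', v'⟩ ⟨⟨hb', hv'⟩, -⟩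
      exact lift b' hb' v' hv'

end

end LagRep

/-! ### The local model near a Lagrangian representation, and its completeness. -/

namespace LagRep

open scoped ContDiff Topology Matrix Matrix.Norms.Operator
open Matrix

noncomputable section

attribute [-instance] instTopologicalSpaceMatrix Matrix.instUniformSpace

/-! ### A local model of the space of Lagrangian representations -/

/-- `exp(πi t)` in the basis of eigenvectors of `A_s`. -/
def rot {n : ℕ} (U : Un n) (t : Fin n → ℝ) : Matrix (Fin n) (Fin n) ℂ := conjEquiv U (Delta t)

theorem rot_zero {n : ℕ} (U : Un n) : rot U 0 = 1 := by
  rw [rot, Delta_zero, conjEquiv_one]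

theorem rot_add {n : ℕ} (U : Un n) (t t' : Fin n → ℝ) : rot U (t + t') = rot U t * rot U t' := by
  rw [rot, Delta_add, conjEquiv_mul, rot, rot]

theorem rot_conjTranspose {n : ℕ} (U : Un n) (t : Fin n → ℝ) : (rot U t)ᴴ = rot U (-t) := by
  rw [rot, conjEquiv_conjTranspose, Delta_conjTranspose, rot]

theorem rot_neg_mul {n : ℕ} (U : Un n) (t : Fin n → ℝ) : rot U (-t) * rot U t = 1 := by
  rw [← rot_add, neg_add_cancel, rot_zero]

theorem IsAdapted.lagMat_eq_rot {ℓ n : ℕ} {U : Fin ℓ → Un n} {α : Fin ℓ → Fin n → ℝ}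
    (h : IsAdapted U α) (s : Fin ℓ) : lagMat (frameSym U) s = rot (U s) (2 • α s) := h.lagMat_eq s

/-- The variation of the eigenvalues with velocity `t`. -/
def rotVar {n : ℕ} (U : Un n) : (Fin n → ℝ) →ₗ[ℝ] Matrix (Fin n) (Fin n) ℂ where
  toFun t := conjEquiv U (Matrix.diagonal fun j => Real.pi * Complex.I * (t j : ℂ))
  map_add' t t' := by
    rw [← map_add, Matrix.diagonal_add]
    congr 2
    funext j
    simp [mul_add]
  map_smul' c t := by
    rw [RingHom.id_apply, ← map_smul, ← Matrix.diagonal_smul]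
    congr 2
    funext j
    simp
    ring

theorem rotVar_apply {n : ℕ} (U : Un n) (t : Fin n → ℝ) :
    rotVar U t = conjEquiv U (Matrix.diagonal fun j => Real.pi * Complex.I * (t j : ℂ)) := rfl

theorem rotVar_conjTranspose {n : ℕ} (U : Un n) (t : Fin n → ℝ) :
    (rotVar U t)ᴴ = -rotVar U t := by
  rw [rotVar_apply, conjEquiv_skew_iff, Matrix.diagonal_conjTranspose, Matrix.diagonal_neg]
  congr 1
  funext j
  simp

theorem rotVar_eq_zero {n : ℕ} {U : Un n} {t : Fin n → ℝ} (h : rotVar U t = 0) : t = 0 := by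
  rw [rotVar_apply, map_eq_zero_iff _ (conjEquiv U).injective] at h
  funext j
  have h1 := congrFun (congrFun h j) j
  rw [Matrix.diagonal_apply_eq] at h1
  simpa using h1

theorem rotVar_commute {n : ℕ} (U : Un n) (t θ : Fin n → ℝ) :
    rotVar U t * rot U θ = rot U θ * rotVar U t := by
  rw [rotVar_apply, rot, ← conjEquiv_mul, ← conjEquiv_mul, Delta, Matrix.diagonal_mul_diagonal,
    Matrix.diagonal_mul_diagonal]
  congr 2
  funext j
  ring

theorem contDiff_Delta {n : ℕ} {k : WithTop ℕ∞} :
    ContDiff ℝ k (Delta : (Fin n → ℝ) → Matrix (Fin n) (Fin n) ℂ) := by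
  have h : (Delta : (Fin n → ℝ) → Matrix (Fin n) (Fin n) ℂ) = fun θ => ∑ j,
      singleCLM j j (Complex.exp (Real.pi * Complex.I * (θ j : ℂ))) := by
    funext θ
    rw [Delta]
    ext i k
    rw [Matrix.sum_apply]
    simp only [singleCLM, Matrix.diagonal_apply]
    change _ = ∑ j, Matrix.single j j _ i k
    simp only [Matrix.single_apply]
    by_cases hik : i = k
    · subst hik
      simp
    · rw [if_neg hik, Finset.sum_eq_zero]
      rintro j -
      rw [if_neg]
      rintro ⟨rfl, rfl⟩
      exact hik rfl
  rw [h]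
  refine ContDiff.sum fun j _ => (singleCLM j j).contDiff.comp ?_
  have h1 : ContDiff ℝ k fun θ : Fin n → ℝ => (θ j : ℂ) :=
    Complex.ofRealCLM.contDiff.comp (contDiff_apply ℝ ℝ j)
  exact ((Complex.contDiff_exp (𝕜 := ℂ) (n := k)).restrict_scalars ℝ).comp (contDiff_const.mul h1)

theorem contDiff_rot {n : ℕ} (U : Un n) {k : WithTop ℕ∞} : ContDiff ℝ k (rot U) :=
  (contDiff_const.mul contDiff_Delta).mul contDiff_const

theorem hasDerivAt_rot {n : ℕ} (U : Un n) (t : Fin n → ℝ) :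
    HasDerivAt (fun τ : ℝ => rot U (τ • t)) (rotVar U t) 0 := by
  have h : HasDerivAt (fun τ : ℝ => Delta (τ • t))
      (Matrix.diagonal fun j => Real.pi * Complex.I * (t j : ℂ)) 0 := by
    rw [hasDerivAt_matrix_iff]
    intro i j
    by_cases hij : i = j
    · subst hij
      simp only [Delta, Matrix.diagonal_apply_eq, Pi.smul_apply, smul_eq_mul]
      have h1 : HasDerivAt (fun τ : ℝ => (τ : ℂ)) 1 0 := Complex.ofRealCLM.hasDerivAt
      have h2 : HasDerivAt (fun τ : ℝ => Real.pi * Complex.I * ((τ * t i : ℝ) : ℂ))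
          (Real.pi * Complex.I * (t i : ℂ)) 0 := by
        refine ((h1.mul_const (t i : ℂ)).const_mul (Real.pi * Complex.I)).congr_deriv ?_ |>.congr_of_eventuallyEq ?_
        · ring
        · exact Filter.Eventually.of_forall fun τ => by push_cast; rfl
      refine h2.cexp.congr_deriv ?_
      simp
    · simp only [Delta, Matrix.diagonal_apply_ne _ hij]
      exact hasDerivAt_const _ _
  exact (h.const_mul _).mul_const _

section Model

variable {ℓ n : ℕ} (U : Fin ℓ → Un n)

/-- The matrices obtained from `A_s` by moving its eigenvectors by `cay p_s` and its spectrum by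
`t_s`. -/
def modelMat (q : (Fin ℓ → Matrix (Fin n) (Fin n) ℂ) × (Fin ℓ → Fin n → ℝ)) (s : Fin ℓ) :
    Matrix (Fin n) (Fin n) ℂ :=
  cay (q.1 s) * (rot (U s) (q.2 s) * lagMat (frameSym U) s * rot (U s) (q.2 s)) * (cay (q.1 s))ᴴ

/-- The transition between the moved frames for `L_s` and `L_{s+1}`. -/
def modelRel (q : (Fin ℓ → Matrix (Fin n) (Fin n) ℂ) × (Fin ℓ → Fin n → ℝ)) (s : Fin ℓ) :
    Matrix (Fin n) (Fin n) ℂ :=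
  rot (U s) (q.2 s) * (cay (q.1 s))ᴴ * cay (q.1 (finRotate ℓ s))

/-- The defect of the closing condition. -/
def modelSym (q : (Fin ℓ → Matrix (Fin n) (Fin n) ℂ) × (Fin ℓ → Fin n → ℝ)) (s : Fin ℓ) :
    Matrix (Fin n) (Fin n) ℂ :=
  modelRel U q s * refl (frameSym U (finRotate ℓ s)) (modelRel U q s)

theorem contDiffAt_cay_apply {k : WithTop ℕ∞} (s : Fin ℓ) :
    ContDiffAt ℝ k (fun q : (Fin ℓ → Matrix (Fin n) (Fin n) ℂ) × (Fin ℓ → Fin n → ℝ) =>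
      cay (q.1 s)) 0 :=
  ContDiffAt.comp (g := cay) (0 : (Fin ℓ → Matrix (Fin n) (Fin n) ℂ) × (Fin ℓ → Fin n → ℝ))
    (contDiffAt_cay (by simp)) (by fun_prop)

theorem contDiffAt_rot_apply {k : WithTop ℕ∞} (s : Fin ℓ) :
    ContDiffAt ℝ k (fun q : (Fin ℓ → Matrix (Fin n) (Fin n) ℂ) × (Fin ℓ → Fin n → ℝ) =>
      rot (U s) (q.2 s)) 0 :=
  ((contDiff_rot (U s)).comp (by fun_prop)).contDiffAt

theorem contDiffAt_modelMat {k : WithTop ℕ∞} (s : Fin ℓ) :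
    ContDiffAt ℝ k (fun q => modelMat U q s) 0 :=
  ((contDiffAt_cay_apply s).mul (((contDiffAt_rot_apply U s).mul contDiffAt_const).mul
    (contDiffAt_rot_apply U s))).mul
    ((conjTransposeCLM n).contDiff.contDiffAt.comp _ (contDiffAt_cay_apply s))

theorem contDiffAt_modelRel {k : WithTop ℕ∞} (s : Fin ℓ) :
    ContDiffAt ℝ k (fun q => modelRel U q s) 0 :=
  ((contDiffAt_rot_apply U s).mul ((conjTransposeCLM n).contDiff.contDiffAt.comp _
    (contDiffAt_cay_apply s))).mul (contDiffAt_cay_apply _)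

theorem contDiffAt_modelSym {k : WithTop ℕ∞} (s : Fin ℓ) :
    ContDiffAt ℝ k (fun q => modelSym U q s) 0 :=
  (contDiffAt_modelRel U s).mul ((contDiffAt_const.mul
    ((transposeCLM n).contDiff.contDiffAt.comp _ (contDiffAt_modelRel U s))).mul contDiffAt_const)

theorem modelMat_zero (s : Fin ℓ) : modelMat U 0 s = lagMat (frameSym U) s := by
  simp [modelMat, rot_zero, cay_zero]

theorem modelRel_zero (s : Fin ℓ) : modelRel U 0 s = 1 := by
  simp [modelRel, rot_zero, cay_zero]

theorem refl_one {S : Matrix (Fin n) (Fin n) ℂ} (h : IsSymUnitary S) : refl S 1 = 1 := by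
  rw [refl, Matrix.transpose_one, mul_one, h.mul_star]

theorem modelSym_zero (s : Fin ℓ) : modelSym U 0 s = 1 := by
  rw [modelSym, modelRel_zero, refl_one (isSymUnitary_frameSym U _), one_mul]

variable {U}

theorem hasDerivAt_conj_of_eq_one {f g : ℝ → Matrix (Fin n) (Fin n) ℂ}
    {F G : Matrix (Fin n) (Fin n) ℂ} (hf : HasDerivAt f F 0) (hg : HasDerivAt g G 0) (hf0 : f 0 = 1)
    (hg0 : g 0 = 1) (A : Matrix (Fin n) (Fin n) ℂ) :
    HasDerivAt (fun τ => f τ * (g τ * A * g τ) * (f τ)ᴴ) (F * A + (G * A + A * G) + A * Fᴴ) 0 := by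
  have h1 : HasDerivAt (fun τ => g τ * A * g τ) (G * A + A * G) 0 := by
    refine ((hg.mul_const A).mul hg).congr_deriv ?_
    rw [hg0, one_mul, mul_one]
  have h2 : HasDerivAt (fun τ => f τ * (g τ * A * g τ)) (F * A + (G * A + A * G)) 0 := by
    refine (hf.mul h1).congr_deriv ?_
    rw [hg0, hf0]
    simp only [one_mul, mul_one]
  refine (h2.mul (HasDerivAt.conjTranspose hf)).congr_deriv ?_
  rw [hg0, hf0, Matrix.conjTranspose_one]
  simp only [one_mul, mul_one]

/-- The factor `2` arises because the rotation acts on both sides of `A_s` and its velocity commutes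
with `A_s`. -/
theorem hasDerivAt_modelMat {α : Fin ℓ → Fin n → ℝ} (hU : IsAdapted U α)
    {q : (Fin ℓ → Matrix (Fin n) (Fin n) ℂ) × (Fin ℓ → Fin n → ℝ)} (hq : ∀ s, (q.1 s)ᴴ = -q.1 s)
    (s : Fin ℓ) :
    HasDerivAt (fun τ : ℝ => modelMat U (τ • q) s)
      (q.1 s * lagMat (frameSym U) s - lagMat (frameSym U) s * q.1 s +
        (2 : ℂ) • rotVar (U s) (q.2 s) * lagMat (frameSym U) s) 0 := by
  refine (hasDerivAt_conj_of_eq_one (hasDerivAt_cay_smul (q.1 s))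
    (hasDerivAt_rot (U s) (q.2 s)) (by rw [zero_smul, cay_zero]) (by rw [zero_smul, rot_zero])
    (lagMat (frameSym U) s)).congr_deriv ?_
  have h1 : lagMat (frameSym U) s * rotVar (U s) (q.2 s)
      = rotVar (U s) (q.2 s) * lagMat (frameSym U) s := by
    rw [hU.lagMat_eq_rot, rotVar_commute]
  rw [h1, hq, Matrix.smul_mul, two_smul, mul_neg]
  abel

theorem hasDerivAt_modelRel {q : (Fin ℓ → Matrix (Fin n) (Fin n) ℂ) × (Fin ℓ → Fin n → ℝ)}
    (hq : ∀ s, (q.1 s)ᴴ = -q.1 s) (s : Fin ℓ) :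
    HasDerivAt (fun τ : ℝ => modelRel U (τ • q) s)
      (q.1 (finRotate ℓ s) - q.1 s + rotVar (U s) (q.2 s)) 0 := by
  have h1 := hasDerivAt_cay_smul (q.1 s)
  have h2 := hasDerivAt_rot (U s) (q.2 s)
  have h3 := hasDerivAt_cay_smul (q.1 (finRotate ℓ s))
  refine ((h2.mul (HasDerivAt.conjTranspose h1)).mul h3).congr_deriv ?_
  simp only [zero_smul, rot_zero, cay_zero, one_mul, mul_one, Matrix.conjTranspose_one, hq,
    Pi.mul_apply]
  abel

theorem hasDerivAt_modelSym {q : (Fin ℓ → Matrix (Fin n) (Fin n) ℂ) × (Fin ℓ → Fin n → ℝ)}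
    (hq : ∀ s, (q.1 s)ᴴ = -q.1 s) (s : Fin ℓ) :
    HasDerivAt (fun τ : ℝ => modelSym U (τ • q) s)
      (symVar (frameSym U (finRotate ℓ s))
        (q.1 (finRotate ℓ s) - q.1 s + rotVar (U s) (q.2 s))) 0 := by
  have h1 := hasDerivAt_modelRel (U := U) hq s
  refine (h1.mul (((HasDerivAt.transpose h1).const_mul (frameSym U (finRotate ℓ s))).mul_const
    (frameSym U (finRotate ℓ s))ᴴ)).congr_deriv ?_
  have h2 : modelRel U ((0 : ℝ) • q) s = 1 := by rw [zero_smul, modelRel_zero]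
  simp only [h2, Matrix.transpose_one, mul_one, one_mul, (isSymUnitary_frameSym U _).mul_star]
  rfl

theorem hasDerivAt_wordProd {A : ℝ → Fin ℓ → Matrix (Fin n) (Fin n) ℂ}
    {B : Fin ℓ → Matrix (Fin n) (Fin n) ℂ} {τ : ℝ}
    (h : ∀ s, HasDerivAt (fun τ => A τ s) (B s) τ) (w : List (Fin ℓ)) :
    HasDerivAt (fun τ => wordProd (A τ) w) (wordVar (A τ) B w) τ := by
  induction w with
  | nil => exact hasDerivAt_const _ _
  | cons s w ih =>
    simp only [wordProd_cons, wordVar]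
    exact (h s).mul ih

theorem fderiv_eq_of_hasDerivAt_smul {X F : Type*} [NormedAddCommGroup X] [NormedSpace ℝ X]
    [NormedAddCommGroup F] [NormedSpace ℝ F] {f : X → F} {v : X} {w : F}
    (hf : DifferentiableAt ℝ f 0) (h : HasDerivAt (fun τ : ℝ => f (τ • v)) w 0) :
    fderiv ℝ f 0 v = w := by
  have h1 : HasDerivAt (fun τ : ℝ => τ • v) v 0 := by
    simpa using (hasDerivAt_id (0 : ℝ)).smul_const v
  have h2 : HasFDerivAt f (fderiv ℝ f 0) ((0 : ℝ) • v) := by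
    rw [zero_smul]
    exact hf.hasFDerivAt
  exact (h2.comp_hasDerivAt (0 : ℝ) h1).unique h

/-- The frames of the moved configuration. -/
def modelFrame (U : Fin ℓ → Un n) (p : Fin ℓ → Matrix (Fin n) (Fin n) ℂ)
    (hp : ∀ s, (p s)ᴴ = -p s) (s : Fin ℓ) : Un n :=
  ⟨cay (p s), Matrix.mem_unitaryGroup_iff'.2 (cay_star_mul (hp s))⟩ * U s

theorem coe_modelFrame (p : Fin ℓ → Matrix (Fin n) (Fin n) ℂ) (hp : ∀ s, (p s)ᴴ = -p s)
    (s : Fin ℓ) : (modelFrame U p hp s : Matrix (Fin n) (Fin n) ℂ)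
      = cay (p s) * (U s : Matrix (Fin n) (Fin n) ℂ) := rfl

theorem frameSym_next_iff {V : Fin ℓ → Un n} {θ : Fin n → ℝ} {s : Fin ℓ} :
    (stdLagr n).act (V (finRotate ℓ s)) = (stdLagr n).act (V s * DeltaU (-θ)) ↔
      frameSym V (finRotate ℓ s) = (V s : Matrix (Fin n) (Fin n) ℂ) * Delta (-(2 • θ)) *
        (V s : Matrix (Fin n) (Fin n) ℂ)ᵀ := by
  rw [act_std_eq_iff]
  have h : ((V s * DeltaU (-θ) : Un n) : Matrix (Fin n) (Fin n) ℂ) *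
      ((V s * DeltaU (-θ) : Un n) : Matrix (Fin n) (Fin n) ℂ)ᵀ
      = (V s : Matrix (Fin n) (Fin n) ℂ) * Delta (-(2 • θ)) *
        (V s : Matrix (Fin n) (Fin n) ℂ)ᵀ := by
    rw [Un.coe_mul, coe_DeltaU, Matrix.transpose_mul, Delta_transpose,
      show -(2 • θ) = -θ + -θ by rw [two_smul]; abel, Delta_add]
    simp only [mul_assoc]
  rw [h]
  rfl

/-- If the closing condition holds, then the moved frames are adapted to the moved spectrum. -/
theorem isAdapted_modelFrame {α : Fin ℓ → Fin n → ℝ} (hU : IsAdapted U α)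
    {q : (Fin ℓ → Matrix (Fin n) (Fin n) ℂ) × (Fin ℓ → Fin n → ℝ)} (hq : ∀ s, (q.1 s)ᴴ = -q.1 s)
    (h0 : ∀ s j, 0 ≤ (α + q.2) s j) (h1 : ∀ s j, (α + q.2) s j < 1) (hm : ∀ s, Monotone ((α + q.2) s))
    (hN : ∀ s, modelSym U q s = 1) : IsAdapted (modelFrame U q.1 hq) (α + q.2) := by
  refine ⟨h0, h1, hm, fun s => frameSym_next_iff.2 ?_⟩
  obtain ⟨c, hc⟩ : ∃ c, c = cay (q.1 s) := ⟨_, rfl⟩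
  obtain ⟨c', hc'⟩ : ∃ c', c' = cay (q.1 (finRotate ℓ s)) := ⟨_, rfl⟩
  obtain ⟨u, hu⟩ : ∃ u, u = (U s : Matrix (Fin n) (Fin n) ℂ) := ⟨_, rfl⟩
  obtain ⟨S, hS⟩ : ∃ S, S = frameSym U (finRotate ℓ s) := ⟨_, rfl⟩
  have hcc : c * cᴴ = 1 := by rw [hc]; exact mul_eq_one_comm.1 (cay_star_mul (hq s))
  have huu : uᴴ * u = 1 := by rw [hu]; exact Un.star_mul_self _
  have huu' : u * uᴴ = 1 := mul_eq_one_comm.1 huu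
  have hSu := hS ▸ isSymUnitary_frameSym U (finRotate ℓ s)
  have hS2 : S = u * Delta (-(2 • α s)) * uᵀ := by
    rw [hS, hu]; exact frameSym_next_iff.1 (hU.next s)
  have hV : modelRel U q s = rot (U s) (q.2 s) * cᴴ * c' := by rw [modelRel, hc, hc']
  -- The closing condition says that the transition matrix stabilizes `L_{s+1}`: the subspace
  -- predicted by the moved frame of `L_s` and the moved spectrum agrees with `cay(p_{s+1})
  -- L_{s+1}`.
  have hN1 : modelRel U q s * S * (modelRel U q s)ᵀ = S := by
    have := hN s
    rw [modelSym, ← hS, refl] at this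
    calc _ = modelRel U q s * (S * (modelRel U q s)ᵀ * Sᴴ) * S := by
          rw [mul_assoc _ (S * _ * Sᴴ) S, mul_assoc _ Sᴴ S, hSu.star_mul, mul_one]
          simp only [mul_assoc]
      _ = S := by rw [this, one_mul]
  have hrt : (rot (U s) (-q.2 s))ᵀ = uᴴᵀ * Delta (-q.2 s) * uᵀ := by
    rw [rot, conjEquiv_apply, Matrix.transpose_mul, Matrix.transpose_mul, Delta_transpose, ← hu]
    simp only [mul_assoc]
  have hr : rot (U s) (-q.2 s) = u * Delta (-q.2 s) * uᴴ := by rw [rot, conjEquiv_apply, ← hu]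
  have hcV : c' = c * rot (U s) (-q.2 s) * modelRel U q s := by
    rw [hV]
    calc c' = c * cᴴ * c' := by rw [hcc, one_mul]
      _ = c * (rot (U s) (-q.2 s) * rot (U s) (q.2 s)) * cᴴ * c' := by rw [rot_neg_mul, mul_one]
      _ = _ := by simp only [mul_assoc]
  have huut : uᵀ * uᴴᵀ = 1 := by rw [← Matrix.transpose_mul, huu, Matrix.transpose_one]
  have hfs : frameSym (modelFrame U q.1 hq) (finRotate ℓ s) = c' * S * c'ᵀ := by
    rw [frameSym, coe_modelFrame, ← hc', hS, frameSym, Matrix.transpose_mul]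
    simp only [mul_assoc]
  rw [hfs, coe_modelFrame, ← hc, ← hu]
  calc c' * S * c'ᵀ = c * rot (U s) (-q.2 s) * (modelRel U q s * S * (modelRel U q s)ᵀ) *
        (rot (U s) (-q.2 s))ᵀ * cᵀ := by
        rw [hcV, Matrix.transpose_mul, Matrix.transpose_mul]; simp only [mul_assoc]
    _ = c * u * Delta (-q.2 s) * (uᴴ * u) * Delta (-(2 • α s)) * (uᵀ * uᴴᵀ) *
        Delta (-q.2 s) * uᵀ * cᵀ := by
        rw [hN1, hrt, hr, hS2]; simp only [mul_assoc]
    _ = c * u * (Delta (-q.2 s) * Delta (-(2 • α s)) * Delta (-q.2 s)) * (c * u)ᵀ := by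
        rw [huu, huut, mul_one, mul_one, Matrix.transpose_mul]; simp only [mul_assoc]
    _ = _ := by
        rw [← Delta_add, ← Delta_add]
        congr 3
        simp only [Pi.add_apply, two_smul]
        abel

theorem lagMat_modelFrame {α : Fin ℓ → Fin n → ℝ} (hU : IsAdapted U α)
    {q : (Fin ℓ → Matrix (Fin n) (Fin n) ℂ) × (Fin ℓ → Fin n → ℝ)} (hq : ∀ s, (q.1 s)ᴴ = -q.1 s)
    (s : Fin ℓ) :
    rot (modelFrame U q.1 hq s) (2 • (α + q.2) s) = modelMat U q s := by
  rw [modelMat, hU.lagMat_eq_rot, ← rot_add, ← rot_add]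
  have h : q.2 s + 2 • α s + q.2 s = 2 • (α + q.2) s := by
    rw [Pi.add_apply, two_smul, two_smul]; abel
  rw [h, rot, rot, conjEquiv_apply, conjEquiv_apply, coe_modelFrame, Matrix.conjTranspose_mul]
  simp only [mul_assoc]

end Model

/-! ### The target of the closing condition -/

section Closing

variable {ℓ n : ℕ} (U : Fin ℓ → Un n)

/-- The tangent space to the Lagrangian Grassmannian at the Lagrangian subspace with frame `u`. -/
def symAt (u : Un n) : Submodule ℝ (Matrix (Fin n) (Fin n) ℂ) :=
  (stdSym n).map (conjEquiv u).toLinearMap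

theorem mem_symAt {u : Un n} {X : Matrix (Fin n) (Fin n) ℂ} : X ∈ symAt u ↔
    Xᴴ = -X ∧ refl ((u : Matrix (Fin n) (Fin n) ℂ) * (u : Matrix (Fin n) (Fin n) ℂ)ᵀ) X = X := by
  obtain ⟨Y, rfl⟩ := (conjEquiv u).surjective X
  rw [conjEquiv_skew_iff, refl_conjEquiv_eq_iff]
  constructor
  · rintro ⟨Z, hZ, h⟩
    rw [← (conjEquiv u).injective h]
    exact hZ
  · exact fun h => ⟨Y, h, rfl⟩

theorem two_mul_finrank_symAt (u : Un n) : 2 * Module.finrank ℝ (symAt u) = n ^ 2 + n := by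
  rw [symAt, LinearEquiv.finrank_map_eq, two_mul_finrank_stdSym]

/-- The imaginary part of the total trace. -/
def traceIm (ℓ n : ℕ) : (Fin ℓ → Matrix (Fin n) (Fin n) ℂ) →ₗ[ℝ] ℝ where
  toFun X := ∑ s, (X s).trace.im
  map_add' X Y := by simp [Finset.sum_add_distrib]
  map_smul' c X := by simp [Finset.mul_sum]

theorem traceIm_apply (X : Fin ℓ → Matrix (Fin n) (Fin n) ℂ) :
    traceIm ℓ n X = ∑ s, (X s).trace.im := rfl

/-- Families of tangent vectors to the Lagrangian Grassmannian at `L_{s+1}` with total trace `0`. -/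
def closeSub : Submodule ℝ (Fin ℓ → Matrix (Fin n) (Fin n) ℂ) :=
  Submodule.pi Set.univ (fun s => symAt (U (finRotate ℓ s))) ⊓ LinearMap.ker (traceIm ℓ n)

theorem mem_closeSub {D : Fin ℓ → Matrix (Fin n) (Fin n) ℂ} :
    D ∈ closeSub U ↔ (∀ s, (D s)ᴴ = -D s ∧ refl (frameSym U (finRotate ℓ s)) (D s) = D s) ∧
      traceIm ℓ n D = 0 := by
  rw [closeSub, Submodule.mem_inf, Submodule.mem_pi, LinearMap.mem_ker]
  simp only [Set.mem_univ, true_imp_iff, mem_symAt]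
  rfl

theorem trace_re_of_skew {X : Matrix (Fin n) (Fin n) ℂ} (hX : Xᴴ = -X) : X.trace.re = 0 := by
  have h1 := congrArg Matrix.trace hX
  rw [Matrix.trace_conjTranspose, Matrix.trace_neg] at h1
  have h2 := congrArg Complex.re h1
  rw [Complex.star_def, Complex.conj_re, Complex.neg_re] at h2
  linarith

theorem I_smul_one_conjTranspose :
    (Complex.I • (1 : Matrix (Fin n) (Fin n) ℂ))ᴴ = -(Complex.I • 1) := by
  rw [Matrix.conjTranspose_smul, Matrix.conjTranspose_one]
  simp

theorem refl_I_smul_one {S : Matrix (Fin n) (Fin n) ℂ} (h : IsSymUnitary S) :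
    refl S (Complex.I • 1) = Complex.I • 1 := by
  rw [refl, Matrix.transpose_smul, Matrix.transpose_one, Matrix.mul_smul, mul_one,
    Matrix.smul_mul, h.mul_star]

theorem trace_I_smul_one :
    (Complex.I • (1 : Matrix (Fin n) (Fin n) ℂ)).trace = (n : ℂ) * Complex.I := by
  rw [Matrix.trace_smul, Matrix.trace_one, Fintype.card_fin, smul_eq_mul, mul_comm]

/-- The family with all entries `i · 1` is tangent and has nonzero total trace, so the trace
condition lowers the dimension by exactly one. -/
theorem two_mul_finrank_closeSub (hℓ : 1 ≤ ℓ) (hn : 1 ≤ n) :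
    2 * Module.finrank ℝ (closeSub U) + 2 = ℓ * (n ^ 2 + n) := by
  obtain ⟨W, hW⟩ : ∃ W, W = Submodule.pi Set.univ fun s => symAt (U (finRotate ℓ s)) := ⟨_, rfl⟩
  have hWr : 2 * Module.finrank ℝ W = ℓ * (n ^ 2 + n) := by
    rw [hW, finrank_submodule_pi, Finset.mul_sum]
    simp only [two_mul_finrank_symAt]
    simp
  let w : Fin ℓ → Matrix (Fin n) (Fin n) ℂ := fun _ => Complex.I • 1
  have hw : w ∈ W := by
    rw [hW, Submodule.mem_pi]
    exact fun s _ => mem_symAt.2 ⟨I_smul_one_conjTranspose,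
      refl_I_smul_one (isSymUnitary_frameSym U (finRotate ℓ s))⟩
  have hτ : traceIm ℓ n w ≠ 0 := by
    have : traceIm ℓ n w = ℓ * n := by
      simp only [traceIm_apply, w, trace_I_smul_one]
      simp
    rw [this]
    positivity
  have h1 : W ⊔ LinearMap.ker (traceIm ℓ n) = ⊤ := by
    rw [eq_top_iff]
    intro x _
    refine Submodule.mem_sup.2 ⟨(traceIm ℓ n x / traceIm ℓ n w) • w, W.smul_mem _ hw,
      x - (traceIm ℓ n x / traceIm ℓ n w) • w, ?_, by abel⟩
    rw [LinearMap.mem_ker, map_sub, map_smul, smul_eq_mul, div_mul_cancel₀ _ hτ, sub_self]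
  have h2 := Submodule.finrank_sup_add_finrank_inf_eq W (LinearMap.ker (traceIm ℓ n))
  have h3 := Module.Dual.finrank_ker_add_one_of_ne_zero (f := traceIm ℓ n)
    (fun h => hτ (by rw [h]; rfl))
  rw [h1, finrank_top, ← h3] at h2
  rw [closeSub, ← hW, ← hWr]
  omega

/-- The normalized trace of the skew-Hermitian parts. -/
def closeMean : (Fin ℓ → Matrix (Fin n) (Fin n) ℂ) →ₗ[ℝ] ℝ where
  toFun X := (n * ℓ : ℝ)⁻¹ * traceIm ℓ n fun s => skewPart (X s)
  map_add' X Y := by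
    rw [← mul_add, ← map_add]
    congr 2
    funext s
    simp only [Pi.add_apply, skewPart, Matrix.conjTranspose_add, ← smul_add]
    congr 1
    abel
  map_smul' c X := by
    rw [RingHom.id_apply, smul_eq_mul, mul_left_comm, ← smul_eq_mul c (traceIm ℓ n _), ← map_smul]
    congr 2
    funext s
    simp only [Pi.smul_apply, skewPart, Matrix.conjTranspose_smul, star_trivial, ← smul_sub]
    rw [smul_comm]

theorem closeMean_apply (X : Fin ℓ → Matrix (Fin n) (Fin n) ℂ) :
    closeMean X = (n * ℓ : ℝ)⁻¹ * traceIm ℓ n fun s => skewPart (X s) := rfl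

theorem skewPart_of_skew {X : Matrix (Fin n) (Fin n) ℂ} (hX : Xᴴ = -X) : skewPart X = X := by
  rw [skewPart, hX, sub_neg_eq_add, ← two_smul ℝ X, smul_smul]
  norm_num

theorem half_symVar_of_refl {S X : Matrix (Fin n) (Fin n) ℂ} (h : refl S X = X) :
    (1 / 2 : ℝ) • symVar S X = X := by
  rw [symVar, h, ← two_smul ℝ X, smul_smul]
  norm_num

theorem skewPart_add (X Y : Matrix (Fin n) (Fin n) ℂ) :
    skewPart (X + Y) = skewPart X + skewPart Y := by
  simp only [skewPart, Matrix.conjTranspose_add, ← smul_add]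
  congr 1
  abel

theorem skewPart_smul (c : ℝ) (X : Matrix (Fin n) (Fin n) ℂ) :
    skewPart (c • X) = c • skewPart X := by
  simp only [skewPart, Matrix.conjTranspose_smul, star_trivial, ← smul_sub]
  rw [smul_comm]

/-- The projection onto `closeSub`. -/
def closeProj (hℓ : 1 ≤ ℓ) (hn : 1 ≤ n) :
    (Fin ℓ → Matrix (Fin n) (Fin n) ℂ) →ₗ[ℝ] closeSub U where
  toFun X := ⟨fun s => (1 / 2 : ℝ) • symVar (frameSym U (finRotate ℓ s)) (skewPart (X s)) -
    closeMean X • (Complex.I • 1), by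
      have hs := fun s => isSymUnitary_frameSym U s
      refine (mem_closeSub U).2 ⟨fun s => ⟨?_, ?_⟩, ?_⟩
      · rw [Matrix.conjTranspose_sub, Matrix.conjTranspose_smul, Matrix.conjTranspose_smul,
          star_trivial, star_trivial, I_smul_one_conjTranspose,
          symVar_conjTranspose (skewPart_conjTranspose _), smul_neg, smul_neg]
        abel
      · rw [refl_sub, refl_smul, refl_smul, refl_symVar (hs _), refl_I_smul_one (hs _)]
      · have h1 : ∀ s, (symVar (frameSym U (finRotate ℓ s)) (skewPart (X s))).trace
            = 2 * (skewPart (X s)).trace := fun s => by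
          rw [symVar, Matrix.trace_add, trace_refl (hs _), two_mul]
        simp only [traceIm_apply, Matrix.trace_sub, Matrix.trace_smul, h1,
          Complex.sub_im, Complex.smul_im, closeMean_apply, Finset.sum_sub_distrib]
        have hn' : (n : ℝ) ≠ 0 := by positivity
        have hℓ' : (ℓ : ℝ) ≠ 0 := by positivity
        simp
        field_simp
        rw [sub_self, mul_zero]⟩
  map_add' X Y := by
    refine Subtype.ext (funext fun s => ?_)
    simp only [Pi.add_apply, skewPart_add, symVar_add, map_add, add_smul, smul_add,
      Submodule.coe_add]
    abel
  map_smul' c X := by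
    refine Subtype.ext (funext fun s => ?_)
    simp only [Pi.smul_apply, skewPart_smul, symVar_smul, map_smul, RingHom.id_apply,
      Submodule.coe_smul, smul_sub, smul_assoc]
    rw [smul_comm]

variable (hℓ : 1 ≤ ℓ) (hn : 1 ≤ n)

theorem closeProj_apply (X : Fin ℓ → Matrix (Fin n) (Fin n) ℂ) (s : Fin ℓ) :
    (closeProj U hℓ hn X : Fin ℓ → Matrix (Fin n) (Fin n) ℂ) s
      = (1 / 2 : ℝ) • symVar (frameSym U (finRotate ℓ s)) (skewPart (X s)) -
        closeMean X • (Complex.I • 1) := rfl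

theorem refl_conjTranspose_comm {S : Matrix (Fin n) (Fin n) ℂ} (X : Matrix (Fin n) (Fin n) ℂ) :
    refl S Xᴴ = (refl S X)ᴴ := by
  simp only [refl, Matrix.conjTranspose_mul, Matrix.conjTranspose_conjTranspose, mul_assoc]
  rfl

/-- On families fixed by the reflections the projection loses only a common imaginary scalar in the
skew-Hermitian parts. -/
theorem skewPart_eq_of_closeProj_eq_zero {X : Fin ℓ → Matrix (Fin n) (Fin n) ℂ}
    (hX : ∀ s, refl (frameSym U (finRotate ℓ s)) (X s) = X s) (h : closeProj U hℓ hn X = 0)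
    (s : Fin ℓ) : skewPart (X s) = closeMean X • (Complex.I • 1) := by
  have h1 := closeProj_apply U hℓ hn X s
  rw [h, half_symVar_of_refl] at h1
  · exact (sub_eq_zero.1 h1.symm)
  · rw [skewPart, refl_smul, refl_sub, refl_conjTranspose_comm, hX]

theorem closeProj_of_mem {D : Fin ℓ → Matrix (Fin n) (Fin n) ℂ} (hD : D ∈ closeSub U) :
    closeProj U hℓ hn D = ⟨D, hD⟩ := by
  obtain ⟨h1, h2⟩ := (mem_closeSub U).1 hD
  refine Subtype.ext (funext fun s => ?_)
  have h3 : closeMean D = 0 := by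
    rw [closeMean_apply]
    simp only [fun s => skewPart_of_skew (h1 s).1]
    rw [h2, mul_zero]
  rw [closeProj_apply, skewPart_of_skew (h1 s).1, half_symVar_of_refl (h1 s).2, h3, zero_smul,
    sub_zero]

/-! ### The closing condition up to scalars implies the closing condition -/

theorem modelRel_star_mul {q : (Fin ℓ → Matrix (Fin n) (Fin n) ℂ) × (Fin ℓ → Fin n → ℝ)}
    (hq : ∀ s, (q.1 s)ᴴ = -q.1 s) (s : Fin ℓ) : (modelRel U q s)ᴴ * modelRel U q s = 1 := by
  have h1 := mul_eq_one_comm.1 (cay_star_mul (hq s))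
  rw [modelRel, Matrix.conjTranspose_mul, Matrix.conjTranspose_mul,
    Matrix.conjTranspose_conjTranspose, rot_conjTranspose]
  calc _ = (cay (q.1 (finRotate ℓ s)))ᴴ * (cay (q.1 s) * (rot (U s) (-q.2 s) * rot (U s) (q.2 s)) *
        (cay (q.1 s))ᴴ) * cay (q.1 (finRotate ℓ s)) := by simp only [mul_assoc]
    _ = 1 := by rw [rot_neg_mul, mul_one, h1, mul_one, cay_star_mul (hq _)]

theorem modelSym_star_mul {q : (Fin ℓ → Matrix (Fin n) (Fin n) ℂ) × (Fin ℓ → Fin n → ℝ)}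
    (hq : ∀ s, (q.1 s)ᴴ = -q.1 s) (s : Fin ℓ) : (modelSym U q s)ᴴ * modelSym U q s = 1 := by
  have hS := isSymUnitary_frameSym U (finRotate ℓ s)
  have h1 := modelRel_star_mul U hq s
  rw [modelSym, Matrix.conjTranspose_mul, ← refl_conjTranspose_comm]
  calc _ = refl (frameSym U (finRotate ℓ s)) (modelRel U q s)ᴴ *
        ((modelRel U q s)ᴴ * modelRel U q s) *
        refl (frameSym U (finRotate ℓ s)) (modelRel U q s) := by simp only [mul_assoc]
    _ = 1 := by rw [h1, mul_one, ← refl_mul hS, mul_eq_one_comm.1 h1, refl_one hS]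

theorem refl_modelSym (q : (Fin ℓ → Matrix (Fin n) (Fin n) ℂ) × (Fin ℓ → Fin n → ℝ)) (s : Fin ℓ) :
    refl (frameSym U (finRotate ℓ s)) (modelSym U q s) = modelSym U q s := by
  have hS := isSymUnitary_frameSym U (finRotate ℓ s)
  rw [modelSym, refl_mul hS, refl_refl hS]

theorem det_rot (u : Un n) (t : Fin n → ℝ) :
    (rot u t).det = Complex.exp (Real.pi * Complex.I * ((∑ j, t j : ℝ) : ℂ)) := by
  rw [rot, conjEquiv_apply, Matrix.det_mul_right_comm, Un.mul_star_self, one_mul, Delta,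
    Matrix.det_diagonal, ← Complex.exp_sum, Complex.ofReal_sum, Finset.mul_sum]

/-- The determinants of the Cayley factors cancel around the cycle and those of the rotations
multiply to `1` by constancy of the index. This is the one redundancy of the closing equations, and
it justifies imposing them only modulo the total trace. -/
theorem prod_det_modelSym {q : (Fin ℓ → Matrix (Fin n) (Fin n) ℂ) × (Fin ℓ → Fin n → ℝ)}
    (hq : ∀ s, (q.1 s)ᴴ = -q.1 s) (ht : ∑ s, ∑ j, q.2 s j = 0) :
    ∏ s, (modelSym U q s).det = 1 := by
  have h1 : ∀ s, (modelSym U q s).det = (modelRel U q s).det ^ 2 := by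
    intro s
    have hS := isSymUnitary_frameSym U (finRotate ℓ s)
    rw [modelSym, Matrix.det_mul, refl, Matrix.det_mul_right_comm, hS.mul_star, one_mul,
      Matrix.det_transpose, sq]
  have h2 : ∏ s, (modelRel U q s).det = 1 := by
    simp only [modelRel, Matrix.det_mul, det_rot, Finset.prod_mul_distrib]
    rw [Equiv.prod_comp (finRotate ℓ) (fun s => (cay (q.1 s)).det), mul_assoc,
      ← Finset.prod_mul_distrib, ← Complex.exp_sum, ← Finset.mul_sum, ← Complex.ofReal_sum, ht]
    rw [Finset.prod_eq_one fun s _ => by rw [← Matrix.det_mul, cay_star_mul (hq s), Matrix.det_one]]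
    simp
  simp only [h1]
  rw [Finset.prod_pow, h2, one_pow]

/-- If the projected defect vanishes, each defect `N` is unitary with `N - Nᴴ = 2μi` for one real
`μ`, so it satisfies a quadratic equation with roots `r` near `1` and `r'` near `-1`. Close to the
base point `N - r'` is invertible, hence `N = r` for every `s`; the determinant identity gives `r ^
(nℓ) = 1`, and `r` near `1` must equal `1`. -/
theorem eventually_modelSym_eq_one :
    ∀ᶠ q in 𝓝 (0 : (Fin ℓ → Matrix (Fin n) (Fin n) ℂ) × (Fin ℓ → Fin n → ℝ)),
      (∀ s, (q.1 s)ᴴ = -q.1 s) → ∑ s, ∑ j, q.2 s j = 0 → closeProj U hℓ hn (modelSym U q) = 0 →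
        ∀ s, modelSym U q s = 1 := by
  let μ : (Fin ℓ → Matrix (Fin n) (Fin n) ℂ) × (Fin ℓ → Fin n → ℝ) → ℝ :=
    fun q => closeMean (modelSym U q)
  have hNc : ∀ s, ContinuousAt (fun q => modelSym U q s) 0 := fun s =>
    (contDiffAt_modelSym (k := 1) U s).continuousAt
  have hμc : ContinuousAt μ 0 :=
    (LinearMap.toContinuousLinearMap (closeMean (ℓ := ℓ) (n := n))).continuous.continuousAt.comp
      (continuousAt_pi.2 hNc)
  have hμ0 : μ 0 = 0 := by
    change closeMean (fun s => modelSym U 0 s) = 0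
    simp only [modelSym_zero, closeMean_apply, skewPart, Matrix.conjTranspose_one, sub_self,
      smul_zero]
    rw [show (fun _ : Fin ℓ => (0 : Matrix (Fin n) (Fin n) ℂ)) = 0 from rfl, map_zero, mul_zero]
  let r : (Fin ℓ → Matrix (Fin n) (Fin n) ℂ) × (Fin ℓ → Fin n → ℝ) → ℂ :=
    fun q => (Real.sqrt (1 - μ q ^ 2) : ℂ) + μ q * Complex.I
  let r' : (Fin ℓ → Matrix (Fin n) (Fin n) ℂ) × (Fin ℓ → Fin n → ℝ) → ℂ :=
    fun q => -(Real.sqrt (1 - μ q ^ 2) : ℂ) + μ q * Complex.I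
  have hsq : ContinuousAt (fun q => (Real.sqrt (1 - μ q ^ 2) : ℂ)) 0 :=
    Complex.continuous_ofReal.continuousAt.comp
      (Real.continuous_sqrt.continuousAt.comp (continuousAt_const.sub (hμc.pow 2)))
  have hμI : ContinuousAt (fun q => (μ q : ℂ) * Complex.I) 0 :=
    (Complex.continuous_ofReal.continuousAt.comp hμc).mul continuousAt_const
  have hrc : ContinuousAt r 0 := hsq.add hμI
  have hrc' : ContinuousAt r' 0 := hsq.neg.add hμI
  have hr0 : r 0 = 1 := by simp [r, hμ0]
  have hr0' : r' 0 = -1 := by simp [r', hμ0]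
  have h1 : ∀ s, ∀ᶠ q in 𝓝 0, IsUnit (modelSym U q s - r' q • 1) := by
    intro s
    have hc : ContinuousAt (fun q => modelSym U q s - r' q • (1 : Matrix (Fin n) (Fin n) ℂ)) 0 :=
      (hNc s).sub (hrc'.smul continuousAt_const)
    refine hc.eventually (Units.isOpen.mem_nhds ?_)
    change IsUnit (modelSym U 0 s - r' 0 • (1 : Matrix (Fin n) (Fin n) ℂ))
    rw [modelSym_zero, hr0', neg_smul, one_smul, sub_neg_eq_add, ← two_smul ℂ]
    exact isUnit_one.smul (Units.mk0 (2 : ℂ) (by norm_num))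
  have h2 : ∀ᶠ q in 𝓝 0, μ q ^ 2 < 1 :=
    (hμc.pow 2).eventually_lt_const (by rw [Pi.pow_apply, hμ0]; norm_num)
  -- The geometric sum is near `nℓ`, so among the `nℓ`-th roots of unity only `1` is possible.
  have h3 : ∀ᶠ q in 𝓝 0, ∑ i ∈ Finset.range (n * ℓ), r q ^ i ≠ 0 := by
    have hc : ContinuousAt (fun q => ∑ i ∈ Finset.range (n * ℓ), r q ^ i) 0 :=
      tendsto_finsetSum _ fun i _ => hrc.pow i
    refine hc.eventually_ne ?_
    rw [hr0]
    simp
    omega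
  filter_upwards [Filter.eventually_all.2 h1, h2, h3] with q hu hμq hgs hq ht h0
  have hs : ∀ s, modelSym U q s = r q • 1 := by
    intro s
    have hsk := skewPart_eq_of_closeProj_eq_zero U hℓ hn (refl_modelSym U q) h0 s
    obtain ⟨N, hN⟩ : ∃ N, N = modelSym U q s := ⟨_, rfl⟩
    have hNN : Nᴴ * N = 1 := hN ▸ modelSym_star_mul U hq s
    rw [← hN] at hsk ⊢
    have hsum : r q + r' q = 2 * (μ q * Complex.I) := by simp only [r, r']; ring
    have hprod : r q * r' q = -1 := by
      have h4 : (Real.sqrt (1 - μ q ^ 2) : ℂ) ^ 2 = 1 - (μ q : ℂ) ^ 2 := by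
        rw [← Complex.ofReal_pow, Real.sq_sqrt (by linarith)]
        push_cast
        rfl
      simp only [r, r']
      linear_combination -h4 + (μ q : ℂ) ^ 2 * Complex.I_sq
    have h5 : N - Nᴴ = (2 * (μ q * Complex.I)) • (1 : Matrix (Fin n) (Fin n) ℂ) := by
      have h6 : N - Nᴴ = (2 : ℝ) • skewPart N := by
        rw [skewPart, smul_smul]; norm_num
      rw [h6, hsk]
      ext i j
      simp only [Matrix.smul_apply, Complex.real_smul, smul_eq_mul]
      push_cast
      ring
    have h7 : (N - r' q • 1) * (N - r q • 1) = 0 := by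
      have h8 : (N - Nᴴ) * N = (2 * (μ q * Complex.I)) • N := by
        rw [h5, Matrix.smul_mul, one_mul]
      rw [sub_mul, hNN, ← hsum, add_smul] at h8
      have h9 : (N - r' q • 1) * (N - r q • 1)
          = N * N - (r q • N + r' q • N) + (r q * r' q) • 1 := by
        simp only [sub_mul, mul_sub, Matrix.smul_mul, Matrix.mul_smul, one_mul, mul_one, smul_smul]
        abel
      rw [h9, ← h8, hprod, neg_smul, one_smul]
      abel
    exact sub_eq_zero.1 ((hN ▸ hu s).mul_right_eq_zero.1 h7)
  have hdet := prod_det_modelSym U hq ht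
  simp only [hs, Matrix.det_smul, Matrix.det_one, mul_one, Fintype.card_fin, Finset.prod_const,
    Finset.card_univ] at hdet
  rw [← pow_mul] at hdet
  have hgeom := mul_geom_sum (r q) (n * ℓ)
  rw [hdet, sub_self] at hgeom
  intro s
  rw [hs, sub_eq_zero.1 ((mul_eq_zero.1 hgeom).resolve_right hgs), one_smul]

end Closing

/-! ### Infinitesimal gauge transformations -/

/-- Infinitesimal automorphisms of the Lagrangian subspace with frame `u` commuting with
`rot u (2 • α)`. -/
def gaugeAt {n : ℕ} (u : Un n) (α : Fin n → ℝ) : Submodule ℝ (Matrix (Fin n) (Fin n) ℂ) :=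
  (stdGauge α).map (conjEquiv u).toLinearMap

theorem mem_gaugeAt {n : ℕ} {u : Un n} {α : Fin n → ℝ} (h0 : ∀ j, 0 ≤ α j) (h1 : ∀ j, α j < 1)
    {X : Matrix (Fin n) (Fin n) ℂ} : X ∈ gaugeAt u α ↔
      Xᴴ = -X ∧ refl ((u : Matrix (Fin n) (Fin n) ℂ) * (u : Matrix (Fin n) (Fin n) ℂ)ᵀ) X = -X ∧
        X * rot u (2 • α) = rot u (2 • α) * X := by
  obtain ⟨Y, rfl⟩ := (conjEquiv u).surjective X
  rw [conjEquiv_skew_iff, refl_conjEquiv_eq_neg_iff, rot, ← conjEquiv_mul, ← conjEquiv_mul,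
    EmbeddingLike.apply_eq_iff_eq, commute_Delta_iff h0 h1]
  constructor
  · rintro ⟨Z, hZ, h⟩
    rw [← (conjEquiv u).injective h]
    exact hZ
  · exact fun h => ⟨Y, h, rfl⟩

section Gauge

variable {ℓ n : ℕ} (U : Fin ℓ → Un n) (α : Fin ℓ → Fin n → ℝ)

/-- Families of skew-Hermitian matrices. -/
def skewFam (ℓ n : ℕ) : Submodule ℝ (Fin ℓ → Matrix (Fin n) (Fin n) ℂ) :=
  Submodule.pi Set.univ fun _ => skewSub n

theorem mem_skewFam {p : Fin ℓ → Matrix (Fin n) (Fin n) ℂ} :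
    p ∈ skewFam ℓ n ↔ ∀ s, (p s)ᴴ = -p s := by
  simp [skewFam, Submodule.mem_pi, mem_skewSub]

theorem finrank_skewFam : Module.finrank ℝ (skewFam ℓ n) = ℓ * n ^ 2 := by
  rw [skewFam, finrank_submodule_pi]
  simp [finrank_skewSub]

/-- Constant families. -/
def constFam (ℓ n : ℕ) :
    Matrix (Fin n) (Fin n) ℂ →ₗ[ℝ] (Fin ℓ → Matrix (Fin n) (Fin n) ℂ) where
  toFun X _ := X
  map_add' _ _ := rfl
  map_smul' _ _ := rfl

/-- Infinitesimal gauge transformations: conjugations and changes of frames. -/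
def gaugeSub : Submodule ℝ (Fin ℓ → Matrix (Fin n) (Fin n) ℂ) :=
  (skewSub n).map (constFam ℓ n) ⊔ Submodule.pi Set.univ fun s => gaugeAt (U s) (α s)

theorem mem_gaugeSub {p : Fin ℓ → Matrix (Fin n) (Fin n) ℂ} :
    p ∈ gaugeSub U α ↔ ∃ Y, Yᴴ = -Y ∧ ∀ s, p s - Y ∈ gaugeAt (U s) (α s) := by
  rw [gaugeSub, Submodule.mem_sup]
  constructor
  · rintro ⟨_, ⟨Y, hY, rfl⟩, κ, hκ, rfl⟩
    refine ⟨Y, hY, fun s => ?_⟩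
    have := (Submodule.mem_pi.1 hκ) s (Set.mem_univ s)
    simpa [constFam] using this
  · rintro ⟨Y, hY, h⟩
    refine ⟨_, ⟨Y, hY, rfl⟩, fun s => p s - Y, ?_, ?_⟩
    · exact Submodule.mem_pi.2 fun s _ => h s
    · funext s
      simp [constFam]

variable {U α}

theorem IsAdapted.mem_gaugeAt (hU : IsAdapted U α) {s : Fin ℓ} {X : Matrix (Fin n) (Fin n) ℂ} :
    X ∈ gaugeAt (U s) (α s) ↔ Xᴴ = -X ∧ refl (frameSym U s) X = -X ∧
      X * lagMat (frameSym U) s = lagMat (frameSym U) s * X := by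
  rw [LagRep.mem_gaugeAt (hU.nonneg s) (hU.lt_one s), hU.lagMat_eq_rot]
  rfl

theorem gaugeSub_le_skewFam (hU : IsAdapted U α) : gaugeSub U α ≤ skewFam ℓ n := by
  intro p hp
  obtain ⟨Y, hY, h⟩ := (mem_gaugeSub U α).1 hp
  rw [mem_skewFam]
  intro s
  have h1 := (hU.mem_gaugeAt.1 (h s)).1
  rw [Matrix.conjTranspose_sub, hY] at h1
  rw [sub_neg_eq_add] at h1
  rw [eq_sub_of_add_eq h1]
  abel

/-- A constant family drops out of the differences, and a stabilizer of `L_s` commuting with `A_s`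
also stabilizes `L_{s+1}`. Hence surjectivity of the linearized closing map passes to any complement
of the gauge directions. -/
theorem symDiff_of_mem_gaugeSub (hU : IsAdapted U α) {p : Fin ℓ → Matrix (Fin n) (Fin n) ℂ}
    (hp : p ∈ gaugeSub U α) : symDiff (frameSym U) p = 0 := by
  obtain ⟨Y, -, h⟩ := (mem_gaugeSub U α).1 hp
  have h1 := fun s => hU.mem_gaugeAt.1 (h s)
  funext s
  rw [symDiff_apply, ← sub_sub_sub_cancel_right _ _ Y, symVar_sub, symVar, symVar, (h1 _).2.1,
    refl_next_of_commute (isSymUnitary_frameSym U) s (h1 s).2.2, (h1 s).2.1]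
  simp

/-- The sum of conjugations and frame changes is direct: a matrix in both commutes with all `A_s`,
so it is a scalar, which every reflection fixes and must also negate. -/
theorem finrank_gaugeSub (hℓ : 1 ≤ ℓ) (hn : 1 ≤ n) (hU : IsAdapted U α)
    (hA : Submodule.span ℂ (Set.range (wordProd (lagMat (frameSym U)))) = ⊤) :
    Module.finrank ℝ (gaugeSub U α) = n ^ 2 + ∑ s, Module.finrank ℝ (stdGauge (α s)) := by
  have h1 : Function.Injective (constFam ℓ n) := fun X Y h => congrFun h ⟨0, hℓ⟩
  have h2 : (skewSub n).map (constFam ℓ n) ⊓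
      (Submodule.pi Set.univ fun s => gaugeAt (U s) (α s)) = ⊥ := by
    rw [eq_bot_iff]
    rintro _ ⟨⟨Y, hY, rfl⟩, hY'⟩
    have h3 : ∀ s, Yᴴ = -Y ∧ refl (frameSym U s) Y = -Y ∧
        Y * lagMat (frameSym U) s = lagMat (frameSym U) s * Y := fun s =>
      hU.mem_gaugeAt.1 ((Submodule.mem_pi.1 hY') s (Set.mem_univ s))
    obtain ⟨c, rfl⟩ := scalar_of_commute hA fun s => (h3 s).2.2
    have h4 := (h3 ⟨0, hℓ⟩).2.1
    rw [refl, Matrix.transpose_smul, Matrix.transpose_one, Matrix.mul_smul, mul_one,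
      Matrix.smul_mul, (isSymUnitary_frameSym U _).mul_star] at h4
    have h5 := congrFun (congrFun h4 ⟨0, hn⟩) ⟨0, hn⟩
    rw [Matrix.neg_apply, Matrix.smul_apply, Matrix.one_apply_eq, smul_eq_mul, mul_one,
      self_eq_neg] at h5
    rw [h5, zero_smul, map_zero]
    exact Submodule.zero_mem _
  have h3 := Submodule.finrank_sup_add_finrank_inf_eq ((skewSub n).map (constFam ℓ n))
    (Submodule.pi Set.univ fun s => gaugeAt (U s) (α s))
  rw [h2, finrank_bot, add_zero, finrank_submodule_pi,
    (Submodule.equivMapOfInjective _ h1 (skewSub n)).finrank_eq.symm, finrank_skewSub] at h3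
  rw [gaugeSub, h3]
  congr 1
  exact Finset.sum_congr rfl fun s _ => LinearEquiv.finrank_map_eq _ _

/-- A complement in all families of matrices is cut down to skew-Hermitian families by the modular
law. -/
theorem exists_gauge_complement (hU : IsAdapted U α) :
    ∃ C ≤ skewFam ℓ n, C ⊓ gaugeSub U α = ⊥ ∧ gaugeSub U α ⊔ C = skewFam ℓ n := by
  obtain ⟨C, hC⟩ := exists_isCompl (gaugeSub U α)
  refine ⟨C ⊓ skewFam ℓ n, inf_le_right, ?_, ?_⟩
  · rw [eq_bot_iff, ← hC.inf_eq_bot, inf_comm]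
    exact inf_le_inf_left _ inf_le_left
  · rw [← sup_inf_assoc_of_le _ (gaugeSub_le_skewFam hU), hC.sup_eq_top, top_inf_eq]

theorem finrank_complement (hℓ : 1 ≤ ℓ) (hn : 1 ≤ n) (hU : IsAdapted U α)
    (hA : Submodule.span ℂ (Set.range (wordProd (lagMat (frameSym U)))) = ⊤)
    {C : Submodule ℝ (Fin ℓ → Matrix (Fin n) (Fin n) ℂ)} (hC : C ⊓ gaugeSub U α = ⊥)
    (hC' : gaugeSub U α ⊔ C = skewFam ℓ n) :
    Module.finrank ℝ C + (n ^ 2 + ∑ s, Module.finrank ℝ (stdGauge (α s))) = ℓ * n ^ 2 := by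
  have h := Submodule.finrank_sup_add_finrank_inf_eq (gaugeSub U α) C
  rw [hC', inf_comm, hC, finrank_bot, finrank_skewFam, finrank_gaugeSub hℓ hn hU hA] at h
  omega

/-! ### The derivatives of the local model -/

/-- Variations of the spectra which fix the index. -/
def specSub (ℓ n : ℕ) : Submodule ℝ (Fin ℓ → Fin n → ℝ) where
  carrier := {t | ∑ s, ∑ j, t s j = 0}
  add_mem' {t t'} ht ht' := by
    have h1 : ∑ s, ∑ j, t s j = 0 := ht
    have h2 : ∑ s, ∑ j, t' s j = 0 := ht'
    change ∑ s, ∑ j, (t s j + t' s j) = 0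
    simp only [Finset.sum_add_distrib, h1, h2, add_zero]
  zero_mem' := by simp
  smul_mem' c t ht := by
    have h1 : ∑ s, ∑ j, t s j = 0 := ht
    change ∑ s, ∑ j, c * t s j = 0
    simp only [← Finset.mul_sum, h1, mul_zero]

variable (C : Submodule ℝ (Fin ℓ → Matrix (Fin n) (Fin n) ℂ))

/-- The inclusion of the parameter space of the local model. -/
def modelIncl : C × specSub ℓ n →L[ℝ]
    (Fin ℓ → Matrix (Fin n) (Fin n) ℂ) × (Fin ℓ → Fin n → ℝ) :=
  C.subtypeL.prodMap (specSub ℓ n).subtypeL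

variable (U)

/-- The closing condition in the local model. -/
def modelClose (hℓ : 1 ≤ ℓ) (hn : 1 ≤ n) (v : C × specSub ℓ n) : closeSub U :=
  closeProj U hℓ hn (modelSym U (modelIncl C v))

/-- The matrix entries in the local model. -/
def modelCoords (v : C × specSub ℓ n) : Fin ℓ → Fin n → Fin n → ℂ :=
  fun s i j => modelMat U (modelIncl C v) s i j

/-- The traces of words. -/
def wordTrace (w : List (Fin ℓ) × Bool) (c : Fin ℓ → Fin n → Fin n → ℂ) : ℝ :=
  bif w.2 then (wordProd (fun s => Matrix.of (c s)) w.1).trace.re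
    else (wordProd (fun s => Matrix.of (c s)) w.1).trace.im

variable {U}

theorem contDiffAt_comp_modelIncl {F : Type*} [NormedAddCommGroup F] [NormedSpace ℝ F]
    {f : (Fin ℓ → Matrix (Fin n) (Fin n) ℂ) × (Fin ℓ → Fin n → ℝ) → F} {k : WithTop ℕ∞}
    (hf : ContDiffAt ℝ k f 0) : ContDiffAt ℝ k (fun v => f (modelIncl C v)) 0 :=
  ContDiffAt.comp (g := f) (0 : C × specSub ℓ n) (by rwa [map_zero])
    (modelIncl C).contDiff.contDiffAt

theorem contDiffAt_modelClose (hℓ : 1 ≤ ℓ) (hn : 1 ≤ n) {k : WithTop ℕ∞} :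
    ContDiffAt ℝ k (modelClose U C hℓ hn) 0 :=
  (LinearMap.toContinuousLinearMap (closeProj U hℓ hn)).contDiff.contDiffAt.comp _
    (contDiffAt_comp_modelIncl C (contDiffAt_pi.2 fun s => contDiffAt_modelSym U s))

theorem contDiffAt_modelCoords {k : WithTop ℕ∞} : ContDiffAt ℝ k (modelCoords U C) 0 :=
  contDiffAt_pi.2 fun s => contDiffAt_pi.2 fun i => contDiffAt_pi.2 fun j =>
    (entryCLM i j).contDiff.contDiffAt.comp _
      (contDiffAt_comp_modelIncl C (contDiffAt_modelMat U s))

theorem contDiff_matrix_of {k : WithTop ℕ∞} :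
    ContDiff ℝ k (fun c : Fin n → Fin n → ℂ => (Matrix.of c : Matrix (Fin n) (Fin n) ℂ)) := by
  have h : (fun c : Fin n → Fin n → ℂ => (Matrix.of c : Matrix (Fin n) (Fin n) ℂ))
      = fun c => ∑ i, ∑ j, singleCLM i j (c i j) := by
    funext c
    exact (sum_singleCLM (Matrix.of c)).symm
  rw [h]
  exact ContDiff.sum fun i _ => ContDiff.sum fun j _ =>
    (singleCLM i j).contDiff.comp (by fun_prop)

theorem contDiff_wordProd {k : WithTop ℕ∞} (w : List (Fin ℓ)) :
    ContDiff ℝ k (fun c : Fin ℓ → Fin n → Fin n → ℂ => wordProd (fun s => Matrix.of (c s)) w) := by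
  induction w with
  | nil => exact contDiff_const
  | cons s w ih =>
    simp only [wordProd_cons]
    exact (contDiff_matrix_of.comp (contDiff_apply ℝ _ s)).mul ih

theorem contDiff_wordTrace (w : List (Fin ℓ) × Bool) {k : WithTop ℕ∞} :
    ContDiff ℝ k (wordTrace (n := n) w) := by
  have h := (traceCLM n).contDiff.comp (contDiff_wordProd (n := n) (k := k) w.1)
  obtain ⟨w, b⟩ := w
  cases b
  · exact Complex.imCLM.contDiff.comp h
  · exact Complex.reCLM.contDiff.comp h

theorem wordTrace_eq_of_equiv (w : List (Fin ℓ) × Bool) {ρ ρ' : HomU ℓ n} (h : ρ ≈ ρ') :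
    wordTrace w (coords ρ) = wordTrace w (coords ρ') := by
  obtain ⟨g, hg⟩ := h
  have h1 : ∀ s, genMat ρ' s = conjEquiv g (genMat ρ s) := fun s => by
    simp only [genMat, hg]
    rfl
  have h2 : ∀ w, wordProd (genMat ρ') w = conjEquiv g (wordProd (genMat ρ) w) := by
    intro w
    induction w with
    | nil => rw [wordProd_nil, wordProd_nil, conjEquiv_one]
    | cons s w ih => rw [wordProd_cons, wordProd_cons, conjEquiv_mul, ih, h1]
  have h3 : (wordProd (genMat ρ) w.1).trace = (wordProd (genMat ρ') w.1).trace := by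
    rw [h2, conjEquiv_trace]
  change (bif w.2 then (wordProd (genMat ρ) w.1).trace.re else (wordProd (genMat ρ) w.1).trace.im)
    = (bif w.2 then (wordProd (genMat ρ') w.1).trace.re else (wordProd (genMat ρ') w.1).trace.im)
  rw [h3]

variable {C}

theorem fderiv_modelClose (hC : C ≤ skewFam ℓ n) (hℓ : 1 ≤ ℓ) (hn : 1 ≤ n) (v : C × specSub ℓ n) :
    fderiv ℝ (modelClose U C hℓ hn) 0 v = closeProj U hℓ hn fun s =>
      symVar (frameSym U (finRotate ℓ s))
        (v.1.1 (finRotate ℓ s) - v.1.1 s + rotVar (U s) (v.2.1 s)) := by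
  refine fderiv_eq_of_hasDerivAt_smul
    ((contDiffAt_modelClose (k := 1) C hℓ hn).differentiableAt (by simp)) ?_
  have h1 := hasDerivAt_pi.2 fun s =>
    hasDerivAt_modelSym (U := U) (q := modelIncl C v) (mem_skewFam.1 (hC v.1.2)) s
  have h2 := (LinearMap.toContinuousLinearMap (closeProj U hℓ hn)).hasFDerivAt.comp_hasDerivAt _ h1
  refine h2.congr_of_eventuallyEq (Filter.Eventually.of_forall fun τ => ?_)
  simp only [modelClose, map_smul]
  rfl

theorem fderiv_wordTrace (hU : IsAdapted U α) (hC : C ≤ skewFam ℓ n) (w : List (Fin ℓ))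
    (v : C × specSub ℓ n)
    (h : ∀ b, fderiv ℝ (wordTrace (w, b) ∘ modelCoords U C) 0 v = 0) :
    (wordVar (lagMat (frameSym U)) (fun s => v.1.1 s * lagMat (frameSym U) s -
      lagMat (frameSym U) s * v.1.1 s + (2 : ℂ) • rotVar (U s) (v.2.1 s) *
        lagMat (frameSym U) s) w).trace = 0 := by
  have h1 := hasDerivAt_wordProd (fun s =>
    hasDerivAt_modelMat hU (q := modelIncl C v) (mem_skewFam.1 (hC v.1.2)) s) w
  have h0 : (fun s => modelMat U ((0 : ℝ) • modelIncl C v) s) = lagMat (frameSym U) := by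
    funext s
    rw [zero_smul, modelMat_zero]
  have h0' : modelMat U ((0 : ℝ) • modelIncl C v) = lagMat (frameSym U) := h0
  rw [h0'] at h1
  have h2 := (traceCLM n).hasFDerivAt.comp_hasDerivAt _ h1
  have hd : ∀ b, DifferentiableAt ℝ (wordTrace (w, b) ∘ modelCoords U C) 0 := fun b =>
    ((contDiff_wordTrace (n := n) (k := 1) (w, b)).contDiffAt.comp _
      (contDiffAt_modelCoords C)).differentiableAt (by simp)
  have hre := fderiv_eq_of_hasDerivAt_smul (hd true) (v := v)
    (w := ((wordVar (lagMat (frameSym U)) (fun s => v.1.1 s * lagMat (frameSym U) s -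
      lagMat (frameSym U) s * v.1.1 s + (2 : ℂ) • rotVar (U s) (v.2.1 s) *
        lagMat (frameSym U) s) w).trace).re) (by
      refine (Complex.reCLM.hasFDerivAt.comp_hasDerivAt _ h2).congr_of_eventuallyEq
        (Filter.Eventually.of_forall fun τ => ?_)
      simp only [Function.comp_apply, wordTrace]
      rfl)
  have him := fderiv_eq_of_hasDerivAt_smul (hd false) (v := v)
    (w := ((wordVar (lagMat (frameSym U)) (fun s => v.1.1 s * lagMat (frameSym U) s -
      lagMat (frameSym U) s * v.1.1 s + (2 : ℂ) • rotVar (U s) (v.2.1 s) *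
        lagMat (frameSym U) s) w).trace).im) (by
      refine (Complex.imCLM.hasFDerivAt.comp_hasDerivAt _ h2).congr_of_eventuallyEq
        (Filter.Eventually.of_forall fun τ => ?_)
      simp only [Function.comp_apply, wordTrace]
      rfl)
  rw [h] at hre him
  exact Complex.ext hre.symm him.symm

/-- A vector in the kernel satisfies the linearized closing condition up to a common scalar and
keeps all traces of words. Rigidity then makes its spectral part zero and its frame part a gauge
direction, which meets `C` only in `0`. -/
theorem eq_zero_of_fderiv_eq_zero (hℓ : 1 ≤ ℓ) (hn : 1 ≤ n) (hU : IsAdapted U α)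
    (hA : Submodule.span ℂ (Set.range (wordProd (lagMat (frameSym U)))) = ⊤)
    (hC : C ≤ skewFam ℓ n) (hCG : C ⊓ gaugeSub U α = ⊥) (v : C × specSub ℓ n)
    (h1 : fderiv ℝ (modelClose U C hℓ hn) 0 v = 0)
    (h2 : ∀ w, fderiv ℝ (wordTrace w ∘ modelCoords U C) 0 v = 0) : v = 0 := by
  rw [fderiv_modelClose hC] at h1
  have hS := isSymUnitary_frameSym U
  have hp := mem_skewFam.1 (hC v.1.2)
  obtain ⟨μ, h3⟩ : ∃ μ : ℝ, ∀ s, symVar (frameSym U (finRotate ℓ s))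
      (v.1.1 (finRotate ℓ s) - v.1.1 s + rotVar (U s) (v.2.1 s)) = μ • (Complex.I • 1) :=
    ⟨_, fun s => (skewPart_of_skew (symVar_conjTranspose (by
      rw [Matrix.conjTranspose_add, Matrix.conjTranspose_sub, hp, hp, rotVar_conjTranspose]
      abel))).symm.trans
        (skewPart_eq_of_closeProj_eq_zero U hℓ hn (fun s => refl_symVar (hS _) _) h1 s)⟩
  obtain ⟨hT, Y, hY, hg⟩ := eq_gauge_of_trace_wordVar hℓ hn hS hA hp
    (T := fun s => rotVar (U s) (v.2.1 s)) (fun s => rotVar_conjTranspose _ _)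
    (fun s => by rw [hU.lagMat_eq_rot, rotVar_commute]) (c := (μ : ℂ) * Complex.I)
    (fun s => by
      rw [h3, ← smul_smul]
      ext i j
      simp only [Matrix.smul_apply, Complex.real_smul, smul_eq_mul])
    (fun w => fderiv_wordTrace hU hC w v fun b => h2 (w, b))
  have ht : v.2 = 0 := Subtype.ext (funext fun s => rotVar_eq_zero (congrFun hT s))
  have hx : v.1.1 ∈ C ⊓ gaugeSub U α := by
    refine ⟨v.1.2, (mem_gaugeSub U α).2 ⟨Y, hY, fun s => hU.mem_gaugeAt.2 ⟨?_, hg s⟩⟩⟩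
    rw [Matrix.conjTranspose_sub, hp, hY]
    abel
  rw [hCG, Submodule.mem_bot] at hx
  exact Prod.ext (Subtype.ext hx) ht

/-- Surjectivity is obtained with the spectra held fixed. This is what makes the spectra free
parameters on the zero set, and so gives local surjectivity of the spectral projection. -/
theorem exists_fderiv_modelClose_eq (hℓ : 1 ≤ ℓ) (hn : 1 ≤ n) (hU : IsAdapted U α)
    (hA : Submodule.span ℂ (Set.range (wordProd (lagMat (frameSym U)))) = ⊤)
    (hC : C ≤ skewFam ℓ n) (hCG : gaugeSub U α ⊔ C = skewFam ℓ n) (D : closeSub U) :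
    ∃ x : C, fderiv ℝ (modelClose U C hℓ hn) 0 (x, 0) = D := by
  obtain ⟨h1, h2⟩ := (mem_closeSub U).1 D.2
  have htr : ∑ s, (D.1 s).trace = 0 := by
    refine Complex.ext ?_ ?_
    · rw [Complex.re_sum, Complex.zero_re]
      exact Finset.sum_eq_zero fun s _ => trace_re_of_skew (h1 s).1
    · rw [Complex.im_sum, Complex.zero_im]
      exact h2
  obtain ⟨p, hp, hpD⟩ := exists_symDiff_eq (isSymUnitary_frameSym U) hA (fun s => (h1 s).1)
    (fun s => (h1 s).2) htr
  have hp' : p ∈ gaugeSub U α ⊔ C := by rw [hCG]; exact mem_skewFam.2 hp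
  obtain ⟨g, hg, x, hx, rfl⟩ := Submodule.mem_sup.1 hp'
  rw [map_add, symDiff_of_mem_gaugeSub hU hg, zero_add] at hpD
  refine ⟨⟨x, hx⟩, ?_⟩
  rw [fderiv_modelClose hC]
  have h3 : (fun s => symVar (frameSym U (finRotate ℓ s))
      (x (finRotate ℓ s) - x s + rotVar (U s) ((0 : specSub ℓ n).1 s))) = D.1 := by
    funext s
    have : rotVar (U s) ((0 : specSub ℓ n).1 s) = 0 := map_zero _
    rw [this, add_zero, ← symDiff_apply, hpD]
  simp only
  rw [h3]
  exact closeProj_of_mem U hℓ hn D.2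

theorem modelClose_zero (hℓ : 1 ≤ ℓ) (hn : 1 ≤ n) : modelClose U C hℓ hn 0 = 0 := by
  have h1 : modelSym U (modelIncl C 0) = fun _ => 1 := by
    funext s
    rw [map_zero, modelSym_zero]
  have h2 : closeMean (fun _ : Fin ℓ => (1 : Matrix (Fin n) (Fin n) ℂ)) = 0 := by
    simp only [closeMean_apply, skewPart, Matrix.conjTranspose_one, sub_self, smul_zero]
    rw [show (fun _ : Fin ℓ => (0 : Matrix (Fin n) (Fin n) ℂ)) = 0 from rfl, map_zero, mul_zero]
  rw [modelClose, h1]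
  refine Subtype.ext (funext fun s => ?_)
  rw [closeProj_apply, h2, zero_smul, sub_zero, skewPart, Matrix.conjTranspose_one, sub_self,
    smul_zero, symVar, refl]
  simp

end Gauge

/-! ### A slice for the gauge action -/

theorem cay_commute {n : ℕ} {X A : Matrix (Fin n) (Fin n) ℂ} (hX : Xᴴ = -X) (h : X * A = A * X) :
    cay X * A = A * cay X := by
  obtain ⟨B, hB⟩ : ∃ B, B = 1 - (1 / 2 : ℝ) • X := ⟨_, rfl⟩
  have hu : IsUnit B := hB ▸ isUnit_one_sub_skew hX (1 / 2)
  have hd := (Matrix.isUnit_iff_isUnit_det B).1 hu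
  have h1 : B * A = A * B := by
    rw [hB, sub_mul, mul_sub, one_mul, mul_one, Matrix.smul_mul, Matrix.mul_smul, h]
  have h2 : B⁻¹ * A = A * B⁻¹ := by
    calc B⁻¹ * A = B⁻¹ * A * (B * B⁻¹) := by rw [Matrix.mul_nonsing_inv B hd, mul_one]
      _ = B⁻¹ * (A * B) * B⁻¹ := by simp only [mul_assoc]
      _ = (B⁻¹ * B) * A * B⁻¹ := by rw [← h1]; simp only [mul_assoc]
      _ = A * B⁻¹ := by rw [Matrix.nonsing_inv_mul B hd, one_mul]
  rw [cay, ← hB, add_mul, mul_add, one_mul, mul_one, mul_assoc, h2, ← mul_assoc, h, mul_assoc]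

/-- Automorphisms of the Lagrangian subspace with symmetric matrix `S` commuting with `A`. -/
structure IsGauge {n : ℕ} (S A k : Matrix (Fin n) (Fin n) ℂ) : Prop where
  star_mul : kᴴ * k = 1
  symm : k * S * kᵀ = S
  commute : k * A = A * k

theorem IsGauge.mul {n : ℕ} {S A k k' : Matrix (Fin n) (Fin n) ℂ} (h : IsGauge S A k)
    (h' : IsGauge S A k') : IsGauge S A (k * k') := by
  refine ⟨?_, ?_, ?_⟩
  · calc (k * k')ᴴ * (k * k') = k'ᴴ * (kᴴ * k) * k' := by
          rw [Matrix.conjTranspose_mul]; simp only [mul_assoc]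
      _ = 1 := by rw [h.star_mul, mul_one, h'.star_mul]
  · calc k * k' * S * (k * k')ᵀ = k * (k' * S * k'ᵀ) * kᵀ := by
          rw [Matrix.transpose_mul]; simp only [mul_assoc]
      _ = S := by rw [h'.symm, h.symm]
  · rw [mul_assoc, h'.commute, ← mul_assoc, h.commute, mul_assoc]

section Slice

variable {ℓ n : ℕ} {U : Fin ℓ → Un n} {α : Fin ℓ → Fin n → ℝ}

theorem isGauge_cay (hU : IsAdapted U α) {s : Fin ℓ} {κ : Matrix (Fin n) (Fin n) ℂ}
    (hκ : κ ∈ gaugeAt (U s) (α s)) :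
    IsGauge (frameSym U s) (lagMat (frameSym U) s) (cay κ) := by
  obtain ⟨h1, h2, h3⟩ := hU.mem_gaugeAt.1 hκ
  exact ⟨cay_star_mul h1, cay_mul_mul_transpose (isSymUnitary_frameSym U s) h1
    (by rw [symVar, h2, add_neg_cancel]), cay_commute h1 h3⟩

/-- The skew-Hermitian parts of a family of matrices. -/
def skewProj (ℓ n : ℕ) : (Fin ℓ → Matrix (Fin n) (Fin n) ℂ) →ₗ[ℝ] skewFam ℓ n where
  toFun X := ⟨fun s => skewPart (X s), mem_skewFam.2 fun _ => skewPart_conjTranspose _⟩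
  map_add' _ _ := Subtype.ext (funext fun _ => skewPart_add _ _)
  map_smul' _ _ := Subtype.ext (funext fun _ => skewPart_smul _ _)

theorem isUnit_two {n : ℕ} : IsUnit ((1 : Matrix (Fin n) (Fin n) ℂ) + 1) := by
  rw [← two_smul ℂ]
  exact isUnit_one.smul (Units.mk0 (2 : ℂ) (by norm_num))

theorem half_two {n : ℕ} : (1 / 2 : ℝ) • ((1 : Matrix (Fin n) (Fin n) ℂ) + 1) = 1 := by
  rw [← two_smul ℝ (1 : Matrix (Fin n) (Fin n) ℂ), smul_smul]
  norm_num

/-- The map `(g, x, κ) ↦ cay g · cay x · cay κ` has derivative `g + x + κ` at the origin, which is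
onto skew-Hermitian families because `C` complements the gauge directions. The implicit function
theorem then covers a neighbourhood of `1`, with `x` as small as desired. -/
theorem eventually_exists_slice (hU : IsAdapted U α)
    {C : Submodule ℝ (Fin ℓ → Matrix (Fin n) (Fin n) ℂ)} (hC : C ≤ skewFam ℓ n)
    (hCG : gaugeSub U α ⊔ C = skewFam ℓ n) {N : Set C} (hN : N ∈ 𝓝 0) :
    ∀ᶠ V in 𝓝 (1 : Fin ℓ → Matrix (Fin n) (Fin n) ℂ), (∀ s, (V s)ᴴ * V s = 1) →
      ∃ x ∈ N, ∃ g : Matrix (Fin n) (Fin n) ℂ, gᴴ * g = 1 ∧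
        ∃ k : Fin ℓ → Matrix (Fin n) (Fin n) ℂ,
          (∀ s, IsGauge (frameSym U s) (lagMat (frameSym U) s) (k s)) ∧
          ∀ s, V s = g * cay (x.1 s) * k s := by
  let Z := skewSub n × C × Submodule.pi Set.univ fun s => gaugeAt (U s) (α s)
  let F : Z → Fin ℓ → Matrix (Fin n) (Fin n) ℂ := fun z s =>
    cay z.1.1 * cay (z.2.1.1 s) * cay (z.2.2.1 s)
  have hF0 : ∀ s, F 0 s = 1 := fun s => by
    change cay 0 * cay 0 * cay 0 = 1
    simp [cay_zero]
  have hc0 : ContDiffAt ℝ 1 (cay (n := n)) 0 := contDiffAt_cay (by simp)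
  have h1 : ContDiffAt ℝ 1 (fun z : Z => cay z.1.1) 0 :=
    ContDiffAt.comp (g := cay) (0 : Z) hc0
      ((skewSub n).subtypeL.contDiff.comp contDiff_fst).contDiffAt
  have h2 : ∀ s, ContDiffAt ℝ 1 (fun z : Z => cay (z.2.1.1 s)) 0 := fun s =>
    ContDiffAt.comp (g := cay) (0 : Z) hc0
      ((contDiff_apply ℝ _ s).comp (C.subtypeL.contDiff.comp
        (contDiff_fst.comp contDiff_snd))).contDiffAt
  have h3 : ∀ s, ContDiffAt ℝ 1 (fun z : Z => cay (z.2.2.1 s)) 0 := fun s =>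
    ContDiffAt.comp (g := cay) (0 : Z) hc0
      ((contDiff_apply ℝ _ s).comp ((Submodule.pi Set.univ fun s =>
        gaugeAt (U s) (α s)).subtypeL.contDiff.comp (contDiff_snd.comp contDiff_snd))).contDiffAt
  have hF : ∀ s, ContDiffAt ℝ 1 (fun z => F z s) 0 := fun s => (h1.mul (h2 s)).mul (h3 s)
  have hI : ∀ s, ContDiffAt ℝ 1 (fun z => cayInv (F z s)) 0 := fun s =>
    ContDiffAt.comp (g := cayInv) (0 : Z)
      (contDiffAt_cayInv (by rw [hF0, half_two]; exact isUnit_one)) (hF s)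
  let P := LinearMap.toContinuousLinearMap (skewProj ℓ n)
  -- The inverse Cayley transform linearizes the target; the projection to skew-Hermitian parts only
  -- serves to land in a fixed vector space, and loses nothing on unitary matrices.
  let G : Z → skewFam ℓ n := fun z => P fun s => cayInv (F z s)
  have hG : ContDiffAt ℝ 1 G 0 := P.contDiff.contDiffAt.comp _ (contDiffAt_pi.2 hI)
  have hskew : ∀ (z : Z), (z.1.1)ᴴ = -z.1.1 ∧ (∀ s, (z.2.1.1 s)ᴴ = -z.2.1.1 s) ∧
      ∀ s, z.2.2.1 s ∈ gaugeAt (U s) (α s) := fun z =>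
    ⟨z.1.2, mem_skewFam.1 (hC z.2.1.2), fun s => (Submodule.mem_pi.1 z.2.2.2) s (Set.mem_univ s)⟩
  have hG' : ∀ z : Z, fderiv ℝ G 0 z = P fun s => z.1.1 + z.2.1.1 s + z.2.2.1 s := by
    intro z
    refine fderiv_eq_of_hasDerivAt_smul (hG.differentiableAt (by simp)) ?_
    have h4 : ∀ s, HasDerivAt (fun τ : ℝ => cayInv (F (τ • z) s))
        (z.1.1 + z.2.1.1 s + z.2.2.1 s) 0 := by
      intro s
      have h5 : HasDerivAt (fun τ : ℝ => F (τ • z) s) (z.1.1 + z.2.1.1 s + z.2.2.1 s) 0 := by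
        refine (((hasDerivAt_cay_smul z.1.1).mul (hasDerivAt_cay_smul (z.2.1.1 s))).mul
          (hasDerivAt_cay_smul (z.2.2.1 s))).congr_deriv ?_
        simp only [zero_smul, cay_zero, one_mul, mul_one, Pi.mul_apply]
      have h6 : HasFDerivAt cayInv (ContinuousLinearMap.id ℝ (Matrix (Fin n) (Fin n) ℂ))
          (F ((0 : ℝ) • z) s) := by
        rw [zero_smul, hF0]
        exact hasStrictFDerivAt_cayInv.hasFDerivAt
      exact h6.comp_hasDerivAt (0 : ℝ) h5
    exact P.hasFDerivAt.comp_hasDerivAt _ (hasDerivAt_pi.2 h4)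
  have hsurj : (fderiv ℝ G 0).range = ⊤ := by
    rw [LinearMap.range_eq_top]
    rintro ⟨D, hD⟩
    rw [← hCG] at hD
    obtain ⟨g, hg, x, hx, rfl⟩ := Submodule.mem_sup.1 hD
    obtain ⟨Y, hY, hκ⟩ := (mem_gaugeSub U α).1 hg
    refine ⟨(⟨Y, hY⟩, ⟨x, hx⟩, ⟨fun s => g s - Y, Submodule.mem_pi.2 fun s _ => hκ s⟩), ?_⟩
    refine (hG' _).trans (Subtype.ext (funext fun s => ?_))
    have h4 : Y + x s + (g s - Y) = g s + x s := by abel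
    have h5 : (g s + x s)ᴴ = -(g s + x s) := mem_skewFam.1 (hCG ▸ hD) s
    change skewPart (Y + x s + (g s - Y)) = g s + x s
    rw [h4, skewPart_of_skew h5]
  have h0 : FiniteDimensional ℝ (Fin ℓ → Matrix (Fin n) (Fin n) ℂ) := Module.Finite.pi
  have h00 : FiniteDimensional ℝ (Matrix (Fin n) (Fin n) ℂ) := inferInstance
  have h01 : FiniteDimensional ℝ (skewSub n) := inferInstance
  have h02 : FiniteDimensional ℝ C := inferInstance
  have h03 : FiniteDimensional ℝ (Submodule.pi Set.univ fun s => gaugeAt (U s) (α s)) :=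
    inferInstance
  have : CompleteSpace Z := FiniteDimensional.complete ℝ
    (skewSub n × C × Submodule.pi Set.univ fun s => gaugeAt (U s) (α s))
  have hmap := (hG.hasStrictFDerivAt (by simp)).map_nhds_eq_of_surj hsurj
  have hunit : ∀ᶠ z in 𝓝 (0 : Z), ∀ s, IsUnit (F z s + 1) := by
    refine Filter.eventually_all.2 fun s => ?_
    have hc : ContinuousAt (fun z => F z s + 1) 0 := (hF s).continuousAt.add continuousAt_const
    refine hc.eventually (Units.isOpen.mem_nhds ?_)
    change IsUnit (F 0 s + 1)
    rw [hF0]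
    exact isUnit_two
  have hNz : ∀ᶠ z in 𝓝 (0 : Z), z.2.1 ∈ N :=
    (continuous_fst.comp continuous_snd).continuousAt.eventually (f := fun z : Z => z.2.1) hN
  have himg : G '' {z | (∀ s, IsUnit (F z s + 1)) ∧ z.2.1 ∈ N} ∈ 𝓝 (G 0) := by
    rw [← hmap]
    exact Filter.image_mem_map (hunit.and hNz)
  have hVc : ContinuousAt (fun V : Fin ℓ → Matrix (Fin n) (Fin n) ℂ => P fun s => cayInv (V s)) 1 := by
    refine P.continuous.continuousAt.comp (continuousAt_pi.2 fun s => ?_)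
    refine ContinuousAt.comp (g := cayInv) ?_ (continuous_apply s).continuousAt
    exact (contDiffAt_cayInv (k := 1) (by
      rw [Pi.one_apply, half_two]; exact isUnit_one)).continuousAt
  have hG0 : G 0 = P fun s => cayInv ((1 : Fin ℓ → Matrix (Fin n) (Fin n) ℂ) s) := by
    simp only [G, hF0, Pi.one_apply]
  have hVunit : ∀ᶠ V in 𝓝 (1 : Fin ℓ → Matrix (Fin n) (Fin n) ℂ), ∀ s, IsUnit (V s + 1) := by
    refine Filter.eventually_all.2 fun s => ?_
    have hc : ContinuousAt (fun V : Fin ℓ → Matrix (Fin n) (Fin n) ℂ => V s + 1) 1 :=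
      (continuous_apply s).continuousAt.add continuousAt_const
    refine hc.eventually (Units.isOpen.mem_nhds ?_)
    exact isUnit_two
  rw [hG0] at himg
  filter_upwards [hVc.eventually himg, hVunit] with V hV hVu hVV
  obtain ⟨z, ⟨hzu, hzN⟩, hzV⟩ := hV
  obtain ⟨hs1, hs2, hs3⟩ := hskew z
  have hgauge := fun s => isGauge_cay hU (hs3 s)
  refine ⟨z.2.1, hzN, cay z.1.1, cay_star_mul hs1, fun s => cay (z.2.2.1 s), hgauge, fun s => ?_⟩
  have h4 : skewPart (cayInv (F z s)) = skewPart (cayInv (V s)) :=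
    congrFun (congrArg Subtype.val hzV) s
  have hFu : (F z s)ᴴ * F z s = 1 := by
    calc (F z s)ᴴ * F z s = (cay (z.2.2.1 s))ᴴ * ((cay (z.2.1.1 s))ᴴ * ((cay z.1.1)ᴴ * cay z.1.1) *
          cay (z.2.1.1 s)) * cay (z.2.2.1 s) := by
          simp only [F, Matrix.conjTranspose_mul, mul_assoc]
      _ = 1 := by rw [cay_star_mul hs1, mul_one, cay_star_mul (hs2 s), mul_one, (hgauge s).star_mul]
  rw [skewPart_of_skew (cayInv_skew hFu (hzu s)), skewPart_of_skew (cayInv_skew (hVV s) (hVu s))]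
    at h4
  rw [← cay_cayInv (hVu s), ← h4, cay_cayInv (hzu s)]

/-! ### Lagrangian representations near a given one -/

/-- Equality of the products makes `G = S_sᴴ S'_s` independent of `s`. Symmetry of `S'_s` gives `Gᵀ
S_s = S_s G` for all `s`, so `Gᵀ` commutes with all `A_s` and is scalar. -/
theorem exists_smul_of_lagMat_eq {S S' : Fin ℓ → Matrix (Fin n) (Fin n) ℂ}
    (hS : ∀ s, IsSymUnitary (S s)) (hS' : ∀ s, IsSymUnitary (S' s)) (hℓ : 1 ≤ ℓ)
    (hA : Submodule.span ℂ (Set.range (wordProd (lagMat S))) = ⊤)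
    (h : ∀ s, lagMat S' s = lagMat S s) : ∃ c : ℂ, ∀ s, S' s = c • S s := by
  have h1 : ∀ s, (S (finRotate ℓ s))ᴴ * S' (finRotate ℓ s) = (S s)ᴴ * S' s := by
    intro s
    have h2 := h s
    rw [lagMat, lagMat] at h2
    calc _ = (S s)ᴴ * (S s * (S (finRotate ℓ s))ᴴ) * S' (finRotate ℓ s) := by
          rw [← mul_assoc, (hS s).star_mul, one_mul]
      _ = (S s)ᴴ * S' s * ((S' (finRotate ℓ s))ᴴ * S' (finRotate ℓ s)) := by
          rw [← h2]; simp only [mul_assoc]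
      _ = _ := by rw [(hS' _).star_mul, mul_one]
  let s₀ : Fin ℓ := ⟨0, hℓ⟩
  obtain ⟨G, hG⟩ : ∃ G, G = (S s₀)ᴴ * S' s₀ := ⟨_, rfl⟩
  have hconst := eq_of_forall_finRotate (f := fun s => (S s)ᴴ * S' s) h1
  have h3 : ∀ s, S' s = S s * G := fun s => by
    have := hconst s₀ s
    rw [hG, ← this, ← mul_assoc, (hS s).mul_star, one_mul]
  have h4 : ∀ s, Gᵀ * S s = S s * G := fun s => by
    have := (hS' s).symm
    rw [h3 s, Matrix.transpose_mul, (hS s).symm] at this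
    exact this
  have h5 : ∀ s, Gᵀ = S s * G * (S s)ᴴ := fun s => by
    rw [← h4, mul_assoc, (hS s).mul_star, mul_one]
  obtain ⟨c, hc⟩ := scalar_of_commute hA (Z := Gᵀ) fun s => by
    rw [lagMat, ← mul_assoc, h4]
    conv_rhs => rw [h5 (finRotate ℓ s)]
    calc S s * G * (S (finRotate ℓ s))ᴴ = S s * 1 * G * (S (finRotate ℓ s))ᴴ := by rw [mul_one]
      _ = _ := by rw [← (hS (finRotate ℓ s)).star_mul]; simp only [mul_assoc]
  refine ⟨c, fun s => ?_⟩
  rw [h3, ← h4, hc, Matrix.smul_mul, one_mul]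

/-- The only ambiguity is an angle `1` in place of `0`. Fractional parts satisfy `fract θ ≤ θ` and
have the same sum as `a`; since the totals of `θ` and `a` agree, equality holds everywhere and no
angle is `1`. -/
theorem eq_of_conj_Delta_eq {P V : Fin ℓ → Matrix (Fin n) (Fin n) ℂ} {a θ : Fin ℓ → Fin n → ℝ}
    (hP : ∀ s, (P s)ᴴ * P s = 1) (hV : ∀ s, (V s)ᴴ * V s = 1) (ha0 : ∀ s j, 0 ≤ a s j)
    (ha1 : ∀ s j, a s j < 1) (ha : ∀ s, Monotone (a s)) (hθ0 : ∀ s j, 0 ≤ θ s j)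
    (hθ1 : ∀ s j, θ s j ≤ 1) (hθ : ∀ s, Monotone (θ s)) (hsum : ∑ s, ∑ j, θ s j = ∑ s, ∑ j, a s j)
    (h : ∀ s, P s * Delta (2 • θ s) * (P s)ᴴ = V s * Delta (2 • a s) * (V s)ᴴ) : θ = a := by
  let f : ℂ → ℝ := fun w => Int.fract (Complex.arg w / (2 * Real.pi))
  have hf : ∀ x : ℝ, 0 ≤ x → x ≤ 1 →
      f (Complex.exp (2 * Real.pi * Complex.I * (x : ℂ))) = Int.fract x := by
    intro x h0 h1
    rcases h1.lt_or_eq with h1 | rfl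
    · rw [Int.fract_eq_self.2 ⟨h0, h1⟩]
      exact fract_arg_exp h0 h1
    · simp [f, Complex.exp_two_pi_mul_I]
  have h1 : ∀ s, ∑ j, Int.fract (θ s j) = ∑ j, a s j := by
    intro s
    have h2 := congrArg (fun A => A.charpoly.roots) (h s)
    simp only [Delta_two] at h2
    rw [roots_charpoly_conj_diagonal (hP s), roots_charpoly_conj_diagonal (hV s)] at h2
    have h3 := congrArg (fun m => (Multiset.map f m).sum) h2
    simp only [Multiset.map_map] at h3
    calc ∑ j, Int.fract (θ s j)
        = ∑ j, f (Complex.exp (2 * Real.pi * Complex.I * (θ s j : ℂ))) :=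
          Finset.sum_congr rfl fun j _ => (hf _ (hθ0 s j) (hθ1 s j)).symm
      _ = ∑ j, f (Complex.exp (2 * Real.pi * Complex.I * (a s j : ℂ))) := h3
      _ = ∑ j, a s j := Finset.sum_congr rfl fun j _ => by
          rw [hf _ (ha0 s j) (ha1 s j).le, Int.fract_eq_self.2 ⟨ha0 s j, ha1 s j⟩]
  have h2 : ∀ s j, Int.fract (θ s j) ≤ θ s j := fun s j => by
    rw [Int.fract, sub_le_self_iff]
    exact_mod_cast Int.floor_nonneg.2 (hθ0 s j)
  have h3 : ∀ s j, Int.fract (θ s j) = θ s j := by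
    have h4 : ∑ s, ∑ j, Int.fract (θ s j) = ∑ s, ∑ j, θ s j := by
      rw [hsum]; exact Finset.sum_congr rfl fun s _ => h1 s
    intro s j
    have h5 := (Finset.sum_eq_sum_iff_of_le fun s _ => Finset.sum_le_sum fun j _ => h2 s j).1 h4 s
      (Finset.mem_univ s)
    exact (Finset.sum_eq_sum_iff_of_le fun j _ => h2 s j).1 h5 j (Finset.mem_univ j)
  funext s
  have h4 : ∀ j, θ s j < 1 := fun j => by rw [← h3]; exact Int.fract_lt_one _
  rw [← spec_conj_Delta (hP s) (hθ0 s) h4 (hθ s), h s,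
    spec_conj_Delta (hV s) (ha0 s) (ha1 s) (ha s)]

/-- Configurations of unitary frames and spectra satisfying the closing condition; the entries of
the spectra are allowed to be `1`. -/
def configSpace (ℓ n : ℕ) (I : ℝ) :
    Set ((Fin ℓ → Matrix (Fin n) (Fin n) ℂ) × (Fin ℓ → Fin n → ℝ)) :=
  {q | (∀ s, (q.1 s)ᴴ * q.1 s = 1) ∧ (∀ s, q.1 (finRotate ℓ s) * (q.1 (finRotate ℓ s))ᵀ
      = q.1 s * Delta (-(2 • q.2 s)) * (q.1 s)ᵀ) ∧ (∀ s j, 0 ≤ q.2 s j) ∧ (∀ s j, q.2 s j ≤ 1) ∧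
    (∀ s, Monotone (q.2 s)) ∧ ∑ s, ∑ j, q.2 s j = I}

theorem continuous_conjTranspose_matrix {n : ℕ} :
    Continuous fun X : Matrix (Fin n) (Fin n) ℂ => Xᴴ := (conjTransposeCLM n).continuous

theorem continuous_transpose_matrix {n : ℕ} :
    Continuous fun X : Matrix (Fin n) (Fin n) ℂ => Xᵀ := (transposeCLM n).continuous

theorem isCompact_unitary (n : ℕ) : IsCompact {X : Matrix (Fin n) (Fin n) ℂ | Xᴴ * X = 1} := by
  have h1 : IsCompact ((fun c : Fin n → Fin n → ℂ => (Matrix.of c : Matrix (Fin n) (Fin n) ℂ)) ''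
      Metric.closedBall 0 1) :=
    (isCompact_closedBall _ _).image (contDiff_matrix_of (k := 0)).continuous
  refine h1.of_isClosed_subset
    (isClosed_eq (continuous_conjTranspose_matrix.mul continuous_id) continuous_const) ?_
  intro X hX
  refine ⟨fun i j => X i j, ?_, rfl⟩
  rw [mem_closedBall_zero_iff]
  refine (pi_norm_le_iff_of_nonneg zero_le_one).2 fun i =>
    (pi_norm_le_iff_of_nonneg zero_le_one).2 fun j => ?_
  exact entry_norm_bound_of_unitary (Matrix.mem_unitaryGroup_iff'.2 hX) i j

/-- Allowing the angle `1` makes the conditions closed. The fixed index later prevents an angle near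
`1` from degenerating to an eigenangle `0` of the limit. -/
theorem isCompact_configSpace (ℓ n : ℕ) (I : ℝ) : IsCompact (configSpace ℓ n I) := by
  have h1 : IsCompact ((Set.univ.pi fun _ : Fin ℓ => {X : Matrix (Fin n) (Fin n) ℂ | Xᴴ * X = 1}) ×ˢ
      (Set.univ.pi fun _ : Fin ℓ => Set.univ.pi fun _ : Fin n => Set.Icc (0 : ℝ) 1)) :=
    (isCompact_univ_pi fun _ => isCompact_unitary n).prod
      (isCompact_univ_pi fun _ => isCompact_univ_pi fun _ => isCompact_Icc)
  have hD : Continuous (Delta : (Fin n → ℝ) → Matrix (Fin n) (Fin n) ℂ) :=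
    (contDiff_Delta (k := 0)).continuous
  have hp : ∀ s, Continuous fun q : (Fin ℓ → Matrix (Fin n) (Fin n) ℂ) × (Fin ℓ → Fin n → ℝ) =>
      q.1 s := fun s => (continuous_apply s).comp continuous_fst
  have ht : ∀ s, Continuous fun q : (Fin ℓ → Matrix (Fin n) (Fin n) ℂ) × (Fin ℓ → Fin n → ℝ) =>
      q.2 s := fun s => (continuous_apply s).comp continuous_snd
  have htj : ∀ s j, Continuous fun q : (Fin ℓ → Matrix (Fin n) (Fin n) ℂ) × (Fin ℓ → Fin n → ℝ) =>
      q.2 s j := fun s j => (continuous_apply j).comp (ht s)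
  have hpt : ∀ s, Continuous fun q : (Fin ℓ → Matrix (Fin n) (Fin n) ℂ) × (Fin ℓ → Fin n → ℝ) =>
      (q.1 s)ᵀ := fun s => continuous_transpose_matrix.comp (hp s)
  refine h1.of_isClosed_subset ?_ ?_
  · simp only [configSpace, Set.ofPred_and, Set.ofPred_forall]
    refine IsClosed.inter ?_ (IsClosed.inter ?_ (IsClosed.inter ?_ (IsClosed.inter ?_
      (IsClosed.inter ?_ ?_))))
    · exact isClosed_iInter fun s => isClosed_eq
        ((continuous_conjTranspose_matrix.comp (hp s)).mul (hp s)) continuous_const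
    · refine isClosed_iInter fun s => isClosed_eq ((hp _).mul (hpt _)) (((hp s).mul ?_).mul (hpt s))
      exact hD.comp ((ht s).const_smul 2).neg
    · exact isClosed_iInter fun s => isClosed_iInter fun j => isClosed_le continuous_const (htj s j)
    · exact isClosed_iInter fun s => isClosed_iInter fun j => isClosed_le (htj s j) continuous_const
    · simp only [Monotone, Set.ofPred_forall]
      exact isClosed_iInter fun s => isClosed_iInter fun i => isClosed_iInter fun j =>
        isClosed_iInter fun _ => isClosed_le (htj s i) (htj s j)
    · exact isClosed_eq (continuous_finsetSum _ fun s _ => continuous_finsetSum _ fun j _ =>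
        htj s j) continuous_const
  · rintro q ⟨hq1, -, hq3, hq4, -, -⟩
    exact ⟨fun s _ => hq1 s, fun s _ j _ => ⟨hq3 s j, hq4 s j⟩⟩

end Slice

section Slice

variable {ℓ n : ℕ} {U : Fin ℓ → Un n} {α : Fin ℓ → Fin n → ℝ}

theorem lagMat_of_closing {P : Fin ℓ → Matrix (Fin n) (Fin n) ℂ} (hP : ∀ s, (P s)ᴴ * P s = 1)
    {s : Fin ℓ} {θ : Fin n → ℝ} (h : P (finRotate ℓ s) * (P (finRotate ℓ s))ᵀ
      = P s * Delta (-(2 • θ)) * (P s)ᵀ) :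
    lagMat (fun s => P s * (P s)ᵀ) s = P s * Delta (2 • θ) * (P s)ᴴ := by
  have h1 : (P s)ᵀ * (P s)ᵀᴴ = 1 := by
    have := congrArg Matrix.transpose (hP s)
    rw [Matrix.transpose_mul, Matrix.transpose_one] at this
    exact this
  rw [lagMat, h, Matrix.conjTranspose_mul, Matrix.conjTranspose_mul, Delta_conjTranspose, neg_neg]
  calc P s * (P s)ᵀ * ((P s)ᵀᴴ * (Delta (2 • θ) * (P s)ᴴ))
      = P s * ((P s)ᵀ * (P s)ᵀᴴ) * Delta (2 • θ) * (P s)ᴴ := by simp only [mul_assoc]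
    _ = _ := by rw [h1, mul_one]

/-- The configurations over the given matrices form one gauge orbit: the spectra agree by the index
argument, and the subspaces agree up to a common phase by irreducibility. -/
theorem exists_gauge_of_mem_fiber (hU : IsAdapted U α) (hℓ : 1 ≤ ℓ) (hn : 1 ≤ n)
    (hA : Submodule.span ℂ (Set.range (wordProd (lagMat (frameSym U)))) = ⊤)
    {q : (Fin ℓ → Matrix (Fin n) (Fin n) ℂ) × (Fin ℓ → Fin n → ℝ)}
    (hq : q ∈ configSpace ℓ n (∑ s, ∑ j, α s j))
    (hqA : ∀ s, q.1 s * Delta (2 • q.2 s) * (q.1 s)ᴴ = lagMat (frameSym U) s) :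
    q.2 = α ∧ ∃ e : ℂ, starRingEnd ℂ e * e = 1 ∧
      ∃ k : Fin ℓ → Matrix (Fin n) (Fin n) ℂ,
        (∀ s, IsGauge (frameSym U s) (lagMat (frameSym U) s) (k s)) ∧
        ∀ s, q.1 s = e • (k s * (U s : Matrix (Fin n) (Fin n) ℂ)) := by
  obtain ⟨hq1, hq2, hq3, hq4, hq5, hq6⟩ := hq
  have hα : q.2 = α := eq_of_conj_Delta_eq hq1 (fun s => Un.star_mul_self (U s)) hU.nonneg hU.lt_one
    hU.mono hq3 hq4 hq5 hq6 fun s => (hqA s).trans (hU.lagMat_eq s)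
  refine ⟨hα, ?_⟩
  have hS : ∀ s, IsSymUnitary (q.1 s * (q.1 s)ᵀ) := fun s => isSymUnitary_frame (hq1 s)
  obtain ⟨c, hc⟩ := exists_smul_of_lagMat_eq (isSymUnitary_frameSym U) hS hℓ hA fun s => by
    rw [lagMat_of_closing hq1 (hq2 s), hqA]
  have hcc : starRingEnd ℂ c * c = 1 := by
    have h1 := (hS ⟨0, hℓ⟩).star_mul
    rw [hc, Matrix.conjTranspose_smul, Matrix.smul_mul, Matrix.mul_smul,
      (isSymUnitary_frameSym U _).star_mul, smul_smul] at h1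
    have h2 := congrFun (congrFun h1 ⟨0, hn⟩) ⟨0, hn⟩
    simpa using h2
  -- A scalar acting on the frames acts by its square on the symmetric matrices.
  obtain ⟨e, he⟩ := IsAlgClosed.exists_pow_nat_eq c (n := 2) two_pos
  have hee : starRingEnd ℂ e * e = 1 := by
    rw [← he, map_pow, ← mul_pow, ← Complex.normSq_eq_conj_mul_self, ← Complex.ofReal_pow,
      Complex.ofReal_eq_one, pow_eq_one_iff_of_nonneg (Complex.normSq_nonneg e) two_ne_zero] at hcc
    rw [← Complex.normSq_eq_conj_mul_self, hcc, Complex.ofReal_one]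
  have hee' : e * starRingEnd ℂ e = 1 := by rw [mul_comm, hee]
  refine ⟨e, hee, fun s => starRingEnd ℂ e • (q.1 s * (U s : Matrix (Fin n) (Fin n) ℂ)ᴴ),
    fun s => ⟨?_, ?_, ?_⟩, fun s => ?_⟩
  · rw [Matrix.conjTranspose_smul, Matrix.smul_mul, Matrix.mul_smul, smul_smul,
      Matrix.conjTranspose_mul, Matrix.conjTranspose_conjTranspose, starRingEnd_apply, star_star,
      ← starRingEnd_apply, hee', one_smul]
    calc (U s : Matrix (Fin n) (Fin n) ℂ) * (q.1 s)ᴴ * (q.1 s * (U s : Matrix (Fin n) (Fin n) ℂ)ᴴ)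
        = (U s : Matrix (Fin n) (Fin n) ℂ) * ((q.1 s)ᴴ * q.1 s) *
          (U s : Matrix (Fin n) (Fin n) ℂ)ᴴ := by simp only [mul_assoc]
      _ = 1 := by rw [hq1, mul_one, Un.mul_star_self]
  · have h1 : (U s : Matrix (Fin n) (Fin n) ℂ)ᵀ * (U s : Matrix (Fin n) (Fin n) ℂ)ᴴᵀ = 1 := by
      rw [← Matrix.transpose_mul, Un.star_mul_self, Matrix.transpose_one]
    rw [Matrix.transpose_smul, Matrix.smul_mul, Matrix.smul_mul, Matrix.mul_smul, smul_smul,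
      Matrix.transpose_mul, frameSym]
    calc (starRingEnd ℂ e * starRingEnd ℂ e) • (q.1 s * (U s : Matrix (Fin n) (Fin n) ℂ)ᴴ *
          ((U s : Matrix (Fin n) (Fin n) ℂ) * (U s : Matrix (Fin n) (Fin n) ℂ)ᵀ) *
          ((U s : Matrix (Fin n) (Fin n) ℂ)ᴴᵀ * (q.1 s)ᵀ))
        = (starRingEnd ℂ e * starRingEnd ℂ e) • (q.1 s * ((U s : Matrix (Fin n) (Fin n) ℂ)ᴴ *
          (U s : Matrix (Fin n) (Fin n) ℂ)) * ((U s : Matrix (Fin n) (Fin n) ℂ)ᵀ *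
          (U s : Matrix (Fin n) (Fin n) ℂ)ᴴᵀ) * (q.1 s)ᵀ) := by simp only [mul_assoc]
      _ = (starRingEnd ℂ e * starRingEnd ℂ e * (e * e)) • frameSym U s := by
          rw [Un.star_mul_self, h1, mul_one, mul_one, hc, ← he, smul_smul, sq]
      _ = frameSym U s := by
          rw [show starRingEnd ℂ e * starRingEnd ℂ e * (e * e)
            = (starRingEnd ℂ e * e) * (starRingEnd ℂ e * e) by ring, hee, one_mul, one_smul]
  · rw [Matrix.smul_mul, Matrix.mul_smul]
    congr 1
    conv_lhs => rw [hU.lagMat_eq]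
    rw [← hqA, hα]
    calc q.1 s * (U s : Matrix (Fin n) (Fin n) ℂ)ᴴ * ((U s : Matrix (Fin n) (Fin n) ℂ) *
          Delta (2 • α s) * (U s : Matrix (Fin n) (Fin n) ℂ)ᴴ)
        = q.1 s * ((U s : Matrix (Fin n) (Fin n) ℂ)ᴴ * (U s : Matrix (Fin n) (Fin n) ℂ)) *
          Delta (2 • α s) * (U s : Matrix (Fin n) (Fin n) ℂ)ᴴ := by simp only [mul_assoc]
      _ = q.1 s * Delta (2 • α s) * ((q.1 s)ᴴ * q.1 s) * (U s : Matrix (Fin n) (Fin n) ℂ)ᴴ := by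
          rw [Un.star_mul_self, hq1, mul_one, mul_one]
      _ = _ := by simp only [mul_assoc]
  · rw [Matrix.smul_mul, smul_smul, hee', one_smul, mul_assoc, Un.star_mul_self, mul_one]

/-- The configuration `q` is gauge equivalent to one given by the local model at a point of `N`. -/
def IsModelled (U : Fin ℓ → Un n) (α : Fin ℓ → Fin n → ℝ)
    {C : Submodule ℝ (Fin ℓ → Matrix (Fin n) (Fin n) ℂ)} (N : Set (C × specSub ℓ n))
    (q : (Fin ℓ → Matrix (Fin n) (Fin n) ℂ) × (Fin ℓ → Fin n → ℝ)) : Prop :=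
  ∃ v ∈ N, q.2 = α + v.2.1 ∧ ∃ g : Matrix (Fin n) (Fin n) ℂ, gᴴ * g = 1 ∧
    ∃ k : Fin ℓ → Matrix (Fin n) (Fin n) ℂ,
      (∀ s, IsGauge (frameSym U s) (lagMat (frameSym U) s) (k s)) ∧
      ∀ s, q.1 s = g * cay (v.1.1 s) * k s * (U s : Matrix (Fin n) (Fin n) ℂ)

/-- Nearby frames `q'` are compared with the frames of `q` through `q'_s q_sᴴ`, close to `1`, to
which the slice theorem applies; the gauge transformation from the base frames to `q` is then
composed in. -/
theorem eventually_isModelled (hU : IsAdapted U α) (hℓ : 1 ≤ ℓ) (hn : 1 ≤ n)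
    (hA : Submodule.span ℂ (Set.range (wordProd (lagMat (frameSym U)))) = ⊤)
    {C : Submodule ℝ (Fin ℓ → Matrix (Fin n) (Fin n) ℂ)} (hC : C ≤ skewFam ℓ n)
    (hCG : gaugeSub U α ⊔ C = skewFam ℓ n) {N : Set (C × specSub ℓ n)} (hN : N ∈ 𝓝 0)
    {q : (Fin ℓ → Matrix (Fin n) (Fin n) ℂ) × (Fin ℓ → Fin n → ℝ)}
    (hq : q ∈ configSpace ℓ n (∑ s, ∑ j, α s j))
    (hqA : ∀ s, q.1 s * Delta (2 • q.2 s) * (q.1 s)ᴴ = lagMat (frameSym U) s) :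
    ∀ᶠ q' in 𝓝 q, q' ∈ configSpace ℓ n (∑ s, ∑ j, α s j) →
      IsModelled U α N q' := by
  obtain ⟨hα, e, he, k', hk', hqk⟩ := exists_gauge_of_mem_fiber hU hℓ hn hA hq hqA
  obtain ⟨N₁, hN₁, N₂, hN₂, hNN⟩ := mem_nhds_prod_iff.1 hN
  obtain ⟨N₃, hN₃, hNN₃⟩ := (mem_nhds_subtype _ _ _).1 hN₂
  have h1 : Filter.Tendsto (fun q' : (Fin ℓ → Matrix (Fin n) (Fin n) ℂ) × (Fin ℓ → Fin n → ℝ) =>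
      fun s => q'.1 s * (q.1 s)ᴴ) (𝓝 q) (𝓝 1) := by
    have h2 : Continuous fun q' : (Fin ℓ → Matrix (Fin n) (Fin n) ℂ) × (Fin ℓ → Fin n → ℝ) =>
        fun s => q'.1 s * (q.1 s)ᴴ := continuous_pi fun s =>
      ((continuous_apply s).comp continuous_fst).mul continuous_const
    have h3 := h2.tendsto q
    rwa [show (fun s => q.1 s * (q.1 s)ᴴ) = (1 : Fin ℓ → Matrix (Fin n) (Fin n) ℂ) from
      funext fun s => mul_eq_one_comm.1 (hq.1 s)] at h3
  have h2 : Filter.Tendsto (fun q' : (Fin ℓ → Matrix (Fin n) (Fin n) ℂ) × (Fin ℓ → Fin n → ℝ) =>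
      q'.2 - α) (𝓝 q) (𝓝 0) := by
    have h3 : Continuous fun q' : (Fin ℓ → Matrix (Fin n) (Fin n) ℂ) × (Fin ℓ → Fin n → ℝ) =>
      q'.2 - α := continuous_snd.sub continuous_const
    have h4 := h3.tendsto q
    rwa [hα, sub_self] at h4
  filter_upwards [h1.eventually (eventually_exists_slice hU hC hCG hN₁), h2.eventually hN₃] with q' h3 h4
    hq'
  obtain ⟨x, hx, g, hg, k, hk, hxk⟩ := h3 fun s => by
    rw [Matrix.conjTranspose_mul, Matrix.conjTranspose_conjTranspose]
    calc q.1 s * (q'.1 s)ᴴ * (q'.1 s * (q.1 s)ᴴ) = q.1 s * ((q'.1 s)ᴴ * q'.1 s) * (q.1 s)ᴴ := by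
          simp only [mul_assoc]
      _ = 1 := by rw [hq'.1, mul_one, mul_eq_one_comm.1 (hq.1 s)]
  have ht : q'.2 - α ∈ specSub ℓ n := by
    change ∑ s, ∑ j, (q'.2 s j - α s j) = 0
    simp only [Finset.sum_sub_distrib]
    rw [hq'.2.2.2.2.2, sub_self]
  refine ⟨(x, ⟨q'.2 - α, ht⟩), hNN ⟨hx, hNN₃ h4⟩, by simp, e • g, ?_, fun s => k s * k' s,
    fun s => (hk s).mul (hk' s), fun s => ?_⟩
  · rw [Matrix.conjTranspose_smul, Matrix.smul_mul, Matrix.mul_smul, smul_smul, hg]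
    rw [← starRingEnd_apply, he, one_smul]
  · calc q'.1 s = q'.1 s * ((q.1 s)ᴴ * q.1 s) := by rw [hq.1, mul_one]
      _ = (g * cay (x.1 s) * k s) * q.1 s := by rw [← mul_assoc, hxk s]
      _ = _ := by
        rw [hqk s, Matrix.mul_smul, Matrix.smul_mul, Matrix.smul_mul, Matrix.smul_mul]
        simp only [mul_assoc]

/-- The matrices `A_s` of a configuration. -/
def configMat (q : (Fin ℓ → Matrix (Fin n) (Fin n) ℂ) × (Fin ℓ → Fin n → ℝ)) :
    Fin ℓ → Matrix (Fin n) (Fin n) ℂ := fun s => q.1 s * Delta (2 • q.2 s) * (q.1 s)ᴴ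

theorem continuous_configMat : Continuous (configMat (ℓ := ℓ) (n := n)) := by
  refine continuous_pi fun s => ?_
  have h1 : Continuous fun q : (Fin ℓ → Matrix (Fin n) (Fin n) ℂ) × (Fin ℓ → Fin n → ℝ) =>
    q.1 s := (continuous_apply s).comp continuous_fst
  have h2 : Continuous fun q : (Fin ℓ → Matrix (Fin n) (Fin n) ℂ) × (Fin ℓ → Fin n → ℝ) =>
    q.2 s := (continuous_apply s).comp continuous_snd
  have h3 : Continuous fun q : (Fin ℓ → Matrix (Fin n) (Fin n) ℂ) × (Fin ℓ → Fin n → ℝ) =>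
    Delta (2 • q.2 s) := (contDiff_Delta (k := 0)).continuous.comp (h2.const_smul 2)
  have h4 : Continuous fun q : (Fin ℓ → Matrix (Fin n) (Fin n) ℂ) × (Fin ℓ → Fin n → ℝ) =>
    (q.1 s)ᴴ := continuous_conjTranspose_matrix.comp h1
  exact (h1.mul h3).mul h4

/-- Compactness makes the neighbourhood uniform over all configurations: near one over the base
point the previous local result applies, and near any other the matrices stay away from the base
ones. -/
theorem eventually_forall_isModelled (hU : IsAdapted U α) (hℓ : 1 ≤ ℓ) (hn : 1 ≤ n)
    (hA : Submodule.span ℂ (Set.range (wordProd (lagMat (frameSym U)))) = ⊤)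
    {C : Submodule ℝ (Fin ℓ → Matrix (Fin n) (Fin n) ℂ)} (hC : C ≤ skewFam ℓ n)
    (hCG : gaugeSub U α ⊔ C = skewFam ℓ n) {N : Set (C × specSub ℓ n)} (hN : N ∈ 𝓝 0) :
    ∀ᶠ A in 𝓝 (lagMat (frameSym U)), ∀ q ∈ configSpace ℓ n (∑ s, ∑ j, α s j),
      configMat q = A → IsModelled U α N q := by
  have h1 := (isCompact_configSpace ℓ n (∑ s, ∑ j, α s j)).eventually_forall_of_forall_eventually
    (x₀ := lagMat (frameSym U)) (P := fun A q => q ∈ configSpace ℓ n (∑ s, ∑ j, α s j) →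
      configMat q = A → IsModelled U α N q) ?_
  · filter_upwards [h1] with A hA q hq hqA
    exact hA q hq hq hqA
  · intro q hq
    by_cases hqA : configMat q = lagMat (frameSym U)
    · have h2 := eventually_isModelled hU hℓ hn hA hC hCG hN hq (congrFun hqA)
      filter_upwards [(continuous_snd.tendsto (lagMat (frameSym U), q)).eventually h2] with z hz hz' _
      exact hz hz'
    · have h2 : ∀ᶠ z in 𝓝 (lagMat (frameSym U), q), configMat z.2 ≠ z.1 :=
        (isClosed_eq (continuous_configMat.comp continuous_snd) continuous_fst).isOpen_compl.mem_nhds hqA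
      filter_upwards [h2] with z hz _ hz'
      exact absurd hz' hz

end Slice

/-! ### Conjugation of representations -/

variable {ℓ n : ℕ}

/-- The representation `g ρ g⁻¹`. -/
def conjHom (g : Un n) (ρ : HomU ℓ n) : HomU ℓ n := (MulAut.conj g).toMonoidHom.comp ρ

theorem conjHom_equiv (g : Un n) (ρ : HomU ℓ n) : ρ ≈ conjHom g ρ := ⟨g, fun _ => rfl⟩

theorem exists_eq_conjHom {ρ ρ' : HomU ℓ n} (h : ρ ≈ ρ') : ∃ g, ρ' = conjHom g ρ := by
  obtain ⟨g, hg⟩ := h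
  exact ⟨g, MonoidHom.ext hg⟩

theorem genMat_conjHom (g : Un n) (ρ : HomU ℓ n) (s : Fin ℓ) :
    genMat (conjHom g ρ) s = conjEquiv g (genMat ρ s) := rfl

theorem continuous_genMat : Continuous (genMat : HomU ℓ n → Fin ℓ → Matrix (Fin n) (Fin n) ℂ) :=
  have h : Continuous (coords : HomU ℓ n → _) := continuous_induced_dom
  continuous_pi fun s => (contDiff_matrix_of (k := 0)).continuous.comp
    ((continuous_apply s).comp h)

theorem continuous_conjHom (g : Un n) : Continuous (conjHom (ℓ := ℓ) g) := by
  refine continuous_induced_rng.2 (continuous_pi fun s => continuous_pi fun i =>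
    continuous_pi fun j => (entryCLM i j).continuous.comp ?_)
  exact (continuous_const.mul ((continuous_apply s).comp continuous_genMat)).mul continuous_const

/-- The saturation of an open set is the union of its conjugates. -/
theorem isOpen_image_cls {O : Set (HomU ℓ n)} (hO : IsOpen O) : IsOpen (cls '' O) := by
  refine isOpen_coinduced.2 ?_
  have h : Quotient.mk (conjSetoid ℓ n) ⁻¹' (cls '' O) = ⋃ g, conjHom g ⁻¹' O := by
    ext ρ
    simp only [Set.mem_preimage, Set.mem_iUnion]
    constructor
    · rintro ⟨ρ', hρ', h⟩
      obtain ⟨g, rfl⟩ := exists_eq_conjHom (Quotient.exact h.symm)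
      exact ⟨g, hρ'⟩
    · rintro ⟨g, hg⟩
      exact ⟨_, hg, (Quotient.sound (conjHom_equiv g ρ)).symm⟩
  change IsOpen (Quotient.mk (conjSetoid ℓ n) ⁻¹' (cls '' O))
  rw [h]
  exact isOpen_iUnion fun g => hO.preimage (continuous_conjHom g)

theorem frameSym_mul (g : Un n) (U : Fin ℓ → Un n) (s : Fin ℓ) :
    frameSym (fun s => g * U s) s = (g : Matrix (Fin n) (Fin n) ℂ) * frameSym U s *
      (g : Matrix (Fin n) (Fin n) ℂ)ᵀ := by
  rw [frameSym, frameSym, Un.coe_mul, Matrix.transpose_mul]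
  simp only [mul_assoc]

theorem conjHom_lagRep (g : Un n) (U : Fin ℓ → Un n) :
    conjHom g (lagRep fun s => (stdLagr n).act (U s))
      = lagRep fun s => (stdLagr n).act (g * U s) := by
  refine genMat_injective fun s => ?_
  rw [genMat_conjHom, genMat_lagRep_frame, genMat_lagRep_frame (fun s => g * U s), lagMat, lagMat,
    frameSym_mul, frameSym_mul, conjEquiv_apply]
  have h : (g : Matrix (Fin n) (Fin n) ℂ)ᵀ * (g : Matrix (Fin n) (Fin n) ℂ)ᵀᴴ = 1 := by
    have := congrArg Matrix.transpose (Un.star_mul_self g)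
    rw [Matrix.transpose_mul, Matrix.transpose_one] at this
    exact this
  rw [Matrix.conjTranspose_mul, Matrix.conjTranspose_mul]
  calc _ = (g : Matrix (Fin n) (Fin n) ℂ) * frameSym U s * 1 * ((frameSym U (finRotate ℓ s))ᴴ *
        (g : Matrix (Fin n) (Fin n) ℂ)ᴴ) := by simp only [mul_assoc, one_mul]
    _ = _ := by rw [← h]; simp only [mul_assoc]

theorem exists_adapted_of_equiv {ρ ρ' : HomU ℓ n} (hρ : ρ ∈ LHom ℓ n) (h : ρ ≈ ρ') :
    ∃ (U : Fin ℓ → Un n) (α : Fin ℓ → Fin n → ℝ), IsAdapted U α ∧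
      ρ' = lagRep fun s => (stdLagr n).act (U s) := by
  obtain ⟨g, rfl⟩ := exists_eq_conjHom h
  obtain ⟨L, rfl⟩ := hρ
  obtain ⟨V, α, -, rfl⟩ := exists_adapted L
  rw [conjHom_lagRep]
  obtain ⟨U, β, hU, h⟩ := exists_adapted fun s => (stdLagr n).act (g * V s)
  exact ⟨U, β, hU, congrArg lagRep h⟩

/-! ### Vectors with the same multiplicities -/

theorem HasMult.eq_iff {α : Fin n → ℝ} {c : Composition n} (h : HasMult α c) (i j : Fin n) :
    α i = α j ↔ c.index i = c.index j := by
  obtain ⟨β, hβ, hα⟩ := h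
  rw [hα, hα, hβ.injective.eq_iff]

theorem monotone_index (c : Composition n) : Monotone c.index := by
  intro i j hij
  by_contra h
  rw [not_le] at h
  have h1 := c.sizeUpTo_index_le i
  have h2 := c.lt_sizeUpTo_index_succ j
  have h3 : c.sizeUpTo (c.index j).succ ≤ c.sizeUpTo (c.index i) :=
    c.monotone_sizeUpTo (by simpa using h)
  have h4 : (i : ℕ) ≤ j := hij
  omega

theorem HasMult.monotone {α : Fin n → ℝ} {c : Composition n} (h : HasMult α c) : Monotone α := by
  obtain ⟨β, hβ, hα⟩ := h
  intro i j hij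
  rw [hα, hα]
  exact hβ.monotone (monotone_index c hij)

/-! ### Completeness of the local model -/

/-- A rotation constant on the eigenspaces of `A` commutes with the whole centralizer of `A`. -/
theorem commute_rot {u : Un n} {α t : Fin n → ℝ} (h0 : ∀ j, 0 ≤ α j) (h1 : ∀ j, α j < 1)
    (ht : ∀ i j, α i = α j → t i = t j) {k : Matrix (Fin n) (Fin n) ℂ}
    (hk : k * rot u (2 • α) = rot u (2 • α) * k) : k * rot u t = rot u t * k := by
  obtain ⟨Y, rfl⟩ := (conjEquiv u).surjective k
  rw [rot, ← conjEquiv_mul, ← conjEquiv_mul, EmbeddingLike.apply_eq_iff_eq,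
    commute_Delta_iff h0 h1] at hk
  rw [rot, ← conjEquiv_mul, ← conjEquiv_mul, EmbeddingLike.apply_eq_iff_eq, Delta]
  ext i j
  rw [Matrix.mul_diagonal, Matrix.diagonal_mul]
  by_cases hij : α i = α j
  · rw [ht i j hij, mul_comm]
  · rw [hk i j hij, zero_mul, mul_zero]

variable {U : Fin ℓ → Un n} {α : Fin ℓ → Fin n → ℝ}

/-- The converse of `isAdapted_modelFrame`: zeros of the closing equations are exactly the adapted
moved frames. -/
theorem modelSym_eq_one (hU : IsAdapted U α)
    {q : (Fin ℓ → Matrix (Fin n) (Fin n) ℂ) × (Fin ℓ → Fin n → ℝ)} (hq : ∀ s, (q.1 s)ᴴ = -q.1 s)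
    (h : IsAdapted (modelFrame U q.1 hq) (α + q.2)) (s : Fin ℓ) : modelSym U q s = 1 := by
  obtain ⟨c, hc⟩ : ∃ c, c = cay (q.1 s) := ⟨_, rfl⟩
  obtain ⟨c', hc'⟩ : ∃ c', c' = cay (q.1 (finRotate ℓ s)) := ⟨_, rfl⟩
  obtain ⟨u, hu⟩ : ∃ u, u = (U s : Matrix (Fin n) (Fin n) ℂ) := ⟨_, rfl⟩
  obtain ⟨S, hS⟩ : ∃ S, S = frameSym U (finRotate ℓ s) := ⟨_, rfl⟩
  have hcc : cᴴ * c = 1 := by rw [hc]; exact cay_star_mul (hq s)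
  have hcct : cᵀ * cᴴᵀ = 1 := by rw [← Matrix.transpose_mul, hcc, Matrix.transpose_one]
  have huu : uᴴ * u = 1 := by rw [hu]; exact Un.star_mul_self _
  have huut : uᵀ * uᴴᵀ = 1 := by rw [← Matrix.transpose_mul, huu, Matrix.transpose_one]
  have hSu := hS ▸ isSymUnitary_frameSym U (finRotate ℓ s)
  have hS2 : S = u * Delta (-(2 • α s)) * uᵀ := by
    rw [hS, hu]; exact frameSym_next_iff.1 (hU.next s)
  have h1 : c' * S * c'ᵀ = c * u * Delta (-(2 • (α + q.2) s)) * (uᵀ * cᵀ) := by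
    have h2 := frameSym_next_iff.1 (h.next s)
    rw [frameSym, coe_modelFrame, coe_modelFrame, ← hc', ← hc, ← hu, Matrix.transpose_mul,
      Matrix.transpose_mul] at h2
    rw [hS, frameSym, ← h2]
    simp only [mul_assoc]
  have hr : rot (U s) (q.2 s) = u * Delta (q.2 s) * uᴴ := by rw [rot, conjEquiv_apply, ← hu]
  have hrt : (rot (U s) (q.2 s))ᵀ = uᴴᵀ * Delta (q.2 s) * uᵀ := by
    rw [hr, Matrix.transpose_mul, Matrix.transpose_mul, Delta_transpose]
    simp only [mul_assoc]
  have h3 : modelRel U q s * S * (modelRel U q s)ᵀ = S := by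
    rw [modelRel, ← hc, ← hc', Matrix.transpose_mul, Matrix.transpose_mul]
    calc _ = rot (U s) (q.2 s) * cᴴ * (c' * S * c'ᵀ) * cᴴᵀ * (rot (U s) (q.2 s))ᵀ := by
          simp only [mul_assoc]
      _ = rot (U s) (q.2 s) * (cᴴ * c) * u * Delta (-(2 • (α + q.2) s)) * uᵀ * (cᵀ * cᴴᵀ) *
          (rot (U s) (q.2 s))ᵀ := by rw [h1]; simp only [mul_assoc]
      _ = u * Delta (q.2 s) * (uᴴ * u) * Delta (-(2 • (α + q.2) s)) * (uᵀ * uᴴᵀ) *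
          Delta (q.2 s) * uᵀ := by
          rw [hcc, hcct, mul_one, mul_one, hrt, hr]; simp only [mul_assoc]
      _ = u * (Delta (q.2 s) * Delta (-(2 • (α + q.2) s)) * Delta (q.2 s)) * uᵀ := by
          rw [huu, huut, mul_one, mul_one]; simp only [mul_assoc]
      _ = S := by
          rw [hS2, ← Delta_add, ← Delta_add]
          congr 3
          simp only [Pi.add_apply, two_smul]
          abel
  rw [modelSym, ← hS, refl]
  calc _ = modelRel U q s * S * (modelRel U q s)ᵀ * Sᴴ := by simp only [mul_assoc]
    _ = 1 := by rw [h3, hSu.mul_star]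

/-- Removing the gauge factors `k_s` keeps the closing condition because `k_s` stabilizes `L_s` and
commutes with the rotation to the new spectrum. The second point needs the new spectrum to be
constant on the old blocks, which is where staying in one stratum matters. -/
theorem isAdapted_modelFrame_of_gauge (hU : IsAdapted U α)
    {q : (Fin ℓ → Matrix (Fin n) (Fin n) ℂ) × (Fin ℓ → Fin n → ℝ)} (hq : ∀ s, (q.1 s)ᴴ = -q.1 s)
    (hqα : ∀ s i j, α s i = α s j → (α + q.2) s i = (α + q.2) s j) {V : Fin ℓ → Un n}
    (hV : IsAdapted V (α + q.2)) {g : Matrix (Fin n) (Fin n) ℂ} (hg : gᴴ * g = 1)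
    {k : Fin ℓ → Matrix (Fin n) (Fin n) ℂ}
    (hk : ∀ s, IsGauge (frameSym U s) (lagMat (frameSym U) s) (k s))
    (h : ∀ s, (V s : Matrix (Fin n) (Fin n) ℂ)
      = g * cay (q.1 s) * k s * (U s : Matrix (Fin n) (Fin n) ℂ)) :
    IsAdapted (modelFrame U q.1 hq) (α + q.2) ∧
      (lagRep fun s => (stdLagr n).act (modelFrame U q.1 hq s)) ≈
        lagRep fun s => (stdLagr n).act (V s) := by
  have hgt : g * gᴴ = 1 := mul_eq_one_comm.1 hg
  have hgt' : gᵀ * gᴴᵀ = 1 := by rw [← Matrix.transpose_mul, hg, Matrix.transpose_one]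
  have hkt : ∀ s t, (∀ i j, α s i = α s j → t i = t j) → k s * rot (U s) t = rot (U s) t * k s :=
    fun s t ht => commute_rot (hU.nonneg s) (hU.lt_one s) ht (by
      rw [← hU.lagMat_eq_rot]; exact (hk s).commute)
  have hfs : ∀ s, frameSym V s = g * frameSym (modelFrame U q.1 hq) s * gᵀ := by
    intro s
    rw [frameSym, h, frameSym, coe_modelFrame]
    calc _ = g * cay (q.1 s) * (k s * frameSym U s * (k s)ᵀ) * (cay (q.1 s))ᵀ * gᵀ := by
          rw [frameSym, Matrix.transpose_mul, Matrix.transpose_mul, Matrix.transpose_mul]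
          simp only [mul_assoc]
      _ = _ := by
          rw [(hk s).symm, frameSym, Matrix.transpose_mul]
          simp only [mul_assoc]
  refine ⟨⟨hV.nonneg, hV.lt_one, hV.mono, fun s => frameSym_next_iff.2 ?_⟩, ?_⟩
  · have h1 := frameSym_next_iff.1 (hV.next s)
    have h2 : (U s : Matrix (Fin n) (Fin n) ℂ) * Delta (-(2 • (α + q.2) s)) *
        (U s : Matrix (Fin n) (Fin n) ℂ)ᵀ = rot (U s) (-(2 • (α + q.2) s)) * frameSym U s := by
      rw [rot, conjEquiv_apply, frameSym]
      calc _ = (U s : Matrix (Fin n) (Fin n) ℂ) * Delta (-(2 • (α + q.2) s)) * 1 *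
            (U s : Matrix (Fin n) (Fin n) ℂ)ᵀ := by rw [mul_one]
        _ = _ := by rw [← Un.star_mul_self (U s)]; simp only [mul_assoc]
    have h3 : (V s : Matrix (Fin n) (Fin n) ℂ) * Delta (-(2 • (α + q.2) s)) *
        (V s : Matrix (Fin n) (Fin n) ℂ)ᵀ = g * ((modelFrame U q.1 hq s : Matrix (Fin n) (Fin n) ℂ) *
          Delta (-(2 • (α + q.2) s)) * (modelFrame U q.1 hq s : Matrix (Fin n) (Fin n) ℂ)ᵀ) * gᵀ := by
      rw [h, coe_modelFrame]
      calc _ = g * cay (q.1 s) * (k s * ((U s : Matrix (Fin n) (Fin n) ℂ) *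
            Delta (-(2 • (α + q.2) s)) * (U s : Matrix (Fin n) (Fin n) ℂ)ᵀ) * (k s)ᵀ) *
            (cay (q.1 s))ᵀ * gᵀ := by
            rw [Matrix.transpose_mul, Matrix.transpose_mul, Matrix.transpose_mul]
            simp only [mul_assoc]
        _ = g * cay (q.1 s) * (rot (U s) (-(2 • (α + q.2) s)) * (k s * frameSym U s * (k s)ᵀ)) *
            (cay (q.1 s))ᵀ * gᵀ := by
            rw [h2, ← mul_assoc (k s), hkt s (-(2 • (α + q.2) s)) fun i j hij => by
              simp only [Pi.neg_apply, Pi.smul_apply]; rw [hqα s i j hij]]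
            simp only [mul_assoc]
        _ = _ := by
            rw [(hk s).symm, ← h2, Matrix.transpose_mul]
            simp only [mul_assoc]
    rw [hfs, h3] at h1
    have h4 := congrArg (fun X => gᴴ * X * gᴴᵀ) h1
    have h5 : ∀ X : Matrix (Fin n) (Fin n) ℂ, gᴴ * (g * X * gᵀ) * gᴴᵀ = X := fun X => by
      calc _ = (gᴴ * g) * X * (gᵀ * gᴴᵀ) := by simp only [mul_assoc]
        _ = X := by rw [hg, hgt', one_mul, mul_one]
    simpa only [h5] using h4
  · let g' : Un n := ⟨g, Matrix.mem_unitaryGroup_iff'.2 hg⟩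
    have h1 : (lagRep fun s => (stdLagr n).act (V s))
        = lagRep fun s => (stdLagr n).act (g' * modelFrame U q.1 hq s) := by
      congr 1
      funext s
      rw [act_std_eq_iff]
      have h2 := frameSym_mul g' (modelFrame U q.1 hq) s
      exact (hfs s).trans h2.symm
    rw [h1, ← conjHom_lagRep]
    exact conjHom_equiv _ _

end

end LagRep

/-! ### Assembly on a stratum. -/

namespace LagRep

open scoped ContDiff Topology Matrix Matrix.Norms.Operator
open Matrix

noncomputable section

attribute [-instance] instTopologicalSpaceMatrix Matrix.instUniformSpace

/-! ### The fibration of Lagrangian representations -/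

variable {ℓ n : ℕ}

theorem continuous_wordProd (w : List (Fin ℓ)) :
    Continuous fun A : Fin ℓ → Matrix (Fin n) (Fin n) ℂ => wordProd A w := by
  induction w with
  | nil => exact continuous_const
  | cons s w ih =>
    simp only [wordProd_cons]
    exact (continuous_apply s).mul ih

/-- Finitely many words form a basis at `A`, and linear independence of finitely many vectors is
open. -/
theorem eventually_span_wordProd_eq_top {A : Fin ℓ → Matrix (Fin n) (Fin n) ℂ}
    (hA : Submodule.span ℂ (Set.range (wordProd A)) = ⊤) :
    ∀ᶠ B in 𝓝 A, Submodule.span ℂ (Set.range (wordProd B)) = ⊤ := by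
  obtain ⟨f, hf, hfs, hfl⟩ := Submodule.exists_fun_fin_finrank_span_eq ℂ (Set.range (wordProd A))
  choose w hw using hf
  have hc : Continuous fun B : Fin ℓ → Matrix (Fin n) (Fin n) ℂ => fun i => wordProd B (w i) :=
    continuous_pi fun i => continuous_wordProd (w i)
  have h1 : LinearIndependent ℂ fun i => wordProd A (w i) := by
    simpa only [hw] using hfl
  filter_upwards [hc.continuousAt.eventually (isOpen_setOfPred_linearIndependent.mem_nhds h1)] with B hB
  have hB' : LinearIndependent ℂ fun i => wordProd B (w i) := hB
  rw [eq_top_iff, ← hB'.span_eq_top_of_card_eq_finrank' (by rw [Fintype.card_fin, hA, finrank_top])]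
  refine Submodule.span_mono ?_
  rintro _ ⟨i, rfl⟩
  exact ⟨w i, rfl⟩

variable {U : Fin ℓ → Un n} {α : Fin ℓ → Fin n → ℝ}
  {C : Submodule ℝ (Fin ℓ → Matrix (Fin n) (Fin n) ℂ)} {I : ℕ} {m : Fin ℓ → Composition n}
  {z : Set (Fin ℓ)}

theorem coords_eq_modelCoords (hU : IsAdapted U α) {v : C × specSub ℓ n}
    (hv : ∀ s, ((modelIncl C v).1 s)ᴴ = -(modelIncl C v).1 s)
    (h : IsAdapted (modelFrame U (modelIncl C v).1 hv) (α + (modelIncl C v).2)) :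
    coords (lagRep fun s => (stdLagr n).act (modelFrame U (modelIncl C v).1 hv s))
      = modelCoords U C v := by
  funext s i j
  rw [coords, genMat_lagRep_frame, h.lagMat_eq_rot, lagMat_modelFrame hU hv, modelCoords]

theorem exists_coords_eq_of_isModelled (hU : IsAdapted U α) (hℓ : 1 ≤ ℓ) (hn : 1 ≤ n)
    (hC : C ≤ skewFam ℓ n) (hα : ∀ s, HasMult (α s) (m s)) {N : Set (C × specSub ℓ n)}
    {V : Fin ℓ → Un n} {β : Fin ℓ → Fin n → ℝ} (hV : IsAdapted V β) (hβ : ∀ s, HasMult (β s) (m s))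
    (h : IsModelled U α N (fun s => (V s : Matrix (Fin n) (Fin n) ℂ), β)) :
    ∃ p ∈ N, modelClose U C hℓ hn p = 0 ∧ β = α + (p.2 : Fin ℓ → Fin n → ℝ) ∧
      ∃ ρ', ρ' ≈ (lagRep fun s => (stdLagr n).act (V s)) ∧ coords ρ' = modelCoords U C p := by
  obtain ⟨v, hvN, hv2, g, hg, k, hk, hVk⟩ := h
  have hv : ∀ s, ((modelIncl C v).1 s)ᴴ = -(modelIncl C v).1 s := mem_skewFam.1 (hC v.1.2)
  have hβv : β = α + (modelIncl C v).2 := hv2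
  have hconst : ∀ s i j, α s i = α s j →
      (α + (modelIncl C v).2) s i = (α + (modelIncl C v).2) s j := fun s i j hij => by
    rw [← hβv, (hβ s).eq_iff, ← (hα s).eq_iff, hij]
  obtain ⟨h3, h4⟩ := isAdapted_modelFrame_of_gauge hU hv hconst (hβv ▸ hV) hg hk hVk
  refine ⟨v, hvN, ?_, hv2, _, h4, coords_eq_modelCoords hU hv h3⟩
  have h5 : modelSym U (modelIncl C v) = modelSym U (modelIncl C 0) := by
    funext s
    rw [modelSym_eq_one hU hv h3, map_zero, modelSym_zero]
  have h6 := modelClose_zero (U := U) (C := C) hℓ hn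
  rw [modelClose] at h6 ⊢
  rw [h5, h6]

/-- Completeness of the model. A class in the open set has a representative close to the base one;
this representative is again Lagrangian, so its adapted frames form a configuration to which the
compactness statement applies. -/
theorem exists_isOpen_modelled (hU : IsAdapted U α) (hℓ : 1 ≤ ℓ) (hn : 1 ≤ n)
    (hA : Submodule.span ℂ (Set.range (wordProd (lagMat (frameSym U)))) = ⊤)
    (hC : C ≤ skewFam ℓ n) (hCG : gaugeSub U α ⊔ C = skewFam ℓ n) (hα : α ∈ stratum I m z)
    {N : Set (C × specSub ℓ n)} (hN : N ∈ 𝓝 0) :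
    ∃ W, IsOpen W ∧ cls (lagRep fun s => (stdLagr n).act (U s)) ∈ W ∧
      ∀ y ∈ (LRepIrr ℓ n ∩ specProj ⁻¹' lagStratum I m z) ∩ W, ∃ p ∈ N,
        modelClose U C hℓ hn p = 0 ∧ specProj y = α + (p.2 : Fin ℓ → Fin n → ℝ) ∧
        ∃ ρ', cls ρ' = y ∧ coords ρ' = modelCoords U C p := by
  obtain ⟨O, hO, hOo, hO0⟩ := eventually_nhds_iff.1
    (eventually_forall_isModelled hU hℓ hn hA hC hCG hN)
  refine ⟨cls '' (genMat ⁻¹' O), isOpen_image_cls (hOo.preimage continuous_genMat),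
    ⟨_, ?_, rfl⟩, ?_⟩
  · change genMat _ ∈ O
    rwa [show genMat (lagRep fun s => (stdLagr n).act (U s)) = lagMat (frameSym U) from
      funext fun s => genMat_lagRep_frame U s]
  rintro _ ⟨⟨⟨ρ₁, ⟨hρ₁, -⟩, h1⟩, h2⟩, ⟨ρ₂, hρ₂, rfl⟩⟩
  obtain ⟨V, β, hV, rfl⟩ := exists_adapted_of_equiv hρ₁ (Quotient.exact h1)
  have hβ : specProj (cls (lagRep fun s => (stdLagr n).act (V s))) = β := hV.spec_eq
  have hβm : β ∈ stratum I m z := hβ ▸ h2.2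
  have hgen : genMat (lagRep fun s => (stdLagr n).act (V s)) = lagMat (frameSym V) :=
    funext fun s => genMat_lagRep_frame V s
  have hq : ((fun s => (V s : Matrix (Fin n) (Fin n) ℂ), β) :
      (Fin ℓ → Matrix (Fin n) (Fin n) ℂ) × (Fin ℓ → Fin n → ℝ)) ∈
      configSpace ℓ n (∑ s, ∑ j, α s j) :=
    ⟨fun s => Un.star_mul_self _, fun s => frameSym_next_iff.1 (hV.next s), hV.nonneg,
      fun s j => (hV.lt_one s j).le, hV.mono, hβm.2.1.trans hα.2.1.symm⟩
  have hc : configMat (fun s => (V s : Matrix (Fin n) (Fin n) ℂ), β)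
      = genMat (lagRep fun s => (stdLagr n).act (V s)) :=
    (hgen.trans (funext fun s => hV.lagMat_eq s)).symm
  obtain ⟨p, hp, hp0, hpβ, ρ', hρ', hρc⟩ := exists_coords_eq_of_isModelled hU hℓ hn hC hα.2.2.1 hV
    hβm.2.2.1 (hO _ hρ₂ _ hq hc)
  exact ⟨p, hp, hp0, hβ.trans hpβ, ρ', Quotient.sound hρ', hρc⟩

/-- Soundness of the model: zeros of the projected closing equations satisfy the full ones, so the
moved frames are adapted, and irreducibility persists by openness. -/
theorem eventually_exists_lagRep (hU : IsAdapted U α) (hℓ : 1 ≤ ℓ) (hn : 1 ≤ n)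
    (hA : Submodule.span ℂ (Set.range (wordProd (lagMat (frameSym U)))) = ⊤)
    (hC : C ≤ skewFam ℓ n) :
    ∀ᶠ p in 𝓝 (0 : C × specSub ℓ n), modelClose U C hℓ hn p = 0 →
      α + (p.2 : Fin ℓ → Fin n → ℝ) ∈ stratum I m z →
      ∃ ρ', coords ρ' = modelCoords U C p ∧
        cls ρ' ∈ LRepIrr ℓ n ∩ specProj ⁻¹' lagStratum I m z ∧
        specProj (cls ρ') = α + (p.2 : Fin ℓ → Fin n → ℝ) := by
  have h1 : Filter.Tendsto (modelIncl (ℓ := ℓ) C) (𝓝 0) (𝓝 0) := by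
    have := (modelIncl (ℓ := ℓ) C).continuous.tendsto 0
    rwa [map_zero] at this
  have h2 : Filter.Tendsto (fun p => modelMat U (modelIncl C p)) (𝓝 0)
      (𝓝 (lagMat (frameSym U))) := by
    have h3 : ContinuousAt (fun q => modelMat U q) 0 :=
      continuousAt_pi.2 fun s => (contDiffAt_modelMat (k := 0) U s).continuousAt
    have h4 := h3.tendsto.comp h1
    rwa [show modelMat U 0 = lagMat (frameSym U) from funext fun s => modelMat_zero U s] at h4
  filter_upwards [h1.eventually (eventually_modelSym_eq_one U hℓ hn),
    h2.eventually (eventually_span_wordProd_eq_top hA)] with p hp hpA hp0 hpS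
  have hv : ∀ s, ((modelIncl C p).1 s)ᴴ = -(modelIncl C p).1 s := mem_skewFam.1 (hC p.1.2)
  have h3 : IsAdapted (modelFrame U (modelIncl C p).1 hv) (α + (modelIncl C p).2) :=
    isAdapted_modelFrame hU hv (fun s j => (hpS.1 s j).1) (fun s j => (hpS.1 s j).2)
      (fun s => (hpS.2.2.1 s).monotone) (hp hv p.2.2 hp0)
  have h4 := h3.spec_eq
  have hgen : genMat (lagRep fun s => (stdLagr n).act (modelFrame U (modelIncl C p).1 hv s))
      = modelMat U (modelIncl C p) := by
    funext s
    rw [genMat_lagRep_frame, h3.lagMat_eq_rot, lagMat_modelFrame hU hv]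
  refine ⟨_, coords_eq_modelCoords hU hv h3, ⟨⟨_, ⟨⟨_, rfl⟩, ?_⟩, rfl⟩, ?_⟩, h4⟩
  · exact irr_of_span_wordProd_eq_top hn (by rw [hgen]; exact hpA)
  · change specHom _ ∈ lagStratum I m z
    exact ⟨⟨_, ⟨_, rfl⟩, rfl⟩, by rw [h4]; exact hpS⟩

theorem isFibrationNear_lagRep (hU : IsAdapted U α) (hℓ : 1 ≤ ℓ) (hn : 1 ≤ n)
    (hA : Submodule.span ℂ (Set.range (wordProd (lagMat (frameSym U)))) = ⊤)
    (hα : α ∈ stratum I m z) :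
    ∃ d : ℕ, (d : ℝ) = ((ℓ : ℝ) - 2) / 2 * (n : ℝ) ^ 2 + 1
        - 1 / 2 * ∑ s : Fin ℓ, ∑ j : Fin (m s).length, ((m s).blocksFun j : ℝ) ^ 2 ∧
      IsFibrationNear d (LRepIrr ℓ n ∩ specProj ⁻¹' lagStratum I m z) (stratum I m z) specProj
        (cls (lagRep fun s => (stdLagr n).act (U s))) := by
  obtain ⟨C, hC, hCG, hCG'⟩ := exists_gauge_complement hU
  have h0 : FiniteDimensional ℝ (Fin ℓ → Matrix (Fin n) (Fin n) ℂ) := Module.Finite.pi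
  have hspec : specProj (cls (lagRep fun s => (stdLagr n).act (U s))) = α := hU.spec_eq
  have hsurj := exists_fderiv_modelClose_eq hℓ hn hU hA hC hCG'
  have hle : Module.finrank ℝ (closeSub U) ≤ Module.finrank ℝ C := by
    have h1 : Function.Surjective ((fderiv ℝ (modelClose U C hℓ hn) 0).toLinearMap ∘ₗ
      LinearMap.inl ℝ C (specSub ℓ n)) := fun D => hsurj D
    exact LinearMap.finrank_le_finrank_of_surjective h1
  obtain ⟨d, hd⟩ := Nat.exists_eq_add_of_le' hle
  have hgen : genMat (lagRep fun s => (stdLagr n).act (U s)) = lagMat (frameSym U) :=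
    funext fun s => genMat_lagRep_frame U s
  refine ⟨d, ?_, ?_⟩
  -- Here `d = dim C - dim closeSub`. Gauge directions remove `n²` for conjugation and the
  -- dimensions of the block orthogonal algebras, each of which is `½(∑ μ² - n)`; the closing
  -- equations remove `½ℓ(n² + n) - 1`.
  · have h1 := finrank_complement hℓ hn hU hA hCG hCG'
    have h2 := two_mul_finrank_closeSub U hℓ hn
    have h3 : ∀ s, 2 * Module.finrank ℝ (stdGauge (α s)) + n = ∑ j, (m s).blocksFun j ^ 2 :=
      fun s => (two_mul_finrank_stdGauge (α s)).trans (card_filter_hasMult (hα.2.2.1 s))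
    have h4 : 2 * ∑ s, Module.finrank ℝ (stdGauge (α s)) + ℓ * n
        = ∑ s, ∑ j, (m s).blocksFun j ^ 2 := by
      simp only [← h3, Finset.sum_add_distrib, Finset.mul_sum]
      simp
    have h4' : 2 * ((∑ s, Module.finrank ℝ (stdGauge (α s)) : ℕ) : ℝ) + ℓ * n
        = ∑ s : Fin ℓ, ∑ j : Fin (m s).length, ((m s).blocksFun j : ℝ) ^ 2 := by exact_mod_cast h4
    have h1' : (Module.finrank ℝ C : ℝ) + (n ^ 2 + (∑ s, Module.finrank ℝ (stdGauge (α s)) : ℕ))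
      = ℓ * n ^ 2 := by exact_mod_cast h1
    have h2' : 2 * (Module.finrank ℝ (closeSub U) : ℝ) + 2 = ℓ * (n ^ 2 + n) := by exact_mod_cast h2
    have hd' : (Module.finrank ℝ C : ℝ) = d + Module.finrank ℝ (closeSub U) := by exact_mod_cast hd
    rw [← h4']
    linarith
  · refine isFibrationNear_of_model (T := specSub ℓ n) (h := modelClose U C hℓ hn)
      (r := modelCoords U C) (φ := wordTrace (n := n)) ⟨⟨_, ⟨⟨_, rfl⟩, ?_⟩, rfl⟩, ?_⟩
      (fun y hy => hy.2.2) ?_ (contDiffAt_modelClose C hℓ hn) (contDiffAt_modelCoords C)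
      (modelClose_zero hℓ hn) ?_ hsurj hd (fun w => contDiff_wordTrace w)
      (fun w ρ₁ ρ₂ h => wordTrace_eq_of_equiv w h)
      (eq_zero_of_fderiv_eq_zero hℓ hn hU hA hC hCG) ?_ ?_
    · exact irr_of_span_wordProd_eq_top hn (by rw [hgen]; exact hA)
    · change specHom _ ∈ lagStratum I m z
      exact ⟨⟨_, ⟨_, rfl⟩, rfl⟩, by rw [hU.spec_eq]; exact hα⟩
    · intro b hb
      rw [hspec]
      change ∑ s, ∑ j, (b s j - α s j) = 0
      simp only [Finset.sum_sub_distrib]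
      exact sub_eq_zero.2 (hb.2.1.trans hα.2.1.symm)
    · funext s i j
      rw [coords, hgen, modelCoords, map_zero, modelMat_zero]
    · rw [hspec]
      exact eventually_exists_lagRep hU hℓ hn hA hC
    · rw [hspec]
      exact fun N hN => exists_isOpen_modelled hU hℓ hn hA hC hCG' hα hN

/-! ### Tangent vectors of the strata -/

/-- One point `α + t v` of the stratum with `t ≠ 0` suffices: it has the same multiplicity blocks
and the same index as `α`. -/
theorem eq_and_sum_eq_zero_of_isTangent_stratum {v : Fin ℓ → Fin n → ℝ} (hα : α ∈ stratum I m z)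
    (hv : IsTangent (stratum I m z) α v) :
    (∀ s i j, α s i = α s j → v s i = v s j) ∧ ∑ s, ∑ j, v s j = 0 := by
  obtain ⟨t, ht, ht0⟩ := ((hv.filter_mono nhdsWithin_le_nhds).and
    (self_mem_nhdsWithin : {0}ᶜ ∈ 𝓝[≠] (0 : ℝ))).exists
  have ht0' : t ≠ 0 := ht0
  constructor
  · intro s i j hij
    have h1 := hij
    rw [(hα.2.2.1 s).eq_iff, ← (ht.2.2.1 s).eq_iff] at h1
    simp only [Pi.add_apply, Pi.smul_apply, smul_eq_mul, hij, add_right_inj] at h1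
    exact mul_left_cancel₀ ht0' h1
  · have h1 := ht.2.1.trans hα.2.1.symm
    simp only [ind, Pi.add_apply, Pi.smul_apply, smul_eq_mul, Finset.sum_add_distrib,
      ← Finset.mul_sum, add_eq_left] at h1
    exact (mul_eq_zero.1 h1).resolve_left ht0'

end

end LagRep

/-! ### The proposition. -/

open LagRep
theorem mainTheorem4 (ℓ n : ℕ) (hℓ : 3 ≤ ℓ) (hn : 1 ≤ n) (I : ℕ) (m : Fin ℓ → Composition n)
    (z : Set (Fin ℓ)) (a : Fin ℓ → Fin n → ℝ) (ha : a ∈ lagStratum I m z)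
    (ρ : HomU ℓ n) (hρ : ρ ∈ LHom ℓ n) (hirr : Irr ρ) (hspec : specHom ρ = a) :
    ∃ d : ℕ,
      (d : ℝ) = ((ℓ : ℝ) - 2) / 2 * (n : ℝ) ^ 2 + 1
        - 1 / 2 * ∑ s : Fin ℓ, ∑ j : Fin (m s).length, ((m s).blocksFun j : ℝ) ^ 2 ∧
      IsManifoldNear d (LRepIrrAt a) (cls ρ) ∧
      IsLocSurjAt (LRepIrr ℓ n ∩ specProj ⁻¹' lagStratum I m z) (stratum I m z) specProj
        (cls ρ) ∧
      IsFibrationNear d (LRepIrr ℓ n ∩ specProj ⁻¹' lagStratum I m z) (stratum I m z) specProj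
        (cls ρ) ∧
      ∀ L : Fin ℓ → Lagr n, lagRep L = ρ →
        (∀ v : Fin ℓ → Fin n → ℝ, IsTangent (stratum I m z) a v →
          ∃ X ∈ twistBendSpan L, ∃ D : Fin ℓ → Matrix (Fin n) (Fin n) ℂ,
            ∀ s, IsEigenVel (ρ (gen s)) (a s) (v s) (D s) ∧
              IsConjTangent (ρ (gen s)) (X s - D s)) ∧
        (∀ X ∈ lagVel L, ∃ X' ∈ twistBendSpan L,
          ∀ s, IsConjTangent (ρ (gen s)) (X s - X' s)) := by
  have key : ∀ L : Fin ℓ → Lagr n, lagRep L = ρ → ∃ U : Fin ℓ → Un n, IsAdapted U a ∧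
      (L = fun s => (stdLagr n).act (U s)) ∧
      Submodule.span ℂ (Set.range (wordProd (lagMat (frameSym U)))) = ⊤ := by
    intro L hL
    obtain ⟨U, α, hU, rfl⟩ := exists_adapted L
    obtain rfl : α = a := by rw [← hspec, ← hL, hU.spec_eq]
    refine ⟨U, hU, rfl, ?_⟩
    have h1 : genMat ρ = lagMat (frameSym U) := by
      rw [← hL]
      exact funext fun s => genMat_lagRep_frame U s
    rw [← h1]
    exact span_wordProd_eq_top hirr
  obtain ⟨L, hL⟩ := hρ
  obtain ⟨U, hU, hLU, hA⟩ := key L hL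
  obtain ⟨d, hd, hfib⟩ := isFibrationNear_lagRep hU (by omega) hn hA ha.2
  rw [← hLU, hL] at hfib
  have hx : specProj (cls ρ) = a := hspec
  -- The set of classes with spectrum `a` is the fibre of the spectral projection through `[ρ]`, so
  -- the fibration yields its manifold structure.
  have hset : LRepIrrAt a = LRepIrr ℓ n ∩ specProj ⁻¹' lagStratum I m z ∩
      specProj ⁻¹' {specProj (cls ρ)} := by
    ext y
    rw [hx]
    constructor
    · rintro ⟨h1, h2⟩
      have h3 : specProj y = a := h2
      exact ⟨⟨h1, by rw [Set.mem_preimage, h3]; exact ha⟩, h2⟩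
    · rintro ⟨⟨h1, -⟩, h2⟩
      exact ⟨h1, h2⟩
  refine ⟨d, hd, ?_, isLocSurjAt_of_isFibrationNear hfib, hfib, ?_⟩
  · rw [hset]
    exact isManifoldNear_of_isFibrationNear hfib (by rw [hx]; exact ha.2)
  · intro L hL
    obtain ⟨U, hU, rfl, hA⟩ := key L hL
    constructor
    · intro v hv
      obtain ⟨h1, h2⟩ := eq_and_sum_eq_zero_of_isTangent_stratum ha.2 hv
      rw [← hL]
      exact exists_eigenVel hn hU hA h1 h2
    · intro X hX
      -- No conjugation correction is needed: the velocity itself lies in the span of twists and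
      -- bendings.
      refine ⟨X, lagVel_subset_twistBendSpan hn U hA hX, fun s => ⟨0, by simp, by simp⟩⟩
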